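/- Let $n\ge 0$. For a finite field $\mathbb F_q$ put $G=GL_n(\mathbb F_q)$, $V=\mathbb F_q^n$, and let $B\subset G$ be the subgroup of upper triangular matrices. The mirabolic Hecke algebra $\mathcal R_n(q)$ is the space $\mathbb C(G/B\times G/B\times V)^G$ of $G$-invariant functions with the convolution product $$(\alpha*\beta)(F,F',v)=\sum_{H\in G/B,\;u\in V}\alpha(F,H,u)\,\beta(H,F',v-u).$$ It has the basis of characteristic functions $T_{w,\beta}$ of the $G$-orbits, labelled independently of $q$ by pairs $(w,\beta)$, $w\in S_n$, $\beta\subset\{1,\dots,n\}$, such that $i\in\beta$, $j\notin\beta$ imply $i<j$ or $w^{-1}(i)<w^{-1}(j)$; the orbit of $(w,\beta)$ consists of the $(F,F',v)$ for which $V$ has a basis $e_1,\dots,e_n$ with $F_i=\langle e_1,\dots,e_i\rangle$, $F'_j=\langle e_{w(1)},\dots,e_{w(j)}\rangle$, $v=\sum_{i\in\beta}e_i$. The $q$-rook monoid algebra $\mathcal I_n(q)$ is the algebra of double cosets $B\backslash M_n(\mathbb F_q)/B$, that is, $\varepsilon\,\mathbb C[M_n(\mathbb F_q)]\,\varepsilon$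 with $\varepsilon=|B|^{-1}\sum_{b\in B}b$. It has the basis $\varepsilon\sigma\varepsilon$, where $\sigma$ runs over the rook matrices (the $0/1$ matrices with at most one $1$ in each row and column). Let $R_n$ and $I_n$ be the corresponding $\mathbb C[\mathbf q,\mathbf q^{-1}]$-algebras: the $\mathbb C[\mathbf q,\mathbf q^{-1}]$-subalgebras of $\prod_q\mathcal R_n(q)$ and of $\prod_q\mathcal I_n(q)$ (products over all prime powers $q$, with $\mathbf q$ acting on the factor at $q$ as the scalar $q$) generated by the families $(T_{w,\beta})_q$ and $(\varepsilon\sigma\varepsilon)_q$, respectively. Let $\mathcal R_n=\mathbb C(\mathbf q)\otimes_{\mathbb C[\mathbf q,\mathbf q^{-1}]}R_n$ and $\mathcal I_n=\mathbb C(\mathbf q)\otimes_{\mathbb C[\mathbf q,\mathbf q^{-1}]}I_n$ be the generic algebras, and for $z\in\mathbb C^\times$ let $\mathcal R_n(z)=R_n/(\mathbf q-z)$ and $\mathcal I_n(z)=I_n/(\mathbf q-z)$ be the specializations. Write $[n]_z!=\prod_{k=1}^n(1+z+\dots+z^{k-1})$. Then: 1. $\mathcal I_n$ and $\mathcal R_n$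 are semisimple and there is an isomorphism of $\mathbb C(\mathbf q)$-algebras $\mathcal I_n\simeq\mathcal R_n$. 2. For every $z\in\mathbb C^\times$ with $[n]_z!\neq0$, the algebras $\mathcal I_n(z)$ and $\mathcal R_n(z)$ are semisimple and there is an isomorphism of $\mathbb C$-algebras $\mathcal I_n(z)\simeq\mathcal R_n(z)$. 3. For every finite field $\mathbb F_q$ the double coset algebra $\varepsilon\,\mathbb C[M_n(\mathbb F_q)]\,\varepsilon$ and the convolution algebra $\mathbb C(G/B\times G/B\times V)^G$ are isomorphic as $\mathbb C$-algebras. -/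

import Mathlib

open scoped LaurentPolynomial TensorProduct

noncomputable section

namespace QRook

/-! ## Flags over a field -/

/-- The Borel subgroup `B` of invertible upper triangular matrices in `G = GL_n(K)`. -/
def borel (K : Type) [Field K] (n : ℕ) : Subgroup (GL (Fin n) K) where
  carrier := {g | ∀ i j : Fin n, j < i → (g : Matrix (Fin n) (Fin n) K) i j = 0}
  one_mem' := by
    intro i j h
    simp [Matrix.one_apply_ne h.ne']
  mul_mem' := by
    intro a b ha hb
    exact Matrix.BlockTriangular.mul (b := id) (M := (a : Matrix (Fin n) (Fin n) K))
      (N := (b : Matrix (Fin n) (Fin n) K)) (fun i j h => ha i j h) (fun i j h => hb i j h)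
  inv_mem' := by
    intro a ha i j h
    have h1 : Matrix.BlockTriangular (a : Matrix (Fin n) (Fin n) K) id := fun i j h => ha i j h
    let _ := a.invertible
    have h2 := Matrix.blockTriangular_inv_of_blockTriangular h1
    rw [Matrix.coe_units_inv]
    exact h2 h

/-- The variety `G/B` of complete flags in `K^n`: the coset `g B` is the flag whose `i`-th term is
spanned by the first `i` columns of `g`. -/
abbrev Flags (K : Type) [Field K] (n : ℕ) : Type := GL (Fin n) K ⧸ borel K n

instance (K : Type) [Field K] [Finite K] (n : ℕ) : Finite (GL (Fin n) K) :=
  Finite.of_injective (fun g : GL (Fin n) K => (g : Matrix (Fin n) (Fin n) K))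
    (fun _ _ h => Units.ext h)

instance (K : Type) [Field K] [Finite K] (n : ℕ) : Fintype (borel K n) := Fintype.ofFinite _

instance (K : Type) [Field K] [Finite K] (n : ℕ) : Fintype (Flags K n) := Fintype.ofFinite _

instance (K : Type) [Field K] (n : ℕ) : DecidableEq (Flags K n) := Classical.decEq _

/-- The permutation matrix of `w`, sending the basis vector `e_j` to `e_{w(j)}`. -/
def permGL (K : Type) [Field K] {n : ℕ} (w : Equiv.Perm (Fin n)) : GL (Fin n) K where
  val := Matrix.of fun i j => if i = w j then 1 else 0
  inv := Matrix.of fun i j => if w i = j then 1 else 0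
  val_inv := by
    ext i j
    simp only [Matrix.mul_apply, Matrix.one_apply, Matrix.of_apply]
    rw [Finset.sum_eq_single (w.symm i)]
    · simp
    · intro b _ hb
      rw [if_neg, zero_mul]
      rintro rfl
      simp at hb
    · simp
  inv_val := by
    ext i j
    simp only [Matrix.mul_apply, Matrix.one_apply, Matrix.of_apply]
    rw [Finset.sum_eq_single (w i)]
    · simp
    · intro b _ hb
      rw [if_neg (Ne.symm hb), zero_mul]
    · simp

/-! ## The convolution algebra of `G`-invariant functions on `G/B × G/B × V` -/

/-- The space of all functions `G/B × G/B × V → ℂ`, where `V = K^n`, as an algebra under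
convolution.  A function is stored as a matrix indexed by `G/B` with entries in the group algebra of
the additive group `V`: its value at `(F, F', v)` is the coefficient of `v` in the entry
`(F, F')`. -/
abbrev FlagVecFun (K : Type) [Field K] (n : ℕ) : Type :=
  Matrix (Flags K n) (Flags K n) (AddMonoidAlgebra ℂ (Fin n → K))

/-- The value at `(F, F', v)` of a function on `G/B × G/B × V`. -/
def value {K : Type} [Field K] {n : ℕ} (f : FlagVecFun K n) (F F' : Flags K n)
    (v : Fin n → K) : ℂ :=
  (f F F').coeff v

/-- The function on `G/B × G/B × V` with given values. -/
def ofValue {K : Type} [Field K] [Finite K] {n : ℕ} (f : Flags K n → Flags K n → (Fin n → K) → ℂ) :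
    FlagVecFun K n :=
  Matrix.of fun F F' => AddMonoidAlgebra.ofCoeff (Finsupp.equivFunOnFinite.symm (f F F'))

theorem value_ofValue {K : Type} [Field K] [Finite K] {n : ℕ}
    (f : Flags K n → Flags K n → (Fin n → K) → ℂ) (F F' : Flags K n) (v : Fin n → K) :
    value (ofValue f) F F' v = f F F' v := rfl

/-- The product of `FlagVecFun K n` is convolution:
`(α * β)(F, F', v) = ∑_{H, u} α(F, H, u) β(H, F', v - u)`. -/
theorem value_mul {K : Type} [Field K] [Fintype K] {n : ℕ} (α β : FlagVecFun K n)
    (F F' : Flags K n) (v : Fin n → K) :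
    value (α * β) F F' v = ∑ H, ∑ u, value α F H u * value β H F' (v - u) := by
  classical
  simp only [value, Matrix.mul_apply, AddMonoidAlgebra.coeff_sum, Finsupp.finsetSum_apply]
  refine Finset.sum_congr rfl fun H _ => ?_
  rw [AddMonoidAlgebra.coeff_mul_apply_left, Finsupp.sum_fintype _ _ (by simp)]
  simp [sub_eq_neg_add]

/-- The unit is the characteristic function of `{(F, F', v) | F = F', v = 0}`. -/
theorem value_one {K : Type} [Field K] [Finite K] {n : ℕ} (F F' : Flags K n) (v : Fin n → K) :
    open Classical in value (1 : FlagVecFun K n) F F' v = if F = F' ∧ v = 0 then 1 else 0 := by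
  classical
  by_cases h : F = F' <;>
    simp [value, h, Matrix.one_apply, AddMonoidAlgebra.one_def, Finsupp.single_apply, eq_comm]

/-- The action of an invertible matrix on `V`. -/
abbrev actVec {K : Type} [Field K] {n : ℕ} (g : GL (Fin n) K) (v : Fin n → K) : Fin n → K :=
  (g : Matrix (Fin n) (Fin n) K).mulVec v

/-- Invariance of a function on `G/B × G/B × V` under the diagonal action of `G`. -/
def IsInvariant {K : Type} [Field K] {n : ℕ} (f : FlagVecFun K n) : Prop :=
  ∀ (g : GL (Fin n) K) (F F' : Flags K n) (v : Fin n → K),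
    value f (g • F) (g • F') (actVec g v) = value f F F' v

/-- The convolution algebra `ℂ(G/B × G/B × V)^G` over a finite field `K`: the mirabolic Hecke
algebra for `q = |K|`. -/
def mirabolicHecke (K : Type) [Field K] [Finite K] (n : ℕ) : Subalgebra ℂ (FlagVecFun K n) where
  carrier := {f | IsInvariant f}
  mul_mem' := by
    intro a b ha hb g F F' v
    have := Fintype.ofFinite K
    rw [value_mul, value_mul]
    rw [← Equiv.sum_comp (MulAction.toPerm g : Equiv.Perm (Flags K n))]
    refine Finset.sum_congr rfl fun H _ => ?_
    have hbij : Function.Bijective (fun u : Fin n → K => actVec g u) :=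
      Function.bijective_iff_has_inverse.mpr ⟨fun u => actVec g⁻¹ u,
        fun u => by simp [Matrix.mulVec_mulVec], fun u => by simp [Matrix.mulVec_mulVec]⟩
    rw [← Function.Bijective.sum_comp hbij]
    refine Finset.sum_congr rfl fun u _ => ?_
    rw [MulAction.toPerm_apply, ← Matrix.mulVec_sub]
    exact congrArg₂ _ (ha g F H u) (hb g H F' (v - u))
  add_mem' := by
    intro a b ha hb g F F' v
    exact congrArg₂ (· + ·) (ha g F F' v) (hb g F F' v)
  algebraMap_mem' := by
    intro r g F F' v
    have hz : actVec g v = 0 ↔ v = 0 := by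
      constructor
      · intro h
        have := congrArg (actVec g⁻¹) h
        simpa [Matrix.mulVec_mulVec] using this
      · rintro rfl
        simp
    have hv : ∀ (F F' : Flags K n) (v : Fin n → K),
        value (algebraMap ℂ (FlagVecFun K n) r) F F' v = r * value 1 F F' v := by
      intro F F' v
      rw [Algebra.algebraMap_eq_smul_one]
      simp [value]
    rw [hv, hv, value_one, value_one]
    have hf : g • F = g • F' ↔ F = F' := (MulAction.injective g).eq_iff
    by_cases h : F = F' ∧ v = 0
    · rw [if_pos h, if_pos ⟨hf.mpr h.1, hz.mpr h.2⟩]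
    · rw [if_neg h, if_neg fun h' => h ⟨hf.mp h'.1, hz.mp h'.2⟩]

/-- The labels `(w, β)` of the `G`-orbits on `G/B × G/B × V`: a permutation `w` and a set `β` such
that `i ∈ β` and `j ∉ β` imply `i < j` or `w⁻¹(i) < w⁻¹(j)`. -/
structure OrbitLabel (n : ℕ) where
  w : Equiv.Perm (Fin n)
  β : Finset (Fin n)
  cond : ∀ i ∈ β, ∀ j ∉ β, i < j ∨ w.symm i < w.symm j

/-- The `G`-orbit labelled by `(w, β)`: the triples `(F, F', v)` for which there is a basis
`e_1, …, e_n` of `V` (the columns of `g`) with `F_i = ⟨e_1, …, e_i⟩`,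
`F'_j = ⟨e_{w(1)}, …, e_{w(j)}⟩` and `v = ∑_{i ∈ β} e_i`. -/
def orbit (K : Type) [Field K] {n : ℕ} (l : OrbitLabel n) :
    Set (Flags K n × Flags K n × (Fin n → K)) :=
  {x | ∃ g : GL (Fin n) K, x.1 = (g : Flags K n) ∧ x.2.1 = ((g * permGL K l.w : GL (Fin n) K) : Flags K n) ∧
    x.2.2 = ∑ i ∈ l.β, fun k => (g : Matrix (Fin n) (Fin n) K) k i}

theorem isInvariant_ofValue_orbit (K : Type) [Field K] [Finite K] {n : ℕ} (l : OrbitLabel n) :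
    IsInvariant (ofValue fun F F' v => Set.indicator (orbit K l) (fun _ => (1 : ℂ)) (F, F', v)) := by
  classical
  have key : ∀ (g : GL (Fin n) K) (F F' : Flags K n) (v : Fin n → K),
      (F, F', v) ∈ orbit K l → (g • F, g • F', actVec g v) ∈ orbit K l := by
    rintro g F F' v ⟨h, h1, h2, h3⟩
    simp only at h1 h2 h3
    refine ⟨g * h, by simp only [h1]; rfl, by simp only [h2, mul_assoc]; rfl, ?_⟩
    simp only [h3, actVec, Matrix.mulVec_sum]
    refine Finset.sum_congr rfl fun i _ => ?_
    ext k
    simp [Matrix.mulVec, dotProduct, Matrix.mul_apply]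
  intro g F F' v
  rw [value_ofValue, value_ofValue]
  have hiff : (g • F, g • F', actVec g v) ∈ orbit K l ↔ (F, F', v) ∈ orbit K l := by
    refine ⟨fun h => ?_, key g F F' v⟩
    have := key g⁻¹ _ _ _ h
    simpa [Matrix.mulVec_mulVec] using this
  simp only [Set.indicator_apply, hiff]

/-- The characteristic function `T_{w,β}` of the orbit labelled by `(w, β)`. -/
def orbitFun (K : Type) [Field K] [Finite K] {n : ℕ} (l : OrbitLabel n) : mirabolicHecke K n :=
  ⟨ofValue fun F F' v => Set.indicator (orbit K l) (fun _ => (1 : ℂ)) (F, F', v),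
    isInvariant_ofValue_orbit K l⟩

/-! ## The algebra of double cosets `B \ M_n(K) / B` -/

/-- The monoid algebra `ℂ[M_n(K)]` of the multiplicative monoid of `n × n` matrices. -/
abbrev MatMonoidAlgebra (K : Type) [Field K] (n : ℕ) : Type :=
  MonoidAlgebra ℂ (Matrix (Fin n) (Fin n) K)

/-- The idempotent `ε = |B|⁻¹ ∑_{b ∈ B} b`. -/
def borelIdem (K : Type) [Field K] [Finite K] (n : ℕ) : MatMonoidAlgebra K n :=
  (Fintype.card (borel K n) : ℂ)⁻¹ •
    ∑ b : borel K n, MonoidAlgebra.single ((b : GL (Fin n) K) : Matrix (Fin n) (Fin n) K) 1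

theorem borelIdem_isIdempotent (K : Type) [Field K] [Finite K] (n : ℕ) :
    IsIdempotentElem (borelIdem K n) := by
  have hc : (Fintype.card (borel K n) : ℂ) ≠ 0 := by exact_mod_cast Fintype.card_ne_zero
  have key : (∑ b : borel K n,
      MonoidAlgebra.single ((b : GL (Fin n) K) : Matrix (Fin n) (Fin n) K) (1 : ℂ)) *
      (∑ b : borel K n, MonoidAlgebra.single ((b : GL (Fin n) K) : Matrix (Fin n) (Fin n) K) 1) =
      (Fintype.card (borel K n) : ℂ) •
      ∑ b : borel K n, MonoidAlgebra.single ((b : GL (Fin n) K) : Matrix (Fin n) (Fin n) K) 1 := by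
    rw [Finset.sum_mul]
    have : ∀ b : borel K n,
        MonoidAlgebra.single ((b : GL (Fin n) K) : Matrix (Fin n) (Fin n) K) (1 : ℂ) *
        (∑ c : borel K n, MonoidAlgebra.single ((c : GL (Fin n) K) : Matrix (Fin n) (Fin n) K) 1) =
        ∑ c : borel K n, MonoidAlgebra.single ((c : GL (Fin n) K) : Matrix (Fin n) (Fin n) K) 1 := by
      intro b
      rw [Finset.mul_sum, ← Equiv.sum_comp (Equiv.mulLeft b) (fun c : borel K n =>
        MonoidAlgebra.single ((c : GL (Fin n) K) : Matrix (Fin n) (Fin n) K) (1 : ℂ))]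
      simp [MonoidAlgebra.single_mul_single]
    rw [Finset.sum_congr rfl fun b _ => this b, Finset.sum_const, Finset.card_univ, Nat.cast_smul_eq_nsmul]
  unfold IsIdempotentElem borelIdem
  rw [smul_mul_smul_comm, key, smul_smul]
  congr 1
  field_simp

/-- The algebra of double cosets `B \ M_n(K) / B`, that is `ε ℂ[M_n(K)] ε`, over a finite field `K`:
the `q`-rook monoid algebra for `q = |K|`. -/
def qRook (K : Type) [Field K] [Finite K] (n : ℕ) : Type :=
  (borelIdem_isIdempotent K n).Corner

instance (K : Type) [Field K] [Finite K] (n : ℕ) : Ring (qRook K n) :=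
  inferInstanceAs (Ring (borelIdem_isIdempotent K n).Corner)

/-- The element `ε x ε`. -/
def cornerMk (K : Type) [Field K] [Finite K] {n : ℕ} (x : MatMonoidAlgebra K n) : qRook K n :=
  ⟨borelIdem K n * x * borelIdem K n, x, rfl⟩

instance (K : Type) [Field K] [Finite K] (n : ℕ) : Algebra ℂ (qRook K n) where
  smul c x := ⟨c • x.1, by
    obtain ⟨y, hy⟩ := x.2
    exact ⟨c • y, by simp only [← hy, mul_smul_comm, smul_mul_assoc]⟩⟩
  algebraMap :=
    { toFun := fun c => ⟨c • borelIdem K n, c • borelIdem K n, by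
        simp only [mul_smul_comm, smul_mul_assoc, (borelIdem_isIdempotent K n).eq]⟩
      map_one' := Subtype.ext (one_smul _ _)
      map_zero' := Subtype.ext (zero_smul _ _)
      map_add' := fun a b => Subtype.ext (add_smul _ _ _)
      map_mul' := fun a b => Subtype.ext (by
        change (a * b) • borelIdem K n = (a • borelIdem K n) * (b • borelIdem K n)
        rw [smul_mul_smul_comm, (borelIdem_isIdempotent K n).eq]) }
  commutes' := fun c x => Subtype.ext (by
    have h := (Subsemigroup.mem_corner_iff (borelIdem_isIdempotent K n)).mp x.2
    change (c • borelIdem K n) * x.1 = x.1 * (c • borelIdem K n)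
    rw [smul_mul_assoc, mul_smul_comm, h.1, h.2])
  smul_def' := fun c x => Subtype.ext (by
    have h := (Subsemigroup.mem_corner_iff (borelIdem_isIdempotent K n)).mp x.2
    change c • x.1 = (c • borelIdem K n) * x.1
    rw [smul_mul_assoc, h.1])

/-- The element `ε σ ε` for a rook matrix `σ`, i.e. a matrix with entries `0` and `1` and at most one
nonzero entry in each row and column, encoded by a partial injection.  It is the average of the
double coset `B σ B`; Solomon's basis element is `T_σ = q^{ℓ(σ)} ε σ ε`. -/
def rookElt (K : Type) [Field K] [Finite K] {n : ℕ} (σ : Fin n ≃. Fin n) : qRook K n :=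
  cornerMk K (MonoidAlgebra.single (σ.toMatrix : Matrix (Fin n) (Fin n) K) 1)

/-! ## Algebras over `ℂ[𝐪, 𝐪⁻¹]` interpolating families over all finite fields -/

/-- Pairs `(p, k)` with `p` prime, standing for the prime power `p^(k+1)`. -/
abbrev PrimePowers : Type := Nat.Primes × ℕ

instance (i : PrimePowers) : Fact (i.1 : ℕ).Prime := ⟨i.1.2⟩

/-- The field with `p^(k+1)` elements. -/
abbrev FieldAt (i : PrimePowers) : Type := GaloisField i.1 (i.2 + 1)

/-- The prime power `p^(k+1)` as an invertible complex number. -/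
def qAt (i : PrimePowers) : ℂˣ :=
  Units.mk0 (((i.1 : ℕ) : ℂ) ^ (i.2 + 1)) (pow_ne_zero _ (by exact_mod_cast i.1.2.ne_zero))

/-- The specialization map `ℂ[𝐪, 𝐪⁻¹] → ℂ`, `𝐪 ↦ z`. -/
def specialize (z : ℂˣ) : ℂ[T;T⁻¹] →+* ℂ := LaurentPolynomial.eval₂ (RingHom.id ℂ) z

/-- The product of a family of `ℂ`-algebras indexed by the prime powers. -/
def PrimePowerProd (A : PrimePowers → Type) : Type := ∀ i, A i

section PrimePowerProd

variable (A : PrimePowers → Type) [∀ i, Ring (A i)] [∀ i, Algebra ℂ (A i)]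

instance : Ring (PrimePowerProd A) := inferInstanceAs (Ring (∀ i, A i))

/-- A Laurent polynomial acts on the factor at the prime power `q` through its value at `q`. -/
instance : Algebra ℂ[T;T⁻¹] (PrimePowerProd A) :=
  RingHom.toAlgebra'
    (RingHom.pi fun i => (algebraMap ℂ (A i)).comp (specialize (qAt i)) :
      ℂ[T;T⁻¹] →+* (∀ i, A i))
    (fun c x => funext fun i => Algebra.commutes (specialize (qAt i) c) (x i))

end PrimePowerProd

/-- The mirabolic Hecke algebra `R_n` over `ℂ[𝐪, 𝐪⁻¹]`.  Its elements are families of elements of the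
convolution algebras over all finite fields; it is generated over `ℂ[𝐪, 𝐪⁻¹]` by the families
`T_{w,β}` of characteristic functions of orbits.  Thus the `T_{w,β}` multiply with the structure
constants of the convolution algebras, written as functions of `q`. -/
def MirabolicInt (n : ℕ) :
    Subalgebra ℂ[T;T⁻¹] (PrimePowerProd fun i => mirabolicHecke (FieldAt i) n) :=
  Algebra.adjoin ℂ[T;T⁻¹] (Set.range fun (l : OrbitLabel n) i => orbitFun (FieldAt i) l)

/-- The `q`-rook monoid algebra over `ℂ[𝐪, 𝐪⁻¹]`.  Its elements are families of elements of the double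
coset algebras over all finite fields; it is generated over `ℂ[𝐪, 𝐪⁻¹]` by the families `ε σ ε`,
`σ` a rook matrix, equivalently (as `𝐪` is invertible) by Solomon's `T_σ = q^{ℓ(σ)} ε σ ε`. -/
def QRookInt (n : ℕ) :
    Subalgebra ℂ[T;T⁻¹] (PrimePowerProd fun i => qRook (FieldAt i) n) :=
  Algebra.adjoin ℂ[T;T⁻¹] (Set.range fun (σ : Fin n ≃. Fin n) i => rookElt (FieldAt i) σ)

/-! ## Generic algebras and specializations -/

/-- The field `ℂ(𝐪)`. -/
abbrev Cq : Type := FractionRing ℂ[T;T⁻¹]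

/-- The generic mirabolic Hecke algebra over `ℂ(𝐪)`. -/
abbrev GenericMirabolic (n : ℕ) : Type := Cq ⊗[ℂ[T;T⁻¹]] MirabolicInt n

/-- The generic `q`-rook monoid algebra over `ℂ(𝐪)`. -/
abbrev GenericQRook (n : ℕ) : Type := Cq ⊗[ℂ[T;T⁻¹]] QRookInt n

/-- The field `ℂ`, regarded as a `ℂ[𝐪, 𝐪⁻¹]`-algebra through `𝐪 ↦ z`. -/
def CAt (_ : ℂˣ) : Type := ℂ

instance (z : ℂˣ) : Field (CAt z) := inferInstanceAs (Field ℂ)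

instance (z : ℂˣ) : Algebra ℂ (CAt z) := inferInstanceAs (Algebra ℂ ℂ)

instance (z : ℂˣ) : Algebra ℂ[T;T⁻¹] (CAt z) :=
  RingHom.toAlgebra (specialize z : ℂ[T;T⁻¹] →+* ℂ)

instance (z : ℂˣ) : SMulCommClass ℂ[T;T⁻¹] ℂ (CAt z) :=
  ⟨fun a b x => by simp only [Algebra.smul_def]; exact mul_left_comm _ _ _⟩

/-- The specialization of the mirabolic Hecke algebra at `𝐪 = z`. -/
abbrev MirabolicAt (n : ℕ) (z : ℂˣ) : Type := CAt z ⊗[ℂ[T;T⁻¹]] MirabolicInt n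

/-- The specialization of the `q`-rook monoid algebra at `𝐪 = z`. -/
abbrev QRookAt (n : ℕ) (z : ℂˣ) : Type := CAt z ⊗[ℂ[T;T⁻¹]] QRookInt n

/-- `[n]_z! = ∏_{k=1}^n (1 + z + ⋯ + z^{k-1})`. -/
def qFactorial (n : ℕ) (z : ℂ) : ℂ :=
  ∏ k ∈ Finset.Icc 1 n, ∑ j ∈ Finset.range k, z ^ j

end QRook

end

/-! Both algebras are identified with a third one, the model algebra `Model n q`: the product over r
≤ n of the matrix algebras, indexed by the r-element subsets of an n-element set, over the Hecke
algebra H_r(q) of S_r. It is defined over any commutative ring with a parameter q, and over a field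
its dimension is ∑ (n choose r)² r! = `numRook n`, the number of rook matrices.

Each of the two algebras is generated by Hecke elements together with a chain of commuting
idempotents: the averages of the matrices diag(1^k, 0^(n-k)) on the rook side, the averages over the
k-th terms of flags on the mirabolic side. `RookData` and `MiraData` record the relations between
them. Straightening shows that an algebra generated by such elements is spanned by `numRook n`
elements (`RookData.spanBd`, `MiraData.spanBd`, the latter for invertible q). The model carries data
of both kinds, and for invertible q it is generated by either (`dataAlg_modelD`, `dataAlg_modelF`).
Given other data over a field, the pairs of corresponding generators generate a subalgebra of a
product that projects onto the model and is no bigger, so it is the graph of a homomorphism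
(`exists_algHom_of_graph`). Thus both sets of relations present the same algebra.

Over a finite field this gives homomorphisms from the model to both algebras. They are surjective by
the Bruhat decomposition of the matrix monoid and by a triangular expansion of span sets into
orbits. Injectivity is tested on a diagonal corner H_r of a block, where the canonical trace is
nondegenerate: on the rook side the rank filtration isolates the block (`injective_of_rook`), on the
mirabolic side the trace f ↦ ∑_F f(F, F, 0) restricts to a nonzero multiple of the canonical trace
(`injective_of_mira`).

Over the Laurent polynomials the model embeds into the product of its specializations at prime
powers, since a Laurent polynomial vanishing at all primes is zero. The generation arguments invert
nothing but q, so the images are exactly the two integral algebras. These are therefore isomorphic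
before any base change, which yields the generic and the specialized isomorphisms.

For semisimplicity, H_r acts on words. Weighted traces on words in m letters are Markov traces with
parameter q^m/[m], while the canonical trace has parameter 0, and on a given element all of them are
values of one polynomial of degree at most r - 1. On a nilpotent element this polynomial vanishes at
n distinct points, hence also at 0. So the radical lies in the kernel of a nondegenerate form. The
base changes of the integral algebras are quotients of semisimple model algebras over fields. -/

open scoped LaurentPolynomial TensorProduct

noncomputable section

namespace QRook

/-! ## Hecke relations and spanning sets -/

section Spanning

variable {F : Type*} [CommRing F] {D : Type*} [Ring D] [Algebra F D]

/-- The relations of the Iwahori–Hecke algebra of `S_n` for a sequence of elements `t i`,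
`i + 1 < n`. -/
structure HeckeRel (q : F) (n : ℕ) (t : ℕ → D) : Prop where
  quad : ∀ i, i + 1 < n → t i * t i = (q - 1) • t i + q • 1
  braid : ∀ i, i + 2 < n → t i * t (i + 1) * t i = t (i + 1) * t i * t (i + 1)
  comm : ∀ i j, i + 1 < j → j + 1 < n → t i * t j = t j * t i

theorem HeckeRel.mono {q : F} {n m : ℕ} {t : ℕ → D} (h : HeckeRel q n t) (hm : m ≤ n) :
    HeckeRel q m t :=
  ⟨fun i hi => h.quad i (by omega), fun i hi => h.braid i (by omega),
    fun i j hi hj => h.comm i j hi (by omega)⟩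

theorem HeckeRel.map {D' : Type*} [Ring D'] [Algebra F D'] {q : F} {n : ℕ} {t : ℕ → D}
    (h : HeckeRel q n t) (f : D →ₐ[F] D') : HeckeRel q n (fun i => f (t i)) :=
  ⟨fun i hi => by rw [← map_mul, h.quad i hi]; simp,
    fun i hi => by simp only [← map_mul, h.braid i hi],
    fun i j hi hj => by simp only [← map_mul, h.comm i j hi hj]⟩

/-- The subalgebra generated by `t i`, `i + 1 < k`. -/
def parab (F : Type*) [CommRing F] {D : Type*} [Ring D] [Algebra F D] (t : ℕ → D) (k : ℕ) :
    Subalgebra F D :=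
  Algebra.adjoin F (t '' {i | i + 1 < k})

theorem mem_parab {t : ℕ → D} {i k : ℕ} (h : i + 1 < k) : t i ∈ parab F t k :=
  Algebra.subset_adjoin ⟨i, h, rfl⟩

theorem parab_mono {t : ℕ → D} {k l : ℕ} (h : k ≤ l) : parab F t k ≤ parab F t l :=
  Algebra.adjoin_mono (Set.image_mono fun _ (hi : _ < k) => lt_of_lt_of_le hi h)

theorem parab_le_iff {t : ℕ → D} {k : ℕ} {S : Subalgebra F D} :
    parab F t k ≤ S ↔ ∀ i, i + 1 < k → t i ∈ S := by
  simp [parab, Algebra.adjoin_le_iff, Set.subset_def]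

/-- The property carried through `Algebra.adjoin_induction` is that multiplication by `a` on the
left preserves `p`. Products then compose, and only left multiplication by one generator has to be
checked. -/
theorem parab_induction {t : ℕ → D} {k : ℕ} {p : D → Prop} (hone : p 1)
    (hadd : ∀ x y, p x → p y → p (x + y)) (hsmul : ∀ (c : F) x, p x → p (c • x))
    (hmul : ∀ i, i + 1 < k → ∀ x, x ∈ parab F t k → p x → p (t i * x)) {x : D}
    (hx : x ∈ parab F t k) : p x := by
  have key : ∀ a ∈ parab F t k, ∀ y, y ∈ parab F t k → p y → p (a * y) := by
    intro a ha
    refine Algebra.adjoin_induction (p := fun a _ => ∀ y, y ∈ parab F t k → p y → p (a * y))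
      ?_ ?_ ?_ ?_ ha
    · rintro _ ⟨i, hi, rfl⟩ y hy hp
      exact hmul i hi y hy hp
    · intro r y _ hp
      rw [← Algebra.smul_def]
      exact hsmul r y hp
    · intro a b _ _ h1 h2 y hy hp
      rw [add_mul]
      exact hadd _ _ (h1 y hy hp) (h2 y hy hp)
    · intro a b _ hb h1 h2 y hy hp
      rw [mul_assoc]
      exact h1 _ (mul_mem hb hy) (h2 y hy hp)
  simpa using key x hx 1 (one_mem _) hone

/-- The product `t (j + m - 1) * ⋯ * t (j + 1) * t j`. -/
def chain (t : ℕ → D) (j : ℕ) : ℕ → D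
  | 0 => 1
  | m + 1 => t (j + m) * chain t j m

theorem chain_succ' (t : ℕ → D) (j m : ℕ) : chain t j (m + 1) = chain t (j + 1) m * t j := by
  induction m with
  | zero => simp [chain]
  | succ m ih =>
    rw [chain, ih, ← mul_assoc, chain]
    congr 3
    omega

theorem chain_add (t : ℕ → D) (j a b : ℕ) :
    chain t j (a + b) = chain t (j + a) b * chain t j a := by
  induction b with
  | zero => simp [chain]
  | succ b ih => rw [← add_assoc, chain, ih, chain, mul_assoc, add_assoc]

theorem chain_mem {t : ℕ → D} {S : Subalgebra F D} {j m : ℕ}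
    (h : ∀ i, j ≤ i → i < j + m → t i ∈ S) : chain t j m ∈ S := by
  induction m with
  | zero => exact one_mem _
  | succ m ih =>
    exact mul_mem (h _ (by omega) (by omega)) (ih fun i h1 h2 => h i h1 (by omega))

theorem chain_commute {t : ℕ → D} {j m : ℕ} {x : D}
    (h : ∀ i, j ≤ i → i < j + m → Commute (t i) x) : Commute (chain t j m) x := by
  induction m with
  | zero => exact Commute.one_left _
  | succ m ih =>
    exact (h _ (by omega) (by omega)).mul_left (ih fun i h1 h2 => h i h1 (by omega))

theorem HeckeRel.commute {q : F} {n : ℕ} {t : ℕ → D} (h : HeckeRel q n t) {i j : ℕ}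
    (hij : i + 1 < j ∨ j + 1 < i) (hi : i + 1 < n) (hj : j + 1 < n) : Commute (t i) (t j) := by
  rcases hij with h1 | h1
  · exact h.comm i j h1 hj
  · exact (h.comm j i h1 hi).symm

/-- Moving a generator through a descending chain shifts its index. -/
theorem HeckeRel.chain_mul {q : F} {n : ℕ} {t : ℕ → D} (h : HeckeRel q n t) {i j m : ℕ}
    (h1 : j ≤ i) (h2 : i + 1 < j + m) (h3 : j + m < n) :
    chain t j m * t (i + 1) = t i * chain t j m := by
  -- The chain is cut into the part above `t (j + a + 1)`, the pair `t (j + a + 1) * t (j + a)`, and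
  -- the part below. The outer parts commute past the relevant generator, and the braid relation
  -- acts on the middle.
  obtain ⟨a, rfl⟩ : ∃ a, i = j + a := ⟨i - j, by omega⟩
  obtain ⟨b, rfl⟩ : ∃ b, m = a + 2 + b := ⟨m - a - 2, by omega⟩
  rw [chain_add t j (a + 2) b]
  have c1 : Commute (chain t (j + (a + 2)) b) (t (j + a)) :=
    chain_commute fun i hi hi' => h.commute (by omega) (by omega) (by omega)
  have c2 : Commute (chain t j a) (t (j + a + 1)) :=
    chain_commute fun i hi hi' => h.commute (by omega) (by omega) (by omega)
  have e : chain t j (a + 2) = t (j + a + 1) * (t (j + a) * chain t j a) := rfl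
  rw [e, mul_assoc, mul_assoc, mul_assoc, c2.eq, ← mul_assoc (t (j + a)) _ (chain t j a),
    ← mul_assoc (t (j + a + 1)), ← mul_assoc (t (j + a + 1)), ← h.braid (j + a) (by omega),
    mul_assoc, mul_assoc, ← mul_assoc, c1.eq, mul_assoc]

/-- The parabolic subalgebra on `k + 1` letters is spanned by the translates of that on `k` letters
by the descending chains. -/
theorem HeckeRel.parab_succ_le {q : F} {n : ℕ} {t : ℕ → D} (h : HeckeRel q n t) {k : ℕ}
    (hk : k + 1 ≤ n) (S : Submodule F D)
    (hS : ∀ j ≤ k, ∀ a ∈ parab F t k, a * chain t j (k - j) ∈ S) :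
    ∀ x ∈ parab F t (k + 1), x ∈ S := by
  -- The chains play the role of minimal coset representatives of S_k in S_{k+1}. Their span `W`
  -- contains 1, so it suffices that it is stable under right multiplication by generators.
  let W : Submodule F D := ⨆ j : Fin (k + 1),
    (Subalgebra.toSubmodule (parab F t k)).map (LinearMap.mulRight F (chain t j (k - j)))
  have hmem : ∀ j ≤ k, ∀ a ∈ parab F t k, a * chain t j (k - j) ∈ W := fun j hj a ha =>
    Submodule.mem_iSup_of_mem (⟨j, by omega⟩ : Fin (k + 1)) ⟨a, ha, rfl⟩
  have hW : W ≤ S := by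
    refine iSup_le fun j => ?_
    rintro _ ⟨a, ha, rfl⟩
    exact hS j (by omega) a ha
  have hone : (1 : D) ∈ W := by
    simpa [chain] using hmem k le_rfl 1 (one_mem _)
  have hgen : ∀ i, i + 1 < k + 1 → ∀ x ∈ W, x * t i ∈ W := by
    intro i hi x hx
    suffices W ≤ W.comap (LinearMap.mulRight F (t i)) from this hx
    refine iSup_le fun j => ?_
    rintro _ ⟨a, ha, rfl⟩
    have hj : (j : ℕ) ≤ k := by omega
    change a * chain t j (k - j) * t i ∈ W
    rw [mul_assoc]
    generalize (j : ℕ) = j at hj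
    -- A generator far below the chain commutes with it, one just below lengthens it, and one equal
    -- to its last factor is reduced by the quadratic relation. A generator inside comes out on the
    -- left with its index lowered and is absorbed by `parab F t k`.
    rcases lt_trichotomy i j with hij | rfl | hij
    · rcases Nat.lt_or_ge (i + 1) j with h1 | h1
      · have c : Commute (chain t j (k - j)) (t i) :=
          chain_commute fun l h2 h3 => h.commute (by omega) (by omega) (by omega)
        rw [c.eq, ← mul_assoc]
        exact hmem j hj _ (mul_mem ha (mem_parab (by omega)))
      · obtain rfl : j = i + 1 := by omega
        rw [← chain_succ', show k - (i + 1) + 1 = k - i by omega]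
        exact hmem i (by omega) a ha
    · obtain ⟨m, hm⟩ : ∃ m, k - i = m + 1 := ⟨k - i - 1, by omega⟩
      have e := hmem i (by omega) a ha
      have e' := hmem (i + 1) (by omega) a ha
      rw [show k - (i + 1) = m by omega] at e'
      rw [hm, chain_succ'] at e ⊢
      rw [mul_assoc, h.quad i (by omega), mul_add, mul_smul_comm, mul_smul_comm, mul_one, mul_add,
        mul_smul_comm, mul_smul_comm]
      exact W.add_mem (W.smul_mem _ e) (W.smul_mem _ e')
    · obtain ⟨i, rfl⟩ : ∃ l, i = l + 1 := ⟨i - 1, by omega⟩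
      rw [h.chain_mul (by omega) (by omega) (by omega), ← mul_assoc]
      exact hmem j hj _ (mul_mem ha (mem_parab (by omega)))
  intro x hx
  refine hW ?_
  have : ∀ y ∈ W, y * x ∈ W := by
    refine Algebra.adjoin_induction (p := fun a _ => ∀ y ∈ W, y * a ∈ W) ?_ ?_ ?_ ?_ hx
    · rintro _ ⟨i, hi, rfl⟩ y hy
      exact hgen i hi y hy
    · intro r y hy
      rw [← Algebra.commutes, ← Algebra.smul_def]
      exact W.smul_mem r hy
    · intro a b _ _ h1 h2 y hy
      rw [mul_add]
      exact W.add_mem (h1 y hy) (h2 y hy)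
    · intro a b _ _ h1 h2 y hy
      rw [← mul_assoc]
      exact h2 _ (h1 y hy)
  simpa using this 1 hone

/-! ### Bounds on the size of spanning sets -/

variable {M : Type*} [AddCommGroup M] [Module F M]

/-- Modulo `V`, the submodule `W` is contained in the span of at most `N` elements. -/
def SpanBd (V W : Submodule F M) (N : ℕ) : Prop :=
  ∃ s : Finset M, s.card ≤ N ∧ W ≤ Submodule.span F s ⊔ V

theorem SpanBd.mono {V V' W W' : Submodule F M} {N N' : ℕ} (h : SpanBd V W N) (hW : W' ≤ W)
    (hV : V ≤ V') (hN : N ≤ N') : SpanBd V' W' N' := by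
  obtain ⟨s, hs, h⟩ := h
  exact ⟨s, hs.trans hN, hW.trans (h.trans (sup_le_sup_left hV _))⟩

theorem SpanBd.sup {V W W' : Submodule F M} {N N' : ℕ} (h : SpanBd V W N) (h' : SpanBd V W' N') :
    SpanBd V (W ⊔ W') (N + N') := by
  classical
  obtain ⟨s, hs, h⟩ := h
  obtain ⟨s', hs', h'⟩ := h'
  refine ⟨s ∪ s', (Finset.card_union_le _ _).trans (add_le_add hs hs'), ?_⟩
  rw [Finset.coe_union, Submodule.span_union]
  refine sup_le (h.trans ?_) (h'.trans ?_)
  · exact sup_le_sup_right le_sup_left _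
  · exact sup_le_sup_right le_sup_right _

theorem SpanBd.map {V W : Submodule F M} {N : ℕ} (h : SpanBd V W N) {M' : Type*} [AddCommGroup M']
    [Module F M'] (f : M →ₗ[F] M') : SpanBd (V.map f) (W.map f) N := by
  classical
  obtain ⟨s, hs, h⟩ := h
  refine ⟨s.image f, Finset.card_image_le.trans hs, (Submodule.map_mono h).trans ?_⟩
  rw [Submodule.map_sup, Submodule.map_span, Finset.coe_image]

theorem SpanBd.trans {U V W : Submodule F M} {N N' : ℕ} (h : SpanBd V W N) (h' : SpanBd U V N') :
    SpanBd U W (N + N') := by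
  classical
  obtain ⟨s, hs, h⟩ := h
  obtain ⟨s', hs', h'⟩ := h'
  refine ⟨s ∪ s', (Finset.card_union_le _ _).trans (add_le_add hs hs'), h.trans ?_⟩
  rw [Finset.coe_union, Submodule.span_union, sup_assoc]
  exact sup_le_sup_left h' _

theorem SpanBd.self (V : Submodule F M) : SpanBd V V 0 := ⟨∅, by simp, le_sup_right⟩

/-- The submodule generated from `U` by the operators `t i`, `i + 1 < n`. -/
def orb (t : ℕ → Module.End F M) (n : ℕ) (U : Submodule F M) : Submodule F M :=
  Submodule.map₂ (LinearMap.id : Module.End F M →ₗ[F] M →ₗ[F] M)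
    (Subalgebra.toSubmodule (parab F t n)) U

theorem orb_le_iff {t : ℕ → Module.End F M} {n : ℕ} {U W : Submodule F M} :
    orb t n U ≤ W ↔ ∀ a ∈ parab F t n, ∀ u ∈ U, a u ∈ W := Submodule.map₂_le

theorem mem_orb {t : ℕ → Module.End F M} {n : ℕ} {U : Submodule F M} {a : Module.End F M} {u : M}
    (ha : a ∈ parab F t n) (hu : u ∈ U) : a u ∈ orb t n U :=
  Submodule.apply_mem_map₂ (LinearMap.id : Module.End F M →ₗ[F] M →ₗ[F] M) ha hu

theorem le_orb {t : ℕ → Module.End F M} {n : ℕ} {U : Submodule F M} : U ≤ orb t n U :=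
  fun _ hu => mem_orb (one_mem (parab F t n)) hu

/-- A submodule stable under generators is stable under the algebra that they generate. -/
theorem parab_apply_mem {t : ℕ → Module.End F M} {n : ℕ} {U : Submodule F M}
    (h : ∀ i, i + 1 < n → ∀ u ∈ U, t i u ∈ U) : ∀ a ∈ parab F t n, ∀ u ∈ U, a u ∈ U := by
  intro a ha
  refine Algebra.adjoin_induction (p := fun a _ => ∀ u ∈ U, a u ∈ U) ?_ ?_ ?_ ?_ ha
  · rintro _ ⟨i, hi, rfl⟩ u hu
    exact h i hi u hu
  · intro r u hu
    exact U.smul_mem r hu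
  · intro a b _ _ h1 h2 u hu
    exact U.add_mem (h1 u hu) (h2 u hu)
  · intro a b _ _ h1 h2 u hu
    exact h1 _ (h2 u hu)

theorem orb_stable {t : ℕ → Module.End F M} {n : ℕ} {U : Submodule F M} {i : ℕ} (hi : i + 1 < n) :
    ∀ u ∈ orb t n U, t i u ∈ orb t n U := by
  intro u hu
  suffices orb t n U ≤ (orb t n U).comap (t i) from this hu
  exact orb_le_iff.mpr fun a ha u hu => mem_orb (a := t i * a) (mul_mem (mem_parab hi) ha) hu

theorem HeckeRel.orb_succ_le {q : F} {n k : ℕ} {t : ℕ → Module.End F M} (h : HeckeRel q n t)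
    (hk : k + 1 ≤ n) {U W : Submodule F M}
    (hW : ∀ j ≤ k, ∀ a ∈ parab F t k, ∀ u ∈ U, a (chain t j (k - j) u) ∈ W) :
    orb t (k + 1) U ≤ W := by
  refine orb_le_iff.mpr fun a ha u hu => ?_
  exact h.parab_succ_le hk (W.comap (LinearMap.applyₗ u)) (fun j hj a ha => hW j hj a ha u hu) a ha

theorem chain_apply_mem {t : ℕ → Module.End F M} {U : Submodule F M} {j m : ℕ}
    (h : ∀ i, j ≤ i → i < j + m → ∀ u ∈ U, t i u ∈ U) : ∀ u ∈ U, chain t j m u ∈ U := by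
  induction m with
  | zero => exact fun u hu => hu
  | succ m ih =>
    exact fun u hu => h _ (by omega) (by omega) _ (ih (fun i h1 h2 => h i h1 (by omega)) u hu)

/-- A submodule stable under all generators but one generates at most `n.choose k` times as much. -/
theorem HeckeRel.spanBd_orb {q : F} {n : ℕ} {t : ℕ → Module.End F M} (h : HeckeRel q n t)
    {V : Submodule F M} (hV : ∀ i, i + 1 < n → ∀ v ∈ V, t i v ∈ V) {N : ℕ} :
    ∀ (m k : ℕ) (_ : m ≤ n) (_ : k ≤ m) (U : Submodule F M) (_ : V ≤ U)
      (_ : ∀ i, i + 1 < m → i + 1 ≠ k → ∀ u ∈ U, t i u ∈ U) (_ : SpanBd V U N),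
      SpanBd V (orb t m U) (m.choose k * N) := by
  have triv : ∀ (m : ℕ) (U : Submodule F M), (∀ i, i + 1 < m → ∀ u ∈ U, t i u ∈ U) →
      SpanBd V U N → SpanBd V (orb t m U) N := fun m U hU hb =>
    hb.mono (orb_le_iff.mpr (parab_apply_mem hU)) le_rfl le_rfl
  intro m
  induction m with
  | zero =>
    intro k _ hk U _ _ hb
    obtain rfl : k = 0 := by omega
    simpa using triv 0 U (by simp) hb
  | succ m ih =>
    intro k hm hk U hVU hU hb
    rcases Nat.eq_zero_or_pos k with rfl | hk0
    · simpa using triv (m + 1) U (fun i hi => hU i hi (by omega)) hb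
    rcases Nat.lt_or_ge m k with hmk | hmk
    · obtain rfl : k = m + 1 := by omega
      simpa using triv (m + 1) U (fun i hi => hU i hi (by omega)) hb
    obtain ⟨k, rfl⟩ : ∃ l, k = l + 1 := ⟨k - 1, by omega⟩
    -- Pascal's rule: with `k + 1` in place of `k`, the translates of `U` split into `U` itself,
    -- still of type `k + 1` for `m` letters, and the single translate `U'`, which is of type `k`
    -- because the chain shifts indices by one.
    let U' : Submodule F M := U.map (chain t k (m - k)) ⊔ V
    have b1 := ih (k + 1) (by omega) hmk U hVU (fun i hi hi' => hU i (by omega) hi') hb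
    have hcV : V.map (chain t k (m - k)) ≤ V := by
      rintro _ ⟨v, hv, rfl⟩
      exact chain_apply_mem (fun i h1 h2 => hV i (by omega)) v hv
    have hb' : SpanBd V U' N := by
      have := ((hb.map (chain t k (m - k))).mono le_rfl hcV le_rfl).sup (SpanBd.self V)
      simpa using this
    have b2 := ih k (by omega) (by omega) U' le_sup_right (by
      intro i hi hik u hu
      refine (?_ : U' ≤ U'.comap (t i)) hu
      refine sup_le ?_ fun v hv => Submodule.mem_sup_right (hV i (by omega) v hv)
      rintro _ ⟨u, hu, rfl⟩
      refine Submodule.mem_sup_left ?_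
      change (t i * chain t k (m - k)) u ∈ _
      rcases Nat.lt_or_ge (i + 1) k with h1 | h1
      · have c : Commute (chain t k (m - k)) (t i) :=
          chain_commute fun l h2 h3 => h.commute (by omega) (by omega) (by omega)
        rw [← c.eq]
        exact ⟨t i u, hU i (by omega) (by omega) u hu, rfl⟩
      · rw [← h.chain_mul (by omega) (by omega) (by omega)]
        exact ⟨t (i + 1) u, hU (i + 1) (by omega) (by omega) u hu, rfl⟩) hb'
    -- A chain starting above `k` avoids the exceptional generator `t k` and preserves `U`. A chain
    -- starting at `j ≤ k` factors as the chain from `k`, which defines `U'`, after a chain that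
    -- preserves `U`.
    have hle : orb t (m + 1) U ≤ orb t m U' ⊔ orb t m U := by
      refine h.orb_succ_le hm fun j hj a ha u hu => ?_
      rcases Nat.lt_or_ge k j with hkj | hkj
      · refine Submodule.mem_sup_right (mem_orb ha ?_)
        exact chain_apply_mem (fun i h1 h2 => hU i (by omega) (by omega)) u hu
      · refine Submodule.mem_sup_left (mem_orb ha (Submodule.mem_sup_left ?_))
        have e := chain_add t j (k - j) (m - k)
        rw [show k - j + (m - k) = m - j by omega, show j + (k - j) = k by omega] at e
        rw [e]
        exact ⟨_, chain_apply_mem (fun i h1 h2 => hU i (by omega) (by omega)) u hu, rfl⟩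
    have := (b2.sup b1).mono hle le_rfl le_rfl
    rwa [Nat.choose_succ_succ, add_mul]

/-- The Hecke algebra of `S_k` multiplies the size of a spanning set by at most `k!`. -/
theorem HeckeRel.spanBd_orb_factorial {q : F} {n : ℕ} {t : ℕ → Module.End F M}
    (h : HeckeRel q n t) {V : Submodule F M} (hV : ∀ i, i + 1 < n → ∀ v ∈ V, t i v ∈ V) {N : ℕ} :
    ∀ (k : ℕ) (_ : k ≤ n) (U : Submodule F M), SpanBd V U N →
      SpanBd V (orb t k U) (k.factorial * N) := by
  intro k
  induction k with
  | zero =>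
    intro _ U hb
    have : orb t 0 U ≤ U := orb_le_iff.mpr (parab_apply_mem (by simp))
    simpa using hb.mono this le_rfl le_rfl
  | succ k ih =>
    intro hk U hb
    -- Nothing is assumed about the stability of `U`, so each of the `k + 1` chains contributes its
    -- own translate.
    have hsup : ∀ m ≤ k + 1, SpanBd V
        ((Finset.range m).sup fun j => orb t k (U.map (chain t j (k - j)))) (m * (k.factorial * N)) := by
      intro m
      induction m with
      | zero => intro _; exact ⟨∅, by simp, by simp⟩
      | succ m ihm =>
        intro hm
        rw [Finset.range_add_one, Finset.sup_insert, add_mul, one_mul, add_comm]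
        refine SpanBd.sup (ih (by omega) _ ?_) (ihm (by omega))
        refine (hb.map _).mono le_rfl ?_ le_rfl
        rintro _ ⟨v, hv, rfl⟩
        exact chain_apply_mem (fun i h1 h2 => hV i (by omega)) v hv
    have := hsup (k + 1) le_rfl
    rw [← mul_assoc, ← Nat.factorial_succ] at this
    refine this.mono (h.orb_succ_le hk fun j hj a ha u hu => ?_) le_rfl le_rfl
    have hle := Finset.le_sup (f := fun j => orb t k (U.map (chain t j (k - j))))
      (Finset.mem_range.mpr (by omega : j < k + 1))
    exact hle (mem_orb ha ⟨u, hu, rfl⟩)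

/-! ### Two-sided spanning -/

theorem HeckeRel.mulLeft {q : F} {n : ℕ} {t : ℕ → D} (h : HeckeRel q n t) :
    HeckeRel q n (fun i => LinearMap.mulLeft F (t i)) :=
  h.map (Algebra.lmul F D)

/-- The relations read the same backwards, up to exchanging the two sides, so they survive passage
to the opposite algebra. -/
theorem HeckeRel.mulRight {q : F} {n : ℕ} {t : ℕ → D} (h : HeckeRel q n t) :
    HeckeRel q n (fun i => LinearMap.mulRight F (t i)) := by
  refine ⟨fun i hi => ?_, fun i hi => ?_, fun i j hi hj => ?_⟩ <;> ext x
  · simp [mul_assoc, h.quad i hi, mul_add]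
  · simpa [mul_assoc] using congrArg (x * ·) (h.braid i hi)
  · simpa [mul_assoc] using (congrArg (x * ·) (h.comm i j hi hj)).symm

theorem mulLeft_mem_parab {t : ℕ → D} {k : ℕ} {a : D} (ha : a ∈ parab F t k) :
    LinearMap.mulLeft F a ∈ parab F (fun i => LinearMap.mulLeft F (t i)) k := by
  have : parab F t k ≤
      (parab F (fun i => LinearMap.mulLeft F (t i)) k).comap (Algebra.lmul F D) :=
    parab_le_iff.mpr fun i hi => mem_parab (t := fun i => LinearMap.mulLeft F (t i)) hi
  exact this ha

theorem commute_mulLeft_mulRight {t : ℕ → D} {k : ℕ} (x : D) :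
    ∀ a ∈ parab F (fun i => LinearMap.mulRight F (t i)) k,
      ∀ y, a (x * y) = x * a y := by
  intro a ha
  refine Algebra.adjoin_induction (p := fun a _ => ∀ y, a (x * y) = x * a y) ?_ ?_ ?_ ?_ ha
  · rintro _ ⟨i, hi, rfl⟩ y
    simp [mul_assoc]
  · intro r y
    simp
  · intro a b _ _ h1 h2 y
    simp [h1, h2, mul_add]
  · intro a b _ _ h1 h2 y
    simp [h1, h2]

/-- The two-sided translate `∑ H x H` of `x` by the algebra generated by the `t i`. -/
def twoSided (F : Type*) [CommRing F] {D : Type*} [Ring D] [Algebra F D] (t : ℕ → D) (n : ℕ)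
    (x : D) : Submodule F D :=
  orb (fun i => LinearMap.mulRight F (t i)) n
    (orb (fun i => LinearMap.mulLeft F (t i)) n (Submodule.span F {x}))

theorem self_mem_twoSided (t : ℕ → D) (n : ℕ) (x : D) : x ∈ twoSided F t n x :=
  le_orb (le_orb (Submodule.mem_span_singleton_self x))

theorem mul_mem_twoSided {t : ℕ → D} {n i : ℕ} (hi : i + 1 < n) {x y : D}
    (hy : y ∈ twoSided F t n x) : y * t i ∈ twoSided F t n x :=
  orb_stable (t := fun i => LinearMap.mulRight F (t i)) hi y hy

theorem left_mul_mem_orb_right {t : ℕ → D} {n : ℕ} {z : D} {U : Submodule F D}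
    (hU : ∀ u ∈ U, z * u ∈ U) {y : D}
    (hy : y ∈ orb (fun i => LinearMap.mulRight F (t i)) n U) :
    z * y ∈ orb (fun i => LinearMap.mulRight F (t i)) n U := by
  suffices orb (fun i => LinearMap.mulRight F (t i)) n U ≤
      (orb (fun i => LinearMap.mulRight F (t i)) n U).comap (LinearMap.mulLeft F z) from this hy
  refine orb_le_iff.mpr fun a ha u hu => ?_
  change z * a u ∈ orb (fun i => LinearMap.mulRight F (t i)) n U
  rw [← commute_mulLeft_mulRight z a ha]
  exact mem_orb ha (hU u hu)

theorem mul_mem_twoSided' {t : ℕ → D} {n i : ℕ} (hi : i + 1 < n) {x y : D}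
    (hy : y ∈ twoSided F t n x) : t i * y ∈ twoSided F t n x :=
  left_mul_mem_orb_right (fun u hu => orb_stable (t := fun i => LinearMap.mulLeft F (t i)) hi u hu) hy

theorem parab_mul_mem {t : ℕ → D} {n : ℕ} {W : Submodule F D}
    (h : ∀ i, i + 1 < n → ∀ y ∈ W, t i * y ∈ W) {a : D} (ha : a ∈ parab F t n) :
    ∀ y ∈ W, a * y ∈ W :=
  parab_apply_mem (t := fun i => LinearMap.mulLeft F (t i)) h _ (mulLeft_mem_parab ha)

theorem mul_parab_mem {t : ℕ → D} {n : ℕ} {W : Submodule F D}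
    (h : ∀ i, i + 1 < n → ∀ y ∈ W, y * t i ∈ W) {a : D} (ha : a ∈ parab F t n) :
    ∀ y ∈ W, y * a ∈ W := by
  refine Algebra.adjoin_induction (p := fun a _ => ∀ y ∈ W, y * a ∈ W) ?_ ?_ ?_ ?_ ha
  · rintro _ ⟨i, hi, rfl⟩ y hy
    exact h i hi y hy
  · intro r y hy
    rw [← Algebra.commutes, ← Algebra.smul_def]
    exact W.smul_mem r hy
  · intro a b _ _ h1 h2 y hy
    rw [mul_add]
    exact W.add_mem (h1 y hy) (h2 y hy)
  · intro a b _ _ h1 h2 y hy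
    rw [← mul_assoc]
    exact h2 _ (h1 y hy)

/-- A two-sided stable submodule containing `x` contains the two-sided translate of `x`. -/
theorem twoSided_le {t : ℕ → D} {n : ℕ} {W : Submodule F D} {x : D} (hx : x ∈ W)
    (hl : ∀ i, i + 1 < n → ∀ y ∈ W, t i * y ∈ W) (hr : ∀ i, i + 1 < n → ∀ y ∈ W, y * t i ∈ W) :
    twoSided F t n x ≤ W := by
  refine orb_le_iff.mpr fun a ha u hu => parab_apply_mem (fun i hi y hy => hr i hi y hy) a ha u ?_
  exact (orb_le_iff.mpr fun a ha u hu => parab_apply_mem (fun i hi y hy => hl i hi y hy) a ha u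
    ((Submodule.span_singleton_le_iff_mem x W).mpr hx hu)) hu

/-- If modulo `V` the element `x` behaves like the vector of type `k`, the two-sided translate of
`x` has size at most `(n.choose k)² k!` modulo `V`. -/
theorem HeckeRel.spanBd_twoSided {q : F} {n : ℕ} {t : ℕ → D} (h : HeckeRel q n t)
    {V : Submodule F D} (hVl : ∀ i, i + 1 < n → ∀ v ∈ V, t i * v ∈ V)
    (hVr : ∀ i, i + 1 < n → ∀ v ∈ V, v * t i ∈ V) {k : ℕ} (hk : k ≤ n) {x : D}
    (hcomm : ∀ i, i + 1 < n → i + 1 ≠ k → x * t i = t i * x)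
    (hneg : ∀ i, i + 1 < n → k ≤ i → t i * x + x ∈ V) :
    SpanBd V (twoSided F t n x) (n.choose k ^ 2 * k.factorial) := by
  set l : ℕ → Module.End F D := fun i => LinearMap.mulLeft F (t i) with hl
  set r : ℕ → Module.End F D := fun i => LinearMap.mulRight F (t i) with hr
  -- Modulo `V` the generators `t i` with `k ≤ i` act on `x` by the sign. So `U0`, of size at most
  -- k!, is stable under all generators except `t (k - 1)`, and inducing on the left and on the
  -- right costs a factor `n.choose k` each time.
  set U0 : Submodule F D := orb l k (Submodule.span F {x} ⊔ V) with hU0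
  have b0 : SpanBd V U0 k.factorial := by
    have : SpanBd V (Submodule.span F {x} ⊔ V) 1 := ⟨{x}, by simp, by simp⟩
    simpa using h.mulLeft.spanBd_orb_factorial hVl k hk _ this
  have hVU0 : V ≤ U0 := le_sup_right.trans le_orb
  have hxU0 : x ∈ U0 := le_orb (Submodule.mem_sup_left (Submodule.mem_span_singleton_self x))
  have s0 : ∀ i, i + 1 < n → i + 1 ≠ k → ∀ u ∈ U0, t i * u ∈ U0 := by
    intro i hi hik u hu
    rcases Nat.lt_or_ge (i + 1) k with h1 | h1
    · exact orb_stable (t := l) h1 u hu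
    · suffices U0 ≤ U0.comap (l i) from this hu
      refine orb_le_iff.mpr fun a ha u hu => ?_
      have hc : Commute (l i) a := by
        have : a ∈ Subalgebra.centralizer F {l i} := by
          refine (parab_le_iff.mpr fun j hj => ?_ : parab F l k ≤ _) ha
          rw [Subalgebra.mem_centralizer_iff]
          rintro _ rfl
          exact h.mulLeft.commute (by omega) (by omega) (by omega)
        exact (Subalgebra.mem_centralizer_iff F).mp this _ rfl
      change (l i * a) u ∈ U0
      rw [hc.eq]
      refine mem_orb (t := l) (u := l i u) ha ?_
      refine (?_ : Submodule.span F {x} ⊔ V ≤ (Submodule.span F {x} ⊔ V).comap (l i)) hu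
      refine sup_le ?_ fun v hv => Submodule.mem_sup_right (hVl i hi v hv)
      rw [Submodule.span_singleton_le_iff_mem, Submodule.mem_comap]
      have := hneg i hi (by omega)
      have e : l i x = -x + (t i * x + x) := by simp [hl]
      rw [e]
      exact Submodule.add_mem_sup (neg_mem (Submodule.mem_span_singleton_self x)) this
  set U1 : Submodule F D := orb l n U0 with hU1
  have b1 := h.mulLeft.spanBd_orb hVl n k le_rfl hk U0 hVU0 s0 b0
  -- Right multiplication commutes with the left operators and crosses `x` by `hcomm`, where it
  -- becomes a left multiplication that preserves `U0`.
  have s1 : ∀ i, i + 1 < n → i + 1 ≠ k → ∀ u ∈ U1, r i u ∈ U1 := by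
    intro i hi hik u hu
    have comm : ∀ m, ∀ a ∈ parab F l m, ∀ y, a y * t i = a (y * t i) := by
      intro m a ha
      refine Algebra.adjoin_induction (p := fun a _ => ∀ y, a y * t i = a (y * t i)) ?_ ?_ ?_ ?_ ha
      · rintro _ ⟨j, hj, rfl⟩ y
        simp [hl, mul_assoc]
      · intro c y
        simp
      · intro a b _ _ h1 h2 y
        simp [h1, h2, add_mul]
      · intro a b _ _ h1 h2 y
        simp [h1, h2]
    suffices U1 ≤ U1.comap (r i) from this hu
    refine orb_le_iff.mpr fun a ha u hu => ?_
    change a u * t i ∈ U1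
    rw [comm n a ha]
    refine mem_orb ha ?_
    suffices U0 ≤ U0.comap (r i) from this hu
    refine orb_le_iff.mpr fun a ha u hu => ?_
    change a u * t i ∈ U0
    rw [comm k a ha]
    refine (?_ : Submodule.span F {x} ⊔ V ≤ U0.comap (a ∘ₗ r i)) hu
    refine sup_le ?_ fun v hv =>
      mem_orb (t := l) (u := r i v) ha (Submodule.mem_sup_right (hVr i hi v hv))
    rw [Submodule.span_singleton_le_iff_mem, Submodule.mem_comap]
    change a (x * t i) ∈ U0
    rw [hcomm i hi hik]
    exact parab_apply_mem (t := l) (U := U0) (fun j hj u hu => orb_stable (t := l) hj u hu) a ha _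
      (s0 i hi hik x hxU0)
  have b2 := h.mulRight.spanBd_orb hVr n k le_rfl hk U1 (hVU0.trans le_orb) s1 b1
  have hfin : twoSided F t n x ≤ orb r n U1 := by
    refine twoSided_le (le_orb (le_orb hxU0)) (fun i hi y hy => ?_) fun i hi y hy => ?_
    · exact left_mul_mem_orb_right (fun u hu => orb_stable (t := l) hi u hu) hy
    · exact orb_stable (t := r) hi y hy
  refine b2.mono hfin le_rfl (le_of_eq ?_)
  ring

end Spanning

/-! ### Algebras generated by rook data and by mirabolic data -/

section Data

variable {F : Type*} [CommRing F] {D : Type*} [Ring D] [Algebra F D]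

/-- A submodule stable on the right under a generator with invertible parameter. -/
theorem HeckeRel.mem_of_mul_mem {q : F} {n : ℕ} {t : ℕ → D} (h : HeckeRel q n t) (hq : IsUnit q)
    {W : Submodule F D} {i : ℕ} (hi : i + 1 < n) (hW : ∀ y ∈ W, y * t i ∈ W) {z : D}
    (hz : z * t i ∈ W) : z ∈ W := by
  obtain ⟨u, rfl⟩ := hq
  have h1 := hW _ hz
  rw [mul_assoc, h.quad i hi, mul_add, mul_smul_comm, mul_smul_comm, mul_one] at h1
  have h2 := W.sub_mem h1 (W.smul_mem ((u : F) - 1) hz)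
  rw [add_sub_cancel_left] at h2
  have h3 := W.smul_mem (↑u⁻¹ : F) h2
  rwa [smul_smul, Units.inv_mul, one_smul] at h3

theorem HeckeRel.mem_of_mul_mem' {q : F} {n : ℕ} {t : ℕ → D} (h : HeckeRel q n t) (hq : IsUnit q)
    {W : Submodule F D} {i : ℕ} (hi : i + 1 < n) (hW : ∀ y ∈ W, t i * y ∈ W) {z : D}
    (hz : t i * z ∈ W) : z ∈ W := by
  obtain ⟨u, rfl⟩ := hq
  have h1 := hW _ hz
  rw [← mul_assoc, h.quad i hi, add_mul, smul_mul_assoc, smul_mul_assoc, one_mul] at h1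
  have h2 := W.sub_mem h1 (W.smul_mem ((u : F) - 1) hz)
  rw [add_sub_cancel_left] at h2
  have h3 := W.smul_mem (↑u⁻¹ : F) h2
  rwa [smul_smul, Units.inv_mul, one_smul] at h3

/-- The sum of the two-sided translates of `y 0, …, y (m - 1)`. -/
def sumTwoSided (F : Type*) [CommRing F] {D : Type*} [Ring D] [Algebra F D] (t : ℕ → D) (n : ℕ)
    (y : ℕ → D) (m : ℕ) : Submodule F D :=
  (Finset.range m).sup fun s => twoSided F t n (y s)

theorem twoSided_le_sum {t : ℕ → D} {n : ℕ} {y : ℕ → D} {m s : ℕ} (h : s < m) :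
    twoSided F t n (y s) ≤ sumTwoSided F t n y m :=
  Finset.le_sup (f := fun s => twoSided F t n (y s)) (Finset.mem_range.mpr h)

theorem sum_mul_mem {t : ℕ → D} {n : ℕ} {y : ℕ → D} {m i : ℕ} (hi : i + 1 < n) :
    ∀ v ∈ sumTwoSided F t n y m, v * t i ∈ sumTwoSided F t n y m := by
  intro v hv
  suffices sumTwoSided F t n y m ≤ (sumTwoSided F t n y m).comap (LinearMap.mulRight F (t i)) from
    this hv
  exact Finset.sup_le fun s hs v hv =>
    twoSided_le_sum (Finset.mem_range.mp hs) (mul_mem_twoSided hi hv)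

theorem mul_sum_mem {t : ℕ → D} {n : ℕ} {y : ℕ → D} {m i : ℕ} (hi : i + 1 < n) :
    ∀ v ∈ sumTwoSided F t n y m, t i * v ∈ sumTwoSided F t n y m := by
  intro v hv
  suffices sumTwoSided F t n y m ≤ (sumTwoSided F t n y m).comap (LinearMap.mulLeft F (t i)) from
    this hv
  exact Finset.sup_le fun s hs v hv =>
    twoSided_le_sum (Finset.mem_range.mp hs) (mul_mem_twoSided' hi hv)

/-- The partial sums form a filtration. In its m-th layer `y m` is a vector of type `κ m`, since the
sign relation only has to hold modulo the earlier layers, and the sizes of the layers add up. -/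
theorem HeckeRel.spanBd_sum {q : F} {n : ℕ} {t : ℕ → D} (h : HeckeRel q n t) {y : ℕ → D}
    {κ : ℕ → ℕ} (hκ : ∀ s ≤ n, κ s ≤ n)
    (hcomm : ∀ s ≤ n, ∀ i, i + 1 < n → i + 1 ≠ κ s → y s * t i = t i * y s)
    (hneg : ∀ s ≤ n, ∀ i, i + 1 < n → κ s ≤ i → t i * y s + y s ∈ sumTwoSided F t n y s) :
    ∀ m ≤ n + 1, SpanBd ⊥ (sumTwoSided F t n y m)
      (∑ s ∈ Finset.range m, n.choose (κ s) ^ 2 * (κ s).factorial) := by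
  intro m
  induction m with
  | zero => intro _; exact ⟨∅, by simp, by simp [sumTwoSided]⟩
  | succ m ih =>
    intro hm
    have h1 := ih (by omega)
    have h2 := h.spanBd_twoSided (fun i hi => mul_sum_mem (y := y) (m := m) hi)
      (fun i hi => sum_mul_mem hi) (hκ m (by omega)) (hcomm m (by omega)) (hneg m (by omega))
    have h3 : SpanBd (sumTwoSided F t n y m) (sumTwoSided F t n y (m + 1))
        (n.choose (κ m) ^ 2 * (κ m).factorial) := by
      have := h2.sup (SpanBd.self (sumTwoSided F t n y m))
      rw [add_zero] at this
      refine this.mono ?_ le_rfl le_rfl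
      rw [sumTwoSided, Finset.range_add_one, Finset.sup_insert]
      rfl
    rw [Finset.sum_range_succ, add_comm (Finset.sum _ _)]
    exact h3.trans h1

/-- To check that the sum of the two-sided translates is stable under left multiplication by `z`,
it suffices to consider the elements `z * a * y s`, where `a` is in the Hecke algebra. -/
theorem left_stable_sum {t : ℕ → D} {n : ℕ} {y : ℕ → D} {m : ℕ} {z : D}
    (hz : ∀ s < m, ∀ a ∈ parab F t n, z * (a * y s) ∈ sumTwoSided F t n y m) :
    ∀ v ∈ sumTwoSided F t n y m, z * v ∈ sumTwoSided F t n y m := by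
  intro v hv
  suffices sumTwoSided F t n y m ≤ (sumTwoSided F t n y m).comap (LinearMap.mulLeft F z) from
    this hv
  refine Finset.sup_le fun s hs => ?_
  refine orb_le_iff.mpr fun a ha u hu => ?_
  change z * a u ∈ sumTwoSided F t n y m
  rw [← commute_mulLeft_mulRight z a ha]
  refine parab_apply_mem (fun i hi y hy => sum_mul_mem hi y hy) a ha _ ?_
  suffices orb (fun i => LinearMap.mulLeft F (t i)) n (Submodule.span F {y s}) ≤
    (sumTwoSided F t n y m).comap (LinearMap.mulLeft F z) from this hu
  refine orb_le_iff.mpr fun b hb u hu => ?_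
  obtain ⟨c, rfl⟩ := Submodule.mem_span_singleton.mp hu
  rw [map_smul]
  refine Submodule.smul_mem _ _ ?_
  have : ∀ b ∈ parab F (fun i => LinearMap.mulLeft F (t i)) n,
      ∃ a ∈ parab F t n, ∀ x, b x = a * x := by
    intro b hb
    refine parab_induction (F := F) (t := fun i => LinearMap.mulLeft F (t i))
      (p := fun b => ∃ a ∈ parab F t n, ∀ x, b x = a * x) ?_ ?_ ?_ ?_ hb
    · exact ⟨1, one_mem _, by simp⟩
    · rintro x y ⟨a, ha, h1⟩ ⟨b, hb, h2⟩
      exact ⟨a + b, add_mem ha hb, fun x => by simp [h1, h2, add_mul]⟩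
    · rintro c x ⟨a, ha, h1⟩
      exact ⟨c • a, Subalgebra.smul_mem _ ha c, fun x => by simp [h1]⟩
    · rintro i hi x _ ⟨a, ha, h1⟩
      exact ⟨t i * a, mul_mem (mem_parab hi) ha, fun x => by simp [h1, mul_assoc]⟩
  obtain ⟨a, ha, hab⟩ := this b hb
  rw [hab]
  exact hz s (Finset.mem_range.mp hs) a ha

/-- The algebra generated by Hecke elements `t i`, `i + 1 < n`, and further elements `x k`,
`k ≤ n`. -/
def dataAlg (F : Type*) [CommRing F] {D : Type*} [Ring D] [Algebra F D] (n : ℕ) (t x : ℕ → D) :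
    Subalgebra F D :=
  Algebra.adjoin F (t '' {i | i + 1 < n} ∪ x '' {k | k ≤ n})

theorem dataAlg_le_iff {n : ℕ} {t x : ℕ → D} {S : Subalgebra F D} :
    dataAlg F n t x ≤ S ↔ (∀ i, i + 1 < n → t i ∈ S) ∧ ∀ k ≤ n, x k ∈ S := by
  simp [dataAlg, Algebra.adjoin_le_iff, Set.subset_def, or_imp, forall_and]

theorem t_mem_dataAlg {n : ℕ} {t x : ℕ → D} {i : ℕ} (h : i + 1 < n) : t i ∈ dataAlg F n t x :=
  (dataAlg_le_iff.mp le_rfl).1 i h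

theorem x_mem_dataAlg {n : ℕ} {t x : ℕ → D} {k : ℕ} (h : k ≤ n) : x k ∈ dataAlg F n t x :=
  (dataAlg_le_iff.mp le_rfl).2 k h

theorem dataAlg_map {D' : Type*} [Ring D'] [Algebra F D'] (f : D →ₐ[F] D') (n : ℕ) (t x : ℕ → D) :
    (dataAlg F n t x).map f = dataAlg F n (fun i => f (t i)) (fun k => f (x k)) := by
  rw [dataAlg, AlgHom.map_adjoin, Set.image_union, Set.image_image, Set.image_image, dataAlg]

theorem dataAlg_le_submodule {n : ℕ} {t x : ℕ → D} {W : Submodule F D} (hone : 1 ∈ W)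
    (ht : ∀ i, i + 1 < n → ∀ y ∈ W, t i * y ∈ W) (hx : ∀ k ≤ n, ∀ y ∈ W, x k * y ∈ W) :
    Subalgebra.toSubmodule (dataAlg F n t x) ≤ W := by
  intro a ha
  have : ∀ y ∈ W, a * y ∈ W := by
    refine Algebra.adjoin_induction (p := fun a _ => ∀ y ∈ W, a * y ∈ W) ?_ ?_ ?_ ?_ ha
    · rintro _ (⟨i, hi, rfl⟩ | ⟨k, hk, rfl⟩) y hy
      · exact ht i hi y hy
      · exact hx k hk y hy
    · intro r y hy
      rw [← Algebra.smul_def]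
      exact W.smul_mem r hy
    · intro a b _ _ h1 h2 y hy
      rw [add_mul]
      exact W.add_mem (h1 y hy) (h2 y hy)
    · intro a b _ _ h1 h2 y hy
      rw [mul_assoc]
      exact h1 _ (h2 y hy)
  simpa using this 1 hone

/-- The number `∑ (n choose k)² k!` of partial permutations. -/
def numRook (n : ℕ) : ℕ := ∑ k ∈ Finset.range (n + 1), n.choose k ^ 2 * k.factorial

/-! ### Rook data -/

/-- Relations satisfied by the averaged idempotent matrices `diag(1^k, 0^(n-k))`. -/
structure RookData (q : F) (n : ℕ) (t d : ℕ → D) : Prop where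
  hecke : HeckeRel q n t
  top : d n = 1
  mul : ∀ j ≤ n, ∀ k ≤ n, d j * d k = d (min j k)
  comm : ∀ k ≤ n, ∀ i, i + 1 < n → i + 1 ≠ k → d k * t i = t i * d k
  neg : ∀ k ≤ n, ∀ i, i + 1 < n → k ≤ i → t i * d k = -d k
  sandwich : ∀ i, i + 1 < n → d (i + 1) * t i * d (i + 1) = -d i

/-- Writing `d (k + 1)` as a product with the larger idempotent, and moving that idempotent through
all but the top factor of the chain, creates one `sandwich`. It removes the top factor and lowers
the left idempotent, so induction applies and the constant is a sign. -/
theorem RookData.chain_sandwich {q : F} {n : ℕ} {t d : ℕ → D} (h : RookData q n t d) (k m : ℕ)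
    (hk : k + 1 + m < n) :
    ∃ c : F, d (k + 1 + m) * chain t k (m + 1) * d (k + 1) = c • d k := by
  induction m with
  | zero => exact ⟨-1, by simpa [chain] using h.sandwich k (by omega)⟩
  | succ m ih =>
    obtain ⟨c, hc⟩ := ih (by omega)
    refine ⟨-c, ?_⟩
    have e1 : d (k + 1) = d (k + 1 + (m + 1)) * d (k + 1) := by
      rw [h.mul _ (by omega) _ (by omega), min_eq_right (by omega)]
    have c1 : Commute (chain t k (m + 1)) (d (k + 1 + (m + 1))) :=
      chain_commute fun i h1 h2 => (h.comm _ (by omega) i (by omega) (by omega)).symm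
    have e2 := h.sandwich (k + 1 + m) (by omega)
    rw [chain, e1, show k + (m + 1) = k + 1 + m by omega]
    rw [show k + 1 + (m + 1) = k + 1 + m + 1 by omega] at *
    rw [mul_assoc, mul_assoc, ← mul_assoc (chain _ _ _), c1.eq, mul_assoc,
      ← mul_assoc (t _), ← mul_assoc, ← mul_assoc (d _) (t _), e2, neg_mul, ← mul_assoc, hc, neg_smul]

/-- An algebra generated by rook data is spanned by `numRook n` elements. -/
theorem RookData.spanBd {q : F} {n : ℕ} {t d : ℕ → D} (h : RookData q n t d) :
    SpanBd ⊥ (Subalgebra.toSubmodule (dataAlg F n t d)) (numRook n) := by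
  have b := h.hecke.spanBd_sum (y := d) (κ := id) (fun s hs => hs)
    (fun s hs i hi his => h.comm s hs i hi his)
    (fun s hs i hi his => by rw [h.neg s hs i hi his, neg_add_cancel]; exact zero_mem _)
    (n + 1) le_rfl
  have hS : ∀ k ≤ n, d k ∈ sumTwoSided F t n d (n + 1) := fun k hk =>
    twoSided_le_sum (by omega) (self_mem_twoSided t n _)
  refine b.mono (dataAlg_le_submodule (h.top ▸ hS n le_rfl) (fun i hi => mul_sum_mem hi) ?_) le_rfl
    le_rfl
  -- Descending induction from `d n = 1`. The relation `sandwich` writes `d k` through `d (k + 1)`,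
  -- so only `d (n - 1)`, whose sandwich would require a generator that does not exist, needs a
  -- computation.
  have key : ∀ m k, k + m = n → ∀ y ∈ sumTwoSided F t n d (n + 1),
      d k * y ∈ sumTwoSided F t n d (n + 1) := by
    intro m
    induction m with
    | zero =>
      intro k hk y hy
      obtain rfl : k = n := by omega
      rwa [h.top, one_mul]
    | succ m ih =>
      intro k hk y hy
      rcases Nat.eq_zero_or_pos m with rfl | hm
      · obtain rfl : n = k + 1 := by omega
        refine left_stable_sum (fun s hs a ha => ?_) y hy
        -- The coset decomposition leaves `d k * chain * d s`, as `d k` commutes with the Hecke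
        -- algebra of S_k. Either `d s` is 1, or it meets the chain in its interior and
        -- `chain_sandwich` applies, or it passes through the whole chain.
        refine h.hecke.parab_succ_le (S := (sumTwoSided F t (k + 1) d (k + 1 + 1)).comap
          (LinearMap.mulLeft F (d k) ∘ₗ LinearMap.mulRight F (d s))) le_rfl ?_ a ha
        intro j hj a ha
        change d k * (a * chain t j (k - j) * d s) ∈ sumTwoSided F t (k + 1) d (k + 1 + 1)
        have c1 : Commute (d k) a := by
          have : parab F t k ≤ Subalgebra.centralizer F {d k} := by
            refine parab_le_iff.mpr fun i hi => ?_
            rw [Subalgebra.mem_centralizer_iff]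
            rintro _ rfl
            exact h.comm k (by omega) i (by omega) (by omega)
          exact (Subalgebra.mem_centralizer_iff F).mp (this ha) _ rfl
        rw [mul_assoc, ← mul_assoc, c1.eq, mul_assoc]
        refine parab_mul_mem (fun i hi => mul_sum_mem (by omega)) ha _ ?_
        rcases Nat.lt_or_ge j s with hjs | hjs
        · rcases Nat.lt_or_ge k s with hks | hks
          · obtain rfl : s = k + 1 := by omega
            rw [h.top, mul_one]
            exact mul_parab_mem (fun i hi => sum_mul_mem hi)
              (chain_mem fun i h1 h2 => mem_parab (by omega)) _ (hS k (by omega))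
          · obtain ⟨s, rfl⟩ : ∃ l, s = l + 1 := ⟨s - 1, by omega⟩
            obtain ⟨c, hc⟩ := h.chain_sandwich s (k - (s + 1)) (by omega)
            have e := chain_add t j (s - j) (k - (s + 1) + 1)
            rw [show s - j + (k - (s + 1) + 1) = k - j by omega, show j + (s - j) = s by omega] at e
            have c2 : Commute (chain t j (s - j)) (d (s + 1)) :=
              chain_commute fun i h1 h2 => (h.comm _ (by omega) i (by omega) (by omega)).symm
            rw [e, mul_assoc, c2.eq, ← mul_assoc, ← mul_assoc,
              show d k = d (s + 1 + (k - (s + 1))) by congr 1; omega, hc, smul_mul_assoc]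
            refine Submodule.smul_mem _ _ ?_
            exact mul_parab_mem (fun i hi => sum_mul_mem hi)
              (chain_mem fun i h1 h2 => mem_parab (by omega)) _ (hS s (by omega))
        · have c2 : Commute (chain t j (k - j)) (d s) :=
            chain_commute fun i h1 h2 => (h.comm _ (by omega) i (by omega) (by omega)).symm
          rw [c2.eq, ← mul_assoc, h.mul _ (by omega) _ (by omega)]
          exact mul_parab_mem (fun i hi => sum_mul_mem hi)
            (chain_mem fun i h1 h2 => mem_parab (by omega)) _ (hS _ (by omega))
      · have e := h.sandwich k (by omega)
        rw [← neg_eq_iff_eq_neg] at e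
        rw [← e, neg_mul, mul_assoc, mul_assoc]
        exact neg_mem (ih (k + 1) (by omega) _ (mul_sum_mem (by omega) _ (ih (k + 1) (by omega) y hy)))
  exact fun k hk => key (n - k) k (by omega)

/-! ### Mirabolic data -/

/-- Relations satisfied by the idempotents attached to the terms of a flag. -/
structure MiraData (q : F) (n : ℕ) (t f : ℕ → D) : Prop where
  hecke : HeckeRel q n t
  bot : f 0 = 1
  mul : ∀ j ≤ n, ∀ k ≤ n, f j * f k = f (max j k)
  comm : ∀ k ≤ n, ∀ i, i + 1 < n → i + 1 ≠ k → f k * t i = t i * f k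
  sandwich : ∀ i, i + 1 < n → f (i + 1) * t i * f (i + 1) = t i * f (i + 2)
  flag : ∀ i, i + 1 < n →
    (1 + t i) * f (i + 1) * (1 + t i) = (1 + t i) * (f i + q • f (i + 2))

theorem MiraData.map {D' : Type*} [Ring D'] [Algebra F D'] {q : F} {n : ℕ} {t f : ℕ → D}
    (h : MiraData q n t f) (g : D →ₐ[F] D') :
    MiraData q n (fun i => g (t i)) (fun k => g (f k)) where
  hecke := h.hecke.map g
  bot := by rw [h.bot, map_one]
  mul j hj k hk := by rw [← map_mul, h.mul j hj k hk]
  comm k hk i hi hik := by simp only [← map_mul, h.comm k hk i hi hik]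
  sandwich i hi := by simp only [← map_mul, h.sandwich i hi]
  flag i hi := by simpa using congrArg g (h.flag i hi)

/-- The product `t 0 * t 1 * ⋯ * t (l - 1)`. -/
def asc (t : ℕ → D) : ℕ → D
  | 0 => 1
  | l + 1 => asc t l * t l

theorem asc_mem {t : ℕ → D} {S : Subalgebra F D} {l : ℕ} (h : ∀ i < l, t i ∈ S) : asc t l ∈ S := by
  induction l with
  | zero => exact one_mem _
  | succ l ih => exact mul_mem (ih fun i hi => h i (by omega)) (h l (by omega))

theorem asc_commute {t : ℕ → D} {l : ℕ} {x : D} (h : ∀ i < l, Commute (t i) x) :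
    Commute (asc t l) x := by
  induction l with
  | zero => exact Commute.one_left _
  | succ l ih => exact (ih fun i hi => h i (by omega)).mul_left (h l (by omega))

/-- The idempotent `f (k + 2)` absorbs an extra `f (k + 1)`. The induction hypothesis consumes that
factor and turns it into `f (k + 2)` in front of the last generator, where one `sandwich` remains.
-/
theorem MiraData.asc_sandwich {q : F} {n : ℕ} {t f : ℕ → D} (h : MiraData q n t f) (k : ℕ)
    (hk : k + 1 < n) : f 1 * asc t (k + 1) * f (k + 1) = asc t (k + 1) * f (k + 2) := by
  induction k with
  | zero => simpa [asc] using h.sandwich 0 hk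
  | succ k ih =>
    have e1 : f (k + 1) * f (k + 2) = f (k + 2) := by
      rw [h.mul _ (by omega) _ (by omega), max_eq_right (by omega)]
    rw [asc]
    calc f 1 * (asc t (k + 1) * t (k + 1)) * f (k + 2)
        = f 1 * (asc t (k + 1) * t (k + 1)) * (f (k + 1) * f (k + 2)) := by rw [e1]
      _ = f 1 * asc t (k + 1) * (t (k + 1) * f (k + 1)) * f (k + 2) := by simp only [mul_assoc]
      _ = (f 1 * asc t (k + 1) * f (k + 1)) * t (k + 1) * f (k + 2) := by
        rw [← h.comm (k + 1) (by omega) (k + 1) hk (by omega)]; simp only [mul_assoc]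
      _ = asc t (k + 1) * (f (k + 2) * t (k + 1) * f (k + 2)) := by
        rw [ih (by omega)]; simp only [mul_assoc]
      _ = _ := by rw [h.sandwich (k + 1) hk]; simp only [mul_assoc]

/-- For the first generator after `k`, the relation `flag` writes `(1 + t k) * f k` through `f (k +
1)` and `f (k + 2)`. The later generators are conjugate to it, by the braid relation, under
invertible elements commuting with `f k`. Thus modulo the higher idempotents they all act on `f k`
by the sign. -/
theorem MiraData.neg_mem {q : F} {n : ℕ} {t f : ℕ → D} (h : MiraData q n t f) (hq : IsUnit q)
    {W : Submodule F D} (hl : ∀ i, i + 1 < n → ∀ y ∈ W, t i * y ∈ W)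
    (hr : ∀ i, i + 1 < n → ∀ y ∈ W, y * t i ∈ W) {k : ℕ} (hW : ∀ j ≤ n, k < j → f j ∈ W) (m : ℕ)
    (hm : k + m + 1 < n) : t (k + m) * f k + f k ∈ W := by
  induction m with
  | zero =>
    have e := h.flag k (by omega)
    rw [mul_add (1 + t k) (f k), ← sub_eq_iff_eq_add] at e
    have : t k * f k + f k = (1 + t k) * f k := by rw [add_mul, one_mul, add_comm]
    rw [add_zero, this, ← e]
    have s : ∀ y ∈ W, (1 + t k) * y ∈ W := fun y hy => by
      rw [add_mul, one_mul]; exact W.add_mem hy (hl k (by omega) y hy)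
    have s' : ∀ y ∈ W, y * (1 + t k) ∈ W := fun y hy => by
      rw [mul_add, mul_one]; exact W.add_mem hy (hr k (by omega) y hy)
    exact W.sub_mem (s' _ (s _ (hW _ (by omega) (by omega))))
      (s _ (W.smul_mem _ (hW _ (by omega) (by omega))))
  | succ m ih =>
    have ih := ih (by omega)
    set a := t (k + m)
    set b := t (k + (m + 1))
    have ca : f k * a = a * f k := h.comm k (by omega) _ (by omega) (by omega)
    have cb : f k * b = b * f k := h.comm k (by omega) _ (by omega) (by omega)
    have br : a * b * a = b * a * b := h.hecke.braid (k + m) (by omega)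
    refine h.hecke.mem_of_mul_mem hq (i := k + m) (by omega) (hr _ (by omega)) ?_
    refine h.hecke.mem_of_mul_mem hq (i := k + (m + 1)) (by omega) (hr _ (by omega)) ?_
    change (b * f k + f k) * a * b ∈ W
    have : (b * f k + f k) * a * b = a * (b * (a * f k + f k)) := by
      calc (b * f k + f k) * a * b = b * (f k * a) * b + (f k * a) * b := by noncomm_ring
        _ = b * a * (f k * b) + a * (f k * b) := by rw [ca]; noncomm_ring
        _ = (b * a * b) * f k + a * b * f k := by rw [cb]; noncomm_ring
        _ = _ := by rw [← br]; noncomm_ring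
    rw [this]
    exact hl _ (by omega) _ (hl _ (by omega) _ ih)

/-- The diagram automorphism. In mirabolic data the idempotent to be moved is `f 1`, which fails to
commute with `t 0` only, so the coset decomposition is needed for the subgroup omitting the first
generator. -/
theorem HeckeRel.rev {q : F} {m : ℕ} {t : ℕ → D} (h : HeckeRel q (m + 2) t) :
    HeckeRel q (m + 2) (fun i => t (m - i)) where
  quad i hi := h.quad _ (by omega)
  braid i hi := by
    have := h.braid (m - (i + 1)) (by omega)
    rw [show m - (i + 1) + 1 = m - i by omega] at this
    exact this.symm
  comm i j hi hj := (h.comm (m - j) (m - i) (by omega) (by omega)).symm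

theorem chain_rev (t : ℕ → D) (m l : ℕ) (hl : l ≤ m + 1) :
    chain (fun i => t (m - i)) (m + 1 - l) l = asc t l := by
  induction l with
  | zero => rfl
  | succ l ih =>
    rw [chain_succ', show m + 1 - (l + 1) + 1 = m + 1 - l by omega, ih (by omega), asc,
      show m - (m + 1 - (l + 1)) = l by omega]

/-- An algebra generated by mirabolic data is spanned by `numRook n` elements. -/
theorem MiraData.spanBd {q : F} (hq : IsUnit q) {n : ℕ} {t f : ℕ → D} (h : MiraData q n t f) :
    SpanBd ⊥ (Subalgebra.toSubmodule (dataAlg F n t f)) (numRook n) := by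
  -- The order is reversed because `f k` behaves as a sign vector modulo the `f j` with `j > k`,
  -- which must therefore come earlier in the filtration.
  set y : ℕ → D := fun s => f (n - s) with hy
  have b := h.hecke.spanBd_sum (y := y) (κ := fun s => n - s) (fun s hs => by omega)
    (fun s hs i hi his => h.comm _ (by omega) i hi his)
    (fun s hs i hi his => by
      have := h.neg_mem hq (W := sumTwoSided F t n y s) (fun i hi => mul_sum_mem hi)
        (fun i hi => sum_mul_mem hi) (k := n - s) (fun j hj hkj => by
          have : f j = y (n - j) := by rw [hy]; congr 1; omega
          rw [this]
          exact twoSided_le_sum (by omega) (self_mem_twoSided t n _)) (i - (n - s)) (by omega)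
      rwa [show n - s + (i - (n - s)) = i by omega] at this)
    (n + 1) le_rfl
  rw [← Finset.sum_range_reflect] at b
  have hnum : ∑ j ∈ Finset.range (n + 1),
      n.choose (n - (n + 1 - 1 - j)) ^ 2 * (n - (n + 1 - 1 - j)).factorial = numRook n :=
    Finset.sum_congr rfl fun j hj => by
      rw [Finset.mem_range] at hj
      rw [show n - (n + 1 - 1 - j) = j by omega]
  rw [hnum] at b
  have hS : ∀ k ≤ n, f k ∈ sumTwoSided F t n y (n + 1) := fun k hk => by
    have : f k = y (n - k) := by rw [hy]; congr 1; omega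
    rw [this]
    exact twoSided_le_sum (by omega) (self_mem_twoSided t n _)
  refine b.mono (dataAlg_le_submodule (h.bot ▸ hS 0 (by omega)) (fun i hi => mul_sum_mem hi) ?_)
    le_rfl le_rfl
  intro k
  induction k with
  | zero => intro _ z hz; rwa [h.bot, one_mul]
  | succ k ih =>
    intro hk z hz
    rcases Nat.eq_zero_or_pos k with rfl | hk0
    · refine left_stable_sum (fun s hs a ha => ?_) z hz
      -- If the ascending product stops before reaching `t (k - 1)`, it commutes with `f k`.
      -- Otherwise its first `k` factors are absorbed by `asc_sandwich`, and the remaining ones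
      -- commute with `f k` and move to the right.
      have claim : ∀ l < n, f 1 * (asc t l * y s) ∈ sumTwoSided F t n y (n + 1) := by
        intro l hl
        change f 1 * (asc t l * f (n - s)) ∈ sumTwoSided F t n y (n + 1)
        generalize hk : n - s = k
        have hkn : k ≤ n := by omega
        rcases Nat.lt_or_ge l k with hlk | hlk
        · have c : Commute (asc t l) (f k) :=
            asc_commute fun i hi => (h.comm k hkn i (by omega) (by omega)).symm
          rw [c.eq, ← mul_assoc, h.mul _ (by omega) _ hkn]
          exact mul_parab_mem (fun i hi => sum_mul_mem hi)
            (asc_mem fun i hi => mem_parab (by omega)) _ (hS _ (by omega))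
        · rcases Nat.eq_zero_or_pos k with rfl | hk0
          · rw [h.bot, mul_one]
            exact mul_parab_mem (fun i hi => sum_mul_mem hi)
              (asc_mem fun i hi => mem_parab (by omega)) _ (hS _ (by omega))
          · obtain ⟨k, rfl⟩ : ∃ l, k = l + 1 := ⟨k - 1, by omega⟩
            have : ∀ r, k + 1 + r < n → ∃ b ∈ parab F t n,
                f 1 * (asc t (k + 1 + r) * f (k + 1)) = asc t (k + 1) * f (k + 2) * b := by
              intro r
              induction r with
              | zero =>
                intro hr
                exact ⟨1, one_mem _, by rw [add_zero, ← mul_assoc, h.asc_sandwich k hr, mul_one]⟩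
              | succ r ihr =>
                intro hr
                obtain ⟨b, hb, e⟩ := ihr (by omega)
                refine ⟨b * t (k + 1 + r), mul_mem hb (mem_parab (by omega)), ?_⟩
                rw [← add_assoc, asc, mul_assoc (asc _ _),
                  ← h.comm (k + 1) hkn (k + 1 + r) (by omega) (by omega), ← mul_assoc (asc _ _),
                  ← mul_assoc, e, mul_assoc]
            obtain ⟨b, hb, e⟩ := this (l - (k + 1)) (by omega)
            rw [show k + 1 + (l - (k + 1)) = l by omega] at e
            rw [e]
            refine mul_parab_mem (fun i hi => sum_mul_mem hi) hb _ ?_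
            exact parab_mul_mem (fun i hi => mul_sum_mem hi)
              (asc_mem fun i hi => mem_parab (by omega)) _ (hS _ (by omega))
      rcases Nat.lt_or_ge n 2 with hn | hn
      · have : parab F t n ≤ ⊥ := parab_le_iff.mpr fun i hi => by omega
        obtain ⟨c, rfl⟩ := Algebra.mem_bot.mp (this ha)
        rw [← Algebra.smul_def, mul_smul_comm]
        simpa [asc] using Submodule.smul_mem _ c (claim 0 (by omega))
      · obtain ⟨m, rfl⟩ : ∃ m, n = m + 2 := ⟨n - 2, by omega⟩
        have ha' : a ∈ parab F (fun i => t (m - i)) (m + 1 + 1) := by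
          refine (parab_le_iff.mpr fun i hi => ?_ : parab F t (m + 2) ≤ _) ha
          have := mem_parab (F := F) (t := fun i => t (m - i)) (i := m - i) (k := m + 1 + 1) (by omega)
          rwa [show m - (m - i) = i by omega] at this
        refine h.hecke.rev.parab_succ_le (S := (sumTwoSided F t (m + 2) y (m + 2 + 1)).comap
          (LinearMap.mulLeft F (f (0 + 1)) ∘ₗ LinearMap.mulRight F (y s))) le_rfl ?_ a ha'
        intro j hj a ha
        change f 1 * (a * chain _ j (m + 1 - j) * y s) ∈ sumTwoSided F t (m + 2) y (m + 2 + 1)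
        have c1 : Commute (f 1) a := by
          have : parab F (fun i => t (m - i)) (m + 1) ≤ Subalgebra.centralizer F {f 1} := by
            refine parab_le_iff.mpr fun i hi => ?_
            rw [Subalgebra.mem_centralizer_iff]
            rintro _ rfl
            exact h.comm 1 (by omega) _ (by omega) (by omega)
          exact (Subalgebra.mem_centralizer_iff F).mp (this ha) _ rfl
        have e := chain_rev t m (m + 1 - j) (by omega)
        rw [show m + 1 - (m + 1 - j) = j by omega] at e
        rw [e, mul_assoc, ← mul_assoc, c1.eq, mul_assoc]
        have ha2 : a ∈ parab F t (m + 2) :=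
          (parab_le_iff.mpr fun i hi => mem_parab (by omega) : parab F _ (m + 1) ≤ _) ha
        exact parab_mul_mem (fun i hi => mul_sum_mem hi) ha2 _ (claim _ (by omega))
    · obtain ⟨k, rfl⟩ : ∃ l, k = l + 1 := ⟨k - 1, by omega⟩
      have ih := ih (by omega)
      -- By `sandwich`, `t k * f (k + 2)` is a product involving only `f (k + 1)`, and `t k` is
      -- invertible since q is. So only `f 1` required a computation.
      refine h.hecke.mem_of_mul_mem' hq (i := k) (by omega) (mul_sum_mem (by omega)) ?_
      rw [← mul_assoc, ← h.sandwich k (by omega), mul_assoc, mul_assoc]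
      exact ih _ (mul_sum_mem (by omega) _ (ih z hz))

end Data

/-! ## The Hecke algebra of the symmetric group, acting on words -/

section Words

/-- Words of length `n` in `n` letters. -/
abbrev Words (n : ℕ) : Type := Fin n → Fin n

variable {B : Type*} [CommRing B] {n : ℕ}

/-- The basis vector of a word. -/
def wd (B : Type*) [CommRing B] (a : Words n) : Words n → B := Pi.single a 1

/-- The action of a Hecke generator on the positions `x`, `y` of a word. -/
def swapCol (q : B) (x y : Fin n) (a : Words n) : Words n → B :=
  if a x = a y then q • wd B a
  else if a x < a y then wd B (a ∘ Equiv.swap x y)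
  else q • wd B (a ∘ Equiv.swap x y) + (q - 1) • wd B a

/-- The matrix of a Hecke generator acting on the positions `x`, `y`. -/
def swapMat (q : B) (x y : Fin n) : Matrix (Words n) (Words n) B :=
  Matrix.of fun b a => swapCol q x y a b

theorem mulVec_wd (M : Matrix (Words n) (Words n) B) (a : Words n) :
    M.mulVec (wd B a) = fun b => M b a := by
  ext b
  simp [wd]

theorem swapMat_wd (q : B) (x y : Fin n) (a : Words n) :
    (swapMat q x y).mulVec (wd B a) = swapCol q x y a := by
  rw [mulVec_wd]; rfl

theorem swapMat_eq {q : B} {x y : Fin n} {a : Words n} (h : a x = a y) :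
    (swapMat q x y).mulVec (wd B a) = q • wd B a := by
  rw [swapMat_wd, swapCol, if_pos h]

theorem swapMat_lt {q : B} {x y : Fin n} {a : Words n} (h : a x < a y) :
    (swapMat q x y).mulVec (wd B a) = wd B (a ∘ Equiv.swap x y) := by
  rw [swapMat_wd, swapCol, if_neg h.ne, if_pos h]

theorem swapMat_gt {q : B} {x y : Fin n} {a : Words n} (h : a y < a x) :
    (swapMat q x y).mulVec (wd B a) = q • wd B (a ∘ Equiv.swap x y) + (q - 1) • wd B a := by
  rw [swapMat_wd, swapCol, if_neg h.ne', if_neg h.asymm]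

theorem matrix_ext_wd {M N : Matrix (Words n) (Words n) B}
    (h : ∀ a, M.mulVec (wd B a) = N.mulVec (wd B a)) : M = N := by
  ext b a
  have := congrFun (h a) b
  simpa only [mulVec_wd] using this

theorem comp_swap_swap (a : Words n) (x y : Fin n) :
    (a ∘ Equiv.swap x y) ∘ Equiv.swap x y = a := by
  ext p; simp

theorem swapMat_quad (q : B) (x y : Fin n) :
    swapMat q x y * swapMat q x y = (q - 1) • swapMat q x y + q • 1 := by
  refine matrix_ext_wd fun a => ?_
  simp only [← Matrix.mulVec_mulVec, Matrix.add_mulVec, Matrix.smul_mulVec, Matrix.one_mulVec]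
  rcases lt_trichotomy (a x) (a y) with h | h | h
  · have h' : (a ∘ Equiv.swap x y) y < (a ∘ Equiv.swap x y) x := by simpa
    rw [swapMat_lt h, swapMat_gt h', comp_swap_swap, add_comm]
  · simp only [swapMat_eq h, Matrix.mulVec_smul]
    module
  · have h' : (a ∘ Equiv.swap x y) x < (a ∘ Equiv.swap x y) y := by simpa
    simp only [swapMat_gt h, Matrix.mulVec_add, Matrix.mulVec_smul, swapMat_lt h', comp_swap_swap]
    module

theorem swapMat_comm (q : B) {x y z w : Fin n} (h1 : x ≠ z) (h2 : x ≠ w) (h3 : y ≠ z)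
    (h4 : y ≠ w) : swapMat q x y * swapMat q z w = swapMat q z w * swapMat q x y := by
  refine matrix_ext_wd fun a => ?_
  simp only [← Matrix.mulVec_mulVec]
  have e : (a ∘ Equiv.swap x y) ∘ Equiv.swap z w = (a ∘ Equiv.swap z w) ∘ Equiv.swap x y := by
    ext p
    simp only [Function.comp_apply]
    congr 2
    by_cases hx : p = x <;> by_cases hy : p = y <;> by_cases hz : p = z <;> by_cases hw : p = w <;>
      simp_all [Equiv.swap_apply_def, eq_comm]
  have f1 : (a ∘ Equiv.swap x y) z = a z := by simp [Equiv.swap_apply_of_ne_of_ne h1.symm h3.symm]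
  have f2 : (a ∘ Equiv.swap x y) w = a w := by simp [Equiv.swap_apply_of_ne_of_ne h2.symm h4.symm]
  have f3 : (a ∘ Equiv.swap z w) x = a x := by simp [Equiv.swap_apply_of_ne_of_ne h1 h2]
  have f4 : (a ∘ Equiv.swap z w) y = a y := by simp [Equiv.swap_apply_of_ne_of_ne h3 h4]
  simp only [swapMat_wd, swapCol]
  split_ifs <;>
    simp only [Matrix.mulVec_add, Matrix.mulVec_smul, swapMat_wd, swapCol,
      if_true, if_false, *] <;> module

-- Only the relative order of the letters at the three positions matters. In each case both sides
-- expand in the rearrangements of the word, which are identified by `e`, the braid relation in S_3.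
set_option linter.unusedSimpArgs false in
theorem swapMat_braid (q : B) {x y z : Fin n} (hxy : x ≠ y) (hxz : x ≠ z) (hyz : y ≠ z) :
    swapMat q x y * swapMat q y z * swapMat q x y =
      swapMat q y z * swapMat q x y * swapMat q y z := by
  refine matrix_ext_wd fun a => ?_
  simp only [← Matrix.mulVec_mulVec]
  have e : ((a ∘ Equiv.swap x y) ∘ Equiv.swap y z) ∘ Equiv.swap x y =
      ((a ∘ Equiv.swap y z) ∘ Equiv.swap x y) ∘ Equiv.swap y z := by
    ext p
    simp only [Function.comp_apply]
    congr 2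
    by_cases hx : p = x <;> by_cases hy : p = y <;> by_cases hz : p = z <;>
      simp_all [Equiv.swap_apply_def, eq_comm]
  have k1 : ∀ b : Words n, (b ∘ Equiv.swap x y) x = b y := by simp
  have k2 : ∀ b : Words n, (b ∘ Equiv.swap x y) y = b x := by simp
  have k3 : ∀ b : Words n, (b ∘ Equiv.swap x y) z = b z := by
    simp [Equiv.swap_apply_of_ne_of_ne hxz.symm hyz.symm]
  have k4 : ∀ b : Words n, (b ∘ Equiv.swap y z) y = b z := by simp
  have k5 : ∀ b : Words n, (b ∘ Equiv.swap y z) z = b y := by simp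
  have k6 : ∀ b : Words n, (b ∘ Equiv.swap y z) x = b x := by
    simp [Equiv.swap_apply_of_ne_of_ne hxy hxz]
  simp only [swapMat_wd, swapCol]
  rcases lt_trichotomy (a x) (a y) with h | h | h <;>
    rcases lt_trichotomy (a y) (a z) with h' | h' | h' <;>
    rcases lt_trichotomy (a x) (a z) with h'' | h'' | h'' <;>
    first
    | (exfalso; omega)
    | (simp only [h.ne, h.ne', h, h.asymm, h'.ne, h'.ne', h', h'.asymm, h''.ne, h''.ne', h'', h''.asymm, Matrix.mulVec_add, Matrix.mulVec_smul, swapMat_wd,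
        swapCol, k1, k2, k3, k4, k5, k6, e, comp_swap_swap, if_true, if_false, lt_irrefl]
       try module)
    | (simp only [h, h'.ne, h'.ne', h', h'.asymm, h''.ne, h''.ne', h'', h''.asymm, Matrix.mulVec_add, Matrix.mulVec_smul, swapMat_wd,
        swapCol, k1, k2, k3, k4, k5, k6, e, comp_swap_swap, if_true, if_false, lt_irrefl]
       try module)
    | (simp only [h.ne, h.ne', h, h.asymm, h', h''.ne, h''.ne', h'', h''.asymm, Matrix.mulVec_add, Matrix.mulVec_smul, swapMat_wd,
        swapCol, k1, k2, k3, k4, k5, k6, e, comp_swap_swap, if_true, if_false, lt_irrefl]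
       try module)
    | (simp only [h.ne, h.ne', h, h.asymm, h'.ne, h'.ne', h', h'.asymm, h'', Matrix.mulVec_add, Matrix.mulVec_smul, swapMat_wd,
        swapCol, k1, k2, k3, k4, k5, k6, e, comp_swap_swap, if_true, if_false, lt_irrefl]
       try module)
    | (simp only [h, h', h'', Matrix.mulVec_add, Matrix.mulVec_smul, swapMat_wd,
        swapCol, k1, k2, k3, k4, k5, k6, e, comp_swap_swap, if_true, if_false, lt_irrefl]
       try module)

end Words

/-! ### The Hecke algebra as an algebra of operators on words -/

section HeckeAlg

variable {B : Type*} [CommRing B] {n : ℕ}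

/-- The `i`-th generator of the Hecke algebra, acting on words by position. -/
def heckeGen (n : ℕ) (q : B) (i : ℕ) : Matrix (Words n) (Words n) B :=
  if h : i + 1 < n then swapMat q ⟨i, by omega⟩ ⟨i + 1, h⟩ else 0

theorem heckeGen_of_lt (q : B) {i : ℕ} (h : i + 1 < n) :
    heckeGen n q i = swapMat q ⟨i, by omega⟩ ⟨i + 1, h⟩ := dif_pos h

theorem heckeRel_heckeGen (n : ℕ) (q : B) : HeckeRel q n (heckeGen n q) where
  quad i hi := by rw [heckeGen_of_lt q hi, swapMat_quad]
  braid i hi := by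
    rw [heckeGen_of_lt q (show i + 1 < n by omega), heckeGen_of_lt q hi]
    exact swapMat_braid q (by simp) (by simp; omega) (by simp)
  comm i j hi hj := by
    rw [heckeGen_of_lt q (show i + 1 < n by omega), heckeGen_of_lt q hj]
    exact swapMat_comm q (by simp; omega) (by simp; omega) (by simp; omega) (by simp; omega)

/-- The Hecke algebra of `S_k` for `k ≤ n`, acting on the words of length `n`. -/
abbrev heckeAlg (n : ℕ) (q : B) (k : ℕ) : Subalgebra B (Matrix (Words n) (Words n) B) :=
  parab B (heckeGen n q) k

/-- The permutation `σ` fixes all points from `k` on. -/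
def FixesFrom (k : ℕ) (σ : Equiv.Perm (Fin n)) : Prop := ∀ p : Fin n, k ≤ p → σ p = p

theorem FixesFrom.lt {k : ℕ} {σ : Equiv.Perm (Fin n)} (h : FixesFrom k σ) {p : Fin n}
    (hp : (p : ℕ) < k) : (σ p : ℕ) < k := by
  by_contra hc
  have := σ.injective (h (σ p) (by omega))
  rw [this] at hc
  omega

theorem FixesFrom.mul {k : ℕ} {σ τ : Equiv.Perm (Fin n)} (h : FixesFrom k σ) (h' : FixesFrom k τ) :
    FixesFrom k (σ * τ) := fun p hp => by rw [Equiv.Perm.mul_apply, h' p hp, h p hp]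

theorem fixesFrom_one (k : ℕ) : FixesFrom k (1 : Equiv.Perm (Fin n)) := fun _ _ => rfl

theorem fixesFrom_swap {k i : ℕ} (hk : i + 1 < k) (hi : i + 1 < n) :
    FixesFrom k (Equiv.swap (⟨i, by omega⟩ : Fin n) ⟨i + 1, hi⟩) := fun p hp =>
  Equiv.swap_apply_of_ne_of_ne (fun h => by rw [h] at hp; simp at hp; omega)
    (fun h => by rw [h] at hp; simp at hp; omega)

theorem eq_one_of_strictMono {σ : Equiv.Perm (Fin n)} (h : StrictMono σ) : σ = 1 := by
  have := Subsingleton.elim (h.orderIsoOfSurjective _ σ.surjective) (OrderIso.refl (Fin n))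
  exact Equiv.ext fun p => congrArg (fun e : Fin n ≃o Fin n => e p) this

/-- Induction along ascents over the permutations of the first `k` points. -/
theorem ascent_induction {k : ℕ} (hk : k ≤ n) {P : Equiv.Perm (Fin n) → Prop} (h1 : P 1)
    (hs : ∀ (σ : Equiv.Perm (Fin n)) (i : ℕ) (hi : i + 1 < k), FixesFrom k σ →
      σ ⟨i, by omega⟩ < σ ⟨i + 1, by omega⟩ → P σ →
      P (σ * Equiv.swap ⟨i, by omega⟩ ⟨i + 1, by omega⟩)) :
    ∀ σ, FixesFrom k σ → P σ := by
  intro σ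
  -- Exchanging the two letters of a descent makes the word lexicographically smaller, so the
  -- lexicographic order on words replaces the length function.
  induction hl : toLex (σ : Fin n → Fin n) using WellFoundedLT.induction generalizing σ with
  | ind a ih =>
    subst hl
    intro hσ
    by_cases hd : ∃ (i : ℕ) (hi : i + 1 < k), σ ⟨i + 1, by omega⟩ < σ ⟨i, by omega⟩
    · obtain ⟨i, hi, hlt⟩ := hd
      have e : σ = (σ * Equiv.swap ⟨i, by omega⟩ ⟨i + 1, by omega⟩) *
          Equiv.swap ⟨i, by omega⟩ ⟨i + 1, by omega⟩ := by
        rw [mul_assoc, Equiv.swap_mul_self, mul_one]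
      have hf := hσ.mul (fixesFrom_swap hi (by omega))
      rw [e]
      refine hs _ i hi hf (by simpa using hlt) (ih _ ?_ _ rfl hf)
      exact Pi.lex_desc (by simp) hlt
    · push Not at hd
      suffices StrictMono σ by rw [eq_one_of_strictMono this]; exact h1
      cases n with
      | zero => exact fun a => a.elim0
      | succ n =>
        refine Fin.strictMono_iff_lt_succ.mpr fun i => ?_
        have hne : σ i.castSucc ≠ σ i.succ := fun h => by
          have := σ.injective h
          simp [Fin.ext_iff] at this
        by_cases hi : (i : ℕ) + 1 < k
        · exact lt_of_le_of_ne (hd i hi) hne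
        · have h2 := hσ i.succ (by simp; omega)
          rw [h2]
          rcases lt_or_ge (i : ℕ) k with h | h
          · have := hσ.lt (p := i.castSucc) (by simpa using h)
            rw [Fin.lt_def, Fin.val_succ]
            omega
          · rw [hσ i.castSucc (by simpa using h)]
            exact Fin.castSucc_lt_succ

theorem swapMat_apply_ne_zero {q : B} {x y : Fin n} {a b : Words n} (h : swapMat q x y b a ≠ 0) :
    b = a ∨ b = a ∘ Equiv.swap x y := by
  by_contra hc
  push Not at hc
  apply h
  simp only [swapMat, Matrix.of_apply, swapCol]
  split_ifs <;> simp [wd, hc.1, hc.2]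

/-- Elements of the Hecke algebra of `S_k` permute the first `k` letters of words. -/
theorem exists_perm_of_apply_ne_zero {q : B} {k : ℕ} (hk : k ≤ n)
    {y : Matrix (Words n) (Words n) B} (hy : y ∈ heckeAlg n q k) {a b : Words n} (h : y b a ≠ 0) :
    ∃ σ : Equiv.Perm (Fin n), FixesFrom k σ ∧ b = a ∘ σ := by
  refine parab_induction (p := fun y => ∀ a b : Words n, y b a ≠ 0 →
    ∃ σ : Equiv.Perm (Fin n), FixesFrom k σ ∧ b = a ∘ σ) ?_ ?_ ?_ ?_ hy a b h
  · intro a b h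
    refine ⟨1, fixesFrom_one k, ?_⟩
    by_contra hc
    exact h (Matrix.one_apply_ne hc)
  · intro x y hx hy a b h
    by_cases h1 : x b a = 0
    · exact hy a b fun h2 => h (by simp [h1, h2])
    · exact hx a b h1
  · intro c x hx a b h
    exact hx a b fun h1 => h (by simp [h1])
  · intro i hi x _ hx a b h
    rw [Matrix.mul_apply] at h
    obtain ⟨c, -, hc⟩ := Finset.exists_ne_zero_of_sum_ne_zero h
    obtain ⟨σ, hσ, rfl⟩ := hx a c (right_ne_zero_of_mul hc)
    have h2 := left_ne_zero_of_mul hc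
    rw [heckeGen_of_lt q (show i + 1 < n by omega)] at h2
    rcases swapMat_apply_ne_zero h2 with rfl | rfl
    · exact ⟨σ, hσ, rfl⟩
    · exact ⟨σ * _, hσ.mul (fixesFrom_swap hi (by omega)), rfl⟩

/-- Along an ascent a generator is a pure exchange of letters, so a reduced product carries the
identity word to σ without lower terms. -/
theorem exists_mulVec_wd_id (q : B) {k : ℕ} (hk : k ≤ n) (σ : Equiv.Perm (Fin n))
    (hσ : FixesFrom k σ) : ∃ y ∈ heckeAlg n q k, y.mulVec (wd B id) = wd B σ := by
  refine ascent_induction hk (P := fun σ => ∃ y ∈ heckeAlg n q k, y.mulVec (wd B id) = wd B σ)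
    ⟨1, one_mem _, by simp⟩ ?_ σ hσ
  rintro σ i hi - hlt ⟨y, hy, e⟩
  refine ⟨heckeGen n q i * y, mul_mem (mem_parab hi) hy, ?_⟩
  rw [← Matrix.mulVec_mulVec, e, heckeGen_of_lt q (show i + 1 < n by omega), swapMat_lt hlt]
  rfl

theorem vecMul_wd_swapMat {q : B} {x y : Fin n} {a : Words n} (h : a x < a y) :
    (swapMat q x y).vecMul (wd B a) = q • wd B (a ∘ Equiv.swap x y) := by
  have hne : a ∘ Equiv.swap x y ≠ a := fun e => h.ne' (by simpa using congrFun e x)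
  ext b
  simp only [wd, Matrix.single_one_vecMul, Matrix.row_apply, swapMat, Matrix.of_apply, swapCol,
    Pi.smul_apply, smul_eq_mul]
  by_cases hb : b = a ∘ Equiv.swap x y
  · subst hb
    simp [h.ne', h.asymm, comp_swap_swap, hne.symm]
  · rw [Pi.single_eq_of_ne hb, mul_zero]
    by_cases hba : b = a
    · subst hba
      simp [h.ne, h, hne.symm]
    · have h2 : b ∘ Equiv.swap x y ≠ a := fun e => hb (by rw [← e, comp_swap_swap])
      split_ifs <;> simp [Ne.symm hba, h2.symm]

/-- The transposed statement. On row vectors each ascent costs a factor q, which is where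
nondegeneracy of the trace form will need `q ≠ 0`. -/
theorem exists_vecMul_wd_id (q : B) {k : ℕ} (hk : k ≤ n) (σ : Equiv.Perm (Fin n))
    (hσ : FixesFrom k σ) :
    ∃ y ∈ heckeAlg n q k, ∃ m : ℕ, y.vecMul (wd B id) = q ^ m • wd B σ := by
  refine ascent_induction hk (P := fun σ => ∃ y ∈ heckeAlg n q k, ∃ m : ℕ,
    y.vecMul (wd B id) = q ^ m • wd B σ) ⟨1, one_mem _, 0, by simp⟩ ?_ σ hσ
  rintro σ i hi - hlt ⟨y, hy, m, e⟩
  refine ⟨y * heckeGen n q i, mul_mem hy (mem_parab hi), m + 1, ?_⟩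
  rw [← Matrix.vecMul_vecMul, e, heckeGen_of_lt q (show i + 1 < n by omega), Matrix.smul_vecMul,
    vecMul_wd_swapMat hlt, smul_smul, pow_succ]
  rfl

end HeckeAlg

/-! ### Lifting homomorphisms along graphs -/

section Graph

variable {F : Type*} [Field F]

theorem finrank_le_of_spanBd {M : Type*} [AddCommGroup M] [Module F M] {W : Submodule F M} {N : ℕ}
    (h : SpanBd ⊥ W N) : Module.Finite F W ∧ Module.finrank F W ≤ N := by
  obtain ⟨s, hs, h⟩ := h
  rw [sup_bot_eq] at h
  have : Module.Finite F (Submodule.span F (s : Set M)) := Module.Finite.span_finset F s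
  have : FiniteDimensional F W := Submodule.finiteDimensional_of_le h
  exact ⟨this, (Submodule.finrank_mono h).trans ((finrank_span_finset_le_card s).trans hs)⟩

/-- A subalgebra of a product projecting onto `S` and no bigger than `S` is a graph. -/
theorem exists_algHom_of_graph {A D : Type*} [Ring A] [Algebra F A] [Ring D] [Algebra F D]
    (S : Subalgebra F A) (Γ : Subalgebra F (A × D)) (hΓ : Γ.map (AlgHom.fst F A D) = S) {N : ℕ}
    (hb : SpanBd ⊥ (Subalgebra.toSubmodule Γ) N) (hN : N ≤ Module.finrank F S) :
    ∃ φ : S →ₐ[F] D, ∀ x ∈ Γ, ∀ h : x.1 ∈ S, φ ⟨x.1, h⟩ = x.2 := by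
  obtain ⟨hfin, hle⟩ := finrank_le_of_spanBd hb
  have hmem : ∀ x : Γ, (AlgHom.fst F A D).comp Γ.val x ∈ S := fun x => hΓ ▸ ⟨x, x.2, rfl⟩
  let p : Γ →ₐ[F] S := ((AlgHom.fst F A D).comp Γ.val).codRestrict S hmem
  have hsurj : Function.Surjective p := by
    rintro ⟨a, ha⟩
    rw [← hΓ] at ha
    obtain ⟨x, hx, rfl⟩ := ha
    exact ⟨⟨x, hx⟩, rfl⟩
  -- The domain has dimension at most `N`, which is at most that of the target, so the surjection
  -- has trivial kernel.
  have hinj : Function.Injective p := by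
    have hfin' : Module.Finite F Γ := hfin
    have h1 := LinearMap.finrank_range_add_finrank_ker p.toLinearMap
    rw [LinearMap.range_eq_top.mpr hsurj, finrank_top] at h1
    have h2 : Module.finrank F Γ ≤ N := hle
    exact LinearMap.ker_eq_bot.mp (Submodule.finrank_eq_zero.mp
      (show Module.finrank F (LinearMap.ker p.toLinearMap) = 0 by omega))
  let e := AlgEquiv.ofBijective p ⟨hinj, hsurj⟩
  refine ⟨((AlgHom.snd F A D).comp Γ.val).comp e.symm.toAlgHom, fun x hx h => ?_⟩
  have : e.symm ⟨x.1, h⟩ = ⟨x, hx⟩ := by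
    rw [AlgEquiv.symm_apply_eq]; rfl
  simp [this]

end Graph

/-! ### Dimension, trace form and universal property of the Hecke algebra over a field -/

section HeckeField

variable {F : Type*} [Field F] {n : ℕ}

theorem HeckeRel.spanBd_parab {q : F} {D : Type*} [Ring D] [Algebra F D] {t : ℕ → D}
    (h : HeckeRel q n t) : SpanBd ⊥ (Subalgebra.toSubmodule (parab F t n)) n.factorial := by
  have h1 : SpanBd (⊥ : Submodule F D) (Submodule.span F {1}) 1 :=
    ⟨{1}, by simp, by simp⟩
  have h2 := h.mulLeft.spanBd_orb_factorial (V := ⊥) (by simp) n le_rfl _ h1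
  rw [mul_one] at h2
  refine h2.mono (fun a ha => ?_) le_rfl le_rfl
  have := mem_orb (mulLeft_mem_parab ha) (Submodule.mem_span_singleton_self (R := F) (1 : D))
  simpa using this

theorem card_fixesFrom {k : ℕ} (hk : k ≤ n) :
    Nat.card {σ : Equiv.Perm (Fin n) // FixesFrom k σ} = k.factorial := by
  have e := Equiv.Perm.subtypeEquivSubtypePerm (fun p : Fin n => (p : ℕ) < k)
  have e2 : {f : Equiv.Perm (Fin n) // ∀ a : Fin n, ¬(a : ℕ) < k → f a = a} ≃
      {σ : Equiv.Perm (Fin n) // FixesFrom k σ} :=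
    Equiv.subtypeEquivRight fun f => by simp [FixesFrom]
  rw [← Nat.card_congr (e.trans e2), Nat.card_eq_fintype_card, Fintype.card_perm,
    Fintype.card_fin_lt_of_le hk]

/-- The value of an operator on the word `id`. -/
def evalId (q : F) (k : ℕ) : heckeAlg n q k →ₗ[F] (Words n → F) :=
  ((Matrix.mulVecBilin F F).flip (wd F id)).comp (heckeAlg n q k).val.toLinearMap

theorem evalId_apply {q : F} {k : ℕ} (y : heckeAlg n q k) :
    evalId q k y = (y : Matrix (Words n) (Words n) F).mulVec (wd F id) := rfl

/-- The spanning bound gives at most k!, while the values on the identity word include k! linearly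
independent words. Equality yields the dimension and at the same time that an element is determined
by its value on that word. -/
theorem finrank_heckeAlg_aux (q : F) {k : ℕ} (hk : k ≤ n) :
    Module.finrank F (heckeAlg n q k) = k.factorial ∧ Function.Injective (evalId (n := n) q k) := by
  obtain ⟨hfin, hle⟩ := finrank_le_of_spanBd ((heckeRel_heckeGen n q).mono hk).spanBd_parab
  have hfin' : Module.Finite F (heckeAlg n q k) := hfin
  have hle' : Module.finrank F (heckeAlg n q k) ≤ k.factorial := hle
  have hli : LinearIndependent F
      (fun σ : {σ : Equiv.Perm (Fin n) // FixesFrom k σ} => wd F (n := n) σ.1) := by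
    have := (Pi.basisFun F (Words n)).linearIndependent.comp
      (fun σ : {σ : Equiv.Perm (Fin n) // FixesFrom k σ} => (σ.1 : Words n))
      (fun σ τ h => Subtype.ext (Equiv.ext (congrFun h)))
    convert this using 2 with σ
    ext b
    simp [wd]
  have hsub : Submodule.span F (Set.range
      fun σ : {σ : Equiv.Perm (Fin n) // FixesFrom k σ} => wd F (n := n) σ.1) ≤
      LinearMap.range (evalId (n := n) q k) := by
    rw [Submodule.span_le]
    rintro _ ⟨σ, rfl⟩
    obtain ⟨y, hy, e⟩ := exists_mulVec_wd_id q hk σ.1 σ.2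
    exact ⟨⟨y, hy⟩, e⟩
  have h1 := Submodule.finrank_mono hsub
  have : Fintype {σ : Equiv.Perm (Fin n) // FixesFrom k σ} := Fintype.ofFinite _
  rw [finrank_span_eq_card hli, ← Nat.card_eq_fintype_card, card_fixesFrom hk] at h1
  have h2 := LinearMap.finrank_range_add_finrank_ker (evalId (n := n) q k)
  exact ⟨by omega, LinearMap.ker_eq_bot.mp (Submodule.finrank_eq_zero.mp (by omega))⟩

theorem finrank_heckeAlg (q : F) {k : ℕ} (hk : k ≤ n) :
    Module.finrank F (heckeAlg n q k) = k.factorial := (finrank_heckeAlg_aux q hk).1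

instance (q : F) (k : ℕ) : Module.Finite F (heckeAlg n q k) :=
  FiniteDimensional.finiteDimensional_subalgebra _

/-- The canonical trace form of the Hecke algebra is nondegenerate. -/
theorem eq_zero_of_mul_id_id {q : F} (hq : q ≠ 0) {k : ℕ} (hk : k ≤ n)
    {z : Matrix (Words n) (Words n) F} (hz : z ∈ heckeAlg n q k)
    (h : ∀ y ∈ heckeAlg n q k, (y * z) id id = 0) : z = 0 := by
  suffices evalId q k ⟨z, hz⟩ = 0 from
    congrArg Subtype.val ((finrank_heckeAlg_aux q hk).2 (this.trans (map_zero _).symm))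
  ext b
  rw [evalId_apply, mulVec_wd]
  by_contra hb
  obtain ⟨σ, hσ, rfl⟩ := exists_perm_of_apply_ne_zero hk hz hb
  -- The row of `y` at the identity word is a multiple of the single word σ, so `(y * z) id id` is
  -- q^m times the coefficient of σ in `z` applied to the identity word.
  obtain ⟨y, hy, m, e⟩ := exists_vecMul_wd_id q hk σ hσ
  have h1 := h y hy
  rw [Matrix.mul_apply] at h1
  have h2 : ∀ c, y id c = q ^ m * wd F (σ : Words n) c := fun c => by
    simpa [wd] using congrFun e c
  simp only [h2, wd, Pi.single_apply] at h1
  simp at h1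
  exact hb (h1.resolve_left fun h => absurd h.1 hq)

/-- Elements satisfying the Hecke relations define a homomorphism from the Hecke algebra. -/
theorem HeckeRel.exists_algHom {q : F} {k : ℕ} (hk : k ≤ n) {D : Type*} [Ring D] [Algebra F D]
    {t : ℕ → D} (h : HeckeRel q k t) :
    ∃ φ : heckeAlg n q k →ₐ[F] D, ∀ i (hi : i + 1 < k), φ ⟨heckeGen n q i, mem_parab hi⟩ = t i := by
  have h0 := (heckeRel_heckeGen n q).mono hk
  have hp : HeckeRel q k (fun i => (heckeGen n q i, t i)) :=
    ⟨fun i hi => Prod.ext (h0.quad i hi) (h.quad i hi),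
      fun i hi => Prod.ext (h0.braid i hi) (h.braid i hi),
      fun i j hi hj => Prod.ext (h0.comm i j hi hj) (h.comm i j hi hj)⟩
  obtain ⟨φ, hφ⟩ := exists_algHom_of_graph (heckeAlg n q k) (parab F (fun i => (heckeGen n q i, t i)) k)
    (by rw [parab, AlgHom.map_adjoin, Set.image_image]; rfl) hp.spanBd_parab
    (finrank_heckeAlg q hk).ge
  exact ⟨φ, fun i hi => hφ _ (mem_parab hi) _⟩

end HeckeField

/-! ### Markov traces on words and semisimplicity of the Hecke algebra -/

section HeckeTrace

variable {F : Type*} [Field F] {n : ℕ}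

/-- The `q`-integer `1 + q + ⋯ + q^(m-1)`. -/
def qInt (q : F) (m : ℕ) : F := ∑ j ∈ Finset.range m, q ^ j

/-- The weight of the letter `l` for the trace with `m` letters. -/
def letterWt (q : F) (m l : ℕ) : F := if l < m then q ^ (m - 1 - l) / qInt q m else 0

/-- The weight of a word. -/
def wordWt (q : F) (m : ℕ) (a : Words n) : F := ∏ p, letterWt q m (a p)

/-- The Markov trace coming from words in `m` letters. -/
def wordTrace (q : F) (m : ℕ) : Matrix (Words n) (Words n) F →ₗ[F] F :=
  (Matrix.traceLinearMap (Words n) F F).comp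
    (LinearMap.mulLeft F (Matrix.diagonal (wordWt (n := n) q m)))

theorem wordTrace_apply (q : F) (m : ℕ) (z : Matrix (Words n) (Words n) F) :
    wordTrace q m z = ∑ a, wordWt q m a * z a a := by
  simp [wordTrace, Matrix.trace, Matrix.diagonal_mul]

theorem wordWt_comp (q : F) (m : ℕ) (a : Words n) (σ : Equiv.Perm (Fin n)) :
    wordWt q m (a ∘ σ) = wordWt q m a :=
  Equiv.prod_comp σ fun p => letterWt q m (a p)

/-- The weight depends only on the multiset of letters, and elements of the Hecke algebra merely
permute letters. This is what makes the weighted trace a trace on the Hecke algebra. -/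
theorem wordWt_commute (q : F) (m : ℕ) {k : ℕ} (hk : k ≤ n) {z : Matrix (Words n) (Words n) F}
    (hz : z ∈ heckeAlg n q k) : Commute (Matrix.diagonal (wordWt (n := n) q m)) z := by
  ext b a
  rw [Matrix.diagonal_mul, Matrix.mul_diagonal]
  by_cases h : z b a = 0
  · simp [h]
  · obtain ⟨σ, -, rfl⟩ := exists_perm_of_apply_ne_zero hk hz h
    rw [wordWt_comp, mul_comm]

theorem wordTrace_mul_comm (q : F) (m : ℕ) {k : ℕ} (hk : k ≤ n)
    {y z : Matrix (Words n) (Words n) F} (hy : y ∈ heckeAlg n q k) :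
    wordTrace q m (y * z) = wordTrace q m (z * y) := by
  simp only [wordTrace, LinearMap.comp_apply, LinearMap.mulLeft_apply, Matrix.traceLinearMap_apply]
  rw [← mul_assoc, (wordWt_commute q m hk hy).eq, mul_assoc, Matrix.trace_mul_comm, mul_assoc]

/-- The operator replacing the letter at the position `p` by `l`. -/
def setLetter (p l : Fin n) : Matrix (Words n) (Words n) F :=
  Matrix.of fun b a => wd F (Function.update a p l) b

theorem setLetter_wd (p l : Fin n) (a : Words n) :
    (setLetter p l : Matrix (Words n) (Words n) F).mulVec (wd F a) =
      wd F (Function.update a p l) := by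
  rw [mulVec_wd]; rfl

theorem setLetter_commute {q : F} {k : ℕ} {p l : Fin n} (hp : k ≤ p)
    {z : Matrix (Words n) (Words n) F} (hz : z ∈ heckeAlg n q k) : Commute z (setLetter p l) := by
  suffices heckeAlg n q k ≤ Subalgebra.centralizer F {(setLetter p l : Matrix _ _ F)} from
    ((Subalgebra.mem_centralizer_iff F).mp (this hz) _ rfl).symm
  refine parab_le_iff.mpr fun i hi => (Subalgebra.mem_centralizer_iff F).mpr ?_
  rintro _ rfl
  refine matrix_ext_wd fun a => ?_
  have hin : i + 1 < n := by omega
  have h1 : (⟨i, by omega⟩ : Fin n) ≠ p := fun h => by rw [← h] at hp; simp at hp; omega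
  have h2 : (⟨i + 1, hin⟩ : Fin n) ≠ p := fun h => by rw [← h] at hp; simp at hp; omega
  have e : Function.update a p l ∘ Equiv.swap ⟨i, by omega⟩ ⟨i + 1, hin⟩ =
      Function.update (a ∘ Equiv.swap ⟨i, by omega⟩ ⟨i + 1, hin⟩) p l := by
    have := Function.update_comp_equiv a (Equiv.swap ⟨i, by omega⟩ ⟨i + 1, hin⟩) p l
    rw [this, Equiv.symm_swap, Equiv.swap_apply_of_ne_of_ne h1.symm h2.symm]
  rw [heckeGen_of_lt q hin, ← Matrix.mulVec_mulVec, ← Matrix.mulVec_mulVec, setLetter_wd,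
    swapMat_wd, swapMat_wd, swapCol, swapCol, Function.update_of_ne h1, Function.update_of_ne h2, e]
  split_ifs <;> simp [Matrix.mulVec_add, Matrix.mulVec_smul, setLetter_wd]

/-- Elements of H_k neither see nor move the letters at positions from k on: replacing such a letter
commutes with them, and the two products are compared at a diagonal entry. -/
theorem apply_update {q : F} {k : ℕ} (hk : k ≤ n) {p : Fin n} (l : Fin n) (hp : k ≤ p)
    {z : Matrix (Words n) (Words n) F} (hz : z ∈ heckeAlg n q k) (a : Words n) :
    z (Function.update a p l) (Function.update a p l) = z a a := by
  have h := congrFun (congrArg (fun M => Matrix.mulVec M (wd F a)) (setLetter_commute (l := l) hp hz).eq)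
    (Function.update a p l)
  simp only [← Matrix.mulVec_mulVec, setLetter_wd, mulVec_wd z] at h
  rw [h, Matrix.mulVec, dotProduct, Finset.sum_eq_single a]
  · simp [setLetter, wd]
  · intro c _ hc
    by_cases h0 : z c a = 0
    · simp [h0]
    · obtain ⟨σ, hσ, rfl⟩ := exists_perm_of_apply_ne_zero hk hz h0
      rw [setLetter, Matrix.of_apply, wd, Pi.single_eq_of_ne, zero_mul]
      intro he
      apply hc
      ext r
      by_cases hr : r = p
      · subst hr; simp [hσ r hp]
      · have := congrFun he r
        simp only [Function.update_of_ne hr] at this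
        rw [this]
  · simp

theorem sum_letterWt (q : F) {m : ℕ} (hm : m ≤ n) (g : ℕ → F) :
    ∑ l : Fin n, letterWt q m l * g l =
      (∑ l ∈ Finset.range m, q ^ (m - 1 - l) * g l) / qInt q m := by
  rw [Fin.sum_univ_eq_sum_range (fun l => letterWt q m l * g l) n, Finset.sum_div]
  symm
  refine Finset.sum_subset_zero_on_sdiff (Finset.range_subset_range.mpr hm) (fun l hl => ?_)
    fun l hl => ?_
  · rw [letterWt, if_neg (by simp at hl; omega), zero_mul]
  · rw [letterWt, if_pos (by simpa using hl)]
    ring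

theorem sum_letterWt_one {q : F} {m : ℕ} (hm : m ≤ n) (h : qInt q m ≠ 0) :
    ∑ l : Fin n, letterWt q m l = 1 := by
  have := sum_letterWt q hm (fun _ => 1)
  simp only [mul_one] at this
  rw [this, div_eq_one_iff_eq h, qInt, ← Finset.sum_range_reflect]
  refine Finset.sum_congr rfl fun j hj => ?_
  rw [Finset.mem_range] at hj
  congr 1
  omega

/-- The terms with `l < j` telescope to q^m - q^(m-j), the term `l = j` contributes q^(m-j), and
those with `l > j` vanish. The total does not depend on `j`, which is the source of the Markov
property. -/
theorem qsum_aux (q : F) (m j : ℕ) (hj : j < m) :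
    ∑ l ∈ Finset.range m, q ^ (m - 1 - l) * (if j = l then q else if j < l then 0 else q - 1) =
      q ^ m := by
  have h1 : ∀ j ≤ m, ∑ l ∈ Finset.range j, q ^ (m - 1 - l) * (q - 1) = q ^ m - q ^ (m - j) := by
    intro j hj
    induction j with
    | zero => simp
    | succ j ih =>
      rw [Finset.sum_range_succ, ih (by omega), show m - j = m - 1 - j + 1 by omega,
        show m - (j + 1) = m - 1 - j by omega]
      ring
  obtain ⟨d, rfl⟩ := Nat.exists_eq_add_of_lt hj
  have h2 : ∑ l ∈ Finset.range d, q ^ (j + d + 1 - 1 - (j + 1 + l)) *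
      (if j = j + 1 + l then q else if j < j + 1 + l then 0 else q - 1) = 0 :=
    Finset.sum_eq_zero fun l _ => by rw [if_neg (by omega), if_pos (by omega), mul_zero]
  have h3 : ∑ l ∈ Finset.range j, q ^ (j + d + 1 - 1 - l) *
      (if j = l then q else if j < l then 0 else q - 1) =
      ∑ l ∈ Finset.range j, q ^ (j + d + 1 - 1 - l) * (q - 1) :=
    Finset.sum_congr rfl fun l hl => by
      rw [Finset.mem_range] at hl
      rw [if_neg (by omega), if_neg (by omega)]
  rw [show Finset.range (j + d + 1) = Finset.range (j + 1 + d) by congr 1; omega,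
    Finset.sum_range_add, Finset.sum_range_succ, h2, h3, h1 j (by omega), if_pos rfl, ← pow_succ,
    show j + d + 1 - 1 - j + 1 = j + d + 1 - j by omega]
  ring

theorem swapMat_diag {q : F} {x y : Fin n} (a : Words n) :
    swapMat q x y a a = if a x = a y then q else if a x < a y then 0 else q - 1 := by
  simp only [swapMat, Matrix.of_apply, swapCol]
  by_cases h : a x = a y
  · simp [h, wd]
  · have hne : a ≠ a ∘ Equiv.swap x y := fun e => h (by simpa using congrFun e x)
    split_ifs <;> simp [wd, hne]

/-- An off-diagonal path would change the letter at position `k + 1` by the generator, and `z`,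
acting on the positions up to `k`, could not restore it. -/
theorem mul_heckeGen_diag {q : F} {k : ℕ} (hk : k + 1 < n) {z : Matrix (Words n) (Words n) F}
    (hz : z ∈ heckeAlg n q (k + 1)) (a : Words n) :
    (z * heckeGen n q k) a a = z a a * swapMat q ⟨k, by omega⟩ ⟨k + 1, hk⟩ a a := by
  rw [heckeGen_of_lt q hk, Matrix.mul_apply, Finset.sum_eq_single a]
  · intro b _ hb
    by_contra hc
    obtain ⟨σ, hσ, e⟩ := exists_perm_of_apply_ne_zero (by omega) hz (left_ne_zero_of_mul hc)
    rcases swapMat_apply_ne_zero (right_ne_zero_of_mul hc) with rfl | h3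
    · exact hb rfl
    · generalize hp' : (⟨k, by omega⟩ : Fin n) = p' at *
      generalize hp : (⟨k + 1, hk⟩ : Fin n) = p at *
      have h4 := congrFun e p
      rw [Function.comp_apply, hσ p (by rw [← hp])] at h4
      have h5 := congrFun h3 p
      rw [Function.comp_apply, Equiv.swap_apply_right] at h5
      apply hb
      rw [h3]
      ext r
      rw [Function.comp_apply]
      rcases eq_or_ne r p with rfl | hr
      · rw [Equiv.swap_apply_right, h4, h5]
      · rcases eq_or_ne r p' with rfl | hr'
        · rw [Equiv.swap_apply_left, h4, h5]
        · rw [Equiv.swap_apply_of_ne_of_ne hr' hr]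
  · simp

theorem wordWt_update_mul (q : F) (m : ℕ) (p l : Fin n) (a : Words n) :
    wordWt q m (Function.update a p l) * letterWt q m (a p) = wordWt q m a * letterWt q m l := by
  simp only [wordWt]
  rw [← Finset.mul_prod_erase _ _ (Finset.mem_univ p),
    ← Finset.mul_prod_erase (Finset.univ) (fun r => letterWt q m (a r)) (Finset.mem_univ p),
    Function.update_self, Finset.prod_congr rfl (g := fun r => letterWt q m (a r))]
  · ring
  · intro r hr
    rw [Function.update_of_ne (Finset.ne_of_mem_erase hr)]

/-- The exchange of an auxiliary letter with the letter at `p` is an involution on pairs. It serves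
to integrate out one position of a word. -/
theorem sum_update_swap (p : Fin n) (g : Words n → Fin n → F) :
    ∑ a, ∑ l, g a l = ∑ a, ∑ l, g (Function.update a p l) (a p) := by
  have inv : Function.Involutive
      (fun x : Words n × Fin n => (Function.update x.1 p x.2, x.1 p)) := by
    rintro ⟨a, l⟩
    simp
  have := Equiv.sum_comp inv.toPerm (fun x : Words n × Fin n => g x.1 x.2)
  rw [Fintype.sum_prod_type, Fintype.sum_prod_type] at this
  exact this.symm

/-- An auxiliary letter is inserted with total weight 1 and exchanged with the letter at `p`, of
which `f` is independent. The inner sum is then `qsum_aux`, unless a letter outside the alphabet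
makes the weight zero. -/
theorem sum_wordWt_swapMat {q : F} {m : ℕ} (hm : m ≤ n) (h : qInt q m ≠ 0) {p p' : Fin n}
    (hpp : p' ≠ p) {f : Words n → F} (hf : ∀ a l, f (Function.update a p l) = f a) :
    ∑ a, wordWt q m a * (f a * swapMat q p' p a a) =
      q ^ m / qInt q m * ∑ a, wordWt q m a * f a := by
  have h1 : ∀ a, wordWt q m a * (f a * swapMat q p' p a a) =
      ∑ l : Fin n, letterWt q m l * (wordWt q m a * (f a * swapMat q p' p a a)) := fun a => by
    rw [← Finset.sum_mul, sum_letterWt_one hm h, one_mul]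
  rw [Finset.sum_congr rfl fun a _ => h1 a, sum_update_swap p, Finset.mul_sum]
  refine Finset.sum_congr rfl fun a _ => ?_
  have h2 : ∀ l : Fin n, letterWt q m (a p) * (wordWt q m (Function.update a p l) *
      (f (Function.update a p l) * swapMat q p' p (Function.update a p l)
        (Function.update a p l))) = wordWt q m a * f a * (letterWt q m l *
          (if (a p' : ℕ) = l then q else if (a p' : ℕ) < l then 0 else q - 1)) := fun l => by
    rw [hf, swapMat_diag, Function.update_self, Function.update_of_ne hpp]
    simp only [Fin.ext_iff, Fin.lt_def]
    generalize (if (a p' : ℕ) = l then q else if (a p' : ℕ) < l then 0 else q - 1) = c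
    have := wordWt_update_mul q m p l a
    linear_combination f a * c * this
  rw [Finset.sum_congr rfl fun l _ => h2 l, ← Finset.mul_sum, sum_letterWt q hm
    (fun l => if (a p' : ℕ) = l then q else if (a p' : ℕ) < l then 0 else q - 1)]
  rcases lt_or_ge (a p' : ℕ) m with hl | hl
  · rw [qsum_aux q m _ hl]; ring
  · have : wordWt q m a = 0 := Finset.prod_eq_zero (Finset.mem_univ p') (if_neg (by omega))
    simp [this]

/-- The Markov property with parameter q^m/[m]. The dependence of the parameter on `m` provides the
interpolation points used below. -/
theorem wordTrace_mul_gen {q : F} {m : ℕ} (hm : m ≤ n) (h : qInt q m ≠ 0) {k : ℕ}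
    (hk : k + 1 < n) {z : Matrix (Words n) (Words n) F} (hz : z ∈ heckeAlg n q (k + 1)) :
    wordTrace q m (z * heckeGen n q k) = q ^ m / qInt q m * wordTrace q m z := by
  have hf : ∀ (a : Words n) (l : Fin n), z (Function.update a ⟨k + 1, hk⟩ l)
      (Function.update a ⟨k + 1, hk⟩ l) = z a a := fun a l =>
    apply_update (k := k + 1) (by omega) l (by simp) hz a
  have hpp : (⟨k, by omega⟩ : Fin n) ≠ ⟨k + 1, hk⟩ := by simp
  rw [wordTrace_apply, wordTrace_apply, ← sum_wordWt_swapMat hm h hpp (f := fun a => z a a) hf]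
  exact Finset.sum_congr rfl fun a _ => by rw [mul_heckeGen_diag hk hz a]

/-- The canonical trace is Markov with parameter 0. The word met by the generator has the letter `k
+ 1` at position `k + 1` and a smaller one before it, so the generator has no diagonal term there,
and after the exchange `x` cannot bring that letter back. -/
theorem gen_sandwich_id_id {q : F} {k : ℕ} (hk : k + 1 < n) {x y : Matrix (Words n) (Words n) F}
    (hx : x ∈ heckeAlg n q (k + 1)) (hy : y ∈ heckeAlg n q (k + 1)) :
    (x * heckeGen n q k * y) id id = 0 := by
  rw [Matrix.mul_apply]
  refine Finset.sum_eq_zero fun c _ => ?_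
  by_contra hc
  obtain ⟨σ, hσ, rfl⟩ := exists_perm_of_apply_ne_zero (by omega) hy (right_ne_zero_of_mul hc)
  have h1 := left_ne_zero_of_mul hc
  rw [Matrix.mul_apply] at h1
  obtain ⟨b, -, hb⟩ := Finset.exists_ne_zero_of_sum_ne_zero h1
  obtain ⟨τ, hτ, e⟩ := exists_perm_of_apply_ne_zero (by omega) hx (left_ne_zero_of_mul hb)
  have hb2 := right_ne_zero_of_mul hb
  have eb : b = (τ.symm : Words n) := by
    ext r
    have := congrFun e (τ.symm r)
    simp at this
    rw [this]
  have hp : ∀ r : Fin n, k + 1 ≤ (r : ℕ) → b r = r := fun r hr => by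
    rw [eb, Equiv.symm_apply_eq, hτ r hr]
  have hσk : (σ ⟨k, by omega⟩ : ℕ) < k + 1 := hσ.lt (by simp)
  have hσk1 : σ ⟨k + 1, hk⟩ = ⟨k + 1, hk⟩ := hσ _ le_rfl
  rw [heckeGen_of_lt q hk] at hb2
  rcases swapMat_apply_ne_zero hb2 with h | h
  · rw [h, swapMat_diag] at hb2
    simp only [Function.comp_apply, id, hσk1] at hb2
    rw [if_neg (fun h => by rw [h] at hσk; simp at hσk), if_pos (by rw [Fin.lt_def]; simpa using hσk)]
      at hb2
    exact hb2 rfl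
  · have := congrFun h ⟨k + 1, hk⟩
    rw [hp _ le_rfl] at this
    simp only [Function.comp_apply, id, Equiv.swap_apply_right] at this
    rw [← this] at hσk
    simp at hσk

open Polynomial in
/-- The word traces and the canonical trace are values of one polynomial. -/
theorem exists_trace_polynomial {q : F} (hq : ∀ m, 1 ≤ m → m ≤ n → qInt q m ≠ 0) (k : ℕ)
    (hk : k ≤ n) : ∀ z ∈ heckeAlg n q k, ∃ P : F[X], P.natDegree ≤ k - 1 ∧ P.eval 0 = z id id ∧
      ∀ m, 1 ≤ m → m ≤ n → wordTrace q m z = P.eval (q ^ m / qInt q m) := by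
  induction k with
  | zero =>
    intro z hz
    have hz' : z ∈ (⊥ : Subalgebra F (Matrix (Words n) (Words n) F)) :=
      parab_le_iff.mpr (by simp) hz
    obtain ⟨c, rfl⟩ := Algebra.mem_bot.mp hz'
    refine ⟨C c, by simp, by simp [Matrix.algebraMap_matrix_apply], fun m h1 hm => ?_⟩
    have h2 : ∑ a : Words n, wordWt q m a = 1 := by
      simp only [wordWt]
      have := Finset.prod_univ_sum (fun _ : Fin n => (Finset.univ : Finset (Fin n)))
        (fun (_ l : Fin n) => letterWt q m l)
      rw [Fintype.piFinset_univ] at this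
      rw [← this]
      simp [sum_letterWt_one hm (hq m h1 hm)]
    simp [wordTrace_apply, Matrix.algebraMap_matrix_apply, ← Finset.sum_mul, h2]
  | succ k ih =>
    let S : Submodule F (Matrix (Words n) (Words n) F) :=
      { carrier := {z | ∃ P : F[X], P.natDegree ≤ k + 1 - 1 ∧ P.eval 0 = z id id ∧
          ∀ m, 1 ≤ m → m ≤ n → wordTrace q m z = P.eval (q ^ m / qInt q m)}
        add_mem' := by
          rintro y z ⟨P, h1, h2, h3⟩ ⟨Q, h1', h2', h3'⟩
          exact ⟨P + Q, natDegree_add_le_of_degree_le h1 h1', by simp [h2, h2'],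
            fun m hm hm' => by simp [h3 m hm hm', h3' m hm hm']⟩
        zero_mem' := ⟨0, by simp, by simp, by simp⟩
        smul_mem' := by
          rintro c z ⟨P, h1, h2, h3⟩
          exact ⟨c • P, (natDegree_smul_le _ _).trans h1, by simp [h2],
            fun m hm hm' => by simp [h3 m hm hm']⟩ }
    refine (heckeRel_heckeGen n q).parab_succ_le hk S fun j hj x hx => ?_
    rcases hj.eq_or_lt with rfl | hj
    · obtain ⟨P, h1, h2⟩ := ih (by omega) x hx
      rw [Nat.sub_self, chain, mul_one]
      exact ⟨P, by omega, h2⟩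
    · obtain ⟨l, rfl⟩ : ∃ l, k = l + 1 := ⟨k - 1, by omega⟩
      have hy : chain (heckeGen n q) j (l - j) ∈ heckeAlg n q (l + 1) :=
        chain_mem fun i h1 h2 => mem_parab (by omega)
      have e : chain (heckeGen n q) j (l + 1 - j) =
          heckeGen n q l * chain (heckeGen n q) j (l - j) := by
        rw [show l + 1 - j = l - j + 1 by omega, chain, show j + (l - j) = l by omega]
      obtain ⟨P, h1, h2, h3⟩ := ih (by omega) _ (mul_mem hy hx)
      refine ⟨X * P, ?_, ?_, fun m hm hm' => ?_⟩
      · refine natDegree_mul_le.trans ?_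
        have := natDegree_X_le (R := F)
        omega
      · rw [e, ← mul_assoc, gen_sandwich_id_id hk hx hy]; simp
      · rw [e, ← mul_assoc, ← wordTrace_mul_comm q m (by omega) hy, ← mul_assoc,
          wordTrace_mul_gen hm' (hq m hm hm') hk (mul_mem hy hx), h3 m hm hm']
        simp

theorem qInt_add (q : F) (a b : ℕ) : qInt q (a + b) = qInt q a + q ^ a * qInt q b := by
  simp [qInt, Finset.sum_range_add, Finset.mul_sum, pow_add]

/-- All word traces of a nilpotent element vanish, so the interpolating polynomial, of degree at
most `k - 1 < n`, has the n distinct roots q^m/[m]. It is therefore zero, and so is its value at 0.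
-/
theorem id_id_eq_zero_of_isNilpotent {q : F} (hq0 : q ≠ 0)
    (hq : ∀ m, 1 ≤ m → m ≤ n → qInt q m ≠ 0) {k : ℕ} (hk : k ≤ n)
    {z : Matrix (Words n) (Words n) F} (hz : z ∈ heckeAlg n q k) (hnil : IsNilpotent z) :
    z id id = 0 := by
  have htr : ∀ m, wordTrace q m z = 0 := fun m =>
    (Matrix.isNilpotent_trace_of_isNilpotent
      ((wordWt_commute q m hk hz).isNilpotent_mul_left hnil)).eq_zero
  obtain ⟨P, h1, h2, h3⟩ := exists_trace_polynomial hq k hk z hz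
  rcases Nat.eq_zero_or_pos n with rfl | hn
  · have := (Matrix.isNilpotent_trace_of_isNilpotent hnil).eq_zero
    rw [Matrix.trace, Fintype.sum_unique, Matrix.diag_apply] at this
    convert this
  · have hP : P = 0 := by
      refine Polynomial.eq_zero_of_natDegree_lt_card_of_eval_eq_zero P
        (f := fun m : Fin n => q ^ ((m : ℕ) + 1) / qInt q (m + 1)) ?_ ?_ ?_
      · have key : ∀ a b : ℕ, a < b → b < n →
            q ^ (a + 1) / qInt q (a + 1) ≠ q ^ (b + 1) / qInt q (b + 1) := by
          intro a b hab hb h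
          rw [div_eq_div_iff (hq _ (by omega) (by omega)) (hq _ (by omega) (by omega))] at h
          obtain ⟨d, rfl⟩ := Nat.exists_eq_add_of_lt hab
          -- With `b = a + d + 1`, the addition rule for q-integers reduces a coincidence of two
          -- interpolation points to q^(a+1) [d+1] = 0.
          have h4 : qInt q (a + d + 1 + 1) = qInt q (d + 1) + q ^ (d + 1) * qInt q (a + 1) := by
            rw [← qInt_add]; congr 1; omega
          rw [h4] at h
          have h5 : q ^ (a + 1) * qInt q (d + 1) = 0 := by
            linear_combination h
          rcases mul_eq_zero.mp h5 with h6 | h6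
          · exact pow_ne_zero _ hq0 h6
          · exact hq _ (by omega) (by omega) h6
        intro a b hab
        rcases lt_trichotomy (a : ℕ) b with h | h | h
        · exact absurd hab (key _ _ h b.2)
        · exact Fin.ext h
        · exact absurd hab.symm (key _ _ h a.2)
      · intro m
        rw [← h3 _ (by omega) (by omega), htr]
      · rw [Fintype.card_fin]; omega
    rw [← h2, hP, Polynomial.eval_zero]

/-- The Hecke algebra of `S_k` is semisimple if the `q`-integers up to `n` do not vanish. -/
theorem isSemisimpleRing_heckeAlg {q : F} (hq0 : q ≠ 0)
    (hq : ∀ m, 1 ≤ m → m ≤ n → qInt q m ≠ 0) {k : ℕ} (hk : k ≤ n) :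
    IsSemisimpleRing (heckeAlg n q k) := by
  have : IsArtinianRing (heckeAlg n q k) := IsArtinianRing.of_finite F _
  rw [IsArtinianRing.isSemisimpleRing_iff_jacobson, eq_bot_iff]
  intro z hz
  obtain ⟨N, hN⟩ := IsArtinianRing.isNilpotent_jacobson_bot (R := heckeAlg n q k)
  -- All left multiples of a radical element are nilpotent, so the canonical form pairs it to zero
  -- with the whole algebra.
  have hnil : ∀ y : heckeAlg n q k, IsNilpotent ((y * z : heckeAlg n q k) :
      Matrix (Words n) (Words n) F) := by
    intro y
    have h1 : y * z ∈ Ideal.jacobson (⊥ : Ideal (heckeAlg n q k)) := by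
      rw [Ideal.jacobson_bot]
      exact Ideal.mul_mem_left _ y hz
    have h2 := Ideal.pow_mem_pow h1 N
    rw [hN] at h2
    exact ⟨N, by rw [← SubmonoidClass.coe_pow, h2]; rfl⟩
  exact Subtype.ext (eq_zero_of_mul_id_id hq0 hk z.2 fun y hy =>
    id_id_eq_zero_of_isNilpotent hq0 hq hk (mul_mem hy z.2) (hnil ⟨y, hy⟩))

end HeckeTrace

/-! ## The model algebra: matrices over Hecke algebras indexed by subsets -/

section SubsetMatrices

/-- The subsets of `{0, …, n - 1}` with `r` elements. -/
abbrev Sub (n r : ℕ) : Type := {I : Finset ℕ // I ∈ (Finset.range n).powersetCard r}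

variable {n r : ℕ}

/-- The transposition of `i` and `i + 1` acting on subsets. -/
def swapSub (i : ℕ) (hi : i + 1 < n) (I : Sub n r) : Sub n r :=
  ⟨I.1.map (Equiv.swap i (i + 1)).toEmbedding, by
    have h := Finset.mem_powersetCard.mp I.2
    refine Finset.mem_powersetCard.mpr ⟨fun j hj => ?_, by rw [Finset.card_map, h.2]⟩
    rw [Finset.mem_map_equiv, Equiv.symm_swap] at hj
    have h1 := Finset.mem_range.mp (h.1 hj)
    rw [Equiv.swap_apply_def] at h1
    rw [Finset.mem_range]
    split_ifs at h1 <;> omega⟩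

theorem mem_swapSub {i : ℕ} {hi : i + 1 < n} {I : Sub n r} {j : ℕ} :
    j ∈ (swapSub i hi I).1 ↔ Equiv.swap i (i + 1) j ∈ I.1 := by
  rw [swapSub, Finset.mem_map_equiv, Equiv.symm_swap]

theorem mem_swapSub_self {i : ℕ} {hi : i + 1 < n} {I : Sub n r} :
    i ∈ (swapSub i hi I).1 ↔ i + 1 ∈ I.1 := by rw [mem_swapSub, Equiv.swap_apply_left]

theorem mem_swapSub_succ {i : ℕ} {hi : i + 1 < n} {I : Sub n r} :
    i + 1 ∈ (swapSub i hi I).1 ↔ i ∈ I.1 := by rw [mem_swapSub, Equiv.swap_apply_right]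

theorem mem_swapSub_of_ne {i : ℕ} {hi : i + 1 < n} {I : Sub n r} {j : ℕ} (h1 : j ≠ i)
    (h2 : j ≠ i + 1) : j ∈ (swapSub i hi I).1 ↔ j ∈ I.1 := by
  rw [mem_swapSub, Equiv.swap_apply_of_ne_of_ne h1 h2]

theorem swapSub_swapSub {i : ℕ} (hi : i + 1 < n) (I : Sub n r) :
    swapSub i hi (swapSub i hi I) = I := by
  ext j
  rw [mem_swapSub, mem_swapSub, Equiv.swap_apply_self]

theorem swapSub_comm {i j : ℕ} (hi : i + 1 < n) (hj : j + 1 < n) (h : i + 1 < j) (I : Sub n r) :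
    swapSub i hi (swapSub j hj I) = swapSub j hj (swapSub i hi I) := by
  ext l
  rw [mem_swapSub, mem_swapSub, mem_swapSub, mem_swapSub]
  congr! 1
  simp only [Equiv.swap_apply_def]
  split_ifs <;> omega

/-- The number of elements of a set below `i`. -/
def rankBelow (I : Finset ℕ) (i : ℕ) : ℕ := (I.filter (· < i)).card

theorem rankBelow_succ (I : Finset ℕ) (i : ℕ) :
    rankBelow I (i + 1) = if i ∈ I then rankBelow I i + 1 else rankBelow I i := by
  unfold rankBelow
  have e : I.filter (· < i + 1) = I.filter (· < i) ∪ I.filter (· = i) := by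
    ext j; simp only [Finset.mem_union, Finset.mem_filter]; grind
  rw [e, Finset.card_union_of_disjoint, Finset.filter_eq']
  · split_ifs <;> simp
  · rw [Finset.disjoint_filter]; intros; omega

theorem rankBelow_mono (I : Finset ℕ) {i j : ℕ} (h : i ≤ j) : rankBelow I i ≤ rankBelow I j :=
  Finset.card_le_card fun x hx => by
    rw [Finset.mem_filter] at hx ⊢; exact ⟨hx.1, by omega⟩

theorem rankBelow_lt {I : Sub n r} {i : ℕ} (h : i ∈ I.1) : rankBelow I.1 i < r := by
  have h1 := rankBelow_succ I.1 i
  rw [if_pos h] at h1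
  have h2 : rankBelow I.1 (i + 1) ≤ I.1.card := Finset.card_filter_le _ _
  rw [(Finset.mem_powersetCard.mp I.2).2] at h2
  omega

theorem rankBelow_swapSub_of_le {i : ℕ} {hi : i + 1 < n} {I : Sub n r} {j : ℕ} (h : j ≤ i) :
    rankBelow (swapSub i hi I).1 j = rankBelow I.1 j := by
  unfold rankBelow
  congr 1
  ext l
  rw [Finset.mem_filter, Finset.mem_filter]
  refine and_congr_left fun hl => mem_swapSub_of_ne (by omega) (by omega)

theorem rankBelow_swapSub_of_lt {i : ℕ} {hi : i + 1 < n} {I : Sub n r} {j : ℕ} (h : i + 1 < j) :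
    rankBelow (swapSub i hi I).1 j = rankBelow I.1 j := by
  unfold rankBelow
  rw [swapSub, Finset.filter_map, Finset.card_map]
  congr 1
  refine Finset.filter_congr fun l _ => ?_
  simp only [Function.comp_apply, Equiv.coe_toEmbedding, Equiv.swap_apply_def]
  split_ifs <;> omega

variable {B : Type*} [CommRing B] {H : Type*} [Ring H] [Algebra B H]

/-- The vector with the entry `h` at the subset `I`. -/
abbrev col (I : Sub n r) (h : H) : Sub n r → H := Pi.single I h

/-- The column of the generator `T_i` at the subset `I`. -/
def subCol (q : B) (t : ℕ → H) (i : ℕ) (hi : i + 1 < n) (I : Sub n r) : Sub n r → H :=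
  if i ∈ I.1 then
    if i + 1 ∈ I.1 then col I (t (rankBelow I.1 i)) else col (swapSub i hi I) 1
  else
    if i + 1 ∈ I.1 then q • col (swapSub i hi I) 1 + (q - 1) • col I 1
    else -col I 1

/-- The generator `T_i` on the block of `r`-element subsets. -/
def subGen (n r : ℕ) (q : B) (t : ℕ → H) (i : ℕ) : Matrix (Sub n r) (Sub n r) H :=
  if hi : i + 1 < n then Matrix.of fun J I => subCol q t i hi I J else 0

theorem mulVec_col (M : Matrix (Sub n r) (Sub n r) H) (I : Sub n r) (h : H) :
    M.mulVec (col I h) = fun J => M J I * h := by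
  rw [Matrix.mulVec_single]; rfl

theorem subGen_mulVec {q : B} {t : ℕ → H} {i : ℕ} (hi : i + 1 < n) (I : Sub n r) (h : H) :
    (subGen n r q t i).mulVec (col I h) = fun J => subCol q t i hi I J * h := by
  rw [mulVec_col, subGen, dif_pos hi]; rfl

theorem single_mul_right (I : Sub n r) (g h : H) :
    (fun J => col I g J * h) = col I (g * h) := by
  ext J
  by_cases e : J = I
  · subst e; simp
  · simp [e]

theorem subGen_both {q : B} {t : ℕ → H} {i : ℕ} (hi : i + 1 < n) {I : Sub n r} (h1 : i ∈ I.1)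
    (h2 : i + 1 ∈ I.1) (h : H) : (subGen n r q t i).mulVec (col I h) =
      col I (t (rankBelow I.1 i) * h) := by
  rw [subGen_mulVec hi, subCol, if_pos h1, if_pos h2, single_mul_right]

theorem subGen_fst {q : B} {t : ℕ → H} {i : ℕ} (hi : i + 1 < n) {I : Sub n r} (h1 : i ∈ I.1)
    (h2 : i + 1 ∉ I.1) (h : H) : (subGen n r q t i).mulVec (col I h) =
      col (swapSub i hi I) h := by
  rw [subGen_mulVec hi, subCol, if_pos h1, if_neg h2, single_mul_right, one_mul]

theorem subGen_snd {q : B} {t : ℕ → H} {i : ℕ} (hi : i + 1 < n) {I : Sub n r} (h1 : i ∉ I.1)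
    (h2 : i + 1 ∈ I.1) (h : H) : (subGen n r q t i).mulVec (col I h) =
      q • col (swapSub i hi I) h + (q - 1) • col I h := by
  rw [subGen_mulVec hi, subCol, if_neg h1, if_pos h2]
  simp only [Pi.add_apply, Pi.smul_apply, add_mul, smul_mul_assoc]
  have e1 := single_mul_right (swapSub i hi I) (1 : H) h
  have e2 := single_mul_right I (1 : H) h
  rw [one_mul] at e1 e2
  rw [← e1, ← e2]
  rfl

theorem subGen_none {q : B} {t : ℕ → H} {i : ℕ} (hi : i + 1 < n) {I : Sub n r} (h1 : i ∉ I.1)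
    (h2 : i + 1 ∉ I.1) (h : H) : (subGen n r q t i).mulVec (col I h) =
      -col I h := by
  rw [subGen_mulVec hi, subCol, if_neg h1, if_neg h2]
  have e2 := single_mul_right I (1 : H) h
  rw [one_mul] at e2
  rw [← e2]
  ext J
  simp

theorem matrix_ext_col {M N : Matrix (Sub n r) (Sub n r) H}
    (h : ∀ I, M.mulVec (col I 1) = N.mulVec (col I 1)) : M = N := by
  ext J I
  simpa [mulVec_col] using congrFun (h I) J

theorem col_smul (I : Sub n r) (q : B) (h : H) : col I (q • h) = q • col I h := by
  ext J
  by_cases e : J = I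
  · subst e; simp
  · simp [e]

theorem col_add (I : Sub n r) (g h : H) : col I (g + h) = col I g + col I h := by
  ext J
  by_cases e : J = I
  · subst e; simp
  · simp [e]

/-- The block is the representation induced from H_r ⊗ H_{n-r} with the sign on the second factor,
the subsets indexing the cosets. The relations are checked on a column according to which of the
indices involved lie in the subset. -/
theorem heckeRel_subGen {q : B} {t : ℕ → H} (ht : HeckeRel q r t) :
    HeckeRel q n (subGen n r q t) where
  quad i hi := by
    refine matrix_ext_col fun I => ?_
    simp only [← Matrix.mulVec_mulVec, Matrix.add_mulVec, Matrix.smul_mulVec, Matrix.one_mulVec]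
    by_cases h1 : i ∈ I.1 <;> by_cases h2 : i + 1 ∈ I.1
    · have h3 : rankBelow I.1 i + 1 < r := by
        have := rankBelow_succ I.1 i
        rw [if_pos h1] at this
        rw [← this]
        exact rankBelow_lt h2
      simp only [subGen_both hi h1 h2, ht.quad _ h3, mul_one, col_add,
        col_smul]
    · have h1' := mem_swapSub_succ (hi := hi).mpr h1
      have h2' := mem_swapSub_self (hi := hi).not.mpr h2
      rw [subGen_fst hi h1 h2, subGen_snd hi h2' h1', swapSub_swapSub, add_comm]
    · have h1' := mem_swapSub_succ (hi := hi).not.mpr h1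
      have h2' := mem_swapSub_self (hi := hi).mpr h2
      simp only [subGen_snd hi h1 h2, Matrix.mulVec_add, Matrix.mulVec_smul, subGen_fst hi h2' h1',
        swapSub_swapSub]
      module
    · simp only [subGen_none hi h1 h2, Matrix.mulVec_neg]
      module
  braid i hi := by
    have hi1 : i + 1 < n := by omega
    refine matrix_ext_col fun I => ?_
    simp only [← Matrix.mulVec_mulVec]
    have k1 : ∀ J : Sub n r, i ∈ (swapSub i hi1 J).1 ↔ i + 1 ∈ J.1 := fun J => mem_swapSub_self
    have k2 : ∀ J : Sub n r, i + 1 ∈ (swapSub i hi1 J).1 ↔ i ∈ J.1 := fun J => mem_swapSub_succ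
    have k3 : ∀ J : Sub n r, i + 1 + 1 ∈ (swapSub i hi1 J).1 ↔ i + 1 + 1 ∈ J.1 := fun J =>
      mem_swapSub_of_ne (by omega) (by omega)
    have k4 : ∀ J : Sub n r, i ∈ (swapSub (i + 1) hi J).1 ↔ i ∈ J.1 := fun J =>
      mem_swapSub_of_ne (by omega) (by omega)
    have k5 : ∀ J : Sub n r, i + 1 ∈ (swapSub (i + 1) hi J).1 ↔ i + 1 + 1 ∈ J.1 := fun J =>
      mem_swapSub_self
    have k6 : ∀ J : Sub n r, i + 1 + 1 ∈ (swapSub (i + 1) hi J).1 ↔ i + 1 ∈ J.1 := fun J =>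
      mem_swapSub_succ
    have r1 : ∀ J : Sub n r, rankBelow (swapSub i hi1 J).1 i = rankBelow J.1 i := fun J =>
      rankBelow_swapSub_of_le le_rfl
    have r2 : ∀ J : Sub n r, rankBelow (swapSub (i + 1) hi J).1 i = rankBelow J.1 i := fun J =>
      rankBelow_swapSub_of_le (by omega)
    by_cases h1 : i ∈ I.1 <;> by_cases h2 : i + 1 ∈ I.1 <;> by_cases h3 : i + 1 + 1 ∈ I.1
    · have h4 : rankBelow I.1 i + 2 < r := by
        have e1 := rankBelow_succ I.1 i
        have e2 := rankBelow_succ I.1 (i + 1)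
        rw [if_pos h1] at e1
        rw [if_pos h2, e1] at e2
        rw [← e2]
        exact rankBelow_lt h3
      have e1 := rankBelow_succ I.1 i
      rw [if_pos h1] at e1
      simp only [subGen_both hi1 h1 h2, subGen_both hi h2 h3, e1, mul_one, ← mul_assoc,
        ht.braid _ h4]
    -- The case i ∉ I and i + 1, i + 2 ∈ I. It is the one mixed case in which the generator of H_r
    -- is applied twice, so that the quadratic relation of H_r is needed.
    on_goal 4 =>
      have h4 : rankBelow I.1 i + 1 < r := by
        have e1 := rankBelow_succ I.1 i
        have e2 := rankBelow_succ I.1 (i + 1)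
        rw [if_neg h1] at e1
        rw [if_pos h2, e1] at e2
        rw [← e2]
        exact rankBelow_lt h3
      have h5 := ht.quad _ h4
    all_goals
      simp (discharger := simp only [hi, hi1, k1, k2, k3, k4, k5, k6, h1, h2, h3, not_false_eq_true])
        only [subGen_both, subGen_fst, subGen_snd, subGen_none, rankBelow_succ, k1, k5, h1, h2, h3,
          r1, r2, swapSub_swapSub, if_false, Matrix.mulVec_add,
          Matrix.mulVec_smul, Matrix.mulVec_neg]
      try simp only [mul_one, h5, col_add, col_smul]
      try module
  comm i j hij hj := by
    have hi : i + 1 < n := by omega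
    refine matrix_ext_col fun I => ?_
    simp only [← Matrix.mulVec_mulVec]
    have k1 : ∀ J : Sub n r, i ∈ (swapSub i hi J).1 ↔ i + 1 ∈ J.1 := fun J => mem_swapSub_self
    have k2 : ∀ J : Sub n r, i + 1 ∈ (swapSub i hi J).1 ↔ i ∈ J.1 := fun J => mem_swapSub_succ
    have k3 : ∀ J : Sub n r, j ∈ (swapSub j hj J).1 ↔ j + 1 ∈ J.1 := fun J => mem_swapSub_self
    have k4 : ∀ J : Sub n r, j + 1 ∈ (swapSub j hj J).1 ↔ j ∈ J.1 := fun J => mem_swapSub_succ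
    have k5 : ∀ J : Sub n r, i ∈ (swapSub j hj J).1 ↔ i ∈ J.1 := fun J =>
      mem_swapSub_of_ne (by omega) (by omega)
    have k6 : ∀ J : Sub n r, i + 1 ∈ (swapSub j hj J).1 ↔ i + 1 ∈ J.1 := fun J =>
      mem_swapSub_of_ne (by omega) (by omega)
    have k7 : ∀ J : Sub n r, j ∈ (swapSub i hi J).1 ↔ j ∈ J.1 := fun J =>
      mem_swapSub_of_ne (by omega) (by omega)
    have k8 : ∀ J : Sub n r, j + 1 ∈ (swapSub i hi J).1 ↔ j + 1 ∈ J.1 := fun J =>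
      mem_swapSub_of_ne (by omega) (by omega)
    have r1 : ∀ J : Sub n r, rankBelow (swapSub i hi J).1 j = rankBelow J.1 j := fun J =>
      rankBelow_swapSub_of_lt hij
    have r2 : ∀ J : Sub n r, rankBelow (swapSub j hj J).1 i = rankBelow J.1 i := fun J =>
      rankBelow_swapSub_of_le (by omega)
    by_cases h1 : i ∈ I.1 <;> by_cases h2 : i + 1 ∈ I.1 <;> by_cases h3 : j ∈ I.1 <;>
      by_cases h4 : j + 1 ∈ I.1
    · have e1 := rankBelow_succ I.1 i
      have e2 := rankBelow_succ I.1 (i + 1)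
      have e3 := rankBelow_succ I.1 j
      rw [if_pos h1] at e1
      rw [if_pos h2] at e2
      rw [if_pos h3] at e3
      have e4 := rankBelow_mono I.1 (show i + 1 + 1 ≤ j by omega)
      have e5 := rankBelow_lt h4
      simp only [subGen_both hi h1 h2, subGen_both hj h3 h4, mul_one]
      rw [ht.comm _ _ (by omega) (by omega)]
    all_goals
      simp (discharger := simp only [hi, hj, k1, k2, k3, k4, k5, k6, k7, k8, h1, h2, h3, h4,
          not_false_eq_true])
        only [subGen_both, subGen_fst, subGen_snd, subGen_none, r1, r2, Matrix.mulVec_add,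
          Matrix.mulVec_smul, Matrix.mulVec_neg, swapSub_comm hi hj hij]
      try module

end SubsetMatrices

/-! ### Diagonal projections in a block and the two kinds of data -/

section SubsetDiagonal

variable {n r : ℕ} {B : Type*} [CommRing B] {H : Type*} [Ring H] [Algebra B H]

/-- The projection to the subsets satisfying `P`. -/
def subDiag (n r : ℕ) (H : Type*) [Ring H] (P : Finset ℕ → Prop) [DecidablePred P] :
    Matrix (Sub n r) (Sub n r) H :=
  Matrix.diagonal fun I => if P I.1 then 1 else 0

theorem subDiag_mulVec (P : Finset ℕ → Prop) [DecidablePred P] (I : Sub n r) (h : H) :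
    (subDiag n r H P).mulVec (col I h) = if P I.1 then col I h else 0 := by
  ext J
  rw [subDiag, Matrix.mulVec_diagonal]
  by_cases e : J = I
  · subst e; split_ifs <;> simp
  · by_cases hP : P I.1 <;> simp [e, hP]

theorem subDiag_pos {P : Finset ℕ → Prop} [DecidablePred P] {I : Sub n r} (hI : P I.1) (h : H) :
    (subDiag n r H P).mulVec (col I h) = col I h := by rw [subDiag_mulVec, if_pos hI]

theorem subDiag_neg {P : Finset ℕ → Prop} [DecidablePred P] {I : Sub n r} (hI : ¬P I.1) (h : H) :
    (subDiag n r H P).mulVec (col I h) = 0 := by rw [subDiag_mulVec, if_neg hI]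

theorem subDiag_mul_subDiag (P Q : Finset ℕ → Prop) [DecidablePred P] [DecidablePred Q] :
    subDiag n r H P * subDiag n r H Q = subDiag n r H (fun I => P I ∧ Q I) := by
  rw [subDiag, subDiag, Matrix.diagonal_mul_diagonal, subDiag]
  congr 1
  ext I
  by_cases h1 : P I.1 <;> by_cases h2 : Q I.1 <;> simp [h1, h2]

theorem subDiag_congr {P Q : Finset ℕ → Prop} [DecidablePred P] [DecidablePred Q]
    (h : ∀ I : Sub n r, P I.1 ↔ Q I.1) : subDiag n r H P = subDiag n r H Q := by
  simp only [subDiag, h]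

theorem subDiag_eq_one {P : Finset ℕ → Prop} [DecidablePred P] (h : ∀ I : Sub n r, P I.1) :
    subDiag n r H P = 1 := by
  simp [subDiag, h]

theorem subDiag_eq_zero {P : Finset ℕ → Prop} [DecidablePred P] (h : ∀ I : Sub n r, ¬P I.1) :
    subDiag n r H P = 0 := by
  simp [subDiag, h]

theorem subDiag_comm {P : Finset ℕ → Prop} [DecidablePred P] {i : ℕ} (hi : i + 1 < n)
    (hP : ∀ I : Sub n r, P (swapSub i hi I).1 ↔ P I.1) (q : B) (t : ℕ → H) :
    subDiag n r H P * subGen n r q t i = subGen n r q t i * subDiag n r H P := by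
  refine matrix_ext_col fun I => ?_
  simp only [← Matrix.mulVec_mulVec]
  by_cases h1 : i ∈ I.1 <;> by_cases h2 : i + 1 ∈ I.1 <;> by_cases h3 : P I.1
  all_goals
    simp (discharger := simp only [hi, h1, h2, h3, hP, not_false_eq_true])
      only [subGen_both, subGen_fst, subGen_snd, subGen_none, subDiag_pos, subDiag_neg,
        Matrix.mulVec_add, Matrix.mulVec_smul, Matrix.mulVec_neg, Matrix.mulVec_zero, smul_zero,
        add_zero, neg_zero]

theorem range_subset_swapSub {i k : ℕ} (hi : i + 1 < n) (hk : i + 1 ≠ k) (I : Sub n r) :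
    Finset.range k ⊆ (swapSub i hi I).1 ↔ Finset.range k ⊆ I.1 := by
  simp only [Finset.subset_iff, Finset.mem_range, mem_swapSub, Equiv.swap_apply_def]
  constructor <;> intro h x hx
  · by_cases h1 : x = i
    · subst h1
      simpa using h (x := x + 1) (by omega)
    · by_cases h2 : x = i + 1
      · subst h2
        simpa using h (x := i) (by omega)
      · simpa [h1, h2] using h hx
  · split_ifs
    · exact h (by omega)
    · exact h (by omega)
    · exact h hx

theorem swapSub_subset_range {i k : ℕ} (hi : i + 1 < n) (hk : i + 1 ≠ k) (I : Sub n r) :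
    (swapSub i hi I).1 ⊆ Finset.range k ↔ I.1 ⊆ Finset.range k := by
  simp only [Finset.subset_iff, Finset.mem_range, mem_swapSub, Equiv.swap_apply_def]
  constructor <;> intro h x hx
  · by_cases h1 : x = i
    · subst h1
      have := h (x := x + 1) (by simpa using hx)
      omega
    · by_cases h2 : x = i + 1
      · subst h2
        have := h (x := i) (by simpa using hx)
        omega
      · exact h (by simpa [h1, h2] using hx)
  · split_ifs at hx
    · have := h hx; omega
    · have := h hx; omega
    · exact h hx

theorem range_succ_subset (I : Finset ℕ) (i : ℕ) :
    Finset.range (i + 1) ⊆ I ↔ Finset.range i ⊆ I ∧ i ∈ I := by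
  rw [Finset.range_add_one, Finset.insert_subset_iff, and_comm]

/-- Everything reduces to whether i and i + 1 lie in the subset and whether it contains the indices
below i. In `flag` the quadratic relation of H_r enters when i and i + 1 both belong to it. -/
theorem miraData_sub {q : B} {t : ℕ → H} (ht : HeckeRel q r t) :
    MiraData q n (subGen n r q t) (fun k => subDiag n r H (Finset.range k ⊆ ·)) where
  hecke := heckeRel_subGen ht
  bot := subDiag_eq_one (by simp)
  mul j _ k _ := by
    rw [subDiag_mul_subDiag]
    refine subDiag_congr fun I => ?_
    rcases le_total j k with h | h
    · rw [max_eq_right h]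
      exact and_iff_right_of_imp fun h' => (Finset.range_subset_range.mpr h).trans h'
    · rw [max_eq_left h]
      exact and_iff_left_of_imp fun h' => (Finset.range_subset_range.mpr h).trans h'
  comm k _ i hi hik := subDiag_comm hi (range_subset_swapSub hi hik) q t
  sandwich i hi := by
    refine matrix_ext_col fun I => ?_
    simp only [← Matrix.mulVec_mulVec]
    have k1 : i ∈ (swapSub i hi I).1 ↔ i + 1 ∈ I.1 := mem_swapSub_self
    by_cases h1 : i ∈ I.1 <;> by_cases h2 : i + 1 ∈ I.1 <;> by_cases h3 : Finset.range i ⊆ I.1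
    all_goals
      simp (discharger := simp only [hi, h1, h2, h3, k1, range_succ_subset, and_false, false_and,
          and_true, true_and, not_false_eq_true])
        only [subGen_both, subGen_fst, subDiag_pos, subDiag_neg, Matrix.mulVec_zero]
  flag i hi := by
    refine matrix_ext_col fun I => ?_
    simp only [← Matrix.mulVec_mulVec, Matrix.add_mulVec, Matrix.smul_mulVec, Matrix.one_mulVec]
    have k1 : i ∈ (swapSub i hi I).1 ↔ i + 1 ∈ I.1 := mem_swapSub_self
    have k2 : i + 1 ∈ (swapSub i hi I).1 ↔ i ∈ I.1 := mem_swapSub_succ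
    have k3 := range_subset_swapSub hi (show i + 1 ≠ i by omega) I
    by_cases h1 : i ∈ I.1 <;> by_cases h2 : i + 1 ∈ I.1 <;> by_cases h3 : Finset.range i ⊆ I.1
    on_goal 1 =>
      have h4 : rankBelow I.1 i + 1 < r := by
        have := rankBelow_succ I.1 i
        rw [if_pos h1] at this
        rw [← this]
        exact rankBelow_lt h2
      have h5 := ht.quad _ h4
    all_goals
      simp (discharger := simp only [hi, h1, h2, h3, k1, k2, k3, range_succ_subset, and_false,
          false_and, and_true, true_and, not_false_eq_true])
        only [subGen_both, subGen_fst, subGen_snd, subGen_none, subDiag_pos, subDiag_neg,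
          Matrix.mulVec_add, Matrix.mulVec_smul, Matrix.mulVec_neg, Matrix.mulVec_zero,
          swapSub_swapSub]
      try simp only [mul_one, h5, col_add, col_smul]
      try module

/-- A subset of the first k indices misses i and i + 1 for `k ≤ i`, so the generator acts by -1
there. This accounts for `neg` and for the sign in `sandwich`. -/
theorem rookData_sub {q : B} {t : ℕ → H} (ht : HeckeRel q r t) :
    RookData q n (subGen n r q t) (fun k => subDiag n r H (· ⊆ Finset.range k)) where
  hecke := heckeRel_subGen ht
  top := subDiag_eq_one fun I => (Finset.mem_powersetCard.mp I.2).1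
  mul j _ k _ := by
    rw [subDiag_mul_subDiag]
    refine subDiag_congr fun I => ?_
    rcases le_total j k with h | h
    · rw [min_eq_left h]
      exact and_iff_left_of_imp fun h' => h'.trans (Finset.range_subset_range.mpr h)
    · rw [min_eq_right h]
      exact and_iff_right_of_imp fun h' => h'.trans (Finset.range_subset_range.mpr h)
  comm k _ i hi hik := subDiag_comm hi (swapSub_subset_range hi hik) q t
  neg k _ i hi hik := by
    refine matrix_ext_col fun I => ?_
    simp only [← Matrix.mulVec_mulVec, Matrix.neg_mulVec]
    by_cases h : I.1 ⊆ Finset.range k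
    · have h1 : i ∉ I.1 := fun h' => by have := Finset.mem_range.mp (h h'); omega
      have h2 : i + 1 ∉ I.1 := fun h' => by have := Finset.mem_range.mp (h h'); omega
      rw [subDiag_pos h, subGen_none hi h1 h2]
    · rw [subDiag_neg h, Matrix.mulVec_zero, neg_zero]
  sandwich i hi := by
    refine matrix_ext_col fun I => ?_
    simp only [← Matrix.mulVec_mulVec, Matrix.neg_mulVec]
    have k0 : I.1 ⊆ Finset.range i ↔ I.1 ⊆ Finset.range (i + 1) ∧ i ∉ I.1 := by
      constructor
      · exact fun h => ⟨h.trans (Finset.range_subset_range.mpr (by omega)),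
          fun h' => by have := Finset.mem_range.mp (h h'); omega⟩
      · rintro ⟨h, h'⟩ x hx
        have := Finset.mem_range.mp (h hx)
        rw [Finset.mem_range]
        by_contra hc
        exact h' (by rwa [show i = x by omega])
    by_cases h : I.1 ⊆ Finset.range (i + 1)
    · have h2 : i + 1 ∉ I.1 := fun h' => by have := Finset.mem_range.mp (h h'); omega
      rw [subDiag_pos h]
      by_cases h1 : i ∈ I.1
      · have h3 : ¬(swapSub i hi I).1 ⊆ Finset.range (i + 1) := fun h' => by
          have := Finset.mem_range.mp (h' (mem_swapSub_succ.mpr h1)); omega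
        rw [subGen_fst hi h1 h2, subDiag_neg h3, subDiag_neg (fun h' => (k0.mp h').2 h1), neg_zero]
      · rw [subGen_none hi h1 h2, Matrix.mulVec_neg, subDiag_pos h, subDiag_pos (k0.mpr ⟨h, h1⟩)]
    · rw [subDiag_neg h, Matrix.mulVec_zero, Matrix.mulVec_zero,
        subDiag_neg (fun h' => h (k0.mp h').1), neg_zero]

end SubsetDiagonal

/-! ### The model algebra -/

section Model

variable {B : Type*} [CommRing B] {n : ℕ}

/-- The generators of the Hecke algebra of `S_r` as elements of it. -/
def hGen (n : ℕ) (q : B) (r p : ℕ) : heckeAlg n q r :=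
  if h : p + 1 < r then ⟨heckeGen n q p, mem_parab h⟩ else 0

theorem hGen_of_lt (q : B) {r p : ℕ} (h : p + 1 < r) :
    hGen n q r p = ⟨heckeGen n q p, mem_parab h⟩ := dif_pos h

theorem heckeRel_hGen (q : B) {r : ℕ} (hr : r ≤ n) : HeckeRel q r (hGen n q r) where
  quad i hi := by
    rw [hGen_of_lt q hi]
    exact Subtype.ext (((heckeRel_heckeGen n q).mono hr).quad i hi)
  braid i hi := by
    rw [hGen_of_lt q (show i + 1 < r by omega), hGen_of_lt q (show i + 1 + 1 < r by omega)]
    exact Subtype.ext (((heckeRel_heckeGen n q).mono hr).braid i hi)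
  comm i j hi hj := by
    rw [hGen_of_lt q (show i + 1 < r by omega), hGen_of_lt q hj]
    exact Subtype.ext (((heckeRel_heckeGen n q).mono hr).comm i j hi hj)

/-- The product over `r ≤ n` of the matrix algebras over the Hecke algebras of `S_r` indexed by the
`r`-element subsets. -/
abbrev Model (n : ℕ) (q : B) : Type _ :=
  ∀ r : Fin (n + 1), Matrix (Sub n r) (Sub n r) (heckeAlg n q r)

/-- The Hecke generators of the model algebra. -/
def modelT (n : ℕ) (q : B) (i : ℕ) : Model n q := fun r => subGen n r q (hGen n q r) i

/-- The projections to the subsets containing an initial segment. -/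
def modelF (n : ℕ) (q : B) (k : ℕ) : Model n q := fun _ => subDiag _ _ _ (Finset.range k ⊆ ·)

/-- The projections to the subsets contained in an initial segment. -/
def modelD (n : ℕ) (q : B) (k : ℕ) : Model n q := fun _ => subDiag _ _ _ (· ⊆ Finset.range k)

theorem miraData_model (n : ℕ) (q : B) : MiraData q n (modelT n q) (modelF n q) := by
  have h : ∀ r : Fin (n + 1), MiraData q n (fun i => modelT n q i r) (fun k => modelF n q k r) :=
    fun r => miraData_sub (heckeRel_hGen q (by omega))
  exact
    { hecke :=
        { quad := fun i hi => funext fun r => (h r).hecke.quad i hi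
          braid := fun i hi => funext fun r => (h r).hecke.braid i hi
          comm := fun i j hi hj => funext fun r => (h r).hecke.comm i j hi hj }
      bot := funext fun r => (h r).bot
      mul := fun j hj k hk => funext fun r => (h r).mul j hj k hk
      comm := fun k hk i hi hik => funext fun r => (h r).comm k hk i hi hik
      sandwich := fun i hi => funext fun r => (h r).sandwich i hi
      flag := fun i hi => funext fun r => (h r).flag i hi }

theorem rookData_model (n : ℕ) (q : B) : RookData q n (modelT n q) (modelD n q) := by
  have h : ∀ r : Fin (n + 1), RookData q n (fun i => modelT n q i r) (fun k => modelD n q k r) :=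
    fun r => rookData_sub (heckeRel_hGen q (by omega))
  exact
    { hecke :=
        { quad := fun i hi => funext fun r => (h r).hecke.quad i hi
          braid := fun i hi => funext fun r => (h r).hecke.braid i hi
          comm := fun i j hi hj => funext fun r => (h r).hecke.comm i j hi hj }
      top := funext fun r => (h r).top
      mul := fun j hj k hk => funext fun r => (h r).mul j hj k hk
      comm := fun k hk i hi hik => funext fun r => (h r).comm k hk i hi hik
      neg := fun k hk i hi hik => funext fun r => (h r).neg k hk i hi hik
      sandwich := fun i hi => funext fun r => (h r).sandwich i hi }

end Model

/-! ### Generation of the model algebra -/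

section Generation

variable {B : Type*} [CommRing B] {n : ℕ}

/-- The initial segment with `r` elements. -/
def initSub {r : ℕ} (hr : r ≤ n) : Sub n r :=
  ⟨Finset.range r, Finset.mem_powersetCard.mpr ⟨Finset.range_subset_range.mpr hr, by simp⟩⟩

theorem mem_initSub {r : ℕ} {hr : r ≤ n} {i : ℕ} : i ∈ (initSub hr).1 ↔ i < r :=
  Finset.mem_range

theorem rankBelow_initSub {r i : ℕ} (hr : r ≤ n) (hi : i ≤ r) :
    rankBelow (initSub hr).1 i = i := by
  rw [rankBelow, initSub]
  have : (Finset.range r).filter (· < i) = Finset.range i := by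
    ext j; simp only [Finset.mem_filter, Finset.mem_range]; omega
  rw [this, Finset.card_range]

/-- A subset without a gap directly below one of its elements is closed downwards, hence an initial
segment. -/
theorem exists_swapSub_of_ne {r : ℕ} (hr : r ≤ n) {I : Sub n r} (h : I ≠ initSub hr) :
    ∃ i, i + 1 < n ∧ i ∉ I.1 ∧ i + 1 ∈ I.1 := by
  have hI := Finset.mem_powersetCard.mp I.2
  by_contra hc
  push Not at hc
  apply h
  have h1 : ∀ j i : ℕ, i + j ∈ I.1 → i ∈ I.1 := by
    intro j
    induction j with
    | zero => exact fun i hi => hi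
    | succ j ih =>
      intro i hi
      have h2 := Finset.mem_range.mp (hI.1 hi)
      exact ih i (by_contra fun h' => hc (i + j) (by omega) h' hi)
  refine Subtype.ext (Finset.eq_of_subset_of_card_le (fun j hj => ?_) (by simp [initSub, hI.2]))
  have h2 : Finset.range (j + 1) ⊆ I.1 := fun i hi =>
    h1 (j - i) i (by rw [Finset.mem_range] at hi; rwa [show i + (j - i) = j by omega])
  have h3 := Finset.card_le_card h2
  rw [Finset.card_range, hI.2] at h3
  exact mem_initSub.mpr (by omega)

/-- Every property which holds for the initial segment and is inherited along the transpositions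
moving an element up holds for all subsets. -/
theorem sub_induction {r : ℕ} (hr : r ≤ n) {P : Sub n r → Prop} (h0 : P (initSub hr))
    (hs : ∀ (i : ℕ) (hi : i + 1 < n) (I : Sub n r), i ∈ I.1 → i + 1 ∉ I.1 → P I →
      P (swapSub i hi I)) (I : Sub n r) : P I := by
  induction hm : ∑ x ∈ I.1, x using Nat.strong_induction_on generalizing I with
  | _ m ih =>
    by_cases h : I = initSub hr
    · rw [h]; exact h0
    · obtain ⟨i, hi, h1, h2⟩ := exists_swapSub_of_ne hr h
      rw [← swapSub_swapSub hi I]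
      refine hs i hi _ (mem_swapSub_self.mpr h2) (mem_swapSub_succ.not.mpr h1) (ih _ ?_ _ rfl)
      rw [← hm, swapSub, Finset.sum_map]
      refine Finset.sum_lt_sum (fun x hx => ?_) ⟨i + 1, h2, by simp⟩
      simp only [Equiv.coe_toEmbedding, Equiv.swap_apply_def]
      have : x ≠ i := fun e => h1 (e ▸ hx)
      split_ifs <;> omega

section Blocks

variable {r : ℕ} {H : Type*} [Ring H] [Algebra B H]

theorem single_mulVec_col (I J L : Sub n r) (g h : H) :
    (Matrix.single I J g).mulVec (col L h) = if J = L then col I (g * h) else 0 := by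
  ext K
  rw [mulVec_col]
  by_cases e : J = L
  · by_cases e' : K = I
    · simp [e, e']
    · simp [e, e', Matrix.single_apply, Ne.symm e']
  · simp [e, Matrix.single_apply]

theorem subGen_mul_single_fst {q : B} {t : ℕ → H} {i : ℕ} (hi : i + 1 < n) {I : Sub n r}
    (h1 : i ∈ I.1) (h2 : i + 1 ∉ I.1) (J : Sub n r) (h : H) :
    subGen n r q t i * Matrix.single I J h = Matrix.single (swapSub i hi I) J h := by
  refine matrix_ext_col fun L => ?_
  rw [← Matrix.mulVec_mulVec, single_mulVec_col, single_mulVec_col]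
  split_ifs
  · rw [subGen_fst hi h1 h2]
  · rw [Matrix.mulVec_zero]

theorem subGen_mul_single_both {q : B} {t : ℕ → H} {i : ℕ} (hi : i + 1 < n) {I : Sub n r}
    (h1 : i ∈ I.1) (h2 : i + 1 ∈ I.1) (J : Sub n r) (h : H) :
    subGen n r q t i * Matrix.single I J h = Matrix.single I J (t (rankBelow I.1 i) * h) := by
  refine matrix_ext_col fun L => ?_
  rw [← Matrix.mulVec_mulVec, single_mulVec_col, single_mulVec_col]
  split_ifs
  · rw [subGen_both hi h1 h2, mul_assoc]
  · rw [Matrix.mulVec_zero]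

/-- The generator reaches the row of `J` only from the column of the swapped subset, where its
coefficient is q. Moving row indices therefore needs q invertible. -/
theorem single_mul_subGen {q : B} {t : ℕ → H} {i : ℕ} (hi : i + 1 < n) {J : Sub n r}
    (h1 : i ∈ J.1) (h2 : i + 1 ∉ J.1) (I : Sub n r) :
    Matrix.single I J (1 : H) * subGen n r q t i =
      q • Matrix.single I (swapSub i hi J) (1 : H) := by
  refine matrix_ext_col fun L => ?_
  rw [← Matrix.mulVec_mulVec, Matrix.smul_mulVec, single_mulVec_col]
  by_cases h3 : i ∈ L.1 <;> by_cases h4 : i + 1 ∈ L.1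
  · have e1 : J ≠ L := fun e => h2 (e ▸ h4)
    have e2 : swapSub i hi J ≠ L := fun e => h2 (mem_swapSub_self.mp (e ▸ h3))
    rw [subGen_both hi h3 h4, single_mulVec_col, if_neg e1, if_neg e2, smul_zero]
  · have e1 : J ≠ swapSub i hi L := fun e => h2 (by rw [e]; exact mem_swapSub_succ.mpr h3)
    have e2 : swapSub i hi J ≠ L := fun e => h2 (mem_swapSub_self.mp (e ▸ h3))
    rw [subGen_fst hi h3 h4, single_mulVec_col, if_neg e1, if_neg e2, smul_zero]
  · have e1 : J ≠ L := fun e => h2 (e ▸ h4)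
    have e2 : swapSub i hi J = L ↔ J = swapSub i hi L :=
      ⟨fun e => by rw [← e, swapSub_swapSub], fun e => by rw [e, swapSub_swapSub]⟩
    rw [subGen_snd hi h3 h4, Matrix.mulVec_add, Matrix.mulVec_smul, Matrix.mulVec_smul,
      single_mulVec_col, single_mulVec_col, if_neg e1, smul_zero, add_zero]
    simp only [e2]
  · have e1 : J ≠ L := fun e => h3 (e ▸ h1)
    have e2 : swapSub i hi J ≠ L := fun e => h4 (by rw [← e]; exact mem_swapSub_succ.mpr h1)
    rw [subGen_none hi h3 h4, Matrix.mulVec_neg, single_mulVec_col, if_neg e1, if_neg e2,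
      neg_zero, smul_zero]

end Blocks

theorem mul_piSingle {ι : Type*} [DecidableEq ι] {A : ι → Type*} [∀ i, Ring (A i)] (x : ∀ i, A i)
    (i : ι) (a : A i) : x * Pi.single i a = Pi.single i (x i * a) := by
  ext j
  by_cases h : j = i
  · subst h; simp
  · simp [h]

theorem piSingle_mul {ι : Type*} [DecidableEq ι] {A : ι → Type*} [∀ i, Ring (A i)] (x : ∀ i, A i)
    (i : ι) (a : A i) : Pi.single i a * x = Pi.single i (a * x i) := by
  ext j
  by_cases h : j = i
  · subst h; simp
  · simp [h]

/-- A subalgebra of the model algebra containing the Hecke generators and one primitive idempotent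
of a block contains the block. -/
theorem block_mem {q : B} (hq : IsUnit q) {S : Subalgebra B (Model n q)}
    (hT : ∀ i, i + 1 < n → modelT n q i ∈ S) (r : Fin (n + 1))
    (hE : (Pi.single r (Matrix.single (initSub (Nat.le_of_lt_succ r.2))
      (initSub (Nat.le_of_lt_succ r.2)) 1) : Model n q) ∈ S)
    (M : Matrix (Sub n r) (Sub n r) (heckeAlg n q r)) : (Pi.single r M : Model n q) ∈ S := by
  set I₀ : Sub n r := initSub (Nat.le_of_lt_succ r.2) with hI₀
  have hcol : ∀ I : Sub n r, (Pi.single r (Matrix.single I I₀ 1) : Model n q) ∈ S := by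
    refine sub_induction (Nat.le_of_lt_succ r.2) hE fun i hi I h1 h2 hI => ?_
    have := S.mul_mem (hT i hi) hI
    rwa [mul_piSingle, modelT, subGen_mul_single_fst hi h1 h2] at this
  -- Columns are moved by multiplying on the left, rows by multiplying on the right. Each row move
  -- produces a factor q, which is then divided out.
  have hrow : ∀ I : Sub n r, (Pi.single r (Matrix.single I₀ I 1) : Model n q) ∈ S := by
    refine sub_induction (Nat.le_of_lt_succ r.2) hE fun i hi I h1 h2 hI => ?_
    have := S.mul_mem hI (hT i hi)
    rw [piSingle_mul, modelT, single_mul_subGen hi h1 h2, Pi.single_smul] at this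
    obtain ⟨u, rfl⟩ := hq
    simpa [smul_smul] using S.smul_mem this ((u⁻¹ : Bˣ) : B)
  -- On the initial subset the first generators of the model act as the generators of H_r, so the
  -- corner is filled by the whole Hecke algebra.
  have hmid : ∀ y (hy : y ∈ heckeAlg n q r),
      (Pi.single r (Matrix.single I₀ I₀ ⟨y, hy⟩) : Model n q) ∈ S := by
    intro y hy
    have hadd : ∀ x y : heckeAlg n q r, (Pi.single r (Matrix.single I₀ I₀ (x + y)) : Model n q) =
        Pi.single r (Matrix.single I₀ I₀ x) + Pi.single r (Matrix.single I₀ I₀ y) :=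
      fun x y => by rw [Matrix.single_add, Pi.single_add]
    have hsmul : ∀ (c : B) (x : heckeAlg n q r),
        (Pi.single r (Matrix.single I₀ I₀ (c • x)) : Model n q) =
          c • Pi.single r (Matrix.single I₀ I₀ x) := fun c x => by
      rw [← Matrix.smul_single, Pi.single_smul]
    refine (parab_induction (p := fun y => ∃ hy : y ∈ heckeAlg n q r,
      (Pi.single r (Matrix.single I₀ I₀ ⟨y, hy⟩) : Model n q) ∈ S) ⟨one_mem _, hE⟩ ?_ ?_ ?_ hy).2
    · rintro x y ⟨hx, hx'⟩ ⟨hy, hy'⟩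
      exact ⟨add_mem hx hy, (hadd ⟨x, hx⟩ ⟨y, hy⟩) ▸ add_mem hx' hy'⟩
    · rintro c x ⟨hx, hx'⟩
      exact ⟨Subalgebra.smul_mem _ hx c, (hsmul c ⟨x, hx⟩) ▸ S.smul_mem hx' c⟩
    · rintro i hi x - ⟨hx, hx'⟩
      refine ⟨mul_mem (mem_parab hi) hx, ?_⟩
      have := S.mul_mem (hT i (by omega)) hx'
      rwa [mul_piSingle, modelT, subGen_mul_single_both (by omega)
        (mem_initSub.mpr (by omega)) (mem_initSub.mpr hi), rankBelow_initSub _ (by omega),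
        hGen_of_lt q hi] at this
  have hunit : ∀ (I J : Sub n r) (h : heckeAlg n q r),
      (Pi.single r (Matrix.single I J h) : Model n q) ∈ S := by
    intro I J h
    have := S.mul_mem (S.mul_mem (hcol I) (hmid h.1 h.2)) (hrow J)
    rw [← Pi.single_mul, ← Pi.single_mul, Matrix.single_mul_single_same,
      Matrix.single_mul_single_same] at this
    simpa using this
  rw [Matrix.matrix_eq_sum_single M]
  have : ∀ M, (Pi.single r M : Model n q) = AddMonoidHom.single
    (fun r : Fin (n + 1) => Matrix (Sub n r) (Sub n r) (heckeAlg n q r)) r M := fun _ => rfl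
  rw [this, map_sum]
  refine sum_mem fun I _ => ?_
  rw [map_sum]
  exact sum_mem fun J _ => hunit I J _

theorem eq_top_of_single_mem {q : B} {S : Subalgebra B (Model n q)}
    (h : ∀ r M, (Pi.single r M : Model n q) ∈ S) : S = ⊤ := by
  refine eq_top_iff.mpr fun x _ => ?_
  rw [← Finset.univ_sum_single x]
  exact sum_mem fun r _ => h r _

theorem modelF_apply_self (q : B) (r : Fin (n + 1)) :
    modelF n q r r = Matrix.single (initSub (Nat.le_of_lt_succ r.2))
      (initSub (Nat.le_of_lt_succ r.2)) 1 := by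
  refine matrix_ext_col fun I => ?_
  have h : Finset.range r ⊆ I.1 ↔ initSub (Nat.le_of_lt_succ r.2) = I := by
    refine ⟨fun h => Subtype.ext (Finset.eq_of_subset_of_card_le h ?_), fun h => h ▸ subset_rfl⟩
    rw [(Finset.mem_powersetCard.mp I.2).2]
    exact (Finset.card_range _).ge
  rw [modelF, subDiag_mulVec, single_mulVec_col, one_mul]
  by_cases h' : initSub (Nat.le_of_lt_succ r.2) = I
  · rw [if_pos (h.mpr h'), if_pos h', h']
  · rw [if_neg (h.not.mpr h'), if_neg h']

theorem modelF_apply_of_lt (q : B) {r s : Fin (n + 1)} (h : s < r) : modelF n q r s = 0 := by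
  refine subDiag_eq_zero fun I h' => ?_
  have := Finset.card_le_card h'
  rw [(Finset.mem_powersetCard.mp I.2).2, Finset.card_range] at this
  exact absurd h (by rw [Fin.lt_def]; omega)

theorem modelD_apply_self (q : B) (r : Fin (n + 1)) :
    modelD n q r r = Matrix.single (initSub (Nat.le_of_lt_succ r.2))
      (initSub (Nat.le_of_lt_succ r.2)) 1 := by
  refine matrix_ext_col fun I => ?_
  have h : I.1 ⊆ Finset.range r ↔ initSub (Nat.le_of_lt_succ r.2) = I := by
    refine ⟨fun h => Subtype.ext (Finset.eq_of_subset_of_card_le h ?_).symm,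
      fun h => h ▸ subset_rfl⟩
    rw [(Finset.mem_powersetCard.mp I.2).2]
    simp
  rw [modelD, subDiag_mulVec, single_mulVec_col, one_mul]
  by_cases h' : initSub (Nat.le_of_lt_succ r.2) = I
  · rw [if_pos (h.mpr h'), if_pos h', h']
  · rw [if_neg (h.not.mpr h'), if_neg h']

theorem modelD_apply_of_lt (q : B) {r s : Fin (n + 1)} (h : r < s) : modelD n q r s = 0 := by
  refine subDiag_eq_zero fun I h' => ?_
  have := Finset.card_le_card h'
  rw [(Finset.mem_powersetCard.mp I.2).2, Finset.card_range] at this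
  exact absurd h (by rw [Fin.lt_def]; omega)

theorem apply_self_mem {ι : Type*} [Fintype ι] [DecidableEq ι] {A : ι → Type*} [∀ i, Ring (A i)]
    [∀ i, Algebra B (A i)] {S : Subalgebra B (∀ i, A i)} {x : ∀ i, A i} (hx : x ∈ S) (r : ι)
    (h : ∀ s, s ≠ r → Pi.single s (x s) ∈ S) : Pi.single r (x r) ∈ S := by
  have e := Finset.univ_sum_single x
  rw [← Finset.add_sum_erase _ _ (Finset.mem_univ r)] at e
  rw [eq_sub_of_add_eq e]
  exact sub_mem hx (sum_mem fun s hs => h s (Finset.ne_of_mem_erase hs))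

/-- Triangularity: `modelF r` is the corner idempotent in block r and vanishes in the smaller
blocks. In descending induction its components in the larger blocks can be subtracted. -/
theorem eq_top_of_modelF_mem {q : B} (hq : IsUnit q) {S : Subalgebra B (Model n q)}
    (hT : ∀ i, i + 1 < n → modelT n q i ∈ S) (hF : ∀ k ≤ n, modelF n q k ∈ S) : S = ⊤ := by
  suffices ∀ (m : ℕ) (r : Fin (n + 1)), n - (r : ℕ) = m → ∀ M, (Pi.single r M : Model n q) ∈ S from
    eq_top_of_single_mem fun r => this _ r rfl
  intro m
  induction m using Nat.strong_induction_on with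
  | _ m ih =>
    intro r hm
    refine block_mem hq hT r ?_
    rw [← modelF_apply_self]
    refine apply_self_mem (hF r (by omega)) r fun s hs => ?_
    rcases lt_or_gt_of_ne hs with h | h
    · rw [modelF_apply_of_lt q h, Pi.single_zero]
      exact zero_mem _
    · rw [Fin.lt_def] at h
      exact ih (n - s) (by omega) s rfl _

/-- The same triangularity with the order reversed: `modelD r` vanishes in the larger blocks, so the
induction ascends. -/
theorem eq_top_of_modelD_mem {q : B} (hq : IsUnit q) {S : Subalgebra B (Model n q)}
    (hT : ∀ i, i + 1 < n → modelT n q i ∈ S) (hD : ∀ k ≤ n, modelD n q k ∈ S) : S = ⊤ := by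
  suffices ∀ (m : ℕ) (r : Fin (n + 1)), (r : ℕ) = m → ∀ M, (Pi.single r M : Model n q) ∈ S from
    eq_top_of_single_mem fun r => this _ r rfl
  intro m
  induction m using Nat.strong_induction_on with
  | _ m ih =>
    intro r hm
    refine block_mem hq hT r ?_
    rw [← modelD_apply_self]
    refine apply_self_mem (hD r (by omega)) r fun s hs => ?_
    rcases lt_or_gt_of_ne hs with h | h
    · rw [Fin.lt_def] at h
      exact ih s (by omega) s rfl _
    · rw [modelD_apply_of_lt q h, Pi.single_zero]
      exact zero_mem _

theorem dataAlg_modelF {q : B} (hq : IsUnit q) :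
    dataAlg B n (modelT n q) (modelF n q) = ⊤ :=
  eq_top_of_modelF_mem hq (dataAlg_le_iff.mp le_rfl).1 (dataAlg_le_iff.mp le_rfl).2

theorem dataAlg_modelD {q : B} (hq : IsUnit q) :
    dataAlg B n (modelT n q) (modelD n q) = ⊤ :=
  eq_top_of_modelD_mem hq (dataAlg_le_iff.mp le_rfl).1 (dataAlg_le_iff.mp le_rfl).2

end Generation

/-! ### The model algebra over a field -/

section ModelField

variable {F : Type*} [Field F] {n : ℕ}

theorem finrank_model (n : ℕ) (q : F) :
    Module.Finite F (Model n q) ∧ Module.finrank F (Model n q) = numRook n := by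
  refine ⟨inferInstance, ?_⟩
  rw [Module.finrank_pi_fintype, numRook, ← Fin.sum_univ_eq_sum_range
    (fun k => n.choose k ^ 2 * k.factorial)]
  refine Finset.sum_congr rfl fun r _ => ?_
  rw [Module.finrank_matrix, finrank_heckeAlg q (Nat.le_of_lt_succ r.2), Fintype.card_coe,
    Finset.card_powersetCard, Finset.card_range, sq]

theorem isSemisimpleRing_model {q : F} (hq0 : q ≠ 0)
    (hq : ∀ m, 1 ≤ m → m ≤ n → qInt q m ≠ 0) : IsSemisimpleRing (Model n q) := by
  have : ∀ r : Fin (n + 1), IsSemisimpleRing (heckeAlg n q r) := fun r =>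
    isSemisimpleRing_heckeAlg hq0 hq (Nat.le_of_lt_succ r.2)
  infer_instance

/-- The subalgebra generated by the pairs projects onto the model and is spanned by as many elements
as the dimension of the model. Hence it is the graph of a homomorphism. -/
theorem exists_algHom_model {q : F} {D : Type*} [Ring D] [Algebra F D] {t x : ℕ → D}
    {u y : ℕ → Model n q} (hgen : dataAlg F n u y = ⊤)
    (hb : SpanBd ⊥ (Subalgebra.toSubmodule (dataAlg F n (fun i => (u i, t i))
      (fun k => (y k, x k)))) (numRook n)) :
    ∃ φ : Model n q →ₐ[F] D, (∀ i, i + 1 < n → φ (u i) = t i) ∧ ∀ k ≤ n, φ (y k) = x k := by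
  obtain ⟨φ, hφ⟩ := exists_algHom_of_graph (⊤ : Subalgebra F (Model n q))
    (dataAlg F n (fun i => (u i, t i)) (fun k => (y k, x k)))
    (by rw [dataAlg_map, ← hgen]; rfl) hb
    (by rw [← Subalgebra.finrank_toSubmodule, Algebra.top_toSubmodule, finrank_top,
      (finrank_model n q).2])
  exact ⟨φ.comp Subalgebra.topEquiv.symm.toAlgHom,
    fun i hi => hφ _ (t_mem_dataAlg hi) trivial, fun k hk => hφ _ (x_mem_dataAlg hk) trivial⟩

theorem MiraData.exists_algHom {q : F} (hq : q ≠ 0) {D : Type*} [Ring D] [Algebra F D]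
    {t f : ℕ → D} (h : MiraData q n t f) :
    ∃ φ : Model n q →ₐ[F] D, (∀ i, i + 1 < n → φ (modelT n q i) = t i) ∧
      ∀ k ≤ n, φ (modelF n q k) = f k := by
  refine exists_algHom_model (dataAlg_modelF (IsUnit.mk0 q hq)) (MiraData.spanBd (IsUnit.mk0 q hq) ?_)
  have h0 := miraData_model n q
  exact
    { hecke :=
        { quad := fun i hi => Prod.ext (h0.hecke.quad i hi) (h.hecke.quad i hi)
          braid := fun i hi => Prod.ext (h0.hecke.braid i hi) (h.hecke.braid i hi)
          comm := fun i j hi hj => Prod.ext (h0.hecke.comm i j hi hj) (h.hecke.comm i j hi hj) }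
      bot := Prod.ext h0.bot h.bot
      mul := fun j hj k hk => Prod.ext (h0.mul j hj k hk) (h.mul j hj k hk)
      comm := fun k hk i hi hik => Prod.ext (h0.comm k hk i hi hik) (h.comm k hk i hi hik)
      sandwich := fun i hi => Prod.ext (h0.sandwich i hi) (h.sandwich i hi)
      flag := fun i hi => Prod.ext (h0.flag i hi) (h.flag i hi) }

theorem RookData.exists_algHom {q : F} (hq : q ≠ 0) {D : Type*} [Ring D] [Algebra F D]
    {t d : ℕ → D} (h : RookData q n t d) :
    ∃ φ : Model n q →ₐ[F] D, (∀ i, i + 1 < n → φ (modelT n q i) = t i) ∧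
      ∀ k ≤ n, φ (modelD n q k) = d k := by
  refine exists_algHom_model (dataAlg_modelD (IsUnit.mk0 q hq)) (RookData.spanBd (q := q) ?_)
  have h0 := rookData_model n q
  exact
    { hecke :=
        { quad := fun i hi => Prod.ext (h0.hecke.quad i hi) (h.hecke.quad i hi)
          braid := fun i hi => Prod.ext (h0.hecke.braid i hi) (h.hecke.braid i hi)
          comm := fun i j hi hj => Prod.ext (h0.hecke.comm i j hi hj) (h.hecke.comm i j hi hj) }
      top := Prod.ext h0.top h.top
      mul := fun j hj k hk => Prod.ext (h0.mul j hj k hk) (h.mul j hj k hk)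
      comm := fun k hk i hi hik => Prod.ext (h0.comm k hk i hi hik) (h.comm k hk i hi hik)
      neg := fun k hk i hi hik => Prod.ext (h0.neg k hk i hi hik) (h.neg k hk i hi hik)
      sandwich := fun i hi => Prod.ext (h0.sandwich i hi) (h.sandwich i hi) }

/-- A nonzero two-sided ideal of the model algebra contains an element of a primitive corner on
which the canonical trace does not vanish. -/
theorem exists_corner_mem {q : F} (hq : q ≠ 0) {D : Type*} [Ring D] [Algebra F D]
    (φ : Model n q →ₐ[F] D) {x : Model n q} (hx : x ≠ 0) (h : φ x = 0) :
    ∃ (r : Fin (n + 1)) (y : heckeAlg n q r), y.1 id id ≠ 0 ∧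
      φ (Pi.single r (Matrix.single (initSub (Nat.le_of_lt_succ r.2))
        (initSub (Nat.le_of_lt_succ r.2)) y)) = 0 := by
  obtain ⟨r, hr⟩ := Function.ne_iff.mp hx
  obtain ⟨I, J, hIJ⟩ : ∃ I J, x r I J ≠ 0 := by
    by_contra hc
    push Not at hc
    exact hr (Matrix.ext hc)
  set I₀ : Sub n r := initSub (Nat.le_of_lt_succ r.2) with hI₀
  -- A nonzero matrix entry is made visible to the canonical trace by nondegeneracy. Matrix units
  -- then move it to the corner without leaving the ideal.
  obtain ⟨y, hy, hτ⟩ : ∃ y ∈ heckeAlg n q r, (y * (x r I J).1) id id ≠ 0 := by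
    by_contra hc
    push Not at hc
    exact hIJ (Subtype.ext (eq_zero_of_mul_id_id hq (Nat.le_of_lt_succ r.2) (x r I J).2 hc))
  refine ⟨r, ⟨y, hy⟩ * x r I J, hτ, ?_⟩
  have e : (Pi.single r (Matrix.single I₀ I₀ (⟨y, hy⟩ * x r I J)) : Model n q) =
      Pi.single r (Matrix.single I₀ I ⟨y, hy⟩) * x * Pi.single r (Matrix.single J I₀ 1) := by
    rw [piSingle_mul, ← Pi.single_mul, Matrix.single_mul_mul_single, mul_one]
  rw [e, map_mul, map_mul, h, mul_zero, zero_mul]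

end ModelField

/-! ### Change of the base ring -/

section BaseChange

variable {B B' : Type*} [CommRing B] [CommRing B'] {n : ℕ}

theorem mapMatrix_heckeGen (φ : B →+* B') (q : B) (i : ℕ) :
    φ.mapMatrix (heckeGen n q i) = heckeGen n (φ q) i := by
  by_cases h : i + 1 < n
  · rw [heckeGen_of_lt q h, heckeGen_of_lt _ h]
    ext b a
    simp only [RingHom.mapMatrix_apply, Matrix.map_apply, swapMat, Matrix.of_apply, swapCol]
    split_ifs <;> simp [wd, Pi.single_apply, apply_ite φ]
  · simp [heckeGen, h]

theorem mapMatrix_mem_heckeAlg (φ : B →+* B') {q : B} {k : ℕ} {y : Matrix (Words n) (Words n) B}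
    (hy : y ∈ heckeAlg n q k) : φ.mapMatrix y ∈ heckeAlg n (φ q) k := by
  refine parab_induction (p := fun y => φ.mapMatrix y ∈ heckeAlg n (φ q) k) ?_ ?_ ?_ ?_ hy
  · rw [map_one]; exact one_mem _
  · intro x y hx hy
    rw [map_add]; exact add_mem hx hy
  · intro c x hx
    have : φ.mapMatrix (c • x) = φ c • φ.mapMatrix x := by ext; simp
    rw [this]
    exact Subalgebra.smul_mem _ hx _
  · intro i hi x _ hx
    rw [map_mul, mapMatrix_heckeGen]
    exact mul_mem (mem_parab hi) hx

/-- Base change for Hecke algebras. -/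
def heckeMap (φ : B →+* B') (q : B) (k : ℕ) : heckeAlg n q k →+* heckeAlg n (φ q) k where
  toFun y := ⟨φ.mapMatrix y.1, mapMatrix_mem_heckeAlg φ y.2⟩
  map_one' := Subtype.ext (map_one φ.mapMatrix)
  map_mul' x y := Subtype.ext (map_mul φ.mapMatrix x.1 y.1)
  map_zero' := Subtype.ext (map_zero φ.mapMatrix)
  map_add' x y := Subtype.ext (map_add φ.mapMatrix x.1 y.1)

theorem heckeMap_smul (φ : B →+* B') (q : B) (k : ℕ) (c : B) (y : heckeAlg n q k) :
    heckeMap φ q k (c • y) = φ c • heckeMap φ q k y := by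
  apply Subtype.ext
  ext a b
  simp [heckeMap]

theorem heckeMap_hGen (φ : B →+* B') (q : B) (r p : ℕ) :
    heckeMap φ q r (hGen n q r p) = hGen n (φ q) r p := by
  by_cases h : p + 1 < r
  · rw [hGen_of_lt q h, hGen_of_lt _ h]
    exact Subtype.ext (mapMatrix_heckeGen φ q p)
  · simp [hGen, h]

/-- Base change for model algebras. -/
def modelMap (n : ℕ) (φ : B →+* B') (q : B) : Model n q →+* Model n (φ q) :=
  RingHom.pi fun r => (heckeMap φ q r).mapMatrix.comp (Pi.evalRingHom _ r)

theorem modelMap_apply (φ : B →+* B') (q : B) (x : Model n q) (r : Fin (n + 1)) (I J : Sub n r) :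
    modelMap n φ q x r I J = heckeMap φ q r (x r I J) := rfl

theorem modelMap_smul (φ : B →+* B') (q : B) (c : B) (x : Model n q) :
    modelMap n φ q (c • x) = φ c • modelMap n φ q x := by
  ext r I J : 3
  rw [modelMap_apply, Pi.smul_apply, Matrix.smul_apply, heckeMap_smul]
  rfl

theorem modelMap_modelT (φ : B →+* B') (q : B) (i : ℕ) :
    modelMap n φ q (modelT n q i) = modelT n (φ q) i := by
  ext r J I : 3
  rw [modelMap_apply, modelT, modelT, subGen, subGen]
  by_cases h : i + 1 < n
  · rw [dif_pos h, dif_pos h, Matrix.of_apply, Matrix.of_apply, subCol, subCol]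
    have h1 : ∀ (K : Sub n r) (y : heckeAlg n q r), heckeMap φ q r (col K y J) = col K (heckeMap φ q r y) J := by
      intro K y
      by_cases e : J = K
      · subst e; simp
      · simp [e]
    split_ifs <;> simp only [Pi.add_apply, Pi.smul_apply, Pi.neg_apply, map_add, map_neg,
      heckeMap_smul, h1, map_one, map_sub, heckeMap_hGen]
  · rw [dif_neg h, dif_neg h]
    exact map_zero _

theorem modelMap_modelF (φ : B →+* B') (q : B) (k : ℕ) :
    modelMap n φ q (modelF n q k) = modelF n (φ q) k := by
  ext r J I : 3
  rw [modelMap_apply, modelF, modelF, subDiag, subDiag, Matrix.diagonal_apply,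
    Matrix.diagonal_apply]
  split_ifs <;> simp

theorem modelMap_modelD (φ : B →+* B') (q : B) (k : ℕ) :
    modelMap n φ q (modelD n q k) = modelD n (φ q) k := by
  ext r J I : 3
  rw [modelMap_apply, modelD, modelD, subDiag, subDiag, Matrix.diagonal_apply,
    Matrix.diagonal_apply]
  split_ifs <;> simp

end BaseChange

/-! ## Invertible matrices -/

section Borel

variable {K : Type} [Field K] {n : ℕ}

/-- The elementary matrix `1 + c E_{x,y}` as an invertible matrix. -/
def transGL {x y : Fin n} (h : x ≠ y) (c : K) : GL (Fin n) K where
  val := Matrix.transvection x y c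
  inv := Matrix.transvection x y (-c)
  val_inv := by rw [Matrix.transvection_mul_transvection_same _ _ h, add_neg_cancel,
    Matrix.transvection_zero]
  inv_val := by rw [Matrix.transvection_mul_transvection_same _ _ h, neg_add_cancel,
    Matrix.transvection_zero]

theorem coe_transGL {x y : Fin n} (h : x ≠ y) (c : K) :
    (transGL h c : Matrix (Fin n) (Fin n) K) = Matrix.transvection x y c := rfl

theorem transGL_zero {x y : Fin n} (h : x ≠ y) : transGL h (0 : K) = 1 :=
  Units.ext (Matrix.transvection_zero x y)

theorem transGL_mul {x y : Fin n} (h : x ≠ y) (c d : K) :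
    transGL h c * transGL h d = transGL h (c + d) :=
  Units.ext (Matrix.transvection_mul_transvection_same x y h c d)

theorem transGL_inv {x y : Fin n} (h : x ≠ y) (c : K) : (transGL h c)⁻¹ = transGL h (-c) :=
  Units.ext rfl

theorem trans_mul_apply {x y : Fin n} (c : K) (A : Matrix (Fin n) (Fin n) K) (k l : Fin n) :
    (Matrix.transvection x y c * A) k l = A k l + if k = x then c * A y l else 0 := by
  rw [Matrix.transvection, add_mul, one_mul, Matrix.add_apply]
  split_ifs with h
  · subst h; simp
  · rw [Matrix.single_mul_apply_of_ne _ _ _ _ _ h]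

theorem mul_trans_apply {x y : Fin n} (c : K) (A : Matrix (Fin n) (Fin n) K) (k l : Fin n) :
    (A * Matrix.transvection x y c) k l = A k l + if l = y then A k x * c else 0 := by
  rw [Matrix.transvection, mul_add, mul_one, Matrix.add_apply]
  split_ifs with h
  · subst h; simp
  · rw [Matrix.mul_single_apply_of_ne _ _ _ _ _ h]

theorem perm_mul_apply (w : Equiv.Perm (Fin n)) (A : Matrix (Fin n) (Fin n) K) (k l : Fin n) :
    ((permGL K w : Matrix (Fin n) (Fin n) K) * A) k l = A (w.symm k) l := by
  rw [Matrix.mul_apply, Finset.sum_eq_single (w.symm k)]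
  · simp [permGL]
  · intro j _ hj
    have : ¬k = w j := fun h => hj (by rw [h, Equiv.symm_apply_apply])
    simp [permGL, this]
  · simp

theorem mul_perm_apply (w : Equiv.Perm (Fin n)) (A : Matrix (Fin n) (Fin n) K) (k l : Fin n) :
    (A * (permGL K w : Matrix (Fin n) (Fin n) K)) k l = A k (w l) := by
  rw [Matrix.mul_apply, Finset.sum_eq_single (w l)]
  · simp [permGL]
  · intro j _ hj
    simp [permGL, hj]
  · simp

theorem permGL_mul (v w : Equiv.Perm (Fin n)) : permGL K v * permGL K w = permGL K (v * w) := by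
  ext k l
  rw [Units.val_mul, perm_mul_apply]
  simp only [permGL, Matrix.of_apply, Equiv.symm_apply_eq, Equiv.Perm.mul_apply]
  congr

theorem permGL_one : permGL K (1 : Equiv.Perm (Fin n)) = 1 := by
  ext k l
  simp only [permGL, Matrix.of_apply, Units.val_one, Matrix.one_apply, Equiv.Perm.one_apply]
  congr

theorem permGL_inv (w : Equiv.Perm (Fin n)) : (permGL K w)⁻¹ = permGL K w⁻¹ := by
  rw [inv_eq_iff_mul_eq_one, permGL_mul, mul_inv_cancel, permGL_one]

theorem permGL_swap_mul_self (x y : Fin n) :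
    permGL K (Equiv.swap x y) * permGL K (Equiv.swap x y) = 1 := by
  rw [permGL_mul, Equiv.swap_mul_self, permGL_one]

theorem transGL_mem_borel {x y : Fin n} (h : x < y) (c : K) : transGL h.ne c ∈ borel K n := by
  intro i j hij
  rw [coe_transGL, Matrix.transvection, Matrix.add_apply, Matrix.one_apply_ne hij.ne', zero_add,
    Matrix.single_apply, if_neg]
  rintro ⟨rfl, rfl⟩
  exact h.asymm hij

/-- An upper triangular matrix with nonzero diagonal entries, as an element of the Borel
subgroup. -/
theorem exists_borel (A : Matrix (Fin n) (Fin n) K) (h : ∀ i j : Fin n, j < i → A i j = 0)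
    (hd : ∀ i, A i i ≠ 0) : ∃ b ∈ borel K n, (b : Matrix (Fin n) (Fin n) K) = A := by
  have hdet : A.det ≠ 0 := by
    rw [Matrix.det_of_isUpperTriangular (fun i j hij => h i j hij)]
    exact Finset.prod_ne_zero_iff.mpr fun i _ => hd i
  exact ⟨Matrix.GeneralLinearGroup.mkOfDetNeZero A hdet, h, rfl⟩

theorem borel_diag_ne_zero {b : GL (Fin n) K} (hb : b ∈ borel K n) (i : Fin n) :
    (b : Matrix (Fin n) (Fin n) K) i i ≠ 0 := by
  have h1 := Matrix.det_of_isUpperTriangular (M := (b : Matrix (Fin n) (Fin n) K))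
    (fun i j hij => hb i j hij)
  have h2 : (b : Matrix (Fin n) (Fin n) K).det ≠ 0 :=
    ((Matrix.isUnit_iff_isUnit_det _).mp b.isUnit).ne_zero
  rw [h1] at h2
  exact Finset.prod_ne_zero_iff.mp h2 i (Finset.mem_univ i)

theorem swap_lt_swap {x y : Fin n} (hxy : (y : ℕ) = x + 1) {k l : Fin n} (h : l < k)
    (hne : ¬(l = x ∧ k = y)) : Equiv.swap x y l < Equiv.swap x y k := by
  simp only [Equiv.swap_apply_def, Fin.ext_iff, Fin.lt_def] at *
  split_ifs <;> omega

theorem ne_of_succ {x y : Fin n} (hxy : (y : ℕ) = x + 1) : x ≠ y := by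
  rintro rfl; omega

theorem lt_of_succ {x y : Fin n} (hxy : (y : ℕ) = x + 1) : x < y := by
  rw [Fin.lt_def]; omega

theorem swap_conj_mem_borel {x y : Fin n} (hxy : (y : ℕ) = x + 1) {b : GL (Fin n) K}
    (hb : b ∈ borel K n) (h0 : (b : Matrix (Fin n) (Fin n) K) x y = 0) :
    permGL K (Equiv.swap x y) * b * permGL K (Equiv.swap x y) ∈ borel K n := by
  intro k l hkl
  rw [Units.val_mul, Units.val_mul, mul_perm_apply, perm_mul_apply, Equiv.symm_swap]
  by_cases h : l = x ∧ k = y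
  · rw [h.1, h.2, Equiv.swap_apply_left, Equiv.swap_apply_right, h0]
  · exact hb _ _ (swap_lt_swap hxy hkl h)

/-- Moving a Borel element past a simple transposition, to the left. -/
theorem swap_mul_borel {x y : Fin n} (hxy : (y : ℕ) = x + 1) {b : GL (Fin n) K}
    (hb : b ∈ borel K n) : ∃ b' ∈ borel K n, permGL K (Equiv.swap x y) * b =
      b' * permGL K (Equiv.swap x y) * transGL (ne_of_succ hxy)
        ((b : Matrix (Fin n) (Fin n) K) x y / (b : Matrix (Fin n) (Fin n) K) x x) := by
  -- This `u` makes the entry at `(x, y)` of `b` times the inverse elementary matrix vanish, which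
  -- is the condition for staying in the Borel subgroup after conjugation by the transposition.
  set u := (b : Matrix (Fin n) (Fin n) K) x y / (b : Matrix (Fin n) (Fin n) K) x x with hu
  refine ⟨permGL K (Equiv.swap x y) * (b * transGL (ne_of_succ hxy) (-u)) *
    permGL K (Equiv.swap x y), swap_conj_mem_borel hxy
    (mul_mem hb (transGL_mem_borel (lt_of_succ hxy) _)) ?_, ?_⟩
  · rw [Units.val_mul, coe_transGL, mul_trans_apply, if_pos rfl, hu]
    field_simp [borel_diag_ne_zero hb x]
    ring
  · simp only [mul_assoc]
    rw [← mul_assoc (permGL K (Equiv.swap x y)) (permGL K _) (transGL _ _), permGL_swap_mul_self,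
      one_mul, transGL_mul, neg_add_cancel, transGL_zero, mul_one]

/-- Moving a Borel element past a simple transposition, to the right. -/
theorem borel_mul_swap {x y : Fin n} (hxy : (y : ℕ) = x + 1) {b : GL (Fin n) K}
    (hb : b ∈ borel K n) : ∃ b' ∈ borel K n, b * permGL K (Equiv.swap x y) =
      transGL (ne_of_succ hxy)
        ((b : Matrix (Fin n) (Fin n) K) x y / (b : Matrix (Fin n) (Fin n) K) y y) *
          permGL K (Equiv.swap x y) * b' := by
  set u := (b : Matrix (Fin n) (Fin n) K) x y / (b : Matrix (Fin n) (Fin n) K) y y with hu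
  refine ⟨permGL K (Equiv.swap x y) * (transGL (ne_of_succ hxy) (-u) * b) *
    permGL K (Equiv.swap x y), swap_conj_mem_borel hxy
    (mul_mem (transGL_mem_borel (lt_of_succ hxy) _) hb) ?_, ?_⟩
  · rw [Units.val_mul, coe_transGL, trans_mul_apply, if_pos rfl, hu]
    field_simp [borel_diag_ne_zero hb y]
    ring
  · simp only [← mul_assoc]
    rw [mul_assoc (transGL _ _) (permGL K _) (permGL K _), permGL_swap_mul_self,
      mul_one, transGL_mul, add_neg_cancel, transGL_zero, one_mul]

/-- The minimal parabolic subgroup: a matrix which is upper triangular except for the entry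
`(y, x)`, and has a nonzero entry there. -/
theorem parabolic_decomp {x y : Fin n} (hxy : (y : ℕ) = x + 1) {p : GL (Fin n) K}
    (hp : ∀ k l : Fin n, l < k → ¬(l = x ∧ k = y) → (p : Matrix (Fin n) (Fin n) K) k l = 0)
    (h0 : (p : Matrix (Fin n) (Fin n) K) y x ≠ 0) :
    ∃ u, ∃ b ∈ borel K n, p = transGL (ne_of_succ hxy) u * permGL K (Equiv.swap x y) * b := by
  -- Subtracting `u` times row `y` from row `x` clears the entry at `(x, x)`. The exchange of the
  -- two rows then gives an upper triangular matrix.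
  set u := (p : Matrix (Fin n) (Fin n) K) x x / (p : Matrix (Fin n) (Fin n) K) y x with hu
  refine ⟨u, permGL K (Equiv.swap x y) * (transGL (ne_of_succ hxy) (-u) * p), ?_, ?_⟩
  · intro k l hkl
    rw [Units.val_mul, perm_mul_apply, Equiv.symm_swap, Units.val_mul, coe_transGL,
      trans_mul_apply]
    have hlt := lt_of_succ hxy
    rcases eq_or_ne k x with rfl | hkx
    · rw [Equiv.swap_apply_left, if_neg hlt.ne', add_zero]
      exact hp _ _ (hkl.trans hlt) (fun h => hkl.ne h.1)
    · rcases eq_or_ne k y with rfl | hky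
      · rw [Equiv.swap_apply_right, if_pos rfl]
        rcases eq_or_ne l x with rfl | hlx
        · rw [hu]; field_simp; ring
        · have hlx' : l < x := by
            rw [Fin.lt_def] at hkl ⊢
            have : (l : ℕ) ≠ x := fun h => hlx (Fin.ext h)
            omega
          rw [hp _ _ hlx' (fun h => hlx h.1), hp _ _ hkl (fun h => hlx h.1), mul_zero, add_zero]
      · rw [Equiv.swap_apply_of_ne_of_ne hkx hky, if_neg hkx, add_zero]
        exact hp _ _ hkl (fun h => hky h.2)
  · simp only [← mul_assoc]
    rw [mul_assoc (transGL _ _) (permGL K _) (permGL K _), permGL_swap_mul_self,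
      mul_one, transGL_mul, add_neg_cancel, transGL_zero, one_mul]

/-- The conjugate of a nontrivial elementary matrix lies in the big cell of the parabolic. -/
theorem swap_trans_swap {x y : Fin n} (hxy : (y : ℕ) = x + 1) {c : K} (hc : c ≠ 0) :
    ∃ u, ∃ b ∈ borel K n,
      permGL K (Equiv.swap x y) * transGL (ne_of_succ hxy) c * permGL K (Equiv.swap x y) =
        transGL (ne_of_succ hxy) u * permGL K (Equiv.swap x y) * b := by
  have hne := ne_of_succ hxy
  have e : ∀ k l, ((permGL K (Equiv.swap x y) * transGL (ne_of_succ hxy) c *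
      permGL K (Equiv.swap x y) : GL (Fin n) K) : Matrix (Fin n) (Fin n) K) k l =
      Matrix.transvection x y c (Equiv.swap x y k) (Equiv.swap x y l) := fun k l => by
    rw [Units.val_mul, Units.val_mul, mul_perm_apply, perm_mul_apply, Equiv.symm_swap, coe_transGL]
  refine parabolic_decomp hxy (fun k l hkl h => ?_) ?_
  · rw [e]
    exact transGL_mem_borel (lt_of_succ hxy) c _ _ (swap_lt_swap hxy hkl h)
  · rw [e, Equiv.swap_apply_left, Equiv.swap_apply_right]
    simpa [Matrix.transvection, hne] using hc

/-- Distinct permutation matrices lie in distinct double cosets. -/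
theorem perm_eq_of_borel {w w' : Equiv.Perm (Fin n)} {b b' : GL (Fin n) K} (hb : b ∈ borel K n)
    (hb' : b' ∈ borel K n) (h : b * permGL K w * b' = permGL K w') : w = w' := by
  -- The entry at `(w j, j)` is a diagonal entry of `b'` on one side. On the other side it vanishes
  -- if `w j > w' j`, so `w ≤ w'` pointwise, and permutations comparable pointwise are equal by
  -- summing values.
  have key : ∀ j, w j ≤ w' j := by
    intro j
    by_contra hlt
    push Not at hlt
    have e : permGL K w * b' = b⁻¹ * permGL K w' := by rw [← h]; group
    have e1 := congrArg (fun g : GL (Fin n) K => (g : Matrix (Fin n) (Fin n) K) (w j) j) e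
    simp only [Units.val_mul] at e1
    rw [perm_mul_apply, Equiv.symm_apply_apply, mul_perm_apply,
      inv_mem hb _ _ hlt] at e1
    exact borel_diag_ne_zero hb' j e1
  have h1 : ∀ j, w'.symm.trans w j ≤ j := fun j => by simpa using key (w'.symm j)
  have h2 : w'.symm.trans w = Equiv.refl _ := by
    have hsum : ∑ j, ((w'.symm.trans w j : Fin n) : ℕ) = ∑ j : Fin n, (j : ℕ) :=
      Equiv.sum_comp (w'.symm.trans w) fun j => (j : ℕ)
    have := (Finset.sum_eq_sum_iff_of_le fun j _ => Fin.le_def.mp (h1 j)).mp hsum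
    exact Equiv.ext fun j => Fin.ext (this j (Finset.mem_univ j))
  refine Equiv.ext fun j => ?_
  have := congrArg (fun e : Fin n ≃ Fin n => e (w' j)) h2
  simpa using this

end Borel

/-! ## The double coset algebra -/

section HeckeDual

variable {F : Type*} [CommRing F] {D : Type*} [Ring D] [Algebra F D]

/-- The Hecke relations are invariant under `t ↦ (q - 1) - t`. -/
theorem HeckeRel.dual {q : F} {n : ℕ} {t : ℕ → D} (h : HeckeRel q n t) :
    HeckeRel q n (fun i => (q - 1) • 1 - t i) where
  quad i hi := by
    simp only [sub_mul, mul_sub, smul_mul_assoc, mul_smul_comm, one_mul, mul_one, h.quad i hi]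
    module
  braid i hi := by
    have e1 := h.quad i (by omega)
    have e2 := h.quad (i + 1) hi
    have e3 := h.braid i hi
    simp only [sub_mul, mul_sub, smul_mul_assoc, mul_smul_comm, one_mul, mul_one, e1, e2, e3]
    module
  comm i j hi hj := by
    simp only [sub_mul, mul_sub, smul_mul_assoc, mul_smul_comm, one_mul, mul_one, h.comm i j hi hj]
    module

end HeckeDual

section Averages

variable {K : Type} [Field K] [Finite K] {n : ℕ}

/-- The monoid element of a matrix. -/
abbrev matOf (m : Matrix (Fin n) (Fin n) K) : MatMonoidAlgebra K n := MonoidAlgebra.single m 1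

theorem matOf_mul (m m' : Matrix (Fin n) (Fin n) K) : matOf m * matOf m' = matOf (m * m') := by
  rw [MonoidAlgebra.single_mul_single, one_mul]

theorem matOf_one : matOf (1 : Matrix (Fin n) (Fin n) K) = 1 := rfl

theorem borel_mul_borelIdem {b : GL (Fin n) K} (hb : b ∈ borel K n) :
    matOf (b : Matrix (Fin n) (Fin n) K) * borelIdem K n = borelIdem K n := by
  rw [borelIdem, mul_smul_comm, Finset.mul_sum,
    ← Equiv.sum_comp (Equiv.mulLeft (⟨b, hb⟩ : borel K n)) (fun c : borel K n =>
      matOf ((c : GL (Fin n) K) : Matrix (Fin n) (Fin n) K))]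
  simp [MonoidAlgebra.single_mul_single]

theorem borelIdem_mul_borel {b : GL (Fin n) K} (hb : b ∈ borel K n) :
    borelIdem K n * matOf (b : Matrix (Fin n) (Fin n) K) = borelIdem K n := by
  rw [borelIdem, smul_mul_assoc, Finset.sum_mul,
    ← Equiv.sum_comp (Equiv.mulRight (⟨b, hb⟩ : borel K n)) (fun c : borel K n =>
      matOf ((c : GL (Fin n) K) : Matrix (Fin n) (Fin n) K))]
  simp [MonoidAlgebra.single_mul_single]

/-- The average of the double coset of a matrix. -/
def avg (m : Matrix (Fin n) (Fin n) K) : qRook K n := cornerMk K (matOf m)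

theorem avg_val (m : Matrix (Fin n) (Fin n) K) :
    (avg m).1 = borelIdem K n * matOf m * borelIdem K n := rfl

theorem qRook_ext {x y : qRook K n} (h : x.1 = y.1) : x = y := Subtype.ext h

theorem avg_one : avg (1 : Matrix (Fin n) (Fin n) K) = 1 := by
  refine qRook_ext ?_
  rw [avg_val, matOf_one, mul_one, (borelIdem_isIdempotent K n).eq]
  rfl

theorem avg_borel_mul {b : GL (Fin n) K} (hb : b ∈ borel K n) (m : Matrix (Fin n) (Fin n) K) :
    avg ((b : Matrix (Fin n) (Fin n) K) * m) = avg m := by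
  refine qRook_ext ?_
  rw [avg_val, avg_val, ← matOf_mul, ← mul_assoc, borelIdem_mul_borel hb]

theorem avg_mul_borel {b : GL (Fin n) K} (hb : b ∈ borel K n) (m : Matrix (Fin n) (Fin n) K) :
    avg (m * (b : Matrix (Fin n) (Fin n) K)) = avg m := by
  refine qRook_ext ?_
  rw [avg_val, avg_val, ← matOf_mul, mul_assoc, mul_assoc, borel_mul_borelIdem hb, ← mul_assoc]

/-- The value of an element of the double coset algebra, as a linear map. -/
def qRookVal (K : Type) [Field K] [Finite K] (n : ℕ) : qRook K n →ₗ[ℂ] MatMonoidAlgebra K n where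
  toFun x := x.1
  map_add' _ _ := rfl
  map_smul' _ _ := rfl

theorem qRookVal_mul (x y : qRook K n) :
    qRookVal K n (x * y) = qRookVal K n x * qRookVal K n y := rfl

theorem qRookVal_avg (m : Matrix (Fin n) (Fin n) K) :
    qRookVal K n (avg m) = borelIdem K n * matOf m * borelIdem K n := rfl

theorem qRookVal_injective : Function.Injective (qRookVal K n) := fun _ _ h => qRook_ext h

theorem avg_mul (m m' : Matrix (Fin n) (Fin n) K) :
    avg m * avg m' = (Fintype.card (borel K n) : ℂ)⁻¹ •
      ∑ b : borel K n, avg (m * ((b : GL (Fin n) K) : Matrix (Fin n) (Fin n) K) * m') := by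
  refine qRookVal_injective ?_
  rw [qRookVal_mul, map_smul, map_sum]
  simp only [qRookVal_avg, ← matOf_mul]
  have e : borelIdem K n * matOf m * borelIdem K n * (borelIdem K n * matOf m' * borelIdem K n) =
      borelIdem K n * matOf m * (borelIdem K n * borelIdem K n) * matOf m' * borelIdem K n := by
    simp only [mul_assoc]
  rw [e, (borelIdem_isIdempotent K n).eq]
  conv_lhs => rw [borelIdem, ← borelIdem]
  nth_rw 2 [borelIdem]
  simp only [mul_smul_comm, smul_mul_assoc, Finset.mul_sum, Finset.sum_mul, mul_assoc]

/-- Averaging over the Borel subgroup a function of a root coordinate. -/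
theorem borel_average [Fintype K] {E : Type*} [AddCommGroup E] [Module ℂ E] (u : borel K n → K)
    (x : K → Equiv.Perm (borel K n)) (hu : ∀ b v, u (x v b) = u b + v) (g : K → E) :
    (Fintype.card (borel K n) : ℂ)⁻¹ • ∑ b, g (u b) = (Fintype.card K : ℂ)⁻¹ • ∑ c, g c := by
  have hB : (Fintype.card (borel K n) : ℂ) ≠ 0 := by exact_mod_cast Fintype.card_ne_zero
  have hK : (Fintype.card K : ℂ) ≠ 0 := by exact_mod_cast Fintype.card_ne_zero
  -- The sum is invariant under translation of the coordinate by any `v`. Summing over `v` and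
  -- exchanging sums shows that the coordinate is equidistributed.
  have h1 : ∀ v, ∑ b, g (u b) = ∑ b, g (u b + v) := fun v => by
    rw [← Equiv.sum_comp (x v)]
    simp [hu]
  have h2 : (Fintype.card K : ℂ) • ∑ b, g (u b) = (Fintype.card (borel K n) : ℂ) • ∑ c, g c := by
    rw [Nat.cast_smul_eq_nsmul, Nat.cast_smul_eq_nsmul, ← Finset.card_univ, ← Finset.sum_const,
      Finset.sum_congr rfl fun v _ => h1 v, Finset.sum_comm, ← Finset.card_univ,
      ← Finset.sum_const]
    refine Finset.sum_congr rfl fun b _ => ?_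
    exact Equiv.sum_comp (Equiv.addLeft (u b)) g
  rw [inv_smul_eq_iff₀ hB, smul_comm, ← h2, inv_smul_smul₀ hK]

/-- The number of elements of the field as a complex number. -/
abbrev cardC (K : Type) : ℂ := (Nat.card K : ℂ)

theorem cardC_ne_zero : cardC K ≠ 0 := by
  have : Nonempty K := ⟨0⟩
  exact_mod_cast Nat.card_pos.ne'

section Simple

variable {x y : Fin n} (hxy : (y : ℕ) = x + 1)
include hxy

/-- By `swap_mul_borel`, a Borel element between the two factors matters only through the root
coordinate b_xy/b_xx, the rest being absorbed on the left, and this coordinate is equidistributed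
over the field. -/
theorem avg_swap_mul [Fintype K] (m : Matrix (Fin n) (Fin n) K) :
    avg (permGL K (Equiv.swap x y) : Matrix (Fin n) (Fin n) K) * avg m = (cardC K)⁻¹ •
      ∑ c : K, avg ((permGL K (Equiv.swap x y) : Matrix (Fin n) (Fin n) K) *
        Matrix.transvection x y c * m) := by
  have h := borel_average (n := n)
    (fun b : borel K n => (b.1 : Matrix (Fin n) (Fin n) K) x y /
      (b.1 : Matrix (Fin n) (Fin n) K) x x)
    (fun v => Equiv.mulRight ⟨transGL (ne_of_succ hxy) v, transGL_mem_borel (lt_of_succ hxy) v⟩)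
    (fun b v => ?_) (fun c => avg ((permGL K (Equiv.swap x y) : Matrix (Fin n) (Fin n) K) *
        Matrix.transvection x y c * m))
  · rw [avg_mul, cardC, Nat.card_eq_fintype_card]
    refine Eq.trans ?_ h
    refine congrArg _ (Finset.sum_congr rfl fun b _ => ?_)
    obtain ⟨b', hb', e⟩ := swap_mul_borel hxy b.2
    have e' := congrArg (fun g : GL (Fin n) K => (g : Matrix (Fin n) (Fin n) K)) e
    simp only [Units.val_mul, coe_transGL] at e'
    rw [e', mul_assoc, mul_assoc, avg_borel_mul hb', mul_assoc]
  · have h0 := borel_diag_ne_zero b.2 x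
    have e1 := mul_trans_apply (x := x) (y := y) v (b.1 : Matrix (Fin n) (Fin n) K) x y
    have e2 := mul_trans_apply (x := x) (y := y) v (b.1 : Matrix (Fin n) (Fin n) K) x x
    rw [if_pos rfl] at e1
    rw [if_neg (ne_of_succ hxy), add_zero] at e2
    exact (congrArg₂ (· / ·) e1 e2).trans (by rw [add_div, mul_div_cancel_left₀ _ h0])

theorem avg_mul_swap [Fintype K] (m : Matrix (Fin n) (Fin n) K) :
    avg m * avg (permGL K (Equiv.swap x y) : Matrix (Fin n) (Fin n) K) = (cardC K)⁻¹ •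
      ∑ c : K, avg (m * Matrix.transvection x y c *
        (permGL K (Equiv.swap x y) : Matrix (Fin n) (Fin n) K)) := by
  have h := borel_average (n := n)
    (fun b : borel K n => (b.1 : Matrix (Fin n) (Fin n) K) x y /
      (b.1 : Matrix (Fin n) (Fin n) K) y y)
    (fun v => Equiv.mulLeft ⟨transGL (ne_of_succ hxy) v, transGL_mem_borel (lt_of_succ hxy) v⟩)
    (fun b v => ?_) (fun c => avg (m * Matrix.transvection x y c *
        (permGL K (Equiv.swap x y) : Matrix (Fin n) (Fin n) K)))
  · rw [avg_mul, cardC, Nat.card_eq_fintype_card]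
    refine Eq.trans ?_ h
    refine congrArg _ (Finset.sum_congr rfl fun b _ => ?_)
    obtain ⟨b', hb', e⟩ := borel_mul_swap hxy b.2
    have e' := congrArg (fun g : GL (Fin n) K => (g : Matrix (Fin n) (Fin n) K)) e
    simp only [Units.val_mul, coe_transGL] at e'
    rw [mul_assoc, e', ← mul_assoc, avg_mul_borel hb', ← mul_assoc]
  · have h0 := borel_diag_ne_zero b.2 y
    have e1 := trans_mul_apply (x := x) (y := y) v (b.1 : Matrix (Fin n) (Fin n) K) x y
    have e2 := trans_mul_apply (x := x) (y := y) v (b.1 : Matrix (Fin n) (Fin n) K) y y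
    rw [if_pos rfl] at e1
    rw [if_neg (ne_of_succ hxy).symm, add_zero] at e2
    exact (congrArg₂ (· / ·) e1 e2).trans (by rw [add_div, mul_div_cancel_right₀ _ h0])

end Simple

end Averages

/-! ### Relations between averaged transpositions and diagonal idempotents -/

section RookRelations

variable {K : Type} [Field K] {n : ℕ}

theorem trans_mul_perm (w : Equiv.Perm (Fin n)) (a b : Fin n) (c : K) :
    Matrix.transvection a b c * (permGL K w : Matrix (Fin n) (Fin n) K) =
      (permGL K w : Matrix (Fin n) (Fin n) K) *
        Matrix.transvection (w.symm a) (w.symm b) c := by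
  ext k l
  rw [mul_perm_apply, perm_mul_apply]
  simp only [Matrix.transvection, Matrix.add_apply, Matrix.one_apply, Matrix.single_apply,
    Equiv.symm_apply_eq, Equiv.apply_symm_apply]

/-- The diagonal idempotent of rank `k`. -/
def truncMat (K : Type) [Field K] (n k : ℕ) : Matrix (Fin n) (Fin n) K :=
  Matrix.diagonal fun i => if (i : ℕ) < k then 1 else 0

theorem truncMat_mul_apply (k : ℕ) (A : Matrix (Fin n) (Fin n) K) (i j : Fin n) :
    (truncMat K n k * A) i j = if (i : ℕ) < k then A i j else 0 := by
  rw [truncMat, Matrix.diagonal_mul]; split_ifs <;> simp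

theorem mul_truncMat_apply (k : ℕ) (A : Matrix (Fin n) (Fin n) K) (i j : Fin n) :
    (A * truncMat K n k) i j = if (j : ℕ) < k then A i j else 0 := by
  rw [truncMat, Matrix.mul_diagonal]; split_ifs <;> simp

theorem truncMat_mul_truncMat (j k : ℕ) :
    truncMat K n j * truncMat K n k = truncMat K n (min j k) := by
  rw [truncMat, truncMat, Matrix.diagonal_mul_diagonal, truncMat]
  congr 1
  ext i
  by_cases h1 : (i : ℕ) < j <;> by_cases h2 : (i : ℕ) < k <;> simp [h1, h2]

theorem truncMat_self : truncMat K n n = 1 := by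
  rw [truncMat, ← Matrix.diagonal_one]
  congr 1
  ext i
  simp

theorem trans_mul_truncMat {k : ℕ} {a b : Fin n} (c : K) (hb : k ≤ b) :
    Matrix.transvection a b c * truncMat K n k = truncMat K n k := by
  ext i j
  rw [trans_mul_apply]
  have : truncMat K n k b j = 0 := by
    rw [← mul_one (truncMat K n k), truncMat_mul_apply, if_neg (by omega)]
  simp [this]

theorem truncMat_mul_trans {k : ℕ} {a b : Fin n} (c : K) (ha : k ≤ a) :
    truncMat K n k * Matrix.transvection a b c = truncMat K n k := by
  ext i j
  rw [mul_trans_apply]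
  have : truncMat K n k i a = 0 := by
    rw [← one_mul (truncMat K n k), mul_truncMat_apply, if_neg (by omega)]
  simp [this]

theorem trans_mul_truncMat_comm {k : ℕ} {a b : Fin n} (c : K) (ha : (a : ℕ) < k)
    (hb : (b : ℕ) < k) : Matrix.transvection a b c * truncMat K n k =
      truncMat K n k * Matrix.transvection a b c := by
  ext i j
  rw [truncMat_mul_apply, mul_truncMat_apply]
  by_cases hi : (i : ℕ) < k <;> by_cases hj : (j : ℕ) < k
  · simp [hi, hj]
  · have h1 : i ≠ j := by rintro rfl; exact hj hi
    have h2 : b ≠ j := by rintro rfl; exact hj hb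
    simp [hi, hj, Matrix.transvection, h1, h2]
  · have h1 : i ≠ j := by rintro rfl; exact hi hj
    have h2 : a ≠ i := by rintro rfl; exact hi ha
    simp [hi, hj, Matrix.transvection, h1, h2]
  · simp [hi, hj]

theorem swap_mul_truncMat {k : ℕ} {x y : Fin n} (hx : k ≤ x) (hy : k ≤ y) :
    (permGL K (Equiv.swap x y) : Matrix (Fin n) (Fin n) K) * truncMat K n k = truncMat K n k := by
  ext i j
  rw [mul_truncMat_apply]
  split_ifs with hj
  · have h1 : Equiv.swap x y j = j := Equiv.swap_apply_of_ne_of_ne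
      (by rintro rfl; omega) (by rintro rfl; omega)
    simp only [permGL, Matrix.of_apply, h1, truncMat, Matrix.diagonal_apply]
    split_ifs with h h' <;> first | rfl | (subst h; exact absurd hj h')
  · rw [← one_mul (truncMat K n k), mul_truncMat_apply, if_neg hj]

theorem swap_mul_truncMat_comm {k : ℕ} {x y : Fin n} (hxy : (y : ℕ) = x + 1)
    (hk : (x : ℕ) + 1 ≠ k) :
    (permGL K (Equiv.swap x y) : Matrix (Fin n) (Fin n) K) * truncMat K n k =
      truncMat K n k * (permGL K (Equiv.swap x y) : Matrix (Fin n) (Fin n) K) := by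
  ext i j
  rw [truncMat_mul_apply, mul_truncMat_apply]
  simp only [permGL, Matrix.of_apply]
  by_cases h : i = Equiv.swap x y j
  · have : ((i : ℕ) < k) ↔ ((j : ℕ) < k) := by
      rw [h, Equiv.swap_apply_def]; split_ifs with h1 h2
      · subst h1; omega
      · subst h2; omega
      · rfl
    by_cases hi : (i : ℕ) < k
    · simp [hi, this.mp hi]
    · simp [hi, mt this.mpr hi]
  · simp [h]

variable [Finite K]

section Good

variable {x y : Fin n} (hxy : (y : ℕ) = x + 1)
include hxy

theorem sum_avg_const [Fintype K] {f : K → qRook K n} {a : qRook K n} (h : ∀ c, f c = a) :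
    (cardC K)⁻¹ • ∑ c, f c = a := by
  rw [Finset.sum_congr rfl fun c _ => h c, Finset.sum_const, Finset.card_univ,
    ← Nat.cast_smul_eq_nsmul ℂ, ← Nat.card_eq_fintype_card, inv_smul_smul₀ cardC_ne_zero]

/-- The case of additive lengths: all terms of the sum over the root subgroup lie in one double
coset. -/
theorem avg_swap_mul_of {m : Matrix (Fin n) (Fin n) K} (h : ∀ c, ∃ b ∈ borel K n,
    Matrix.transvection x y c * m = m * (b : Matrix (Fin n) (Fin n) K)) :
    avg (permGL K (Equiv.swap x y) : Matrix (Fin n) (Fin n) K) * avg m =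
      avg ((permGL K (Equiv.swap x y) : Matrix (Fin n) (Fin n) K) * m) := by
  have := Fintype.ofFinite K
  rw [avg_swap_mul hxy]
  refine sum_avg_const hxy fun c => ?_
  obtain ⟨b, hb, e⟩ := h c
  rw [mul_assoc, e, ← mul_assoc, avg_mul_borel hb]

theorem avg_mul_swap_of {m : Matrix (Fin n) (Fin n) K} (h : ∀ c, ∃ b ∈ borel K n,
    m * Matrix.transvection x y c = (b : Matrix (Fin n) (Fin n) K) * m) :
    avg m * avg (permGL K (Equiv.swap x y) : Matrix (Fin n) (Fin n) K) =
      avg (m * (permGL K (Equiv.swap x y) : Matrix (Fin n) (Fin n) K)) := by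
  have := Fintype.ofFinite K
  rw [avg_mul_swap hxy]
  refine sum_avg_const hxy fun c => ?_
  obtain ⟨b, hb, e⟩ := h c
  rw [e, mul_assoc, avg_borel_mul hb]

theorem sum_avg_but_zero [Fintype K] {f : K → qRook K n} {a : qRook K n}
    (h : ∀ c, c ≠ 0 → f c = a) :
    (cardC K)⁻¹ • ∑ c, f c = (cardC K)⁻¹ • (f 0 + (cardC K - 1) • a) := by
  classical
  rw [← Finset.add_sum_erase _ _ (Finset.mem_univ 0),
    Finset.sum_congr rfl fun c hc => h c (Finset.ne_of_mem_erase hc), Finset.sum_const,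
    Finset.card_erase_of_mem (Finset.mem_univ _), Finset.card_univ, ← Nat.cast_smul_eq_nsmul ℂ,
    Nat.cast_sub Fintype.card_pos, ← Nat.card_eq_fintype_card, Nat.cast_one]

/-- The parameter 0 gives the identity, and the other q - 1 parameters give conjugated elementary
matrices lying in the double coset of the transposition. -/
theorem avg_swap_mul_self :
    avg (permGL K (Equiv.swap x y) : Matrix (Fin n) (Fin n) K) *
      avg (permGL K (Equiv.swap x y) : Matrix (Fin n) (Fin n) K) = (cardC K)⁻¹ •
        (1 + (cardC K - 1) • avg (permGL K (Equiv.swap x y) : Matrix (Fin n) (Fin n) K)) := by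
  have := Fintype.ofFinite K
  have h0 := congrArg (fun g : GL (Fin n) K => (g : Matrix (Fin n) (Fin n) K))
    (permGL_swap_mul_self (K := K) x y)
  simp only [Units.val_mul, Units.val_one] at h0
  rw [avg_swap_mul hxy, sum_avg_but_zero hxy (a := avg (permGL K (Equiv.swap x y)).val),
    Matrix.transvection_zero, mul_one, h0, avg_one]
  intro c hc
  obtain ⟨u, b, hb, e⟩ := swap_trans_swap hxy hc
  have e' := congrArg (fun g : GL (Fin n) K => (g : Matrix (Fin n) (Fin n) K)) e
  simp only [Units.val_mul, coe_transGL] at e'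
  rw [e', avg_mul_borel hb, ← coe_transGL (ne_of_succ hxy),
    avg_borel_mul (transGL_mem_borel (lt_of_succ hxy) _)]

theorem avg_swap_mul_perm {w : Equiv.Perm (Fin n)} (h : w.symm x < w.symm y) :
    avg (permGL K (Equiv.swap x y) : Matrix (Fin n) (Fin n) K) *
      avg (permGL K w : Matrix (Fin n) (Fin n) K) =
        avg (permGL K (Equiv.swap x y * w) : Matrix (Fin n) (Fin n) K) := by
  rw [avg_swap_mul_of hxy, ← Units.val_mul, permGL_mul]
  exact fun c => ⟨_, transGL_mem_borel h c, trans_mul_perm w x y c⟩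

end Good

/-- A Borel element crosses the truncation: b d_k = d_k b', where b' agrees with b in the first k
columns and with the identity in the others. So the averaging in the middle has no effect. -/
theorem avg_mul_truncMat (m : Matrix (Fin n) (Fin n) K) (k : ℕ) :
    avg m * avg (truncMat K n k) = avg (m * truncMat K n k) := by
  have key : ∀ b : borel K n, avg (m * ((b : GL (Fin n) K) : Matrix (Fin n) (Fin n) K) *
      truncMat K n k) = avg (m * truncMat K n k) := fun b => by
    obtain ⟨b', hb', e⟩ := exists_borel (n := n)
      (Matrix.of fun i j : Fin n => if (j : ℕ) < k then (b : GL (Fin n) K).val i j else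
        (1 : Matrix (Fin n) (Fin n) K) i j) (fun i j hij => by
          simp only [Matrix.of_apply]
          split_ifs
          · exact b.2 _ _ hij
          · exact Matrix.one_apply_ne hij.ne') (fun i => by
          simp only [Matrix.of_apply]
          split_ifs
          · exact borel_diag_ne_zero b.2 i
          · simp)
    have e2 : (b : GL (Fin n) K).val * truncMat K n k = truncMat K n k * b'.val := by
      rw [e]
      ext i j
      rw [truncMat_mul_apply, mul_truncMat_apply, Matrix.of_apply]
      by_cases hi : (i : ℕ) < k <;> by_cases hj : (j : ℕ) < k
      · simp [hi, hj]
      · have h1 : i ≠ j := by rintro rfl; exact hj hi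
        simp [hi, hj, h1]
      · simp only [hi, hj, if_true, if_false]
        exact b.2 _ _ (by rw [Fin.lt_def]; omega)
      · simp [hi, hj]
    rw [mul_assoc, e2, ← mul_assoc, avg_mul_borel hb']
  rw [avg_mul, Finset.sum_congr rfl fun b _ => key b, Finset.sum_const, Finset.card_univ,
    ← Nat.cast_smul_eq_nsmul ℂ, inv_smul_smul₀]
  exact_mod_cast Fintype.card_ne_zero

/-- The averages of the simple transpositions. -/
def rookS (K : Type) [Field K] [Finite K] (n i : ℕ) : qRook K n :=
  if h : i + 1 < n then
    avg (permGL K (Equiv.swap ⟨i, by omega⟩ ⟨i + 1, h⟩) : Matrix (Fin n) (Fin n) K) else 0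

theorem rookS_of_lt {i : ℕ} (h : i + 1 < n) : rookS K n i =
    avg (permGL K (Equiv.swap ⟨i, by omega⟩ ⟨i + 1, h⟩) : Matrix (Fin n) (Fin n) K) := dif_pos h

theorem swap_braid {α : Type*} [DecidableEq α] {x y z : α} (hxy : x ≠ y) (hxz : x ≠ z)
    (hyz : y ≠ z) : Equiv.swap x y * (Equiv.swap y z * Equiv.swap x y) =
      Equiv.swap y z * (Equiv.swap x y * Equiv.swap y z) := by
  ext p
  simp only [Equiv.Perm.mul_apply, Equiv.swap_apply_def]
  split_ifs <;> simp_all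

theorem heckeRel_rookS (K : Type) [Field K] [Finite K] (n : ℕ) :
    HeckeRel (cardC K) n (fun i => cardC K • rookS K n i) where
  quad i hi := by
    have h0 : cardC K ≠ 0 := cardC_ne_zero
    rw [smul_mul_smul_comm, rookS_of_lt hi, avg_swap_mul_self rfl, smul_smul,
      mul_inv_cancel_right₀ h0]
    module
  braid i hi := by
    have h1 : i + 1 < n := by omega
    simp only [smul_mul_smul_comm]
    refine congrArg _ ?_
    rw [rookS_of_lt h1, rookS_of_lt (show i + 1 + 1 < n from hi), mul_assoc, mul_assoc,
      avg_swap_mul_perm (by simp), avg_swap_mul_perm (by simp), avg_swap_mul_perm (by simp),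
      avg_swap_mul_perm (by simp), swap_braid (by simp) (by simp; omega) (by simp)]
    all_goals
      simp [Equiv.swap_apply_def, Equiv.Perm.mul_def, show i ≠ i + 1 + 1 by omega,
        show i + 1 + 1 ≠ i by omega]
  comm i j hi hj := by
    simp only [smul_mul_smul_comm]
    refine congrArg _ ?_
    rw [rookS_of_lt (show i + 1 < n by omega), rookS_of_lt hj, avg_swap_mul_perm (by simp),
      avg_swap_mul_perm (by simp)]
    · rw [((Equiv.Perm.disjoint_swap_swap (by simp; omega)).commute).eq]
    all_goals
      rw [Equiv.symm_swap, Equiv.swap_apply_of_ne_of_ne, Equiv.swap_apply_of_ne_of_ne] <;>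
        simp <;> omega

/-- The averages of the diagonal idempotents. -/
abbrev rookD (K : Type) [Field K] [Finite K] (n k : ℕ) : qRook K n := avg (truncMat K n k)

theorem rookD_mul_rookS {i k : ℕ} (hi : i + 1 < n) (hk : i + 1 ≠ k) :
    rookD K n k * rookS K n i = rookS K n i * rookD K n k := by
  rw [rookS_of_lt hi, avg_mul_truncMat, swap_mul_truncMat_comm rfl (by exact hk),
    avg_mul_swap_of rfl]
  intro c
  have hlt : (⟨i, by omega⟩ : Fin n) < ⟨i + 1, hi⟩ := by simp
  by_cases h : k ≤ i
  · exact ⟨1, one_mem _, by rw [truncMat_mul_trans c h, Units.val_one, one_mul]⟩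
  · exact ⟨transGL hlt.ne c, transGL_mem_borel hlt c, by
      rw [coe_transGL, trans_mul_truncMat_comm c (by simp; omega) (by simp; omega)]⟩

/-- For a parameter c the inner product is diagonal with i ones followed by c. It is the smaller
idempotent for c = 0, and a torus multiple of the original one for each of the q - 1 other values.
-/
theorem rookD_mul_rookS_mul_rookD {i : ℕ} (hi : i + 1 < n) :
    rookD K n (i + 1) * rookS K n i * rookD K n (i + 1) =
      (cardC K)⁻¹ • (rookD K n i + (cardC K - 1) • rookD K n (i + 1)) := by
  have := Fintype.ofFinite K
  have e : ∀ c : K, truncMat K n (i + 1) *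
      Matrix.transvection (⟨i, by omega⟩ : Fin n) ⟨i + 1, hi⟩ c *
      (permGL K (Equiv.swap (⟨i, by omega⟩ : Fin n) ⟨i + 1, hi⟩)).val * truncMat K n (i + 1) =
      Matrix.diagonal fun j : Fin n => if (j : ℕ) < i then 1 else if (j : ℕ) = i then c else 0 := by
    intro c
    ext k l
    rw [mul_truncMat_apply, mul_perm_apply, truncMat_mul_apply, Matrix.diagonal_apply]
    simp only [Matrix.transvection, Matrix.add_apply, Matrix.one_apply, Matrix.single_apply]
    rcases lt_trichotomy (l : ℕ) i with h | h | h
    · rw [Equiv.swap_apply_of_ne_of_ne (by rintro rfl; simp at h)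
        (by rintro rfl; simp at h)]
      have h1 : (⟨i + 1, hi⟩ : Fin n) ≠ l := by rintro rfl; simp at h
      by_cases hkl : k = l
      · subst hkl; simp [h, h1, Nat.lt_succ_of_lt h]
      · simp [hkl, h1]
    · have hl : l = ⟨i, by omega⟩ := Fin.ext h
      rw [hl, Equiv.swap_apply_left]
      by_cases hk : k = ⟨i, by omega⟩
      · simp [hk]
      · by_cases hk' : k = ⟨i + 1, hi⟩
        · simp [hk']
        · simp [hk, hk', Ne.symm hk]
    · rw [if_neg (by omega)]
      by_cases hkl : k = l
      · subst hkl; simp [h.ne', h.not_gt]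
      · simp [hkl]
  have e0 : truncMat K n i =
      Matrix.diagonal fun j : Fin n => if (j : ℕ) < i then 1 else if (j : ℕ) = i then 0 else 0 := by
    simp [truncMat]
  rw [rookS_of_lt hi, avg_mul_swap rfl, smul_mul_assoc, Finset.sum_mul]
  simp only [avg_mul_truncMat, e]
  rw [rookD, e0]
  refine sum_avg_but_zero (x := (⟨i, by omega⟩ : Fin n)) (y := ⟨i + 1, hi⟩) rfl
    (f := fun c => avg (Matrix.diagonal fun j : Fin n =>
      if (j : ℕ) < i then 1 else if (j : ℕ) = i then c else 0)) fun c hc => ?_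
  obtain ⟨b, hb, e⟩ := exists_borel (K := K) (n := n)
    (Matrix.diagonal fun j : Fin n => if (j : ℕ) = i then c else 1)
    (fun k l h => Matrix.diagonal_apply_ne _ h.ne') (fun k => by
      rw [Matrix.diagonal_apply_eq]; split_ifs <;> simp [hc])
  rw [rookD, ← avg_borel_mul hb (truncMat K n (i + 1)), e, truncMat, Matrix.diagonal_mul_diagonal]
  congr 2
  ext j
  split_ifs <;> simp_all <;> omega

/-- Averaged transpositions beyond k fix the idempotent, so q times them acts on it by q, whereas
rook data ask for the eigenvalue -1. The involution t ↦ (q - 1) - t of the Hecke relations exchanges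
the two. -/
theorem rookData_rook (K : Type) [Field K] [Finite K] (n : ℕ) :
    RookData (cardC K) n (fun i => (cardC K - 1) • 1 - cardC K • rookS K n i) (rookD K n) where
  hecke := (heckeRel_rookS K n).dual
  top := by rw [rookD, truncMat_self, avg_one]
  mul j _ k _ := by rw [avg_mul_truncMat, truncMat_mul_truncMat]
  comm k _ i hi hk := by
    simp only [sub_mul, mul_sub, smul_mul_assoc, mul_smul_comm, one_mul, mul_one,
      rookD_mul_rookS hi hk]
  neg k _ i hi hk := by
    simp only [sub_mul, smul_mul_assoc, one_mul]
    rw [rookS_of_lt hi, avg_mul_truncMat, swap_mul_truncMat (by exact hk) (by simp; omega)]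
    module
  sandwich i hi := by
    have h0 : cardC K ≠ 0 := cardC_ne_zero
    simp only [sub_mul, mul_sub, smul_mul_assoc, mul_smul_comm, one_mul, mul_one,
      rookD_mul_rookS_mul_rookD hi, smul_inv_smul₀ h0]
    rw [avg_mul_truncMat, truncMat_mul_truncMat, min_self]
    module

end RookRelations

/-! ### Rook matrices -/

section RookMatrices

variable {K : Type} [Field K] {n : ℕ}

/-- The rook matrix with permutations `w`, `v` and rank `k`. -/
def rookMat (K : Type) [Field K] (w : Equiv.Perm (Fin n)) (k : ℕ) (v : Equiv.Perm (Fin n)) :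
    Matrix (Fin n) (Fin n) K :=
  (permGL K w : Matrix (Fin n) (Fin n) K) * truncMat K n k * (permGL K v).val

theorem rookMat_apply (w v : Equiv.Perm (Fin n)) (k : ℕ) (i j : Fin n) :
    rookMat K w k v i j = if w.symm i = v j ∧ (v j : ℕ) < k then 1 else 0 := by
  rw [rookMat, mul_perm_apply, mul_truncMat_apply]
  simp only [permGL, Matrix.of_apply, ← Equiv.symm_apply_eq]
  by_cases h : w.symm i = v j <;> by_cases h' : (v j : ℕ) < k <;> simp [h, h']

theorem perm_mul_rookMat (s w v : Equiv.Perm (Fin n)) (k : ℕ) :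
    (permGL K s).val * rookMat K w k v = rookMat K (s * w) k v := by
  rw [rookMat, rookMat, ← permGL_mul, Units.val_mul]
  simp only [mul_assoc]

theorem rookMat_mul_perm (s w v : Equiv.Perm (Fin n)) (k : ℕ) :
    rookMat K w k v * (permGL K s).val = rookMat K w k (v * s) := by
  rw [rookMat, rookMat, ← permGL_mul, Units.val_mul]
  simp only [mul_assoc]

theorem rookMat_one_one (k : ℕ) : rookMat K 1 k 1 = truncMat K n k := by
  rw [rookMat, permGL_one, Units.val_one, one_mul, mul_one]

/-- The rows `x < y` of the rook matrix are in increasing position. -/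
def LeftGood (w : Equiv.Perm (Fin n)) (k : ℕ) (v : Equiv.Perm (Fin n)) (x y : Fin n) : Prop :=
  k ≤ w.symm y ∨ (w.symm x : ℕ) < k ∧ v.symm (w.symm x) < v.symm (w.symm y)

/-- The columns `x < y` of the rook matrix are in increasing position. -/
def RightGood (w : Equiv.Perm (Fin n)) (k : ℕ) (v : Equiv.Perm (Fin n)) (x y : Fin n) : Prop :=
  k ≤ v x ∨ (v y : ℕ) < k ∧ w (v x) < w (v y)

/-- Exchanging the two rows turns a decreasing pair of rooks into an increasing one, and moves an
empty row into second place. So one of a matrix and its exchange is always good. -/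
theorem leftGood_swap {w v : Equiv.Perm (Fin n)} {k : ℕ} {x y : Fin n} (hne : x ≠ y)
    (h : ¬LeftGood w k v x y) : LeftGood (Equiv.swap x y * w) k v x y := by
  have e1 : (Equiv.swap x y * w).symm x = w.symm y := by
    simp [Equiv.symm_apply_eq]
  have e2 : (Equiv.swap x y * w).symm y = w.symm x := by
    simp [Equiv.symm_apply_eq]
  rw [LeftGood, e1, e2]
  rw [LeftGood, not_or, not_and, not_le, not_lt] at h
  by_cases hx : (w.symm x : ℕ) < k
  · exact Or.inr ⟨h.1, lt_of_le_of_ne (h.2 hx) (by simpa using hne.symm)⟩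
  · exact Or.inl (not_lt.mp hx)

theorem rightGood_swap {w v : Equiv.Perm (Fin n)} {k : ℕ} {x y : Fin n} (hne : x ≠ y)
    (h : ¬RightGood w k v x y) : RightGood w k (v * Equiv.swap x y) x y := by
  have e1 : (v * Equiv.swap x y) x = v y := by simp
  have e2 : (v * Equiv.swap x y) y = v x := by simp
  rw [RightGood, e1, e2]
  rw [RightGood, not_or, not_and, not_le, not_lt] at h
  by_cases hx : (v y : ℕ) < k
  · exact Or.inr ⟨h.1, lt_of_le_of_ne (h.2 hx) (by simpa using hne.symm)⟩
  · exact Or.inl (not_lt.mp hx)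

theorem perm_mul_trans (w : Equiv.Perm (Fin n)) (a b : Fin n) (c : K) :
    (permGL K w).val * Matrix.transvection a b c =
      Matrix.transvection (w a) (w b) c * (permGL K w).val := by
  rw [trans_mul_perm, Equiv.symm_apply_apply, Equiv.symm_apply_apply]

/-- The elementary matrix is conjugated through `w`. It is then either killed by the truncation or
passes through it and through `v`, and goodness says that the resulting root is again positive. -/
theorem LeftGood.exists_borel {w v : Equiv.Perm (Fin n)} {k : ℕ} {x y : Fin n}
    (h : LeftGood w k v x y) (c : K) : ∃ b ∈ borel K n,
      Matrix.transvection x y c * rookMat K w k v = rookMat K w k v * b.val := by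
  rw [rookMat, ← mul_assoc, ← mul_assoc, trans_mul_perm, mul_assoc (permGL K w).val]
  by_cases hy : k ≤ w.symm y
  · exact ⟨1, one_mem _, by rw [trans_mul_truncMat c hy, Units.val_one, mul_one]⟩
  · obtain ⟨hx, hlt⟩ := h.resolve_left hy
    refine ⟨transGL hlt.ne c, transGL_mem_borel hlt c, ?_⟩
    rw [trans_mul_truncMat_comm c hx (not_le.mp hy), coe_transGL, mul_assoc _ (permGL K v).val,
      perm_mul_trans, Equiv.apply_symm_apply, Equiv.apply_symm_apply]
    simp only [mul_assoc]

theorem RightGood.exists_borel {w v : Equiv.Perm (Fin n)} {k : ℕ} {x y : Fin n}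
    (h : RightGood w k v x y) (c : K) : ∃ b ∈ borel K n,
      rookMat K w k v * Matrix.transvection x y c = b.val * rookMat K w k v := by
  rw [rookMat, mul_assoc, perm_mul_trans, ← mul_assoc, mul_assoc (permGL K w).val]
  by_cases hx : k ≤ v x
  · exact ⟨1, one_mem _, by rw [truncMat_mul_trans c hx, Units.val_one, one_mul]⟩
  · obtain ⟨hy, hlt⟩ := h.resolve_left hx
    refine ⟨transGL hlt.ne c, transGL_mem_borel hlt c, ?_⟩
    rw [← trans_mul_truncMat_comm c (not_le.mp hx) hy, coe_transGL, ← mul_assoc,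
      perm_mul_trans]
    simp only [mul_assoc]

/-- Partial injections are represented by rook matrices, over all fields simultaneously. -/
theorem exists_toMatrix_eq_rookMat (σ : Fin n ≃. Fin n) : ∃ w v : Equiv.Perm (Fin n), ∃ k ≤ n,
    ∀ (K : Type) [Field K], (σ.toMatrix : Matrix (Fin n) (Fin n) K) = rookMat K w k v := by
  classical
  set k := Fintype.card {i // (σ i).isSome} with hk
  have hkn : k ≤ n := (Fintype.card_subtype_le _).trans_eq (Fintype.card_fin n)
  have e : {j : Fin n // (j : ℕ) < k} ≃ {i // (σ i).isSome} :=
    Fintype.equivOfCardEq (by rw [Fintype.card_fin_lt_of_le hkn])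
  let g : {i // (σ i).isSome} → Fin n := fun i => (σ i.1).get i.2
  have hg : Function.Injective g := fun a b h => by
    refine Subtype.ext (σ.inj (b := g a) (Option.get_mem a.2) ?_)
    rw [h]
    exact Option.get_mem b.2
  let e' : {j : Fin n // (j : ℕ) < k} ≃ {j // j ∈ Set.range (g ∘ e)} :=
    Equiv.ofInjective _ (hg.comp e.injective)
  -- The first k indices are matched with the domain of σ by `e` and with its image by `e'`,
  -- compatibly with σ. Both bijections are extended to permutations, and the choice does not
  -- involve the field.
  refine ⟨e.extendSubtype, e'.extendSubtype.symm, k, hkn, fun K _ => ?_⟩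
  ext i j
  rw [rookMat_apply, PEquiv.toMatrix_apply]
  have key : j ∈ σ i ↔ e.extendSubtype.symm i = e'.extendSubtype.symm j ∧
      ((e'.extendSubtype.symm j : Fin n) : ℕ) < k := by
    constructor
    · intro h
      have hi : (σ i).isSome := Option.isSome_iff_exists.mpr ⟨j, h⟩
      have h1 : e.extendSubtype.symm i = (e.symm ⟨i, hi⟩).1 := by
        rw [Equiv.symm_apply_eq, e.extendSubtype_apply_of_mem _ (e.symm ⟨i, hi⟩).2]
        simp
      have h2 : e'.extendSubtype.symm j = (e.symm ⟨i, hi⟩).1 := by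
        rw [Equiv.symm_apply_eq, e'.extendSubtype_apply_of_mem _ (e.symm ⟨i, hi⟩).2]
        simp only [e', Equiv.ofInjective_apply, Function.comp, Subtype.coe_eta,
          Equiv.apply_symm_apply, g]
        exact (Option.get_of_mem _ h).symm
      exact ⟨h1.trans h2.symm, h2 ▸ (e.symm ⟨i, hi⟩).2⟩
    · rintro ⟨h1, h2⟩
      set a := e'.extendSubtype.symm j with ha
      have h3 : j = g (e ⟨a, h2⟩) := by
        have := e'.extendSubtype_apply_of_mem a h2
        exact (e'.extendSubtype.apply_symm_apply j).symm.trans this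
      have h4 : i = (e ⟨a, h2⟩).1 := by
        rw [Equiv.symm_apply_eq, e.extendSubtype_apply_of_mem a h2] at h1
        exact h1
      rw [h3, h4]
      exact Option.get_mem _
  simp only [key]

/-- The simple transposition of `i` and `i + 1`. -/
def adjSwap (n i : ℕ) : Equiv.Perm (Fin n) :=
  if h : i + 1 < n then Equiv.swap ⟨i, by omega⟩ ⟨i + 1, h⟩ else 1

theorem adjSwap_of_lt {i : ℕ} (h : i + 1 < n) :
    adjSwap n i = Equiv.swap ⟨i, by omega⟩ ⟨i + 1, h⟩ := dif_pos h

theorem perm_adjSwap_induction {P : Equiv.Perm (Fin n) → Prop} (h1 : P 1)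
    (hs : ∀ w i, i + 1 < n → P w → P (adjSwap n i * w)) (w : Equiv.Perm (Fin n)) : P w := by
  have := ascent_induction (n := n) le_rfl (P := fun σ => P σ⁻¹) (by simpa using h1)
    (fun σ i hi _ _ h => by
      rw [mul_inv_rev, Equiv.swap_inv, ← adjSwap_of_lt hi]
      exact hs _ _ hi h) w⁻¹ (fun p hp => absurd p.2 (by omega))
  simpa using this

/-- For a good pair, multiplication by `s i` changes the permutation. Otherwise the exchanged pair
is good and the inverse `s' i` is used. The statement is abstract in `a` so as to apply both to one
field and to families over all prime powers. -/
theorem rookMat_mem {E : Type*} [Ring E] (S : Subring E) {a : Equiv.Perm (Fin n) → ℕ →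
    Equiv.Perm (Fin n) → E} {s s' : ℕ → E} (hs : ∀ i, i + 1 < n → s i ∈ S)
    (hs' : ∀ i, i + 1 < n → s' i ∈ S) (hinv : ∀ i, i + 1 < n → s' i * s i = 1)
    (hinv' : ∀ i, i + 1 < n → s i * s' i = 1)
    (hl : ∀ w k v i, ∀ h : i + 1 < n, LeftGood w k v ⟨i, by omega⟩ ⟨i + 1, h⟩ →
      s i * a w k v = a (adjSwap n i * w) k v)
    (hr : ∀ w k v i, ∀ h : i + 1 < n, RightGood w k v ⟨i, by omega⟩ ⟨i + 1, h⟩ →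
      a w k v * s i = a w k (v * adjSwap n i))
    {k : ℕ} (hk : a 1 k 1 ∈ S) (w v : Equiv.Perm (Fin n)) : a w k v ∈ S := by
  have hleft : ∀ w v i, i + 1 < n → a w k v ∈ S → a (adjSwap n i * w) k v ∈ S := by
    intro w v i hi h
    by_cases hg : LeftGood w k v ⟨i, by omega⟩ ⟨i + 1, hi⟩
    · rw [← hl w k v i hi hg]
      exact mul_mem (hs i hi) h
    · have := hl (adjSwap n i * w) k v i hi (by rw [adjSwap_of_lt hi]; exact leftGood_swap (by simp) hg)
      rw [← mul_assoc (adjSwap n i), adjSwap_of_lt hi, Equiv.swap_mul_self, one_mul] at this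
      rw [adjSwap_of_lt hi, ← one_mul (a _ k v), ← hinv i hi, mul_assoc, this]
      exact mul_mem (hs' i hi) h
  have hright : ∀ w v i, i + 1 < n → a w k v ∈ S → a w k (v * adjSwap n i) ∈ S := by
    intro w v i hi h
    by_cases hg : RightGood w k v ⟨i, by omega⟩ ⟨i + 1, hi⟩
    · rw [← hr w k v i hi hg]
      exact mul_mem h (hs i hi)
    · have := hr w k (v * adjSwap n i) i hi (by rw [adjSwap_of_lt hi]; exact rightGood_swap (by simp) hg)
      rw [mul_assoc v, adjSwap_of_lt hi, Equiv.swap_mul_self, mul_one] at this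
      rw [adjSwap_of_lt hi, ← mul_one (a w k _), ← hinv' i hi, ← mul_assoc, this]
      exact mul_mem h (hs' i hi)
  have h1 : a 1 k v ∈ S := by
    have := perm_adjSwap_induction (P := fun v => a 1 k v⁻¹ ∈ S) (by simpa using hk)
      (fun w i hi h => by
        rw [mul_inv_rev]
        have e : (adjSwap n i)⁻¹ = adjSwap n i := by rw [adjSwap_of_lt hi, Equiv.swap_inv]
        rw [e]
        exact hright _ _ i hi h) v⁻¹
    simpa using this
  exact perm_adjSwap_induction (P := fun w => a w k v ∈ S) h1 (fun w i hi h => hleft _ _ i hi h) w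

end RookMatrices

/-! ### The Bruhat decomposition of the matrix monoid and generation of the double coset algebra -/

section RookGeneration

variable {K : Type} [Field K] {n : ℕ}

/-- The union of the double cosets of rook matrices. -/
def RookCell (m : Matrix (Fin n) (Fin n) K) : Prop :=
  ∃ b ∈ borel K n, ∃ b' ∈ borel K n, ∃ w v : Equiv.Perm (Fin n), ∃ k ≤ n,
    m = b.val * rookMat K w k v * b'.val

theorem RookCell.borel_mul {m : Matrix (Fin n) (Fin n) K} (h : RookCell m) {c : GL (Fin n) K}
    (hc : c ∈ borel K n) : RookCell (c.val * m) := by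
  obtain ⟨b, hb, b', hb', w, v, k, hk, rfl⟩ := h
  exact ⟨c * b, mul_mem hc hb, b', hb', w, v, k, hk, by simp only [Units.val_mul, mul_assoc]⟩

theorem RookCell.mul_borel {m : Matrix (Fin n) (Fin n) K} (h : RookCell m) {c : GL (Fin n) K}
    (hc : c ∈ borel K n) : RookCell (m * c.val) := by
  obtain ⟨b, hb, b', hb', w, v, k, hk, rfl⟩ := h
  exact ⟨b, hb, b' * c, mul_mem hb' hc, w, v, k, hk, by simp only [Units.val_mul, mul_assoc]⟩

theorem rookCell_rookMat (w v : Equiv.Perm (Fin n)) {k : ℕ} (hk : k ≤ n) :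
    RookCell (rookMat K w k v) :=
  ⟨1, one_mem _, 1, one_mem _, w, v, k, hk, by simp⟩

theorem val_eq_of_eq {g h : GL (Fin n) K} (e : g = h) : g.val = h.val := by rw [e]

/-- Moving `b` past the transposition leaves an elementary matrix, which is absorbed if the rows are
good. Otherwise a second transposition is split off from the rook matrix. The conjugated elementary
matrix is then trivial or lies in the big cell, and the good case applies to the exchanged matrix.
-/
theorem RookCell.swap_mul {x y : Fin n} (hxy : (y : ℕ) = x + 1) {m : Matrix (Fin n) (Fin n) K}
    (h : RookCell m) : RookCell ((permGL K (Equiv.swap x y)).val * m) := by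
  have hne := ne_of_succ hxy
  have good : ∀ (w v : Equiv.Perm (Fin n)) (k : ℕ), k ≤ n → LeftGood w k v x y → ∀ b ∈ borel K n,
      RookCell ((permGL K (Equiv.swap x y)).val * (b.val * rookMat K w k v)) := by
    intro w v k hk hg b hb
    obtain ⟨b', hb', e⟩ := swap_mul_borel hxy hb
    obtain ⟨b'', hb'', e2⟩ := hg.exists_borel (K := K) (b.val x y / b.val x x)
    rw [← mul_assoc, ← Units.val_mul, e, Units.val_mul, Units.val_mul, coe_transGL, mul_assoc, e2,
      ← mul_assoc, mul_assoc b'.val, perm_mul_rookMat]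
    exact ((rookCell_rookMat _ _ hk).borel_mul hb').mul_borel hb''
  obtain ⟨b, hb, b', hb', w, v, k, hk, rfl⟩ := h
  rw [← mul_assoc]
  refine RookCell.mul_borel ?_ hb'
  by_cases hg : LeftGood w k v x y
  · exact good w v k hk hg b hb
  · obtain ⟨b₁, hb₁, e⟩ := swap_mul_borel hxy hb
    rw [← mul_assoc, ← Units.val_mul, e]
    set u := b.val x y / b.val x x
    have e0 : (permGL K (Equiv.swap x y) * permGL K (Equiv.swap x y)).val * rookMat K w k v =
        rookMat K w k v := by rw [permGL_swap_mul_self, Units.val_one, one_mul]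
    have e1 : (b₁ * permGL K (Equiv.swap x y) * transGL (ne_of_succ hxy) u).val * rookMat K w k v =
        b₁.val * ((permGL K (Equiv.swap x y) * transGL (ne_of_succ hxy) u *
          permGL K (Equiv.swap x y)).val * rookMat K (Equiv.swap x y * w) k v) := by
      rw [← perm_mul_rookMat]
      conv_lhs => rw [← e0]
      simp only [Units.val_mul, mul_assoc]
    rw [e1]
    refine RookCell.borel_mul ?_ hb₁
    by_cases hu : u = 0
    · rw [hu, transGL_zero, mul_one, permGL_swap_mul_self, Units.val_one, one_mul]
      exact rookCell_rookMat _ _ hk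
    · obtain ⟨u', b₂, hb₂, e2⟩ := swap_trans_swap hxy hu
      rw [e2, mul_assoc, Units.val_mul, mul_assoc]
      refine RookCell.borel_mul ?_ (transGL_mem_borel (lt_of_succ hxy) u')
      rw [Units.val_mul, mul_assoc]
      exact good _ v k hk (leftGood_swap hne hg) b₂ hb₂

theorem RookCell.mul_swap {x y : Fin n} (hxy : (y : ℕ) = x + 1) {m : Matrix (Fin n) (Fin n) K}
    (h : RookCell m) : RookCell (m * (permGL K (Equiv.swap x y)).val) := by
  have hne := ne_of_succ hxy
  have good : ∀ (w v : Equiv.Perm (Fin n)) (k : ℕ), k ≤ n → RightGood w k v x y → ∀ b ∈ borel K n,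
      RookCell (rookMat K w k v * b.val * (permGL K (Equiv.swap x y)).val) := by
    intro w v k hk hg b hb
    obtain ⟨b', hb', e⟩ := borel_mul_swap hxy hb
    obtain ⟨b'', hb'', e2⟩ := hg.exists_borel (K := K) (b.val x y / b.val y y)
    rw [mul_assoc, ← Units.val_mul, e, Units.val_mul, Units.val_mul, coe_transGL, ← mul_assoc,
      ← mul_assoc, e2, mul_assoc b''.val, rookMat_mul_perm]
    exact ((rookCell_rookMat _ _ hk).borel_mul hb'').mul_borel hb'
  obtain ⟨b, hb, b', hb', w, v, k, hk, rfl⟩ := h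
  rw [mul_assoc, mul_assoc]
  refine RookCell.borel_mul ?_ hb
  by_cases hg : RightGood w k v x y
  · rw [← mul_assoc]
    exact good w v k hk hg b' hb'
  · obtain ⟨b₁, hb₁, e⟩ := borel_mul_swap hxy hb'
    rw [← Units.val_mul, e]
    set u := b'.val x y / b'.val y y
    have e0 : rookMat K w k v * (permGL K (Equiv.swap x y) * permGL K (Equiv.swap x y)).val =
        rookMat K w k v := by rw [permGL_swap_mul_self, Units.val_one, mul_one]
    have e1 : rookMat K w k v * (transGL (ne_of_succ hxy) u * permGL K (Equiv.swap x y) * b₁).val =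
        rookMat K w k (v * Equiv.swap x y) * (permGL K (Equiv.swap x y) *
          transGL (ne_of_succ hxy) u * permGL K (Equiv.swap x y)).val * b₁.val := by
      rw [← rookMat_mul_perm]
      conv_lhs => rw [← e0]
      simp only [Units.val_mul, mul_assoc]
    rw [e1]
    refine RookCell.mul_borel ?_ hb₁
    by_cases hu : u = 0
    · rw [hu, transGL_zero, mul_one, permGL_swap_mul_self, Units.val_one, mul_one]
      exact rookCell_rookMat _ _ hk
    · obtain ⟨u', b₂, hb₂, e2⟩ := swap_trans_swap hxy hu
      rw [e2, Units.val_mul, ← mul_assoc]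
      refine RookCell.mul_borel ?_ hb₂
      rw [Units.val_mul, ← mul_assoc]
      exact good _ _ k hk (rightGood_swap hne hg) _ (transGL_mem_borel (lt_of_succ hxy) u')

theorem RookCell.perm_mul {m : Matrix (Fin n) (Fin n) K} (h : RookCell m)
    (w : Equiv.Perm (Fin n)) : RookCell ((permGL K w).val * m) := by
  refine perm_adjSwap_induction (P := fun w => RookCell ((permGL K w).val * m)) ?_ ?_ w
  · simpa [permGL_one] using h
  · intro w i hi h
    rw [← permGL_mul, Units.val_mul, mul_assoc, adjSwap_of_lt hi]
    exact h.swap_mul rfl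

theorem RookCell.mul_perm {m : Matrix (Fin n) (Fin n) K} (h : RookCell m)
    (w : Equiv.Perm (Fin n)) : RookCell (m * (permGL K w).val) := by
  have := perm_adjSwap_induction (P := fun w => RookCell (m * (permGL K w⁻¹).val)) ?_ ?_ w⁻¹
  · simpa using this
  · simpa [permGL_one] using h
  · intro w i hi h
    rw [mul_inv_rev, ← permGL_mul, Units.val_mul, ← mul_assoc, adjSwap_of_lt hi, Equiv.swap_inv]
    exact h.mul_swap rfl

/-- Conjugation by a transposition makes a lower elementary matrix upper triangular, so permutations
and Borel elements suffice for all elementary operations. -/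
theorem trans_eq_of_lt {a b : Fin n} (c : K) : Matrix.transvection a b c =
    (permGL K (Equiv.swap a b)).val * (Matrix.transvection b a c *
      (permGL K (Equiv.swap a b)).val) := by
  rw [trans_mul_perm, ← mul_assoc, ← Units.val_mul, permGL_swap_mul_self, Equiv.symm_swap,
    Equiv.swap_apply_left, Equiv.swap_apply_right, Units.val_one, one_mul]

theorem RookCell.trans_mul {m : Matrix (Fin n) (Fin n) K} (h : RookCell m) {a b : Fin n}
    (hab : a ≠ b) (c : K) : RookCell (Matrix.transvection a b c * m) := by
  rcases lt_or_gt_of_ne hab with hlt | hlt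
  · exact h.borel_mul (transGL_mem_borel hlt c)
  · rw [trans_eq_of_lt, mul_assoc, mul_assoc]
    exact ((h.perm_mul _).borel_mul (transGL_mem_borel hlt c)).perm_mul _

theorem RookCell.mul_trans {m : Matrix (Fin n) (Fin n) K} (h : RookCell m) {a b : Fin n}
    (hab : a ≠ b) (c : K) : RookCell (m * Matrix.transvection a b c) := by
  rcases lt_or_gt_of_ne hab with hlt | hlt
  · exact h.mul_borel (transGL_mem_borel hlt c)
  · rw [trans_eq_of_lt, ← mul_assoc, ← mul_assoc]
    exact ((h.mul_perm _).mul_borel (transGL_mem_borel hlt c)).mul_perm _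

theorem rookCell_diagonal (d : Fin n → K) : RookCell (Matrix.diagonal d) := by
  classical
  obtain ⟨w, v, k, hk, e⟩ := exists_toMatrix_eq_rookMat (PEquiv.ofSet {i | d i ≠ 0})
  obtain ⟨b, hb, e2⟩ := exists_borel (K := K) (n := n)
    (Matrix.diagonal fun i => if d i = 0 then 1 else d i)
    (fun k l h => Matrix.diagonal_apply_ne _ h.ne') (fun k => by
      rw [Matrix.diagonal_apply_eq]; split_ifs <;> simp_all)
  have e3 : Matrix.diagonal d = b.val * rookMat K w k v := by
    rw [← e, e2]
    ext i j
    rw [Matrix.diagonal_mul, PEquiv.toMatrix_apply, Matrix.diagonal_apply]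
    by_cases hij : i = j
    · subst hij
      by_cases hd : d i = 0 <;> simp [hd, PEquiv.mem_ofSet_iff]
    · simp [hij, PEquiv.mem_ofSet_iff, Ne.symm hij]
  rw [e3]
  exact (rookCell_rookMat w v hk).borel_mul hb

/-- The Bruhat decomposition of the monoid of matrices. -/
theorem rookCell (m : Matrix (Fin n) (Fin n) K) : RookCell m := by
  -- Gaussian elimination reduces to a diagonal matrix, which is a torus element times a partial
  -- identity.
  obtain ⟨L, L', D, rfl⟩ :=
    Matrix.Pivot.exists_list_transvec_mul_diagonal_mul_list_transvec m
  have h1 : ∀ (L : List (Matrix.TransvectionStruct (Fin n) K)) (x : Matrix (Fin n) (Fin n) K),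
      RookCell x → RookCell ((L.map Matrix.TransvectionStruct.toMatrix).prod * x) := by
    intro L
    induction L with
    | nil => intro x hx; simpa using hx
    | cons t L ih =>
      intro x hx
      rw [List.map_cons, List.prod_cons, mul_assoc]
      exact (ih x hx).trans_mul t.hij t.c
  have h2 : ∀ (L : List (Matrix.TransvectionStruct (Fin n) K)) (x : Matrix (Fin n) (Fin n) K),
      RookCell x → RookCell (x * (L.map Matrix.TransvectionStruct.toMatrix).prod) := by
    intro L
    induction L with
    | nil => intro x hx; simpa using hx
    | cons t L ih =>
      intro x hx
      rw [List.map_cons, List.prod_cons, ← mul_assoc]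
      exact ih _ (hx.mul_trans t.hij t.c)
  exact h2 L' _ (h1 L _ (rookCell_diagonal D))

variable [Finite K]

theorem avg_rookMat_of_leftGood {w v : Equiv.Perm (Fin n)} {k i : ℕ} (h : i + 1 < n)
    (hg : LeftGood w k v ⟨i, by omega⟩ ⟨i + 1, h⟩) :
    rookS K n i * avg (rookMat K w k v) = avg (rookMat K (adjSwap n i * w) k v) := by
  rw [rookS_of_lt h, adjSwap_of_lt h, ← perm_mul_rookMat, avg_swap_mul_of rfl hg.exists_borel]

theorem avg_rookMat_of_rightGood {w v : Equiv.Perm (Fin n)} {k i : ℕ} (h : i + 1 < n)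
    (hg : RightGood w k v ⟨i, by omega⟩ ⟨i + 1, h⟩) :
    avg (rookMat K w k v) * rookS K n i = avg (rookMat K w k (v * adjSwap n i)) := by
  rw [rookS_of_lt h, adjSwap_of_lt h, ← rookMat_mul_perm, avg_mul_swap_of rfl hg.exists_borel]

theorem qRook_induction {P : qRook K n → Prop} (hadd : ∀ x y, P x → P y → P (x + y))
    (hsmul : ∀ (c : ℂ) x, P x → P (c • x)) (h : ∀ m, P (avg m)) (x : qRook K n) : P x := by
  obtain ⟨y, hy⟩ := x.2
  have hx : x = cornerMk K y := qRook_ext hy.symm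
  rw [hx]
  clear hx hy
  induction y using MonoidAlgebra.induction_linear with
  | zero =>
    have : cornerMk K (0 : MatMonoidAlgebra K n) = (0 : ℂ) • avg 1 := qRook_ext (by
      change borelIdem K n * 0 * borelIdem K n = (0 : ℂ) • (avg 1 : qRook K n).1
      rw [mul_zero, zero_mul, zero_smul])
    rw [this]
    exact hsmul _ _ (h 1)
  | add f g hf hg =>
    have : cornerMk K (f + g) = cornerMk K f + cornerMk K g := qRook_ext (by
      change borelIdem K n * (f + g) * borelIdem K n =
        borelIdem K n * f * borelIdem K n + borelIdem K n * g * borelIdem K n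
      rw [mul_add, add_mul])
    rw [this]
    exact hadd _ _ hf hg
  | single m c =>
    have : cornerMk K (MonoidAlgebra.single m c) = c • avg m := qRook_ext (by
      change borelIdem K n * MonoidAlgebra.single m c * borelIdem K n =
        c • (borelIdem K n * matOf m * borelIdem K n)
      have e : (MonoidAlgebra.single m c : MatMonoidAlgebra K n) = c • matOf m := by
        rw [MonoidAlgebra.smul_single, smul_eq_mul, mul_one]
      rw [e, mul_smul_comm, smul_mul_assoc])
    rw [this]
    exact hsmul _ _ (h m)

theorem eq_top_of_avg_rookMat_mem {S : Subalgebra ℂ (qRook K n)}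
    (h : ∀ w v, ∀ k ≤ n, avg (rookMat K w k v) ∈ S) : S = ⊤ := by
  refine eq_top_iff.mpr fun x _ => qRook_induction (P := (· ∈ S)) (fun _ _ => add_mem)
    (fun c _ hx => Subalgebra.smul_mem S hx c) (fun m => ?_) x
  obtain ⟨b, hb, b', hb', w, v, k, hk, rfl⟩ := rookCell m
  rw [avg_mul_borel hb', avg_borel_mul hb]
  exact h w v k hk

end RookGeneration

/-! ### Faithfulness of the action of the model algebra on double cosets -/

section RankFiltration

variable (K : Type) [Field K] [Finite K] (n : ℕ)

/-- The span of the matrices of rank at most `s`. -/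
def rankSpan (s : ℕ) : Submodule ℂ (MatMonoidAlgebra K n) :=
  Submodule.span ℂ (matOf '' {m | m.rank ≤ s})

variable {K n}

/-- Rank does not grow under multiplication, so the filtration consists of two-sided ideals. -/
theorem mul_mem_rankSpan {s : ℕ} {f : MatMonoidAlgebra K n} (hf : f ∈ rankSpan K n s)
    (g : MatMonoidAlgebra K n) : g * f ∈ rankSpan K n s ∧ f * g ∈ rankSpan K n s := by
  induction g using MonoidAlgebra.induction_linear with
  | zero => simp
  | add g h hg hh =>
    rw [mul_add, add_mul]
    exact ⟨add_mem hg.1 hh.1, add_mem hg.2 hh.2⟩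
  | single m c =>
    have e : (MonoidAlgebra.single m c : MatMonoidAlgebra K n) = c • matOf m := by
      rw [MonoidAlgebra.smul_single, smul_eq_mul, mul_one]
    rw [e, smul_mul_assoc, mul_smul_comm]
    suffices matOf m * f ∈ rankSpan K n s ∧ f * matOf m ∈ rankSpan K n s from
      ⟨Submodule.smul_mem _ _ this.1, Submodule.smul_mem _ _ this.2⟩
    induction hf using Submodule.span_induction with
    | mem x hx =>
      obtain ⟨m', hm', rfl⟩ := hx
      rw [matOf_mul, matOf_mul]
      exact ⟨Submodule.subset_span ⟨_, (Matrix.rank_mul_le_right _ _).trans hm', rfl⟩,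
        Submodule.subset_span ⟨_, (Matrix.rank_mul_le_left _ _).trans hm', rfl⟩⟩
    | zero => simp
    | add x y _ _ hx hy =>
      rw [mul_add, add_mul]
      exact ⟨add_mem hx.1 hy.1, add_mem hx.2 hy.2⟩
    | smul c x _ hx =>
      rw [smul_mul_assoc, mul_smul_comm]
      exact ⟨Submodule.smul_mem _ _ hx.1, Submodule.smul_mem _ _ hx.2⟩

theorem coeff_eq_zero_of_mem_rankSpan {s : ℕ} {f : MatMonoidAlgebra K n}
    (hf : f ∈ rankSpan K n s) {m : Matrix (Fin n) (Fin n) K} (hm : s < m.rank) :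
    f.coeff m = 0 := by
  classical
  induction hf using Submodule.span_induction with
  | mem x hx =>
    obtain ⟨m', hm', rfl⟩ := hx
    rw [MonoidAlgebra.coeff_single, Finsupp.single_apply, if_neg]
    rintro rfl
    exact absurd hm' (not_le.mpr hm)
  | zero => rfl
  | add x y _ _ hx hy => rw [MonoidAlgebra.coeff_add, Finsupp.add_apply, hx, hy, add_zero]
  | smul c x _ hx => rw [MonoidAlgebra.coeff_smul, Finsupp.smul_apply, hx, smul_zero]

theorem rank_truncMat {k : ℕ} (hk : k ≤ n) : (truncMat K n k).rank = k := by
  classical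
  rw [truncMat, Matrix.rank_diagonal]
  refine Eq.trans ?_ (Fintype.card_fin_lt_of_le hk)
  refine Fintype.card_congr (Equiv.subtypeEquivRight fun i => ?_)
  simp

theorem rookD_mem_rankSpan {k s : ℕ} (hk : k ≤ n) (h : k ≤ s) :
    qRookVal K n (rookD K n k) ∈ rankSpan K n s := by
  rw [qRookVal_avg]
  refine (mul_mem_rankSpan (mul_mem_rankSpan (Submodule.subset_span ⟨_, ?_, rfl⟩) _).1 _).2
  rw [Set.mem_ofPred_eq, rank_truncMat hk]
  exact h

end RankFiltration

/-! ### Corners of the model and expansion in the standard basis -/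

section Faithful

variable {F : Type*} [Field F] {n : ℕ}

/-- A subspace stable under two-sided multiplication that contains the diagonal idempotent of index
`s` contains the block of index `s`. -/
theorem piSingle_mem_of_modelD_mem {q : F} {s : Fin (n + 1)} (N : Submodule F (Model n q))
    (hN : ∀ x ∈ N, ∀ y, y * x ∈ N ∧ x * y ∈ N) (h : modelD n q s ∈ N)
    (M : Matrix (Sub n s) (Sub n s) (heckeAlg n q s)) : (Pi.single s M : Model n q) ∈ N := by
  set I₀ : Sub n s := initSub (Nat.le_of_lt_succ s.2) with hI₀
  have h0 : (Pi.single s (Matrix.single I₀ I₀ 1) : Model n q) ∈ N := by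
    have := (hN _ h (Pi.single s 1)).1
    rwa [piSingle_mul, one_mul, modelD_apply_self] at this
  have h1 : ∀ I J g, (Pi.single s (Matrix.single I J g) : Model n q) ∈ N := by
    intro I J g
    have := (hN _ (hN _ h0 (Pi.single s (Matrix.single I I₀ g))).1
      (Pi.single s (Matrix.single I₀ J 1))).2
    rwa [← Pi.single_mul, ← Pi.single_mul, Matrix.single_mul_single_same,
      Matrix.single_mul_single_same, mul_one, mul_one] at this
  rw [Matrix.matrix_eq_sum_single M]
  have e : (Pi.single s (∑ i, ∑ j, Matrix.single i j (M i j)) : Model n q) =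
      ∑ i, ∑ j, Pi.single s (Matrix.single i j (M i j)) := by
    let f := AddMonoidHom.single (fun r : Fin (n + 1) =>
      Matrix (Sub n r) (Sub n r) (heckeAlg n q r)) s
    exact (map_sum f _ _).trans (Finset.sum_congr rfl fun i _ => map_sum f _ _)
  rw [e]
  exact sum_mem fun i _ => sum_mem fun j _ => h1 _ _ _

/-- The subalgebra of the model algebra generated by the first Hecke generators. -/
theorem exists_model_hecke (q : F) {r : ℕ} (hr : r ≤ n) :
    ∃ ι : heckeAlg n q r →ₐ[F] Model n q,
      ∀ i, ∀ hi : i + 1 < r, ι ⟨heckeGen n q i, mem_parab hi⟩ = modelT n q i :=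
  HeckeRel.exists_algHom hr ((miraData_model n q).hecke.mono hr)

/-- At the initial subset the first generators multiply the corner by the generators of H_r, so `ι`
restricts there to the regular representation. -/
theorem model_hecke_mul_single {q : F} {r : Fin (n + 1)} {ι : heckeAlg n q r →ₐ[F] Model n q}
    (hι : ∀ i, ∀ hi : i + 1 < (r : ℕ), ι ⟨heckeGen n q i, mem_parab hi⟩ = modelT n q i)
    (y : heckeAlg n q r) :
    ∀ (J : Sub n r) (h : heckeAlg n q r), ι y r * Matrix.single (initSub (Nat.le_of_lt_succ r.2)) J h =
      Matrix.single (initSub (Nat.le_of_lt_succ r.2)) J (y * h) := by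
  classical
  obtain ⟨y, hy⟩ := y
  set I₀ : Sub n r := initSub (Nat.le_of_lt_succ r.2) with hI₀
  suffices ∃ h' : y ∈ heckeAlg n q r, ∀ (J : Sub n r) (h : heckeAlg n q r),
      ι ⟨y, h'⟩ r * Matrix.single I₀ J h = Matrix.single I₀ J (⟨y, h'⟩ * h) from this.2
  refine parab_induction (p := fun y => ∃ h' : y ∈ heckeAlg n q r, ∀ (J : Sub n r) (h : heckeAlg n q r),
      ι ⟨y, h'⟩ r * Matrix.single I₀ J h = Matrix.single I₀ J (⟨y, h'⟩ * h)) ?_ ?_ ?_ ?_ hy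
  · refine ⟨one_mem _, fun J h => ?_⟩
    have : ι ⟨1, one_mem _⟩ = 1 := map_one ι
    rw [this, Pi.one_apply, one_mul]
    exact congrArg _ (one_mul h).symm
  · rintro a b ⟨ha, ha'⟩ ⟨hb, hb'⟩
    refine ⟨add_mem ha hb, fun J h => ?_⟩
    have : ι ⟨a + b, add_mem ha hb⟩ = ι ⟨a, ha⟩ + ι ⟨b, hb⟩ := map_add ι ⟨a, ha⟩ ⟨b, hb⟩
    rw [this, Pi.add_apply, add_mul, ha', hb', ← Matrix.single_add, ← add_mul]
    rfl
  · rintro c a ⟨ha, ha'⟩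
    refine ⟨Subalgebra.smul_mem _ ha c, fun J h => ?_⟩
    have : ι ⟨c • a, Subalgebra.smul_mem _ ha c⟩ = c • ι ⟨a, ha⟩ := map_smul ι c ⟨a, ha⟩
    rw [this, Pi.smul_apply, smul_mul_assoc, ha', Matrix.smul_single, ← smul_mul_assoc]
    rfl
  · rintro i hi a - ⟨ha, ha'⟩
    refine ⟨mul_mem (mem_parab hi) ha, fun J h => ?_⟩
    have : ι ⟨heckeGen n q i * a, mul_mem (mem_parab hi) ha⟩ =
        ι ⟨heckeGen n q i, mem_parab hi⟩ * ι ⟨a, ha⟩ := map_mul ι ⟨_, mem_parab hi⟩ ⟨_, ha⟩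
    have hr := Nat.le_of_lt_succ r.2
    rw [this, hι i hi, Pi.mul_apply, mul_assoc, ha', modelT,
      subGen_mul_single_both (by omega) (mem_initSub.mpr (by omega)) (mem_initSub.mpr hi),
      rankBelow_initSub hr (by omega), hGen_of_lt q hi, ← mul_assoc]
    rfl

theorem heckeAlg_algHom_ext {q : F} {k : ℕ} {D : Type*} [Ring D] [Algebra F D]
    {φ ψ : heckeAlg n q k →ₐ[F] D} (h : ∀ i, ∀ hi : i + 1 < k,
      φ ⟨heckeGen n q i, mem_parab hi⟩ = ψ ⟨heckeGen n q i, mem_parab hi⟩) : φ = ψ := by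
  ext ⟨y, hy⟩
  suffices ∃ h' : y ∈ heckeAlg n q k, φ ⟨y, h'⟩ = ψ ⟨y, h'⟩ from this.2
  refine parab_induction (p := fun y => ∃ h' : y ∈ heckeAlg n q k, φ ⟨y, h'⟩ = ψ ⟨y, h'⟩)
    ?_ ?_ ?_ ?_ hy
  · exact ⟨one_mem _, (map_one φ).trans (map_one ψ).symm⟩
  · rintro a b ⟨ha, ha'⟩ ⟨hb, hb'⟩
    exact ⟨add_mem ha hb, (map_add φ ⟨a, ha⟩ ⟨b, hb⟩).trans
      (by rw [ha', hb']; exact (map_add ψ ⟨a, ha⟩ ⟨b, hb⟩).symm)⟩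
  · rintro c a ⟨ha, ha'⟩
    exact ⟨Subalgebra.smul_mem _ ha c, (map_smul φ c ⟨a, ha⟩).trans
      (by rw [ha']; exact (map_smul ψ c ⟨a, ha⟩).symm)⟩
  · rintro i hi a - ⟨ha, ha'⟩
    exact ⟨mul_mem (mem_parab hi) ha, 
      (map_mul φ ⟨heckeGen n q i, mem_parab hi⟩ ⟨a, ha⟩).trans (by
        rw [ha', h i hi]; exact (map_mul ψ ⟨heckeGen n q i, mem_parab hi⟩ ⟨a, ha⟩).symm)⟩

/-- The involution `t ↦ (q - 1) - t` of the Hecke algebra. -/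
theorem exists_hecke_dual (q : F) {k : ℕ} (hk : k ≤ n) :
    ∃ α : heckeAlg n q k →ₐ[F] heckeAlg n q k, (∀ y, α (α y) = y) ∧
      ∀ i, ∀ hi : i + 1 < k, α ⟨heckeGen n q i, mem_parab hi⟩ =
        (q - 1) • 1 - ⟨heckeGen n q i, mem_parab hi⟩ := by
  obtain ⟨α, hα⟩ := HeckeRel.exists_algHom hk (heckeRel_hGen q hk).dual
  have hα' : ∀ i, ∀ hi : i + 1 < k, α ⟨heckeGen n q i, mem_parab hi⟩ =
        (q - 1) • 1 - ⟨heckeGen n q i, mem_parab hi⟩ := fun i hi => by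
    rw [hα i hi, hGen_of_lt q hi]
  refine ⟨α, fun y => ?_, hα'⟩
  have : α.comp α = AlgHom.id F _ := heckeAlg_algHom_ext fun i hi => by
    rw [AlgHom.comp_apply, hα' i hi, map_sub, map_smul, map_one, hα' i hi, AlgHom.id_apply,
      sub_sub_cancel]
  exact congrArg (fun f : heckeAlg n q k →ₐ[F] heckeAlg n q k => f y) this

/-- Expansion of a representation of the Hecke algebra in the standard basis. -/
theorem hecke_expansion {q κ : F} (hκ : κ ≠ 0) {k : ℕ} (hk : k ≤ n) {D : Type*} [Ring D]
    [Algebra F D] {β : heckeAlg n q k →ₐ[F] D} {a : Equiv.Perm (Fin n) → D} (h1 : a 1 = 1)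
    (hs : ∀ (σ : Equiv.Perm (Fin n)) (i : ℕ) (hi : i + 1 < k), FixesFrom k σ →
      σ ⟨i, by omega⟩ < σ ⟨i + 1, by omega⟩ → β ⟨heckeGen n q i, mem_parab hi⟩ * a σ =
        κ • a (σ * Equiv.swap ⟨i, by omega⟩ ⟨i + 1, by omega⟩)) :
    ∃ c : Equiv.Perm (Fin n) → F, (∀ σ, c σ ≠ 0) ∧ ∀ y : heckeAlg n q k,
      (∀ σ : Equiv.Perm (Fin n), ¬FixesFrom k σ → y.1 σ id = 0) ∧
        β y = ∑ σ : Equiv.Perm (Fin n), (y.1 σ id * c σ) • a σ := by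
  classical
  -- Standard basis elements are built along ascents. At each ascent the image gains one factor κ,
  -- so the constants `c` are nonzero.
  have key : ∀ σ : Equiv.Perm (Fin n), ∃ (Y : heckeAlg n q k) (c : F), c ≠ 0 ∧ (FixesFrom k σ →
      Y.1.mulVec (wd F id) = wd F σ ∧ β Y = c • a σ) := by
    intro σ
    by_cases hσ : FixesFrom k σ
    · refine ascent_induction hk (P := fun σ => ∃ (Y : heckeAlg n q k) (c : F), c ≠ 0 ∧
        (FixesFrom k σ → Y.1.mulVec (wd F id) = wd F σ ∧ β Y = c • a σ)) ?_ ?_ σ hσ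
      · exact ⟨1, 1, one_ne_zero, fun _ => ⟨by simp, by rw [map_one, h1, one_smul]⟩⟩
      · rintro σ i hi hf hlt ⟨Y, c, hc, h⟩
        obtain ⟨hY, hβ⟩ := h hf
        refine ⟨⟨heckeGen n q i, mem_parab hi⟩ * Y, c * κ, mul_ne_zero hc hκ, fun _ => ⟨?_, ?_⟩⟩
        · rw [Subalgebra.coe_mul, ← Matrix.mulVec_mulVec, hY]
          refine Eq.trans ?_ (swapMat_lt (q := q) hlt)
          rw [← heckeGen_of_lt q (show i + 1 < n by omega)]
          rfl
        · rw [map_mul, hβ, mul_smul_comm, hs σ i hi hf hlt, smul_smul]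
    · exact ⟨0, 1, one_ne_zero, fun h => absurd h hσ⟩
  choose Y c hc hY using key
  refine ⟨c, hc, fun y => ?_⟩
  have hz : ∀ σ : Equiv.Perm (Fin n), ¬FixesFrom k σ → y.1 σ id = 0 := by
    intro σ hσ
    by_contra h
    obtain ⟨τ, hτ, e⟩ := exists_perm_of_apply_ne_zero hk y.2 h
    have : σ = τ := Equiv.ext fun p => congrFun e p
    exact hσ (this ▸ hτ)
  refine ⟨hz, ?_⟩
  -- Both sides have the same value on the identity word, and evaluation at that word is injective.
  have e : y = ∑ σ : Equiv.Perm (Fin n), y.1 σ id • Y σ := by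
    refine (finrank_heckeAlg_aux q hk).2 ?_
    rw [map_sum]
    ext b
    rw [evalId_apply, mulVec_wd, Finset.sum_apply]
    have e1 : ∀ σ : Equiv.Perm (Fin n), evalId q k (y.1 σ id • Y σ) b =
        if b = σ then y.1 b id else 0 := by
      intro σ
      rw [map_smul, Pi.smul_apply, evalId_apply]
      by_cases hσ : FixesFrom k σ
      · rw [(hY σ hσ).1]
        by_cases hb : b = σ
        · simp [hb, wd]
        · simp [hb, wd]
      · rw [hz σ hσ, zero_smul]
        split_ifs with hb
        · rw [hb, hz σ hσ]
        · rfl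
    rw [Finset.sum_congr rfl fun σ _ => e1 σ]
    by_cases hb : y.1 b id = 0
    · simp [hb]
    · obtain ⟨τ, hτ, e⟩ := exists_perm_of_apply_ne_zero hk y.2 hb
      have hbτ : b = τ := e
      rw [Finset.sum_eq_single τ, if_pos hbτ]
      · intro σ _ hσ
        rw [if_neg]
        intro h
        exact hσ (Equiv.ext fun p => congrFun (h.symm.trans hbτ) p)
      · simp
  conv_lhs => rw [e]
  rw [map_sum]
  refine Finset.sum_congr rfl fun σ _ => ?_
  rw [map_smul]
  by_cases hσ : FixesFrom k σ
  · rw [(hY σ hσ).2, smul_smul]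
  · rw [hz σ hσ, zero_smul, zero_mul, zero_smul]

end Faithful

/-! ### Injectivity of the map to the double coset algebra -/

section RookFaithful

variable {K : Type} [Field K] [Finite K] {n : ℕ}

open Classical in
theorem coeff_avg (m m' : Matrix (Fin n) (Fin n) K) :
    (qRookVal K n (avg m)).coeff m' = (Fintype.card (borel K n) : ℂ)⁻¹ *
      ((Fintype.card (borel K n) : ℂ)⁻¹ *
        ∑ b : borel K n, ∑ b' : borel K n, if b.1.val * m * b'.1.val = m' then 1 else 0) := by
  rw [qRookVal_avg, borelIdem, smul_mul_assoc, smul_mul_smul_comm, Finset.sum_mul,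
    Finset.sum_mul_sum, ← smul_smul, MonoidAlgebra.coeff_smul, MonoidAlgebra.coeff_smul,
    Finsupp.smul_apply, Finsupp.smul_apply, smul_eq_mul, smul_eq_mul, MonoidAlgebra.coeff_sum,
    Finsupp.finsetSum_apply]
  congr 2
  refine Finset.sum_congr rfl fun b _ => ?_
  rw [MonoidAlgebra.coeff_sum, Finsupp.finsetSum_apply]
  refine Finset.sum_congr rfl fun b' _ => ?_
  rw [matOf_mul, matOf_mul, MonoidAlgebra.coeff_single, Finsupp.single_apply]

theorem coeff_avg_self_ne_zero (m : Matrix (Fin n) (Fin n) K) :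
    (qRookVal K n (avg m)).coeff m ≠ 0 := by
  classical
  have hB : (Fintype.card (borel K n) : ℂ)⁻¹ ≠ 0 :=
    inv_ne_zero (by exact_mod_cast Fintype.card_ne_zero)
  rw [coeff_avg]
  refine mul_ne_zero hB (mul_ne_zero hB ?_)
  have : (∑ b : borel K n, ∑ b' : borel K n,
      if b.1.val * m * b'.1.val = m then (1 : ℂ) else 0) =
      ((∑ b : borel K n, ∑ b' : borel K n, if b.1.val * m * b'.1.val = m then 1 else 0 : ℕ) : ℂ) := by
    push_cast
    rfl
  rw [this]
  refine Nat.cast_ne_zero.mpr fun h => ?_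
  have h1 := (Finset.sum_eq_zero_iff.mp h) 1 (Finset.mem_univ _)
  have h2 := (Finset.sum_eq_zero_iff.mp h1) 1 (Finset.mem_univ _)
  simp at h2

theorem perm_eq_one_of_le {w : Equiv.Perm (Fin n)} (h : ∀ j, w j ≤ j) : w = 1 := by
  have hsum : ∑ j, ((w j : Fin n) : ℕ) = ∑ j : Fin n, (j : ℕ) :=
    Equiv.sum_comp w fun j => (j : ℕ)
  have := (Finset.sum_eq_sum_iff_of_le fun j _ => Fin.le_def.mp (h j)).mp hsum
  exact Equiv.ext fun j => Fin.ext (this j (Finset.mem_univ j))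

/-- If d_r belonged to the double coset, comparing entries at `(w j, j)` for j < r would force `w j
≤ j`, since a diagonal entry of a Borel element is nonzero. Then `w` would be the identity. -/
theorem coeff_avg_perm_mul_truncMat {w : Equiv.Perm (Fin n)} {r : ℕ} (hw : FixesFrom r w)
    (hne : w ≠ 1) : (qRookVal K n (avg ((permGL K w).val * truncMat K n r))).coeff
      (truncMat K n r) = 0 := by
  classical
  rw [coeff_avg, Finset.sum_eq_zero, mul_zero, mul_zero]
  refine fun b _ => Finset.sum_eq_zero fun b' _ => if_neg fun h => hne (perm_eq_one_of_le fun j => ?_)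
  by_cases hj : (j : ℕ) < r
  · have e : (permGL K w).val * (truncMat K n r * b'.1.val) = b.1⁻¹.val * truncMat K n r := by
      conv_rhs => rw [← h]
      simp only [← mul_assoc]
      rw [← Units.val_mul b.1⁻¹, inv_mul_cancel, Units.val_one, one_mul]
    have e1 := congrFun (congrFun e (w j)) j
    rw [perm_mul_apply, Equiv.symm_apply_apply, truncMat_mul_apply, if_pos hj, mul_truncMat_apply,
      if_pos hj] at e1
    by_contra hlt
    rw [inv_mem b.2 _ _ (not_le.mp hlt)] at e1
    exact borel_diag_ne_zero b'.2 j e1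
  · exact (hw j (not_lt.mp hj)).le

theorem FixesFrom.inv {k : ℕ} {σ : Equiv.Perm (Fin n)} (h : FixesFrom k σ) : FixesFrom k σ⁻¹ :=
  fun p hp => by rw [Equiv.Perm.inv_eq_iff_eq]; exact (h p hp).symm

/-- The model algebra acts faithfully: a homomorphism to the double coset algebra with the
standard values on generators is injective. -/
theorem injective_of_rook (φ : Model n (cardC K) →ₐ[ℂ] qRook K n)
    (hT : ∀ i, i + 1 < n → φ (modelT n (cardC K) i) = (cardC K - 1) • 1 - cardC K • rookS K n i)
    (hD : ∀ k ≤ n, φ (modelD n (cardC K) k) = rookD K n k) : Function.Injective φ := by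
  classical
  rw [injective_iff_map_eq_zero]
  intro x hx
  by_contra hne
  have hq : cardC K ≠ 0 := cardC_ne_zero
  obtain ⟨r, y, hy, hφ⟩ := exists_corner_mem hq φ hne hx
  have hr : (r : ℕ) ≤ n := Nat.le_of_lt_succ r.2
  set I₀ : Sub n r := initSub hr with hI₀
  obtain ⟨ι, hι⟩ := exists_model_hecke (n := n) (cardC K) hr
  obtain ⟨α, hαα, hα⟩ := exists_hecke_dual (n := n) (cardC K) hr
  -- The generators act through the involution `α`, so the expansion below applies to `α z`.
  -- Nondegeneracy is used again, to find a `z` with nonzero canonical trace while `α z` stays in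
  -- the left ideal generated by `y`.
  obtain ⟨z', hz', hz⟩ : ∃ z' ∈ heckeAlg n (cardC K) r, (z' * (α y).1) id id ≠ 0 := by
    by_contra hc
    push Not at hc
    have h0 : α y = 0 := Subtype.ext (eq_zero_of_mul_id_id hq hr (α y).2 hc)
    have h1 : y = 0 := by rw [← hαα y, h0, map_zero]
    rw [h1] at hy
    exact hy rfl
  set z : heckeAlg n (cardC K) r := ⟨z', hz'⟩ * α y with hzdef
  have hαz : α z = α ⟨z', hz'⟩ * y := by rw [hzdef, map_mul, hαα]
  have hφz : φ (Pi.single r (Matrix.single I₀ I₀ (α z))) = 0 := by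
    have : (Pi.single r (Matrix.single I₀ I₀ (α z)) : Model n (cardC K)) =
        Pi.single r (Matrix.single I₀ I₀ (α ⟨z', hz'⟩)) * Pi.single r (Matrix.single I₀ I₀ y) := by
      rw [← Pi.single_mul, Matrix.single_mul_single_same, hαz]
    rw [this, map_mul, hφ, mul_zero]
  -- Blocks below r only produce matrices of rank less than r, and blocks above r are annihilated by
  -- d_r. Hence only block r can contribute to the coefficient of d_r.
  have hcoeff : ∀ s : Fin (n + 1), s ≠ r →
      (qRookVal K n (φ (Pi.single s ((ι (α z) * modelD n (cardC K) r) s)))).coeff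
        (truncMat K n r) = 0 := by
    intro s hs
    rcases lt_or_gt_of_ne hs with hlt | hgt
    · let N : Submodule ℂ (Model n (cardC K)) :=
        (rankSpan K n s).comap ((qRookVal K n).comp φ.toLinearMap)
      have hN : ∀ x, x ∈ N ↔ qRookVal K n (φ x) ∈ rankSpan K n s := fun x => Iff.rfl
      refine coeff_eq_zero_of_mem_rankSpan (s := s) ((hN _).mp ?_)
        (by rw [rank_truncMat hr]; exact hlt)
      refine piSingle_mem_of_modelD_mem N (fun x hx y => ?_) ?_ _
      · rw [hN, hN, map_mul φ, map_mul φ, qRookVal_mul, qRookVal_mul]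
        exact mul_mem_rankSpan ((hN x).mp hx) _
      · rw [hN, hD s (by omega)]
        exact rookD_mem_rankSpan (by omega) le_rfl
    · rw [Pi.mul_apply, modelD_apply_of_lt _ hgt, mul_zero, Pi.single_zero, map_zero, map_zero]
      rfl
  have hself : (Pi.single r ((ι (α z) * modelD n (cardC K) r) r) : Model n (cardC K)) =
      Pi.single r (Matrix.single I₀ I₀ (α z)) := by
    rw [Pi.mul_apply, modelD_apply_self, model_hecke_mul_single hι, mul_one]
  have htot : (qRookVal K n (φ (ι (α z)) * rookD K n r)).coeff (truncMat K n r) = 0 := by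
    rw [← hD r hr, ← map_mul, ← Finset.univ_sum_single (ι (α z) * modelD n (cardC K) r), map_sum,
      map_sum, MonoidAlgebra.coeff_sum, Finsupp.finsetSum_apply]
    refine Finset.sum_eq_zero fun s _ => ?_
    by_cases hs : s = r
    · subst hs
      rw [hself, hφz, map_zero]
      rfl
    · exact hcoeff s hs
  obtain ⟨c, hc, hexp⟩ := hecke_expansion hq hr (β := φ.comp (ι.comp α))
    (a := fun σ => avg (permGL K σ⁻¹).val) (by rw [inv_one, permGL_one, Units.val_one, avg_one])
    (fun σ i hi hf hlt => by
      have hin : i + 1 < n := by omega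
      rw [AlgHom.comp_apply, AlgHom.comp_apply, hα i hi, map_sub, map_sub, map_smul, map_smul,
        map_one, map_one, hι i hi, hT i hin, sub_sub_cancel, rookS_of_lt hin, smul_mul_assoc,
        avg_swap_mul_perm rfl hlt, mul_inv_rev, Equiv.swap_inv])
  have hz0 := (hexp z).1
  have hz1 : φ (ι (α z)) = _ := (hexp z).2
  -- In the standard expansion only the identity permutation contributes to the coefficient of d_r.
  -- The contribution is the canonical trace of `z` times nonzero factors.
  rw [hz1, Finset.sum_mul, map_sum, MonoidAlgebra.coeff_sum, Finsupp.finsetSum_apply,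
    Finset.sum_eq_single 1] at htot
  · rw [smul_mul_assoc, avg_mul_truncMat, map_smul, MonoidAlgebra.coeff_smul, Finsupp.smul_apply,
      inv_one, permGL_one, Units.val_one, one_mul, smul_eq_mul] at htot
    exact mul_ne_zero (mul_ne_zero hz (hc 1)) (coeff_avg_self_ne_zero _) htot
  · intro σ _ hσ
    rw [smul_mul_assoc, avg_mul_truncMat, map_smul, MonoidAlgebra.coeff_smul, Finsupp.smul_apply]
    by_cases hf : FixesFrom r σ
    · rw [coeff_avg_perm_mul_truncMat hf.inv (inv_ne_one.mpr hσ), smul_zero]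
    · rw [hz0 σ hf, zero_mul, zero_smul]
  · simp

end RookFaithful

/-! ## The convolution algebra of flags and vectors -/

section Lines

variable {K : Type} [Field K] {n : ℕ}

/-- The group element of a vector. -/
abbrev ofVec (v : Fin n → K) : AddMonoidAlgebra ℂ (Fin n → K) := AddMonoidAlgebra.single v 1

theorem ofVec_mul (v w : Fin n → K) : ofVec v * ofVec w = ofVec (v + w) := by
  rw [AddMonoidAlgebra.single_mul_single, one_mul]

theorem ofVec_zero : ofVec (0 : Fin n → K) = 1 := rfl

theorem actVec_inv_mul (g h : GL (Fin n) K) (v : Fin n → K) :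
    actVec (g * h)⁻¹ v = actVec h⁻¹ (actVec g⁻¹ v) := by
  rw [mul_inv_rev, actVec, Units.val_mul, ← Matrix.mulVec_mulVec]

/-- A vector is supported on the index set `D`. -/
def SuppIn (D : Finset (Fin n)) (v : Fin n → K) : Prop := ∀ j ∉ D, v j = 0

variable [Fintype K]

/-- The average of the multiples of a vector. -/
def lineIdem (v : Fin n → K) : AddMonoidAlgebra ℂ (Fin n → K) :=
  (cardC K)⁻¹ • ∑ c : K, ofVec (c • v)

theorem sum_shift_const {E : Type*} [AddCommGroup E] [Module ℂ E] (f : K → K → E) (h : K → E)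
    (hf : ∀ c, ∑ d, f c d = ∑ d, h d) : ∑ c, ∑ d, f c d = cardC K • ∑ d, h d := by
  rw [Finset.sum_congr rfl fun c _ => hf c, Finset.sum_const, Finset.card_univ,
    ← Nat.cast_smul_eq_nsmul ℂ, ← Nat.card_eq_fintype_card]

theorem lineIdem_mul_self (v : Fin n → K) : lineIdem v * lineIdem v = lineIdem v := by
  have h0 : cardC K ≠ 0 := cardC_ne_zero
  rw [lineIdem, smul_mul_smul_comm, Finset.sum_mul_sum, sum_shift_const _ fun d => ofVec (d • v),
    smul_smul, mul_assoc, inv_mul_cancel₀ h0, mul_one]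
  intro c
  simp only [ofVec_mul, ← add_smul]
  exact Equiv.sum_comp (Equiv.addLeft c) fun d => ofVec (d • v)

/-- The sum of the idempotents of the lines in a plane. -/
theorem lineIdem_pencil (x y : Fin n → K) :
    lineIdem x + ∑ u : K, lineIdem (y + u • x) = 1 + cardC K • (lineIdem x * lineIdem y) := by
  classical
  have h0 : cardC K ≠ 0 := cardC_ne_zero
  -- For c ≠ 0 the substitution u ↦ cu lets c multiply only `y`, so the lines of the pencil together
  -- sweep out the plane. The terms with c = 0 are counted separately.
  have e1 : ∀ c : K, ∑ u : K, ofVec (c • (y + u • x)) =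
      if c = 0 then cardC K • 1 else ∑ u : K, ofVec (c • y + u • x) := by
    intro c
    split_ifs with hc
    · rw [hc]
      simp only [zero_smul, ofVec_zero]
      rw [Finset.sum_const, Finset.card_univ, ← Nat.cast_smul_eq_nsmul ℂ,
        ← Nat.card_eq_fintype_card]
    · rw [← Equiv.sum_comp (Equiv.mulLeft₀ c hc) fun u => ofVec (c • y + u • x)]
      simp [smul_add, smul_smul]
  have e2 : ∑ u : K, lineIdem (y + u • x) = (cardC K)⁻¹ •
      (cardC K • 1 + ∑ c ∈ Finset.univ.erase (0 : K), ∑ u : K, ofVec (c • y + u • x)) := by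
    simp only [lineIdem]
    rw [← Finset.smul_sum, Finset.sum_comm, ← Finset.add_sum_erase _ _ (Finset.mem_univ 0),
      e1, if_pos rfl, Finset.sum_congr rfl fun c hc => (e1 c).trans
        (if_neg (Finset.ne_of_mem_erase hc))]
  have e3 : cardC K • (lineIdem x * lineIdem y) = (cardC K)⁻¹ •
      ∑ c : K, ∑ u : K, ofVec (c • y + u • x) := by
    rw [mul_comm (lineIdem x), lineIdem, lineIdem, smul_mul_smul_comm, smul_smul, ← mul_assoc,
      mul_inv_cancel₀ h0, one_mul, Finset.sum_mul_sum]
    simp only [ofVec_mul]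
  rw [e3, e2, ← Finset.add_sum_erase _ _ (Finset.mem_univ (0 : K)), smul_add, smul_add,
    inv_smul_smul₀ h0, lineIdem]
  simp only [zero_smul, zero_add]
  abel

theorem lineIdem_coeff_mul (w : Fin n → K) (f : AddMonoidAlgebra ℂ (Fin n → K)) (v : Fin n → K) :
    (lineIdem w * f).coeff v = (cardC K)⁻¹ * ∑ c : K, f.coeff (v - c • w) := by
  rw [lineIdem, smul_mul_assoc, AddMonoidAlgebra.coeff_smul, Finsupp.smul_apply, smul_eq_mul,
    Finset.sum_mul, AddMonoidAlgebra.coeff_sum, Finsupp.finsetSum_apply]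
  congr 1
  refine Finset.sum_congr rfl fun c _ => ?_
  rw [AddMonoidAlgebra.coeff_single_mul_apply, one_mul, sub_eq_neg_add]

/-- The average of the subspace spanned by the columns of `g` with indices in `D`. -/
def subIdem (g : GL (Fin n) K) (D : Finset (Fin n)) : AddMonoidAlgebra ℂ (Fin n → K) :=
  ∏ j ∈ D, lineIdem fun k => g.val k j

theorem subIdem_mul (g : GL (Fin n) K) (D D' : Finset (Fin n)) :
    subIdem g D * subIdem g D' = subIdem g (D ∪ D') := by
  have h : ∀ D : Finset (Fin n), subIdem g D * subIdem g D = subIdem g D := fun D => by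
    rw [subIdem, ← Finset.prod_mul_distrib]
    exact Finset.prod_congr rfl fun j _ => lineIdem_mul_self _
  have hu : ∀ D D' : Finset (Fin n), Disjoint D D' →
      subIdem g (D ∪ D') = subIdem g D * subIdem g D' := fun D D' h => Finset.prod_union h
  have e1 : D ∪ D' = D ∪ (D' \ D) := Finset.union_sdiff_self_eq_union.symm
  have e2 : subIdem g D' = subIdem g (D' \ D) * subIdem g (D' ∩ D) := by
    rw [← hu _ _ (Finset.disjoint_sdiff_inter D' D), Finset.sdiff_union_inter]
  have e3 : subIdem g D = subIdem g (D \ D') * subIdem g (D' ∩ D) := by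
    rw [Finset.inter_comm, ← hu _ _ (Finset.disjoint_sdiff_inter D D'), Finset.sdiff_union_inter]
  rw [e1, hu _ _ Finset.disjoint_sdiff, e2, e3]
  calc _ = subIdem g (D \ D') * (subIdem g (D' ∩ D) * subIdem g (D' ∩ D)) *
        subIdem g (D' \ D) := by ring
    _ = _ := by rw [h]

-- A product of line averages is the uniform measure on the span. When a column is added, exactly
-- one multiple of it can bring the vector back into the smaller span, namely the one given by the
-- coordinate.
open Classical in
theorem subIdem_coeff (g : GL (Fin n) K) (D : Finset (Fin n)) (v : Fin n → K) :
    (subIdem g D).coeff v =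
      if SuppIn D (actVec g⁻¹ v) then ((cardC K)⁻¹) ^ D.card else 0 := by
  have hinv : ∀ j c, actVec g⁻¹ (c • fun k => g.val k j) = Pi.single j c := by
    intro j c
    have : (c • fun k => g.val k j) = g.val.mulVec (Pi.single j c) := by
      ext k; simp [mul_comm]
    rw [this, actVec, Matrix.mulVec_mulVec, ← Units.val_mul, inv_mul_cancel, Units.val_one,
      Matrix.one_mulVec]
  induction D using Finset.induction_on generalizing v with
  | empty =>
    rw [subIdem, Finset.prod_empty, Finset.card_empty, pow_zero, AddMonoidAlgebra.one_def,
      AddMonoidAlgebra.coeff_single, Finsupp.single_apply]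
    congr 1
    refine propext ⟨fun h => ?_, fun h => ?_⟩
    · rw [← h]; intro j _; simp
    · have h1 : actVec g⁻¹ v = 0 := funext fun j => h j (by simp)
      have h2 := congrArg (actVec g) h1
      simpa [Matrix.mulVec_mulVec] using h2.symm
  | insert a D ha ih =>
    rw [subIdem, Finset.prod_insert ha, ← subIdem, lineIdem_coeff_mul, Finset.card_insert_of_notMem ha,
      pow_succ']
    simp only [ih]
    have key : ∀ c, SuppIn D (actVec g⁻¹ (v - c • fun k => g.val k a)) ↔
        SuppIn (insert a D) (actVec g⁻¹ v) ∧ c = actVec g⁻¹ v a := by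
      intro c
      rw [actVec, Matrix.mulVec_sub, ← actVec, ← actVec, hinv]
      constructor
      · intro h
        refine ⟨fun j hj => ?_, ?_⟩
        · rw [Finset.mem_insert, not_or] at hj
          have := h j hj.2
          rwa [Pi.sub_apply, Pi.single_eq_of_ne hj.1, sub_zero] at this
        · have := h a ha
          rw [Pi.sub_apply, Pi.single_eq_same, sub_eq_zero] at this
          exact this.symm
      · rintro ⟨h1, h2⟩ j hj
        by_cases hja : j = a
        · subst hja
          rw [Pi.sub_apply, Pi.single_eq_same, h2, sub_self]
        · rw [Pi.sub_apply, Pi.single_eq_of_ne hja, sub_zero]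
          exact h1 j (by simp [hja, hj])
    simp only [key]
    by_cases h : SuppIn (insert a D) (actVec g⁻¹ v)
    · simp [h]
    · simp [h]

/-- The average depends only on the subspace spanned. This makes averages over terms of a flag
independent of the representing matrix. -/
theorem subIdem_mul_right {g p : GL (Fin n) K} {D D' : Finset (Fin n)} (hc : D.card = D'.card)
    (h : ∀ v, SuppIn D (actVec p⁻¹ v) ↔ SuppIn D' v) : subIdem (g * p) D = subIdem g D' := by
  classical
  refine AddMonoidAlgebra.ext (Finsupp.ext fun v => ?_)
  rw [subIdem_coeff, subIdem_coeff, actVec_inv_mul, hc]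
  simp only [h]

end Lines

/-! ### Supports of vectors under Borel elements and permutations -/

section SuppAction

variable {K : Type} [Field K] {n : ℕ}

theorem SuppIn.actVec_borel {k : ℕ} {D : Finset (Fin n)} (hD : ∀ j, j ∈ D ↔ (j : ℕ) < k)
    {b : GL (Fin n) K} (hb : b ∈ borel K n) {v : Fin n → K} (hv : SuppIn D v) :
    SuppIn D (actVec b v) := by
  intro i hi
  rw [actVec, Matrix.mulVec, dotProduct]
  refine Finset.sum_eq_zero fun j _ => ?_
  by_cases hj : j ∈ D
  · rw [hD] at hi hj
    rw [hb i j (by rw [Fin.lt_def]; omega), zero_mul]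
  · rw [hv j hj, mul_zero]

theorem suppIn_borel_iff {k : ℕ} {D : Finset (Fin n)} (hD : ∀ j, j ∈ D ↔ (j : ℕ) < k)
    {b : GL (Fin n) K} (hb : b ∈ borel K n) (v : Fin n → K) :
    SuppIn D (actVec b⁻¹ v) ↔ SuppIn D v := by
  refine ⟨fun h => ?_, fun h => h.actVec_borel hD (inv_mem hb)⟩
  have := h.actVec_borel hD hb
  simpa [Matrix.mulVec_mulVec] using this

theorem actVec_perm (w : Equiv.Perm (Fin n)) (v : Fin n → K) (i : Fin n) :
    actVec (permGL K w) v i = v (w.symm i) := by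
  rw [actVec, Matrix.mulVec, dotProduct, Finset.sum_eq_single (w.symm i)]
  · simp [permGL]
  · intro j _ hj
    have : ¬i = w j := fun h => hj (by rw [h, Equiv.symm_apply_apply])
    simp [permGL, this]
  · simp

theorem suppIn_perm_iff (w : Equiv.Perm (Fin n)) (D : Finset (Fin n)) (v : Fin n → K) :
    SuppIn D (actVec (permGL K w)⁻¹ v) ↔ SuppIn (D.map w.toEmbedding) v := by
  rw [permGL_inv]
  constructor
  · intro h j hj
    have := h (w.symm j) (fun h' => hj (by
      rw [Finset.mem_map_equiv]; exact h'))
    rw [actVec_perm] at this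
    change v (w (w.symm j)) = 0 at this
    rwa [Equiv.apply_symm_apply] at this
  · intro h j hj
    rw [actVec_perm]
    refine h _ (fun h' => hj ?_)
    rw [Finset.mem_map_equiv] at h'
    change w.symm (w j) ∈ D at h'
    rwa [Equiv.symm_apply_apply] at h'

/-- The set of the first `k` indices. -/
def initFin (n k : ℕ) : Finset (Fin n) := Finset.univ.filter fun j => (j : ℕ) < k

theorem mem_initFin {k : ℕ} {j : Fin n} : j ∈ initFin n k ↔ (j : ℕ) < k := by simp [initFin]

theorem initFin_map_swap {x y : Fin n} (hxy : (y : ℕ) = x + 1) {k : ℕ} (hk : (x : ℕ) + 1 ≠ k) :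
    (initFin n k).map (Equiv.swap x y).toEmbedding = initFin n k := by
  ext j
  rw [Finset.mem_map_equiv, Equiv.symm_swap, mem_initFin, mem_initFin, Equiv.swap_apply_def]
  split_ifs with h1 h2
  · subst h1; omega
  · subst h2; omega
  · rfl

theorem swap_trans_swap_inv {x y : Fin n} (hxy : (y : ℕ) = x + 1) {c : K} (hc : c ≠ 0) :
    ∃ b ∈ borel K n,
      permGL K (Equiv.swap x y) * transGL (ne_of_succ hxy) c * permGL K (Equiv.swap x y) =
        transGL (ne_of_succ hxy) c⁻¹ * permGL K (Equiv.swap x y) * b := by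
  have hne := ne_of_succ hxy
  obtain ⟨u, b, hb, e⟩ := swap_trans_swap hxy hc
  have hu : u = c⁻¹ := by
    have e1 := congrFun (congrFun (val_eq_of_eq e) y) x
    have e2 := congrFun (congrFun (val_eq_of_eq e) x) x
    simp only [Units.val_mul, mul_assoc, perm_mul_apply, trans_mul_apply, Equiv.symm_swap,
      Equiv.swap_apply_left, Equiv.swap_apply_right, coe_transGL, hb _ _ (lt_of_succ hxy)] at e1 e2
    simp [permGL, hne, hne.symm] at e1 e2
    rw [← e1] at e2
    exact eq_inv_of_mul_eq_one_left e2.symm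
  exact ⟨b, hb, hu ▸ e⟩

end SuppAction

/-! ### Adjacent flags and characteristic functions of span sets -/

section FlagMatrices

variable {K : Type} [Field K] {n : ℕ}

theorem flag_eq_iff {g h : GL (Fin n) K} :
    (g : Flags K n) = (h : Flags K n) ↔ ∃ b ∈ borel K n, h = g * b := by
  rw [QuotientGroup.eq]
  exact ⟨fun hb => ⟨_, hb, by group⟩, by rintro ⟨b, hb, rfl⟩; simpa using hb⟩

theorem flag_mul_borel (g : GL (Fin n) K) {b : GL (Fin n) K} (hb : b ∈ borel K n) :
    ((g * b : GL (Fin n) K) : Flags K n) = (g : Flags K n) :=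
  (flag_eq_iff.mpr ⟨b, hb, rfl⟩).symm

theorem flagVecFun_ext {M N : FlagVecFun K n}
    (h : ∀ (g : GL (Fin n) K) F v, value M (g : Flags K n) F v = value N (g : Flags K n) F v) :
    M = N := by
  refine Matrix.ext fun F F' => ?_
  induction F using QuotientGroup.induction_on with
  | H g => exact AddMonoidAlgebra.ext (Finsupp.ext fun v => h g F' v)

/-- The triples `(g B, g w B, v)` with `v` in the span of the columns of `g` with indices in `D`. -/
def spanSet (K : Type) [Field K] {n : ℕ} (w : Equiv.Perm (Fin n)) (D : Finset (Fin n)) :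
    Set (Flags K n × Flags K n × (Fin n → K)) :=
  {x | ∃ g : GL (Fin n) K, x.1 = (g : Flags K n) ∧
    x.2.1 = ((g * permGL K w : GL (Fin n) K) : Flags K n) ∧ SuppIn D (actVec g⁻¹ x.2.2)}

theorem mem_spanSet {w : Equiv.Perm (Fin n)} {D : Finset (Fin n)} {g : GL (Fin n) K}
    {F : Flags K n} {v : Fin n → K} : ((g : Flags K n), F, v) ∈ spanSet K w D ↔
      ∃ b ∈ borel K n, F = ((g * b * permGL K w : GL (Fin n) K) : Flags K n) ∧
        SuppIn D (actVec (g * b)⁻¹ v) := by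
  constructor
  · rintro ⟨h, h1, h2, h3⟩
    obtain ⟨b, hb, rfl⟩ := flag_eq_iff.mp h1
    exact ⟨b, hb, h2, h3⟩
  · rintro ⟨b, hb, h1, h2⟩
    exact ⟨g * b, (flag_mul_borel g hb).symm, h1, h2⟩

variable [Finite K]

/-- The characteristic function of `spanSet`. -/
def spanMat (K : Type) [Field K] [Finite K] {n : ℕ} (w : Equiv.Perm (Fin n))
    (D : Finset (Fin n)) : FlagVecFun K n :=
  ofValue fun F F' v => Set.indicator (spanSet K w D) (fun _ => (1 : ℂ)) (F, F', v)

open Classical in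
theorem value_spanMat (w : Equiv.Perm (Fin n)) (D : Finset (Fin n)) (F F' : Flags K n)
    (v : Fin n → K) : value (spanMat K w D) F F' v = if (F, F', v) ∈ spanSet K w D then 1 else 0 := by
  rw [spanMat, value_ofValue, Set.indicator_apply]

theorem suppIn_empty {v : Fin n → K} : SuppIn ∅ v ↔ v = 0 :=
  ⟨fun h => funext fun j => h j (by simp), fun h j _ => by rw [h]; rfl⟩

theorem actVec_eq_zero_iff {g : GL (Fin n) K} {v : Fin n → K} : actVec g v = 0 ↔ v = 0 := by
  refine ⟨fun h => ?_, fun h => by rw [h, actVec, Matrix.mulVec_zero]⟩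
  have := congrArg (actVec g⁻¹) h
  simpa [Matrix.mulVec_mulVec] using this

open Classical in
theorem spanMat_empty_apply (w : Equiv.Perm (Fin n)) (g : GL (Fin n) K) (F : Flags K n) :
    spanMat K w ∅ (g : Flags K n) F =
      if ∃ b ∈ borel K n, F = ((g * b * permGL K w : GL (Fin n) K) : Flags K n) then 1 else 0 := by
  refine AddMonoidAlgebra.ext (Finsupp.ext fun v => ?_)
  have h := value_spanMat w ∅ (g : Flags K n) F v
  rw [value] at h
  rw [h]
  simp only [mem_spanSet, suppIn_empty, actVec_eq_zero_iff]
  split_ifs with h1 h2 h2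
  · obtain ⟨b, hb, h3, h4⟩ := h1
    rw [AddMonoidAlgebra.one_def, AddMonoidAlgebra.coeff_single, h4, Finsupp.single_eq_same]
  · obtain ⟨b, hb, h3, h4⟩ := h1
    exact absurd ⟨b, hb, h3⟩ h2
  · obtain ⟨b, hb, h3⟩ := h2
    rw [AddMonoidAlgebra.one_def, AddMonoidAlgebra.coeff_single, Finsupp.single_apply, if_neg]
    exact fun h0 => h1 ⟨b, hb, h3, h0.symm⟩
  · rfl

theorem spanMat_one_empty : spanMat K (1 : Equiv.Perm (Fin n)) ∅ = 1 := by
  classical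
  ext F F'
  induction F using QuotientGroup.induction_on with
  | H g =>
    rw [spanMat_empty_apply, Matrix.one_apply]
    have : (∃ b ∈ borel K n, F' = ((g * b * permGL K 1 : GL (Fin n) K) : Flags K n)) ↔
        (g : Flags K n) = F' := by
      rw [permGL_one]
      constructor
      · rintro ⟨b, hb, rfl⟩
        rw [mul_one, flag_mul_borel g hb]
      · intro h
        exact ⟨1, one_mem _, by rw [mul_one, mul_one, h]⟩
    simp only [this]

section Neighbours

variable {x y : Fin n} (hxy : (y : ℕ) = x + 1)

/-- The flags adjacent to a given one. -/
def nbr (g : GL (Fin n) K) (c : K) : Flags K n :=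
  ((g * transGL (ne_of_succ hxy) c * permGL K (Equiv.swap x y) : GL (Fin n) K) : Flags K n)

theorem trans_mem (c : K) : transGL (ne_of_succ hxy) c ∈ borel K n :=
  transGL_mem_borel (lt_of_succ hxy) c

theorem nbr_eq_mk {g : GL (Fin n) K} {b : GL (Fin n) K} (hb : b ∈ borel K n) :
    ((g * b * permGL K (Equiv.swap x y) : GL (Fin n) K) : Flags K n) =
      nbr hxy g (b.val x y / b.val y y) := by
  obtain ⟨b', hb', e⟩ := borel_mul_swap hxy hb
  rw [mul_assoc, e, ← mul_assoc, flag_mul_borel _ hb', nbr, ← mul_assoc]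

theorem nbr_mul_trans (g : GL (Fin n) K) (c d : K) :
    nbr hxy (g * transGL (ne_of_succ hxy) c) d = nbr hxy g (c + d) := by
  rw [nbr, mul_assoc g, transGL_mul, ← nbr]

theorem nbr_mul_swap_zero (g : GL (Fin n) K) :
    nbr hxy (g * permGL K (Equiv.swap x y)) 0 = (g : Flags K n) := by
  rw [nbr, transGL_zero, mul_one, mul_assoc, permGL_swap_mul_self, mul_one]

theorem nbr_mul_swap (g : GL (Fin n) K) {c : K} (hc : c ≠ 0) :
    nbr hxy (g * permGL K (Equiv.swap x y)) c = nbr hxy g c⁻¹ := by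
  obtain ⟨b, hb, e⟩ := swap_trans_swap_inv hxy hc
  rw [nbr, mul_assoc, mul_assoc, ← mul_assoc (permGL K _), e, ← mul_assoc, flag_mul_borel _ hb,
    ← mul_assoc, nbr]

/-- Two equal neighbours with different parameters would put the conjugate of a nontrivial
elementary matrix into the Borel subgroup, although it lies in the other Bruhat cell. -/
theorem nbr_injective (g : GL (Fin n) K) : Function.Injective (nbr hxy g) := by
  intro c d h
  by_contra hne
  obtain ⟨b, hb, e⟩ := flag_eq_iff.mp h
  have h1 : permGL K (Equiv.swap x y) * transGL (ne_of_succ hxy) (d - c) *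
      permGL K (Equiv.swap x y) = b := by
    have e1 : transGL (ne_of_succ hxy) d * permGL K (Equiv.swap x y) =
        transGL (ne_of_succ hxy) c * permGL K (Equiv.swap x y) * b := by
      have := congrArg (g⁻¹ * ·) e
      simpa only [mul_assoc, inv_mul_cancel_left] using this
    have e2 : transGL (ne_of_succ hxy) d =
        transGL (ne_of_succ hxy) c * transGL (ne_of_succ hxy) (d - c) := by
      rw [transGL_mul, add_sub_cancel]
    rw [e2, mul_assoc, mul_assoc, mul_left_cancel_iff] at e1
    rw [mul_assoc, e1, ← mul_assoc, permGL_swap_mul_self, one_mul]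
  obtain ⟨u, b', hb', e'⟩ := swap_trans_swap hxy (sub_ne_zero.mpr (Ne.symm hne))
  rw [h1] at e'
  have h2 : transGL (ne_of_succ hxy) u * permGL K (Equiv.swap x y) * (b' * b⁻¹) = permGL K 1 := by
    rw [← mul_assoc, ← e', mul_inv_cancel, permGL_one]
  have h3 := perm_eq_of_borel (trans_mem hxy u) (mul_mem hb' (inv_mem hb)) h2
  exact ne_of_succ hxy (by simpa using (congrArg (fun w : Equiv.Perm (Fin n) => w y) h3))

theorem spanMat_swap_apply [Fintype K] (g : GL (Fin n) K) (F : Flags K n) :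
    spanMat K (Equiv.swap x y) ∅ (g : Flags K n) F = ∑ c : K, if nbr hxy g c = F then 1 else 0 := by
  classical
  rw [spanMat_empty_apply]
  by_cases h : ∃ c, nbr hxy g c = F
  · obtain ⟨c, rfl⟩ := h
    rw [if_pos ⟨_, trans_mem hxy c, rfl⟩, Finset.sum_eq_single c, if_pos rfl]
    · intro d _ hd
      rw [if_neg fun h => hd (nbr_injective hxy g h)]
    · simp
  · rw [if_neg, Finset.sum_eq_zero]
    · exact fun c _ => if_neg fun h' => h ⟨c, h'⟩
    · rintro ⟨b, hb, rfl⟩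
      exact h ⟨_, (nbr_eq_mk hxy hb).symm⟩

theorem spanMat_swap_mul_apply [Fintype K] (M : FlagVecFun K n) (g : GL (Fin n) K)
    (F : Flags K n) : (spanMat K (Equiv.swap x y) ∅ * M) (g : Flags K n) F =
      ∑ c : K, M (nbr hxy g c) F := by
  rw [Matrix.mul_apply]
  simp only [spanMat_swap_apply hxy, Finset.sum_mul]
  rw [Finset.sum_comm]
  simp

/-- A flag together with its q neighbours of a given type forms a panel, and the panel is the same
seen from any member: from the neighbour at c, the parameter 0 returns the original flag and d ≠ 0
gives the neighbour at c + d⁻¹. -/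
theorem sum_class [Fintype K] {E : Type*} [AddCommGroup E] (h : Flags K n → E) (g : GL (Fin n) K)
    (c : K) : h (nbr hxy g c) +
      ∑ d : K, h (nbr hxy (g * transGL (ne_of_succ hxy) c * permGL K (Equiv.swap x y)) d) =
        h (g : Flags K n) + ∑ d : K, h (nbr hxy g d) := by
  classical
  have e1 : ∀ d ∈ Finset.univ.erase (0 : K),
      h (nbr hxy (g * transGL (ne_of_succ hxy) c * permGL K (Equiv.swap x y)) d) =
        h (nbr hxy g (c + d⁻¹)) := fun d hd => by
    rw [nbr_mul_swap hxy _ (Finset.ne_of_mem_erase hd), nbr_mul_trans]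
  have e2 : ∑ d : K, h (nbr hxy g d) = ∑ d : K, h (nbr hxy g (c + d⁻¹)) := by
    rw [← Equiv.sum_comp (Equiv.addLeft c), ← Equiv.sum_comp (Equiv.inv K)]
    rfl
  rw [← Finset.add_sum_erase _ _ (Finset.mem_univ (0 : K)), Finset.sum_congr rfl e1,
    nbr_mul_swap_zero, flag_mul_borel _ (trans_mem hxy c), e2,
    ← Finset.add_sum_erase (a := (0 : K)) Finset.univ _ (Finset.mem_univ 0), inv_zero, add_zero]
  abel

theorem suppIn_trans_iff {D : Finset (Fin n)} (hD : y ∈ D → x ∈ D) (c : K) (v : Fin n → K) :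
    SuppIn D (actVec (transGL (ne_of_succ hxy) c)⁻¹ v) ↔ SuppIn D v := by
  have key : ∀ c : K, ∀ v, SuppIn D v → SuppIn D (actVec (transGL (ne_of_succ hxy) c) v) := by
    intro c v hv i hi
    rw [actVec, coe_transGL, Matrix.transvection, Matrix.add_mulVec, Matrix.one_mulVec,
      Pi.add_apply, hv i hi, zero_add]
    by_cases hix : i = x
    · subst hix
      rw [Matrix.mulVec, dotProduct]
      refine Finset.sum_eq_zero fun j _ => ?_
      by_cases hj : j = y
      · rw [hj, hv y fun h => hi (hD h), mul_zero]
      · simp [Matrix.single_apply, Ne.symm hj]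
    · simp [Matrix.mulVec, dotProduct, Matrix.single_apply, Ne.symm hix]
  refine ⟨fun h => ?_, fun h => ?_⟩
  · have := key c _ h
    simpa [Matrix.mulVec_mulVec] using this
  · rw [transGL_inv]
    exact key _ _ h

theorem trans_mul_permGL {w : Equiv.Perm (Fin n)} (hw : w.symm x < w.symm y) (c : K) :
    ∃ b ∈ borel K n, transGL (ne_of_succ hxy) c * permGL K w = permGL K w * b :=
  ⟨_, transGL_mem_borel hw c, Units.ext (trans_mul_perm w x y c)⟩

theorem mem_spanSet_swap_mul {w : Equiv.Perm (Fin n)} {D : Finset (Fin n)}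
    (hw : w.symm x < w.symm y) (hD : y ∈ D → x ∈ D) (g : GL (Fin n) K) (F : Flags K n)
    (v : Fin n → K) : (∃ c, (nbr hxy g c, F, v) ∈ spanSet K w D) ↔
      ((g : Flags K n), F, v) ∈
        spanSet K (Equiv.swap x y * w) (D.map (Equiv.swap x y).toEmbedding) := by
  constructor
  · rintro ⟨c, h⟩
    obtain ⟨b, hb, rfl, h2⟩ := mem_spanSet.mp h
    obtain ⟨b', hb', e⟩ := swap_mul_borel hxy hb
    set u := b.val x y / b.val x x
    obtain ⟨b'', hb'', e2⟩ := trans_mul_permGL hxy hw u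
    refine mem_spanSet.mpr ⟨transGL (ne_of_succ hxy) c * b', mul_mem (trans_mem hxy c) hb', ?_, ?_⟩
    · have : g * transGL (ne_of_succ hxy) c * permGL K (Equiv.swap x y) * b * permGL K w =
          g * (transGL (ne_of_succ hxy) c * b') * permGL K (Equiv.swap x y * w) * b'' := by
        calc _ = g * transGL (ne_of_succ hxy) c * (permGL K (Equiv.swap x y) * b) * permGL K w := by
              simp only [mul_assoc]
          _ = g * transGL (ne_of_succ hxy) c * b' * permGL K (Equiv.swap x y) *
              (transGL (ne_of_succ hxy) u * permGL K w) := by rw [e]; simp only [mul_assoc]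
          _ = _ := by rw [e2, ← permGL_mul]; simp only [mul_assoc]
      rw [this, flag_mul_borel _ hb'']
    · have : g * transGL (ne_of_succ hxy) c * permGL K (Equiv.swap x y) * b =
          g * (transGL (ne_of_succ hxy) c * b') * permGL K (Equiv.swap x y) *
            transGL (ne_of_succ hxy) u := by
        rw [mul_assoc _ (permGL K _), e]; simp only [mul_assoc]
      rw [this, actVec_inv_mul, suppIn_trans_iff hxy hD, actVec_inv_mul, suppIn_perm_iff] at h2
      exact h2
  · intro h
    obtain ⟨b, hb, rfl, h2⟩ := mem_spanSet.mp h
    obtain ⟨b', hb', e⟩ := borel_mul_swap hxy hb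
    set u := b.val x y / b.val y y
    have e' : g * b * permGL K (Equiv.swap x y) =
        g * transGL (ne_of_succ hxy) u * permGL K (Equiv.swap x y) * b' := by
      rw [mul_assoc, e]; simp only [mul_assoc]
    refine ⟨u, mem_spanSet.mpr ⟨b', hb', ?_, ?_⟩⟩
    · rw [← e', ← permGL_mul, mul_assoc (g * b)]
    · rw [← e', actVec_inv_mul, suppIn_perm_iff]
      exact h2

/-- Two neighbours through which the same triple factors would put one element into the double
cosets of both `w` and the longer permutation. -/
theorem nbr_unique {w : Equiv.Perm (Fin n)} {D : Finset (Fin n)} (hw : w.symm x < w.symm y)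
    {g : GL (Fin n) K} {F : Flags K n} {v : Fin n → K} {c d : K}
    (hc : (nbr hxy g c, F, v) ∈ spanSet K w D) (hd : (nbr hxy g d, F, v) ∈ spanSet K w D) :
    c = d := by
  by_contra hne
  obtain ⟨b, hb, rfl, -⟩ := mem_spanSet.mp hc
  obtain ⟨b', hb', h, -⟩ := mem_spanSet.mp hd
  obtain ⟨b₁, hb₁, e⟩ := flag_eq_iff.mp h
  obtain ⟨u, b₂, hb₂, e2⟩ := swap_trans_swap hxy (sub_ne_zero.mpr (Ne.symm hne))
  obtain ⟨b₃, hb₃, e3⟩ := swap_mul_borel hxy (mul_mem hb₂ hb')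
  set u' := (b₂ * b').val x y / (b₂ * b').val x x
  obtain ⟨b₄, hb₄, e4⟩ := trans_mul_permGL hxy hw u'
  have e5 : b * permGL K w * b₁ = permGL K (Equiv.swap x y) * transGL (ne_of_succ hxy) (d - c) *
      permGL K (Equiv.swap x y) * b' * permGL K w := by
    have e6 : transGL (ne_of_succ hxy) d =
        transGL (ne_of_succ hxy) c * transGL (ne_of_succ hxy) (d - c) := by
      rw [transGL_mul, add_sub_cancel]
    rw [e6] at e
    simp only [mul_assoc, mul_left_cancel_iff] at e
    have := congrArg (permGL K (Equiv.swap x y) * ·) e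
    simp only [← mul_assoc, permGL_swap_mul_self, one_mul] at this
    exact this.symm
  have e7 : b * permGL K w * b₁ = transGL (ne_of_succ hxy) u * b₃ * permGL K (Equiv.swap x y * w) *
      b₄ := by
    rw [e5, e2]
    calc _ = transGL (ne_of_succ hxy) u * (permGL K (Equiv.swap x y) * (b₂ * b')) * permGL K w := by
          simp only [mul_assoc]
      _ = transGL (ne_of_succ hxy) u * b₃ * permGL K (Equiv.swap x y) *
          (transGL (ne_of_succ hxy) u' * permGL K w) := by rw [e3]; simp only [mul_assoc]
      _ = _ := by rw [e4, ← permGL_mul]; simp only [mul_assoc]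
  have e8 : ((transGL (ne_of_succ hxy) u * b₃)⁻¹ * b) * permGL K w * (b₁ * b₄⁻¹) =
      permGL K (Equiv.swap x y * w) := by
    calc _ = (transGL (ne_of_succ hxy) u * b₃)⁻¹ * (b * permGL K w * b₁) * b₄⁻¹ := by
          simp only [mul_assoc]
      _ = _ := by rw [e7]; group
  have h3 := perm_eq_of_borel (mul_mem (inv_mem (mul_mem (trans_mem hxy u) hb₃)) hb)
    (mul_mem hb₁ (inv_mem hb₄)) e8
  have h4 := congrArg (fun τ : Equiv.Perm (Fin n) => τ (w.symm y)) h3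
  simp only [Equiv.apply_symm_apply, Equiv.Perm.mul_apply, Equiv.swap_apply_right] at h4
  exact ne_of_succ hxy h4.symm

-- The value of the product counts the neighbours through which a triple factors. Such a neighbour
-- exists exactly on the longer span set, and it is unique when the length increases.
include hxy in
theorem spanMat_swap_mul [Fintype K] {w : Equiv.Perm (Fin n)} {D : Finset (Fin n)}
    (hw : w.symm x < w.symm y) (hD : y ∈ D → x ∈ D) :
    spanMat K (Equiv.swap x y) ∅ * spanMat K w D =
      spanMat K (Equiv.swap x y * w) (D.map (Equiv.swap x y).toEmbedding) := by
  classical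
  refine flagVecFun_ext fun g F v => ?_
  rw [value, spanMat_swap_mul_apply hxy, AddMonoidAlgebra.coeff_sum, Finsupp.finsetSum_apply]
  change ∑ c, value (spanMat K w D) (nbr hxy g c) F v = _
  simp only [value_spanMat]
  rw [← mem_spanSet_swap_mul hxy hw hD]
  by_cases h : ∃ c, (nbr hxy g c, F, v) ∈ spanSet K w D
  · rw [if_pos h]
    obtain ⟨c, hc⟩ := h
    rw [Finset.sum_eq_single c, if_pos hc]
    · intro d _ hd
      rw [if_neg fun h => hd (nbr_unique hxy hw h hc)]
    · simp
  · rw [if_neg h]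
    exact Finset.sum_eq_zero fun c _ => if_neg fun h' => h ⟨c, h'⟩

end Neighbours

end FlagMatrices

/-! ### The relations of the convolution algebra -/

section FlagRelations

variable {K : Type} [Field K] [Fintype K] {n : ℕ}

/-- The average of the `k`-th term of a flag. -/
def flagIdem (k : ℕ) (F : Flags K n) : AddMonoidAlgebra ℂ (Fin n → K) :=
  subIdem F.out (initFin n k)

theorem flagIdem_mk (k : ℕ) (g : GL (Fin n) K) :
    flagIdem k (g : Flags K n) = subIdem g (initFin n k) := by
  obtain ⟨b, hb, e⟩ := flag_eq_iff.mp (QuotientGroup.out_eq' (g : Flags K n)).symm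
  rw [flagIdem, e]
  exact subIdem_mul_right rfl fun v => suppIn_borel_iff (fun _ => mem_initFin) hb v

/-- Multiplication by the averages of the `k`-th terms of flags. -/
def flagMat (K : Type) [Field K] [Fintype K] (n k : ℕ) : FlagVecFun K n :=
  Matrix.diagonal (flagIdem k)

theorem subIdem_swap {x y : Fin n} (g : GL (Fin n) K) (D : Finset (Fin n)) :
    subIdem (g * permGL K (Equiv.swap x y)) D =
      subIdem g (D.map (Equiv.swap x y).toEmbedding) :=
  subIdem_mul_right (Finset.card_map _).symm fun v => suppIn_perm_iff _ _ _

theorem subIdem_trans {x y : Fin n} (hxy : (y : ℕ) = x + 1) (g : GL (Fin n) K) (c : K) (k : ℕ) :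
    subIdem (g * transGL (ne_of_succ hxy) c) (initFin n k) = subIdem g (initFin n k) :=
  subIdem_mul_right rfl fun v => suppIn_borel_iff (fun _ => mem_initFin) (trans_mem hxy c) v

theorem flagIdem_nbr {x y : Fin n} (hxy : (y : ℕ) = x + 1) {k : ℕ} (hk : (x : ℕ) + 1 ≠ k)
    (g : GL (Fin n) K) (c : K) : flagIdem k (nbr hxy g c) = flagIdem k (g : Flags K n) := by
  rw [nbr, flagIdem_mk, flagIdem_mk, subIdem_swap, initFin_map_swap hxy hk, subIdem_trans hxy]

theorem initFin_succ (x : Fin n) : initFin n (x + 1) = insert x (initFin n x) := by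
  ext j
  rw [Finset.mem_insert, mem_initFin, mem_initFin, Fin.ext_iff]
  omega

theorem initFin_succ_succ {x y : Fin n} (hxy : (y : ℕ) = x + 1) :
    initFin n (x + 2) = insert y (insert x (initFin n x)) := by
  rw [← initFin_succ x]
  ext j
  rw [Finset.mem_insert, mem_initFin, mem_initFin, Fin.ext_iff]
  omega

/-- Two adjacent flags differ in one term, and together their two versions of it span the next term,
which they share. -/
theorem flagIdem_mul_self_nbr {x y : Fin n} (hxy : (y : ℕ) = x + 1) (g : GL (Fin n) K) (c : K) :
    flagIdem (x + 1) (g : Flags K n) * flagIdem (x + 1) (nbr hxy g c) =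
      flagIdem (x + 2) (nbr hxy g c) := by
  rw [← flag_mul_borel g (trans_mem hxy c), nbr, flagIdem_mk,
    flagIdem_mk, flagIdem_mk, subIdem_swap, subIdem_swap _ (initFin n (x + 2)),
    initFin_map_swap hxy (k := x + 2) (by omega), subIdem_mul, initFin_succ_succ hxy, initFin_succ,
    Finset.map_insert, initFin_map_swap hxy (by omega)]
  congr 1
  rw [Equiv.coe_toEmbedding, Equiv.swap_apply_left]
  ext j
  simp only [Finset.mem_union, Finset.mem_insert]
  tauto

/-- The terms of dimension x + 1 in a panel are the lines of a plane modulo the common term of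
dimension x. The identity is `lineIdem_pencil` multiplied by the average of that common term. -/
theorem flagIdem_pencil {x y : Fin n} (hxy : (y : ℕ) = x + 1) (g : GL (Fin n) K) :
    flagIdem (x + 1) (g : Flags K n) + ∑ c : K, flagIdem (x + 1) (nbr hxy g c) =
      flagIdem x (g : Flags K n) + cardC K • flagIdem (x + 2) (g : Flags K n) := by
  have hx : x ∉ initFin n x := by simp [mem_initFin]
  have hy : y ∉ insert x (initFin n x) := by
    rw [← initFin_succ, mem_initFin]; omega
  set p := fun k => g.val k x
  set r := fun k => g.val k y
  have e1 : flagIdem (x + 1) (g : Flags K n) = lineIdem p * subIdem g (initFin n x) := by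
    rw [flagIdem_mk, initFin_succ, subIdem, Finset.prod_insert hx, ← subIdem]
  have e2 : ∀ c, flagIdem (x + 1) (nbr hxy g c) =
      lineIdem (r + c • p) * subIdem g (initFin n x) := by
    intro c
    rw [nbr, flagIdem_mk, initFin_succ, subIdem, Finset.prod_insert hx, ← subIdem, subIdem_swap,
      initFin_map_swap hxy (by omega), subIdem_trans hxy]
    congr 2
    ext k
    rw [Units.val_mul, mul_perm_apply, Equiv.swap_apply_left, Units.val_mul, coe_transGL,
      mul_trans_apply, if_pos rfl, Pi.add_apply, Pi.smul_apply, smul_eq_mul, mul_comm c]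
  have e3 : flagIdem (x + 2) (g : Flags K n) =
      lineIdem r * (lineIdem p * subIdem g (initFin n x)) := by
    rw [flagIdem_mk, initFin_succ_succ hxy, subIdem, Finset.prod_insert hy,
      Finset.prod_insert hx, ← subIdem]
  rw [e1, Finset.sum_congr rfl fun c _ => e2 c, e3, ← Finset.sum_mul, ← add_mul, lineIdem_pencil,
    flagIdem_mk, add_mul, one_mul, smul_mul_assoc]
  congr 2
  ring

/-- The Hecke generators of the convolution algebra. -/
def flagT (K : Type) [Field K] [Finite K] (n i : ℕ) : FlagVecFun K n := spanMat K (adjSwap n i) ∅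

theorem flagT_of_lt {i : ℕ} (h : i + 1 < n) :
    flagT K n i = spanMat K (Equiv.swap ⟨i, by omega⟩ ⟨i + 1, h⟩) ∅ := by
  rw [flagT, adjSwap_of_lt h]

theorem succ_eq {i : ℕ} (h : i + 1 < n) :
    ((⟨i + 1, h⟩ : Fin n) : ℕ) = ((⟨i, by omega⟩ : Fin n) : ℕ) + 1 := rfl

theorem flagT_mul_apply {i : ℕ} (h : i + 1 < n) (M : FlagVecFun K n) (g : GL (Fin n) K)
    (F : Flags K n) : (flagT K n i * M) (g : Flags K n) F = ∑ c : K, M (nbr (succ_eq h) g c) F := by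
  rw [flagT_of_lt h, spanMat_swap_mul_apply (succ_eq h)]

theorem flagT_apply {i : ℕ} (h : i + 1 < n) (g : GL (Fin n) K) (F : Flags K n) :
    flagT K n i (g : Flags K n) F = ∑ c : K, (1 : FlagVecFun K n) (nbr (succ_eq h) g c) F := by
  rw [← flagT_mul_apply h, mul_one]

/-- The operator 1 + T sums over a panel, so it takes the same value at all members. The quadratic
and the flag relation both come from this. -/
theorem one_add_flagT_nbr {i : ℕ} (h : i + 1 < n) (g : GL (Fin n) K) (F : Flags K n) (c : K) :
    (1 + flagT K n i) (nbr (succ_eq h) g c) F = (1 + flagT K n i) (g : Flags K n) F := by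
  have := sum_class (succ_eq h) (fun F' => (1 : FlagVecFun K n) F' F) g c
  rw [Matrix.add_apply, Matrix.add_apply, flagT_apply h, nbr, flagT_apply h]
  exact this

theorem flagVecFun_ext' {M N : FlagVecFun K n}
    (h : ∀ (g : GL (Fin n) K) F, M (g : Flags K n) F = N (g : Flags K n) F) : M = N :=
  flagVecFun_ext fun g F v => by rw [value, value, h]

theorem flagT_quad {i : ℕ} (h : i + 1 < n) :
    flagT K n i * flagT K n i = (cardC K - 1) • flagT K n i + cardC K • 1 := by
  have key : flagT K n i * (1 + flagT K n i) = cardC K • (1 + flagT K n i) :=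
    flagVecFun_ext' fun g F => by
      rw [flagT_mul_apply h, Finset.sum_congr rfl fun c _ => one_add_flagT_nbr h g F c,
        Finset.sum_const, Finset.card_univ, ← Nat.cast_smul_eq_nsmul ℂ,
        ← Nat.card_eq_fintype_card, Matrix.smul_apply]
  rw [mul_add, mul_one, smul_add] at key
  rw [eq_sub_of_add_eq' key]
  module

theorem flagT_mul_spanMat {w : Equiv.Perm (Fin n)} {D : Finset (Fin n)} {i : ℕ} (h : i + 1 < n)
    (hw : w.symm ⟨i, by omega⟩ < w.symm ⟨i + 1, h⟩)
    (hD : (⟨i + 1, h⟩ : Fin n) ∈ D → (⟨i, by omega⟩ : Fin n) ∈ D) :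
    flagT K n i * spanMat K w D =
      spanMat K (adjSwap n i * w) (D.map (adjSwap n i).toEmbedding) := by
  rw [flagT_of_lt h, spanMat_swap_mul (succ_eq h) hw hD, adjSwap_of_lt h]

theorem flagT_mul_spanMat_empty {w : Equiv.Perm (Fin n)} {i : ℕ} (h : i + 1 < n)
    (hw : w.symm ⟨i, by omega⟩ < w.symm ⟨i + 1, h⟩) :
    flagT K n i * spanMat K w ∅ = spanMat K (adjSwap n i * w) ∅ := by
  rw [flagT_mul_spanMat h hw (by simp), Finset.map_empty]

theorem heckeRel_flagT (K : Type) [Field K] [Fintype K] (n : ℕ) :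
    HeckeRel (cardC K) n (flagT K n) where
  quad i hi := flagT_quad hi
  braid i hi := by
    have h1 : i + 1 < n := by omega
    have e0 := flagT_of_lt (K := K) h1
    have e1 := flagT_of_lt (K := K) (show i + 1 + 1 < n from hi)
    have e2 : ∀ j, flagT K n j = spanMat K (adjSwap n j) ∅ := fun j => rfl
    rw [mul_assoc, mul_assoc]
    nth_rw 3 [e2]
    nth_rw 5 [e2]
    rw [flagT_mul_spanMat_empty hi, flagT_mul_spanMat_empty h1, flagT_mul_spanMat_empty h1,
      flagT_mul_spanMat_empty hi, adjSwap_of_lt h1, adjSwap_of_lt (show i + 1 + 1 < n from hi),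
      swap_braid (by simp) (by simp; omega) (by simp)]
    all_goals
      simp [adjSwap_of_lt h1, adjSwap_of_lt (show i + 1 + 1 < n from hi), Equiv.swap_apply_def,
        Equiv.Perm.mul_def, show i ≠ i + 1 + 1 by omega, show i + 1 + 1 ≠ i by omega]
  comm i j hi hj := by
    have h1 : i + 1 < n := by omega
    have e2 : ∀ j, flagT K n j = spanMat K (adjSwap n j) ∅ := fun j => rfl
    nth_rw 2 [e2]
    nth_rw 3 [e2]
    rw [flagT_mul_spanMat_empty h1, flagT_mul_spanMat_empty hj, adjSwap_of_lt h1, adjSwap_of_lt hj,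
      ((Equiv.Perm.disjoint_swap_swap (by simp; omega)).commute).eq]
    · rw [adjSwap_of_lt h1, Equiv.symm_swap, Equiv.swap_apply_of_ne_of_ne,
        Equiv.swap_apply_of_ne_of_ne] <;> simp <;> omega
    · rw [adjSwap_of_lt hj, Equiv.symm_swap, Equiv.swap_apply_of_ne_of_ne,
        Equiv.swap_apply_of_ne_of_ne] <;> simp <;> omega

theorem flagMat_mul_apply (k : ℕ) (M : FlagVecFun K n) (F F' : Flags K n) :
    (flagMat K n k * M) F F' = flagIdem k F * M F F' := by
  rw [flagMat, Matrix.diagonal_mul]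

theorem flagMat_comm_flagT {i k : ℕ} (hi : i + 1 < n) (hk : i + 1 ≠ k) :
    flagMat K n k * flagT K n i = flagT K n i * flagMat K n k := by
  refine flagVecFun_ext' fun g F => ?_
  rw [flagMat_mul_apply, flagT_mul_apply hi, flagT_apply hi, Finset.mul_sum]
  refine Finset.sum_congr rfl fun c _ => ?_
  rw [← mul_one (flagMat K n k), flagMat_mul_apply, flagIdem_nbr _ (by exact hk)]

theorem miraData_flag (K : Type) [Field K] [Fintype K] (n : ℕ) :
    MiraData (cardC K) n (flagT K n) (flagMat K n) where
  hecke := heckeRel_flagT K n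
  bot := by
    rw [flagMat, ← Matrix.diagonal_one]
    congr 1
    ext F : 1
    rw [flagIdem, initFin]
    simp [subIdem]
  mul j _ k _ := by
    rw [flagMat, flagMat, Matrix.diagonal_mul_diagonal, flagMat]
    congr 1
    ext F : 1
    rw [flagIdem, flagIdem, subIdem_mul, flagIdem]
    congr 1
    ext l
    rw [Finset.mem_union, mem_initFin, mem_initFin, mem_initFin, lt_max_iff]
  comm k _ i hi hk := flagMat_comm_flagT hi hk
  sandwich i hi := by
    refine flagVecFun_ext' fun g F => ?_
    rw [mul_assoc, flagMat_mul_apply, flagT_mul_apply hi, flagT_mul_apply hi, Finset.mul_sum]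
    refine Finset.sum_congr rfl fun c _ => ?_
    rw [← mul_one (flagMat K n (i + 1)), flagMat_mul_apply, ← mul_assoc]
    rw [← mul_one (flagMat K n (i + 2)), flagMat_mul_apply]
    exact congrArg (· * _) (flagIdem_mul_self_nbr (succ_eq hi) g c)
  flag i hi := by
    -- With the diagonal factors moved to the left, the relation becomes an identity for each flag:
    -- the sum over the panel of averages of its terms of dimension i + 1, multiplied by the
    -- constant value of 1 + T.
    have hcomm : (1 + flagT K n i) * (flagMat K n i + cardC K • flagMat K n (i + 2)) =
        (flagMat K n i + cardC K • flagMat K n (i + 2)) * (1 + flagT K n i) := by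
      simp only [mul_add, add_mul, one_mul, mul_one, smul_mul_assoc, mul_smul_comm, smul_add,
        flagMat_comm_flagT hi (show i + 1 ≠ i by omega),
        flagMat_comm_flagT hi (show i + 1 ≠ i + 2 by omega)]
      abel
    rw [hcomm, mul_assoc, add_mul 1, one_mul]
    refine flagVecFun_ext' fun g F => ?_
    rw [Matrix.add_apply, flagT_mul_apply hi, flagMat_mul_apply]
    have e : ∀ c, (flagMat K n (i + 1) * (1 + flagT K n i)) (nbr (succ_eq hi) g c) F =
        flagIdem (i + 1) (nbr (succ_eq hi) g c) * (1 + flagT K n i) (g : Flags K n) F := by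
      intro c
      rw [flagMat_mul_apply, one_add_flagT_nbr]
    rw [Finset.sum_congr rfl fun c _ => e c, ← Finset.sum_mul, ← add_mul]
    have e2 := flagIdem_pencil (succ_eq hi) g
    simp only at e2
    rw [e2]
    generalize 1 + flagT K n i = P
    rw [add_mul (flagMat K n i), Matrix.add_apply, smul_mul_assoc, Matrix.smul_apply,
      flagMat_mul_apply, flagMat_mul_apply, add_mul, smul_mul_assoc]

end FlagRelations

/-! ### Orbits of flags and vectors -/

section Orbits

variable {n : ℕ}

/-- The condition on the labels of the orbits. -/
def Adm (w : Equiv.Perm (Fin n)) (β : Finset (Fin n)) : Prop :=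
  ∀ i ∈ β, ∀ j ∉ β, i < j ∨ w.symm i < w.symm j

/-- Admissible sets are the order ideals of the partial order i ≤ l and w⁻¹(i) ≤ w⁻¹(l). -/
theorem Adm.mem {w : Equiv.Perm (Fin n)} {β : Finset (Fin n)} (h : Adm w β) {i l : Fin n}
    (hl : l ∈ β) (h1 : i ≤ l) (h2 : w.symm i ≤ w.symm l) : i ∈ β := by
  by_contra hi
  rcases h l hl i hi with h | h
  · exact absurd h (not_lt.mpr h1)
  · exact absurd h (not_lt.mpr h2)

theorem adm_univ (w : Equiv.Perm (Fin n)) : Adm w Finset.univ := fun _ _ j hj => by simp at hj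

theorem adm_initFin (w : Equiv.Perm (Fin n)) (k : ℕ) : Adm w (initFin n k) := fun i hi j hj => by
  rw [mem_initFin] at hi hj
  exact Or.inl (by rw [Fin.lt_def]; omega)

theorem Adm.swap {w : Equiv.Perm (Fin n)} {D : Finset (Fin n)} (h : Adm w D) {x y : Fin n}
    (hxy : (y : ℕ) = x + 1) (hx : x ∉ D) :
    Adm (Equiv.swap x y * w) (D.map (Equiv.swap x y).toEmbedding) := by
  have e : ∀ a, (Equiv.swap x y * w).symm a = w.symm (Equiv.swap x y a) := fun a => by
    rw [Equiv.symm_apply_eq, Equiv.Perm.mul_apply, Equiv.apply_symm_apply, Equiv.swap_apply_self]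
  intro a ha b hb
  rw [Finset.mem_map_equiv, Equiv.symm_swap] at ha hb
  rw [e, e]
  rcases h _ ha _ hb with h1 | h1
  · refine Or.inl ?_
    have := swap_lt_swap hxy h1 (fun h2 => hx (h2.1 ▸ ha))
    simpa using this
  · exact Or.inr h1

variable {K : Type} [Field K]

/-- The characteristic vector of a set of indices. -/
def indVec (K : Type) [Field K] (β : Finset (Fin n)) : Fin n → K := fun i => if i ∈ β then 1 else 0

theorem actVec_indVec (g : GL (Fin n) K) (β : Finset (Fin n)) :
    actVec g (indVec K β) = ∑ i ∈ β, fun k => g.val k i := by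
  ext k
  simp only [actVec, Matrix.mulVec, dotProduct, indVec, Finset.sum_apply, mul_ite, mul_one, mul_zero,
    Finset.sum_ite_mem, Finset.univ_inter]

theorem mem_orbit {l : OrbitLabel n} {x : Flags K n × Flags K n × (Fin n → K)} :
    x ∈ orbit K l ↔ ∃ g : GL (Fin n) K, x.1 = (g : Flags K n) ∧
      x.2.1 = ((g * permGL K l.w : GL (Fin n) K) : Flags K n) ∧
        x.2.2 = actVec g (indVec K l.β) := by
  simp only [actVec_indVec]
  rfl

/-- The stabilizer of a pair of flags consists of matrices supported on the partial order of `w`,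
being upper triangular with respect to both flags. -/
theorem entry_ne_zero_of_stab {w : Equiv.Perm (Fin n)} {b b' : GL (Fin n) K} (hb : b ∈ borel K n)
    (hb' : b' ∈ borel K n) (h : b * permGL K w = permGL K w * b') {i j : Fin n}
    (hij : b.val i j ≠ 0) : i ≤ j ∧ w.symm i ≤ w.symm j := by
  refine ⟨not_lt.mp fun hlt => hij (hb i j hlt), not_lt.mp fun hlt => hij ?_⟩
  have e := congrFun (congrFun (val_eq_of_eq h) i) (w.symm j)
  rw [Units.val_mul, Units.val_mul, mul_perm_apply, perm_mul_apply, Equiv.apply_symm_apply,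
    hb' _ _ hlt] at e
  exact e

theorem subset_of_stab {w : Equiv.Perm (Fin n)} {b b' : GL (Fin n) K} (hb : b ∈ borel K n)
    (hb' : b' ∈ borel K n) (h : b * permGL K w = permGL K w * b') {β β' : Finset (Fin n)}
    (hβ : Adm w β') (e : indVec K β = actVec b (indVec K β')) : β ⊆ β' := by
  intro i hi
  have e1 := congrFun e i
  rw [indVec, if_pos hi] at e1
  have e2 : ∑ j, b.val i j * indVec K β' j ≠ 0 := fun h0 => one_ne_zero (e1.trans h0)
  obtain ⟨j, -, hj⟩ := Finset.exists_ne_zero_of_sum_ne_zero e2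
  have h1 : j ∈ β' := by
    by_contra hc
    rw [indVec, if_neg hc, mul_zero] at hj
    exact hj rfl
  obtain ⟨h2, h3⟩ := entry_ne_zero_of_stab hb hb' h (left_ne_zero_of_mul hj)
  exact hβ.mem h1 h2 h3

theorem actVec_injective (g : GL (Fin n) K) : Function.Injective (actVec g) := fun v w h => by
  have := congrArg (actVec g⁻¹) h
  simpa [Matrix.mulVec_mulVec] using this

theorem actVec_mul (g h : GL (Fin n) K) (v : Fin n → K) :
    actVec (g * h) v = actVec g (actVec h v) := by
  rw [actVec, Units.val_mul, ← Matrix.mulVec_mulVec]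

theorem OrbitLabel.ext' {l l' : OrbitLabel n} (h : l.w = l'.w) (h' : l.β = l'.β) : l = l' := by
  cases l; cases l'; simp_all

/-- The pair of flags determines `w` by the Bruhat decomposition. The stabilizer cannot carry the
characteristic vector of one order ideal outside that ideal, so the two sets contain each other. -/
theorem orbit_unique {l l' : OrbitLabel n} {x : Flags K n × Flags K n × (Fin n → K)}
    (h : x ∈ orbit K l) (h' : x ∈ orbit K l') : l = l' := by
  obtain ⟨g, h1, h2, h3⟩ := mem_orbit.mp h
  obtain ⟨g', h1', h2', h3'⟩ := mem_orbit.mp h'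
  obtain ⟨b, hb, rfl⟩ := flag_eq_iff.mp (h1.symm.trans h1')
  obtain ⟨b', hb', e⟩ := flag_eq_iff.mp (h2.symm.trans h2')
  rw [mul_assoc, mul_assoc, mul_left_cancel_iff] at e
  have hw : l.w = l'.w := (perm_eq_of_borel hb (inv_mem hb')
    (by rw [e, mul_inv_cancel_right])).symm
  rw [← hw] at e
  have e3 : indVec K l.β = actVec b (indVec K l'.β) := by
    refine actVec_injective g ?_
    rw [← h3, h3', actVec_mul]
  refine OrbitLabel.ext' hw (Finset.Subset.antisymm
    (subset_of_stab hb hb' e (hw ▸ l'.cond : Adm l.w l'.β) e3) ?_)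
  have e4 : indVec K l'.β = actVec b⁻¹ (indVec K l.β) := by
    rw [e3, ← actVec_mul, inv_mul_cancel, actVec, Units.val_one, Matrix.one_mulVec]
  refine subset_of_stab (w := l.w) (inv_mem hb) (inv_mem hb') ?_ l.cond e4
  rw [inv_mul_eq_iff_eq_mul, ← mul_assoc, e, mul_inv_cancel_right]

/-- The set β is the order ideal generated by the support of the vector. The stabilizer is large
enough to rescale the nonzero coordinates and to cancel a superfluous 1 against a coordinate above
it. -/
theorem exists_stab {w : Equiv.Perm (Fin n)} {D : Finset (Fin n)} (hD : Adm w D) {v : Fin n → K}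
    (hv : SuppIn D v) : ∃ β ⊆ D, Adm w β ∧ ∃ b ∈ borel K n, ∃ b' ∈ borel K n,
      b * permGL K w = permGL K w * b' ∧ actVec b (indVec K β) = v := by
  classical
  have hmem : ∀ {l}, v l ≠ 0 → l ∈ D := fun {l} h => by
    by_contra hc
    exact h (hv l hc)
  set β := Finset.univ.filter fun i => ∃ l, v l ≠ 0 ∧ i ≤ l ∧ w.symm i ≤ w.symm l with hβdef
  have hβ : ∀ i, i ∈ β ↔ ∃ l, v l ≠ 0 ∧ i ≤ l ∧ w.symm i ≤ w.symm l := fun i => by simp [hβdef]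
  have hvβ : ∀ {l}, v l ≠ 0 → l ∈ β := fun {l} h => (hβ l).mpr ⟨l, h, le_rfl, le_rfl⟩
  have hch : ∀ i, ∃ l, i ∈ β → v l ≠ 0 ∧ i ≤ l ∧ w.symm i ≤ w.symm l := fun i => by
    by_cases h : i ∈ β
    · obtain ⟨l, hl⟩ := (hβ i).mp h
      exact ⟨l, fun _ => hl⟩
    · exact ⟨i, fun h' => absurd h' h⟩
  choose f hf using hch
  -- Row i is v_i times a unit row if v_i ≠ 0. If v_i = 0 and i ∈ β, an entry -1 at an index of the
  -- support above i cancels the diagonal 1, so the characteristic vector of β is sent to v.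
  let A : Matrix (Fin n) (Fin n) K := Matrix.of fun i j =>
    (if j = i then (if v i = 0 then 1 else v i) else 0) +
      if v i = 0 ∧ i ∈ β ∧ j = f i then -1 else 0
  have hfne : ∀ i, v i = 0 → i ∈ β → f i ≠ i := fun i h1 h2 h3 => (hf i h2).1 (h3.symm ▸ h1)
  have hAd : ∀ i, A i i ≠ 0 := fun i => by
    have : ¬(v i = 0 ∧ i ∈ β ∧ i = f i) := fun h => hfne i h.1 h.2.1 h.2.2.symm
    simp only [A, Matrix.of_apply, if_true, if_neg this, add_zero]
    split_ifs with h
    · exact one_ne_zero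
    · exact h
  have hA0 : ∀ i j, ¬(i ≤ j ∧ w.symm i ≤ w.symm j) → A i j = 0 := fun i j h => by
    have h1 : ¬j = i := by rintro rfl; exact h ⟨le_rfl, le_rfl⟩
    have h2 : ¬(v i = 0 ∧ i ∈ β ∧ j = f i) := by
      rintro ⟨-, h3, rfl⟩
      exact h (hf i h3).2
    simp only [A, Matrix.of_apply, if_neg h1, if_neg h2, add_zero]
  obtain ⟨b, hb, eb⟩ := exists_borel A (fun i j hij => hA0 i j fun h => absurd hij (not_lt.mpr h.1))
    hAd
  have hb' : (permGL K w)⁻¹ * b * permGL K w ∈ borel K n := by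
    intro i j hij
    rw [permGL_inv, Units.val_mul, Units.val_mul, mul_perm_apply, perm_mul_apply, eb]
    refine hA0 _ _ fun h => ?_
    have h2 : w.symm (w⁻¹.symm i) ≤ w.symm (w j) := h.2
    change w.symm (w i) ≤ w.symm (w j) at h2
    rw [Equiv.symm_apply_apply, Equiv.symm_apply_apply] at h2
    exact absurd hij (not_lt.mpr h2)
  refine ⟨β, fun i hi => ?_, ?_, b, hb, _, hb', by group, ?_⟩
  · obtain ⟨l, h1, h2, h3⟩ := (hβ i).mp hi
    exact hD.mem (hmem h1) h2 h3
  · intro i hi j hj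
    by_contra hc
    push Not at hc
    obtain ⟨l, h1, h2, h3⟩ := (hβ i).mp hi
    exact hj ((hβ j).mpr ⟨l, h1, hc.1.trans h2, hc.2.trans h3⟩)
  · ext i
    rw [actVec, eb, Matrix.mulVec, dotProduct]
    simp only [A, Matrix.of_apply, add_mul, Finset.sum_add_distrib, ite_mul, zero_mul]
    rw [Finset.sum_ite_eq' Finset.univ i]
    by_cases hi : v i = 0
    · by_cases hiβ : i ∈ β
      · have : f i ∈ β := hvβ (hf i hiβ).1
        simp [hi, hiβ, indVec, this]
      · simp [hi, hiβ, indVec]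
    · simp [hi, indVec, hvβ hi]

theorem exists_mem_orbit {w : Equiv.Perm (Fin n)} {D : Finset (Fin n)} (hD : Adm w D)
    {x : Flags K n × Flags K n × (Fin n → K)} (hx : x ∈ spanSet K w D) :
    ∃ β, ∃ h : Adm w β, β ⊆ D ∧ x ∈ orbit K ⟨w, β, h⟩ := by
  obtain ⟨g, h1, h2, h3⟩ := hx
  obtain ⟨β, hβ, hadm, b, hb, b', hb', e, e'⟩ := exists_stab hD h3
  refine ⟨β, hadm, hβ, mem_orbit.mpr ⟨g * b, ?_, ?_, ?_⟩⟩
  · rw [h1, flag_mul_borel _ hb]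
  · rw [h2, mul_assoc, e, ← mul_assoc, flag_mul_borel _ hb']
  · rw [actVec_mul, e', ← actVec_mul, mul_inv_cancel, actVec, Units.val_one, Matrix.one_mulVec]

theorem orbit_subset_spanSet {l : OrbitLabel n} {D : Finset (Fin n)} (h : l.β ⊆ D) :
    orbit K l ⊆ spanSet K l.w D := by
  intro x hx
  obtain ⟨g, h1, h2, h3⟩ := mem_orbit.mp hx
  refine ⟨g, h1, h2, fun j hj => ?_⟩
  rw [h3, ← actVec_mul, inv_mul_cancel, actVec, Units.val_one, Matrix.one_mulVec, indVec,
    if_neg fun h' => hj (h h')]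

theorem smul_mem_spanSet {w : Equiv.Perm (Fin n)} {D : Finset (Fin n)} (g : GL (Fin n) K)
    {F F' : Flags K n} {v : Fin n → K} (h : (F, F', v) ∈ spanSet K w D) :
    (g • F, g • F', actVec g v) ∈ spanSet K w D := by
  obtain ⟨h, h1, h2, h3⟩ := h
  simp only at h1 h2 h3
  refine ⟨g * h, by simp only [h1]; rfl, by simp only [h2, mul_assoc]; rfl, ?_⟩
  rw [actVec_inv_mul, ← actVec_mul g⁻¹, inv_mul_cancel, actVec, actVec, Units.val_one,
    Matrix.one_mulVec]
  exact h3

variable [Finite K]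

theorem isInvariant_spanMat (w : Equiv.Perm (Fin n)) (D : Finset (Fin n)) :
    IsInvariant (spanMat K w D) := by
  classical
  intro g F F' v
  rw [value_spanMat, value_spanMat]
  have : (g • F, g • F', actVec g v) ∈ spanSet K w D ↔ (F, F', v) ∈ spanSet K w D := by
    refine ⟨fun h => ?_, smul_mem_spanSet g⟩
    have := smul_mem_spanSet g⁻¹ h
    simpa [Matrix.mulVec_mulVec] using this
  simp only [this]

/-- The characteristic function of `spanSet` as an element of the convolution algebra. -/
def spanFun (K : Type) [Field K] [Finite K] {n : ℕ} (w : Equiv.Perm (Fin n))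
    (D : Finset (Fin n)) : mirabolicHecke K n := ⟨spanMat K w D, isInvariant_spanMat w D⟩

open Classical in
theorem value_orbitFun (l : OrbitLabel n) (F F' : Flags K n) (v : Fin n → K) :
    value (orbitFun K l).1 F F' v = if (F, F', v) ∈ orbit K l then 1 else 0 := by
  change value (ofValue _) F F' v = _
  rw [value_ofValue, Set.indicator_apply]

theorem mirabolic_ext {f h : mirabolicHecke K n}
    (e : ∀ F F' v, value f.1 F F' v = value h.1 F F' v) : f = h :=
  Subtype.ext (flagVecFun_ext fun g F' v => e _ _ _)

theorem value_sum {ι : Type*} (s : Finset ι) (f : ι → mirabolicHecke K n) (F F' : Flags K n)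
    (v : Fin n → K) : value (∑ i ∈ s, f i : mirabolicHecke K n).1 F F' v =
      ∑ i ∈ s, value (f i).1 F F' v := by
  rw [value, AddSubmonoidClass.coe_finsetSum, Matrix.sum_apply, AddMonoidAlgebra.coeff_sum,
    Finsupp.finsetSum_apply]
  rfl

open Classical in
theorem spanFun_eq_sum {w : Equiv.Perm (Fin n)} {D : Finset (Fin n)} (hD : Adm w D) :
    spanFun K w D = ∑ β : {β : Finset (Fin n) // β ⊆ D ∧ Adm w β},
      orbitFun K ⟨w, β.1, β.2.2⟩ := by
  refine mirabolic_ext fun F F' v => ?_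
  rw [value_sum]
  simp only [value_orbitFun]
  change value (spanMat K w D) F F' v = _
  rw [value_spanMat]
  split_ifs with h
  · obtain ⟨β, hβ, hβD, hx⟩ := exists_mem_orbit hD h
    rw [Finset.sum_eq_single ⟨β, hβD, hβ⟩, if_pos hx]
    · intro β' _ hne
      refine if_neg fun h' => hne (Subtype.ext ?_)
      exact congrArg OrbitLabel.β (orbit_unique h' hx)
    · simp
  · refine (Finset.sum_eq_zero fun β _ => if_neg fun h' => h ?_).symm
    exact orbit_subset_spanSet (l := ⟨w, β.1, β.2.2⟩) β.2.1 h'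

/-- The Bruhat decomposition of the monoid, where invertibility forces the rook matrix to have full
rank. -/
theorem exists_bruhat (g : GL (Fin n) K) : ∃ b ∈ borel K n, ∃ b' ∈ borel K n,
    ∃ w : Equiv.Perm (Fin n), g = b * permGL K w * b' := by
  obtain ⟨b, hb, b', hb', w, v, k, hk, e⟩ := rookCell g.val
  have hr : n ≤ k := by
    have h1 : (g.val).rank = n := by
      rw [Matrix.rank_of_isUnit _ g.isUnit, Fintype.card_fin]
    have h2 : (g.val).rank ≤ (truncMat K n k).rank := by
      rw [e, rookMat]
      exact (Matrix.rank_mul_le_left _ _).trans ((Matrix.rank_mul_le_right _ _).trans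
        ((Matrix.rank_mul_le_left _ _).trans (Matrix.rank_mul_le_right _ _)))
    rwa [h1, rank_truncMat hk] at h2
  obtain rfl := le_antisymm hk hr
  refine ⟨b, hb, b', hb', w * v, Units.ext ?_⟩
  rw [e, rookMat, truncMat_self, mul_one, ← permGL_mul]
  simp only [Units.val_mul]

theorem exists_orbit (x : Flags K n × Flags K n × (Fin n → K)) : ∃ l, x ∈ orbit K l := by
  obtain ⟨F, F', v⟩ := x
  induction F using QuotientGroup.induction_on with
  | H g =>
  induction F' using QuotientGroup.induction_on with
  | H h =>
  obtain ⟨b, hb, b', hb', w, e⟩ := exists_bruhat (g⁻¹ * h)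
  have hx : ((g : Flags K n), (h : Flags K n), v) ∈ spanSet K w Finset.univ := by
    refine mem_spanSet.mpr ⟨b, hb, ?_, fun j hj => by simp at hj⟩
    have : h = g * b * permGL K w * b' := by
      rw [mul_assoc g, mul_assoc g, ← e, mul_inv_cancel_left]
    rw [this, flag_mul_borel _ hb']
  obtain ⟨β, hβ, -, hx⟩ := exists_mem_orbit (adm_univ w) hx
  exact ⟨_, hx⟩

instance : Finite (OrbitLabel n) :=
  Finite.of_injective (fun l : OrbitLabel n => (l.w, l.β)) fun l l' h =>
    OrbitLabel.ext' (congrArg Prod.fst h) (congrArg Prod.snd h)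

theorem eq_top_of_orbitFun_mem {S : Subalgebra ℂ (mirabolicHecke K n)}
    (h : ∀ l, orbitFun K l ∈ S) : S = ⊤ := by
  classical
  have := Fintype.ofFinite (OrbitLabel n)
  refine eq_top_iff.mpr fun f _ => ?_
  have e : f = ∑ l : OrbitLabel n, value f.1 ((1 : GL (Fin n) K) : Flags K n)
      ((permGL K l.w : GL (Fin n) K) : Flags K n) (indVec K l.β) • orbitFun K l := by
    refine mirabolic_ext fun F F' v => ?_
    rw [value_sum]
    obtain ⟨l, hl⟩ := exists_orbit (F, F', v)
    rw [Finset.sum_eq_single l]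
    · change _ = _ * value (orbitFun K l).1 F F' v
      rw [value_orbitFun, if_pos hl, mul_one]
      obtain ⟨g, h1, h2, h3⟩ := mem_orbit.mp hl
      simp only at h1 h2 h3
      have := f.2 g ((1 : GL (Fin n) K) : Flags K n) ((permGL K l.w : GL (Fin n) K) : Flags K n)
        (indVec K l.β)
      rw [← this, h1, h2, h3]
      congr 1
      change (g : Flags K n) = ((g * 1 : GL (Fin n) K) : Flags K n)
      rw [mul_one]
    · intro l' _ hne
      change _ * value (orbitFun K l').1 F F' v = 0
      rw [value_orbitFun, if_neg fun h' => hne (orbit_unique h' hl), mul_zero]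
    · simp
  rw [e]
  exact sum_mem fun l _ => Subalgebra.smul_mem _ (h l) _

end Orbits

/-! ### Generation by Hecke elements and averages over flags -/

section OrbitGeneration

variable {n : ℕ}

-- Three reductions: empty span sets are built along ascents, general ones by moving elements of D
-- downwards until D is an initial segment, and orbits by inverting the unitriangular expansion of
-- span sets. As with `rookMat_mem`, the ring is abstract so that families are covered.
open Classical in
theorem orbit_mem {E : Type*} [Ring E] (S : Subring E) {t : ℕ → E}
    {sp : Equiv.Perm (Fin n) → Finset (Fin n) → E} {ob : OrbitLabel n → E}
    (ht : ∀ i, i + 1 < n → t i ∈ S)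
    (hmul : ∀ w D i, ∀ h : i + 1 < n, w.symm ⟨i, by omega⟩ < w.symm ⟨i + 1, h⟩ →
      ((⟨i + 1, h⟩ : Fin n) ∈ D → (⟨i, by omega⟩ : Fin n) ∈ D) →
      t i * sp w D = sp (adjSwap n i * w) (D.map (adjSwap n i).toEmbedding))
    (hinit : ∀ w, sp w ∅ ∈ S → ∀ k ≤ n, sp w (initFin n k) ∈ S) (h1 : sp 1 ∅ ∈ S)
    (hsum : ∀ w D, Adm w D → sp w D = ∑ β : {β : Finset (Fin n) // β ⊆ D ∧ Adm w β},
      ob ⟨w, β.1, β.2.2⟩) (l : OrbitLabel n) : ob l ∈ S := by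
  have hempty : ∀ w, sp w ∅ ∈ S := by
    intro w
    have := ascent_induction (n := n) le_rfl (P := fun σ => sp σ⁻¹ ∅ ∈ S) (by simpa using h1)
      (fun σ i hi _ hlt h => by
        have e := hmul σ⁻¹ ∅ i hi hlt (by simp)
        rw [mul_inv_rev, Equiv.swap_inv, ← adjSwap_of_lt hi, ← Finset.map_empty
          (adjSwap n i).toEmbedding, ← e]
        exact mul_mem (ht i hi) h) w⁻¹ (fun p hp => absurd p.2 (by omega))
    simpa using this
  have hspan : ∀ (m : ℕ) (w : Equiv.Perm (Fin n)) (D : Finset (Fin n)), ∑ j ∈ D, (j : ℕ) = m → Adm w D → sp w D ∈ S := by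
    intro m
    induction m using Nat.strong_induction_on with
    | _ m ih =>
      intro w D hm hD
      by_cases hex : ∃ i, ∃ h : i + 1 < n, (⟨i, by omega⟩ : Fin n) ∉ D ∧ (⟨i + 1, h⟩ : Fin n) ∈ D
      · obtain ⟨i, hi, hi1, hi2⟩ := hex
        set x : Fin n := ⟨i, by omega⟩
        set y : Fin n := ⟨i + 1, hi⟩
        have hxy : (y : ℕ) = x + 1 := rfl
        have hne := ne_of_succ hxy
        -- Admissibility at a gap i ∉ D, i + 1 ∈ D forces this descent. So `sp w D` is `t i` times
        -- the span element of the shorter permutation, with a set of smaller sum.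
        have hlt : w.symm y < w.symm x :=
          (hD y hi2 x hi1).resolve_left (not_lt.mpr (lt_of_succ hxy).le)
        have hD' := hD.swap hxy hi1
        have hmem : ∀ j, j ∈ D.map (Equiv.swap x y).toEmbedding ↔ Equiv.swap x y j ∈ D := fun j => by
          rw [Finset.mem_map_equiv, Equiv.symm_swap]
        have hsumlt : ∑ j ∈ D.map (Equiv.swap x y).toEmbedding, (j : ℕ) < m := by
          rw [Finset.sum_map, ← hm]
          refine Finset.sum_lt_sum (fun j hj => ?_) ⟨y, hi2, ?_⟩
          · simp only [Equiv.coe_toEmbedding, Equiv.swap_apply_def]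
            split_ifs with h1 h2
            · exact absurd (h1 ▸ hj) hi1
            · subst h2; omega
            · exact le_rfl
          · simp only [Equiv.coe_toEmbedding, Equiv.swap_apply_right]
            omega
        have := hmul (Equiv.swap x y * w) (D.map (Equiv.swap x y).toEmbedding) i hi
          (by
            change (Equiv.swap x y * w).symm x < (Equiv.swap x y * w).symm y
            have e : ∀ a, (Equiv.swap x y * w).symm a = w.symm (Equiv.swap x y a) := fun a => by
              rw [Equiv.symm_apply_eq, Equiv.Perm.mul_apply, Equiv.apply_symm_apply,
                Equiv.swap_apply_self]
            rw [e, e, Equiv.swap_apply_left, Equiv.swap_apply_right]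
            exact hlt)
          (fun _ => by rw [hmem, Equiv.swap_apply_left]; exact hi2)
        rw [adjSwap_of_lt hi, ← mul_assoc, Equiv.swap_mul_self, one_mul, Finset.map_map] at this
        have e : D.map ((Equiv.swap x y).toEmbedding.trans (Equiv.swap x y).toEmbedding) = D := by
          ext j
          simp
        rw [e] at this
        rw [← this]
        exact mul_mem (ht i hi) (ih _ hsumlt _ _ rfl hD')
      · push Not at hex
        have hdown : ∀ (d : ℕ) (j : Fin n), j ∈ D → ∀ i : Fin n, (i : ℕ) + d = j → i ∈ D := by
          intro d
          induction d with
          | zero => intro j hj i h; rwa [show i = j from Fin.ext h]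
          | succ d ihd =>
            intro j hj i h
            by_contra hi
            have h1 : (i : ℕ) + 1 < n := by omega
            exact hex i h1 hi (ihd j hj ⟨i + 1, h1⟩ (by simp; omega))
        -- Without gaps D is closed downwards, hence an initial segment.
        have hDk : D = initFin n D.card := by
          have hsub : ∀ k, initFin n k ⊆ D ∨ D ⊆ initFin n k := by
            intro k
            by_cases h : D ⊆ initFin n k
            · exact Or.inr h
            · obtain ⟨j, hj, hjk⟩ := Finset.not_subset.mp h
              rw [mem_initFin] at hjk
              refine Or.inl fun i hi => ?_
              rw [mem_initFin] at hi
              exact hdown (j - i) j hj i (by omega)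
          have hcard : (initFin n D.card).card = D.card := by
            have hle : D.card ≤ n := (Finset.card_le_univ D).trans_eq (Fintype.card_fin n)
            rw [initFin, ← Fintype.card_subtype, Fintype.card_fin_lt_of_le hle]
          rcases hsub D.card with h | h
          · exact (Finset.eq_of_subset_of_card_le h hcard.ge).symm
          · exact Finset.eq_of_subset_of_card_le h hcard.le
        rw [hDk]
        exact hinit w (hempty w) _ ((Finset.card_le_univ D).trans_eq (Fintype.card_fin n))
  suffices ∀ (m : ℕ) (l : OrbitLabel n), l.β.card = m → ob l ∈ S from this _ l rfl
  intro m
  induction m using Nat.strong_induction_on with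
  | _ m ih =>
    intro l hl
    have e := hsum l.w l.β l.cond
    rw [← Finset.add_sum_erase _ _ (Finset.mem_univ ⟨l.β, subset_rfl, l.cond⟩)] at e
    have e' : ob l = _ := eq_sub_of_add_eq e.symm
    rw [e']
    refine sub_mem (hspan _ _ _ rfl l.cond) (sum_mem fun β hβ => ih _ ?_ _ rfl)
    have hne : β.1 ≠ l.β := fun h => Finset.ne_of_mem_erase hβ (Subtype.ext h)
    rw [← hl]
    exact Finset.card_lt_card (lt_of_le_of_ne β.2.1 hne)

end OrbitGeneration

/-! ### Generators of the convolution algebra -/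

section FlagGenerators

variable {K : Type} [Field K] [Fintype K] {n : ℕ}

theorem card_initFin {k : ℕ} (hk : k ≤ n) : (initFin n k).card = k := by
  rw [initFin, ← Fintype.card_subtype, Fintype.card_fin_lt_of_le hk]

/-- For an initial segment the condition on the vector depends on the first flag only. The indicator
is the average over the k-th term, rescaled by its q^k elements. -/
theorem flagMat_mul_spanMat {k : ℕ} (hk : k ≤ n) (w : Equiv.Perm (Fin n)) :
    spanMat K w (initFin n k) = cardC K ^ k • (flagMat K n k * spanMat K w ∅) := by
  classical
  refine flagVecFun_ext fun g F v => ?_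
  have h1 : value (spanMat K w (initFin n k)) (g : Flags K n) F v =
      if ∃ b ∈ borel K n, F = ((g * b * permGL K w : GL (Fin n) K) : Flags K n) then
        (if SuppIn (initFin n k) (actVec g⁻¹ v) then 1 else 0) else 0 := by
    rw [value_spanMat, ← ite_and]
    refine if_congr ?_ rfl rfl
    rw [mem_spanSet]
    constructor
    · rintro ⟨b, hb, h1, h2⟩
      rw [mul_inv_rev, actVec_mul, suppIn_borel_iff (fun _ => mem_initFin) hb] at h2
      exact ⟨⟨b, hb, h1⟩, h2⟩
    · rintro ⟨⟨b, hb, h1⟩, h2⟩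
      refine ⟨b, hb, h1, ?_⟩
      rwa [mul_inv_rev, actVec_mul, suppIn_borel_iff (fun _ => mem_initFin) hb]
  have h2 : (cardC K ^ k • (flagMat K n k * spanMat K w ∅)) (g : Flags K n) F =
      cardC K ^ k • (flagIdem k (g : Flags K n) * spanMat K w ∅ (g : Flags K n) F) := by
    rw [Matrix.smul_apply, flagMat_mul_apply]
  change value (spanMat K w (initFin n k)) (g : Flags K n) F v = _
  rw [h1, value, h2, flagIdem_mk, spanMat_empty_apply]
  split_ifs with h3 h4
  · rw [mul_one, AddMonoidAlgebra.coeff_smul, Finsupp.smul_apply, subIdem_coeff, if_pos h4,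
      card_initFin hk, smul_eq_mul, ← mul_pow, mul_inv_cancel₀ cardC_ne_zero, one_pow]
  · rw [mul_one, AddMonoidAlgebra.coeff_smul, Finsupp.smul_apply, subIdem_coeff, if_neg h4,
      smul_zero]
  · rw [mul_zero, smul_zero]
    rfl

theorem flagMat_eq {k : ℕ} (hk : k ≤ n) :
    flagMat K n k = (cardC K)⁻¹ ^ k • spanMat K (1 : Equiv.Perm (Fin n)) (initFin n k) := by
  rw [flagMat_mul_spanMat hk, spanMat_one_empty, mul_one, smul_smul, ← mul_pow,
    inv_mul_cancel₀ cardC_ne_zero, one_pow, one_smul]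

/-- The Hecke generators in the algebra of invariant functions. -/
def mirT (K : Type) [Field K] [Finite K] (n i : ℕ) : mirabolicHecke K n :=
  spanFun K (adjSwap n i) ∅

/-- The averages of the terms of flags in the algebra of invariant functions. -/
def mirF (K : Type) [Field K] [Finite K] (n k : ℕ) : mirabolicHecke K n :=
  (cardC K)⁻¹ ^ k • spanFun K 1 (initFin n k)

theorem mirF_val {k : ℕ} (hk : k ≤ n) : (mirF K n k).1 = flagMat K n k := (flagMat_eq hk).symm

theorem miraData_mir (K : Type) [Field K] [Finite K] (n : ℕ) :
    MiraData (cardC K) n (mirT K n) (mirF K n) := by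
  have := Fintype.ofFinite K
  have h := miraData_flag K n
  exact
    { hecke :=
        { quad := fun i hi => Subtype.ext (h.hecke.quad i hi)
          braid := fun i hi => Subtype.ext (h.hecke.braid i hi)
          comm := fun i j hi hj => Subtype.ext (h.hecke.comm i j hi hj) }
      bot := Subtype.ext ((mirF_val (Nat.zero_le n)).trans h.bot)
      mul := fun j hj k hk => Subtype.ext (by
        rw [MulMemClass.coe_mul, mirF_val hj, mirF_val hk, mirF_val (max_le hj hk), h.mul j hj k hk])
      comm := fun k hk i hi hik => Subtype.ext (by
        rw [MulMemClass.coe_mul, MulMemClass.coe_mul, mirF_val hk]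
        exact h.comm k hk i hi hik)
      sandwich := fun i hi => Subtype.ext (by
        rw [MulMemClass.coe_mul, MulMemClass.coe_mul, MulMemClass.coe_mul, mirF_val hi.le,
          mirF_val (show i + 2 ≤ n from hi)]
        exact h.sandwich i hi)
      flag := fun i hi => Subtype.ext (by
        have e1 : (mirF K n (i + 1)).1 = _ := mirF_val hi.le
        have e0 : (mirF K n i).1 = _ := mirF_val (by omega)
        have e2 : (mirF K n (i + 2)).1 = _ := mirF_val (show i + 2 ≤ n from hi)
        change (1 + flagT K n i) * (mirF K n (i + 1)).1 * (1 + flagT K n i) =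
          (1 + flagT K n i) * ((mirF K n i).1 + cardC K • (mirF K n (i + 2)).1)
        rw [e0, e1, e2]
        exact h.flag i hi) }

end FlagGenerators

section FlagGenerators

variable {K : Type} [Field K] [Finite K] {n : ℕ}

theorem mirT_mul_spanFun {w : Equiv.Perm (Fin n)} {D : Finset (Fin n)} {i : ℕ} (h : i + 1 < n)
    (hw : w.symm ⟨i, by omega⟩ < w.symm ⟨i + 1, h⟩)
    (hD : (⟨i + 1, h⟩ : Fin n) ∈ D → (⟨i, by omega⟩ : Fin n) ∈ D) :
    mirT K n i * spanFun K w D =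
      spanFun K (adjSwap n i * w) (D.map (adjSwap n i).toEmbedding) :=
  by
  have := Fintype.ofFinite K
  exact Subtype.ext (flagT_mul_spanMat h hw hD)

theorem mirF_mul_spanFun {k : ℕ} (hk : k ≤ n) (w : Equiv.Perm (Fin n)) :
    spanFun K w (initFin n k) = cardC K ^ k • (mirF K n k * spanFun K w ∅) :=
  Subtype.ext (by
    have := Fintype.ofFinite K
    change spanMat K w (initFin n k) = cardC K ^ k • ((mirF K n k).1 * spanMat K w ∅)
    rw [mirF_val hk, flagMat_mul_spanMat hk])

theorem spanFun_one : spanFun K (1 : Equiv.Perm (Fin n)) ∅ = 1 := Subtype.ext spanMat_one_empty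

theorem adm_empty (w : Equiv.Perm (Fin n)) : Adm w ∅ := fun i hi => by simp at hi

end FlagGenerators

/-! ### Faithfulness on the convolution algebra -/

section MiraModel

variable {F : Type*} [Field F] {n : ℕ}

theorem rankBelow_of_subset {r i : ℕ} {I : Finset ℕ} (h : Finset.range r ⊆ I) (hi : i ≤ r) :
    rankBelow I i = i := by
  have : I.filter (· < i) = Finset.range i := by
    ext j
    rw [Finset.mem_filter, Finset.mem_range]
    exact ⟨fun h => h.2, fun hj => ⟨h (Finset.mem_range.mpr (by omega)), hj⟩⟩
  rw [rankBelow, this, Finset.card_range]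

/-- If the subset contains the first r indices, their ranks in it are the indices themselves. So H_r
acts on that diagonal entry through its inclusion into the larger Hecke algebra of the block. -/
theorem model_hecke_mul_single_of_subset {q : F} {r : ℕ} {ι : heckeAlg n q r →ₐ[F] Model n q}
    (hr : r ≤ n) (hι : ∀ i, ∀ hi : i + 1 < r, ι ⟨heckeGen n q i, mem_parab hi⟩ = modelT n q i)
    {j : Fin (n + 1)} (hj : r ≤ j) (I : Sub n j) (hI : Finset.range r ⊆ I.1)
    (y : heckeAlg n q r) : ι y j * Matrix.single I I 1 =
      Matrix.single I I ⟨y.1, parab_mono hj y.2⟩ := by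
  classical
  obtain ⟨y, hy⟩ := y
  suffices ∃ h' : y ∈ heckeAlg n q r, ι ⟨y, h'⟩ j * Matrix.single I I 1 =
      Matrix.single I I (⟨y, parab_mono hj h'⟩ : heckeAlg n q j) from this.2
  refine parab_induction (p := fun y => ∃ h' : y ∈ heckeAlg n q r, ι ⟨y, h'⟩ j * Matrix.single I I 1 =
      Matrix.single I I (⟨y, parab_mono hj h'⟩ : heckeAlg n q j)) ?_ ?_ ?_ ?_ hy
  · refine ⟨one_mem _, ?_⟩
    have : ι ⟨1, one_mem _⟩ = 1 := map_one ι
    rw [this, Pi.one_apply, one_mul]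
    rfl
  · rintro a b ⟨ha, ha'⟩ ⟨hb, hb'⟩
    refine ⟨add_mem ha hb, ?_⟩
    have : ι ⟨a + b, add_mem ha hb⟩ = ι ⟨a, ha⟩ + ι ⟨b, hb⟩ := map_add ι ⟨a, ha⟩ ⟨b, hb⟩
    rw [this, Pi.add_apply, add_mul, ha', hb', ← Matrix.single_add]
    rfl
  · rintro c a ⟨ha, ha'⟩
    refine ⟨Subalgebra.smul_mem _ ha c, ?_⟩
    have : ι ⟨c • a, Subalgebra.smul_mem _ ha c⟩ = c • ι ⟨a, ha⟩ := map_smul ι c ⟨a, ha⟩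
    rw [this, Pi.smul_apply, smul_mul_assoc, ha', Matrix.smul_single]
    rfl
  · rintro i hi a - ⟨ha, ha'⟩
    refine ⟨mul_mem (mem_parab hi) ha, ?_⟩
    have : ι ⟨heckeGen n q i * a, mul_mem (mem_parab hi) ha⟩ =
        ι ⟨heckeGen n q i, mem_parab hi⟩ * ι ⟨a, ha⟩ := map_mul ι ⟨_, mem_parab hi⟩ ⟨_, ha⟩
    rw [this, hι i hi, Pi.mul_apply, mul_assoc, ha', modelT,
      subGen_mul_single_both (by omega) (hI (Finset.mem_range.mpr (by omega)))
      (hI (Finset.mem_range.mpr hi)),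
      rankBelow_of_subset hI (by omega), hGen_of_lt q (by omega)]
    rfl

theorem subDiag_eq_sum {r : ℕ} {H : Type*} [Ring H] (P : Finset ℕ → Prop) [DecidablePred P] :
    subDiag n r H P = ∑ I : Sub n r, if P I.1 then Matrix.single I I 1 else 0 := by
  classical
  refine Matrix.ext fun J L => ?_
  rw [Matrix.sum_apply, subDiag, Matrix.diagonal_apply, Finset.sum_eq_single J]
  · by_cases h : P J.1 <;> simp [h, Matrix.single_apply]
  · intro I _ hI
    split_ifs
    · rw [Matrix.single_apply_of_ne]
      exact fun h => hI h.1
    · rfl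
  · simp

theorem sum_sub_apply {M : Type*} [AddCommMonoid M] (g : Finset ℕ → M) :
    ∑ j : Fin (n + 1), ∑ I : Sub n j, g I.1 = ∑ I ∈ (Finset.range n).powerset, g I := by
  rw [Finset.sum_powerset, Finset.card_range, ← Fin.sum_univ_eq_sum_range
    (fun j => ∑ I ∈ (Finset.range n).powersetCard j, g I)]
  exact Finset.sum_congr rfl fun j _ => Finset.sum_coe_sort _ g

/-- Passing to complements, this is the binomial expansion of ((q - 1) + 1)^(n-r). It suggests the
values of the trace on the individual corners. -/
theorem sum_superset (q : F) {r : ℕ} (hr : r ≤ n) :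
    ∑ I ∈ (Finset.range n).powerset, (if Finset.range r ⊆ I then (q - 1) ^ (n - I.card) else 0) =
      q ^ (n - r) := by
  have h : Finset.range r ⊆ Finset.range n := Finset.range_subset_range.mpr hr
  have e := Finset.sum_pow_mul_eq_add_pow (q - 1) 1 (Finset.range n \ Finset.range r)
  rw [Finset.card_sdiff_of_subset h, Finset.card_range, Finset.card_range, sub_add_cancel] at e
  rw [← e, ← Finset.sum_filter]
  refine Finset.sum_bij' (fun I _ => Finset.range n \ I) (fun I _ => Finset.range n \ I)
    ?_ ?_ ?_ ?_ ?_
  · intro I hI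
    rw [Finset.mem_filter] at hI
    exact Finset.mem_powerset.mpr (Finset.sdiff_subset_sdiff subset_rfl hI.2)
  · intro I hI
    rw [Finset.mem_powerset] at hI
    rw [Finset.mem_filter, Finset.mem_powerset]
    refine ⟨Finset.sdiff_subset, fun i hi => Finset.mem_sdiff.mpr ⟨h hi, fun h' => ?_⟩⟩
    exact (Finset.mem_sdiff.mp (hI h')).2 hi
  · intro I hI
    rw [Finset.mem_filter, Finset.mem_powerset] at hI
    exact Finset.sdiff_sdiff_eq_self hI.1
  · intro I hI
    rw [Finset.mem_powerset] at hI
    exact Finset.sdiff_sdiff_eq_self (hI.trans Finset.sdiff_subset)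
  · intro I hI
    rw [Finset.mem_filter, Finset.mem_powerset] at hI
    rw [one_pow, mul_one, Finset.card_sdiff_of_subset hI.1, Finset.card_range]

/-- A trace functional on the model algebra which is a multiple of the trace of each Hecke algebra on
`ι(y) f_r`. -/
theorem trace_corner {q : F} {s : Model n q →ₗ[F] F} (hs : ∀ a b, s (a * b) = s (b * a)) {N : F}
    (hq : q ≠ 0)
    (h : ∀ r ≤ n, ∀ ι : heckeAlg n q r →ₐ[F] Model n q,
      (∀ i, ∀ hi : i + 1 < r, ι ⟨heckeGen n q i, mem_parab hi⟩ = modelT n q i) →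
        ∀ y : heckeAlg n q r, s (ι y * modelF n q r) = N * q⁻¹ ^ r * y.1 id id)
    (d : ℕ) (r : Fin (n + 1)) (hd : (r : ℕ) + d = n) (I : Sub n r) (y : heckeAlg n q r) :
    s (Pi.single r (Matrix.single I I y)) = N * (q - 1) ^ d * q⁻¹ ^ n * y.1 id id := by
  classical
  induction d using Nat.strong_induction_on generalizing r with
  | _ d ih =>
    have hr : (r : ℕ) ≤ n := by omega
    -- The trace property makes the value independent of the diagonal position, so the initial
    -- subset may be taken.
    have hind : ∀ J : Sub n r, s (Pi.single r (Matrix.single I I y)) =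
        s (Pi.single r (Matrix.single J J y)) := by
      intro J
      have e1 : (Pi.single r (Matrix.single I I y) : Model n q) =
          Pi.single r (Matrix.single I J y) * Pi.single r (Matrix.single J I 1) := by
        rw [← Pi.single_mul, Matrix.single_mul_single_same, mul_one]
      have e2 : (Pi.single r (Matrix.single J J y) : Model n q) =
          Pi.single r (Matrix.single J I 1) * Pi.single r (Matrix.single I J y) := by
        rw [← Pi.single_mul, Matrix.single_mul_single_same, one_mul]
      rw [e1, e2, hs]
    rw [hind (initSub hr)]
    obtain ⟨ι, hι⟩ := exists_model_hecke (n := n) q hr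
    -- `S` collects the actual traces of the components of ι(y) f_r and `G` the predicted ones. The
    -- totals agree by hypothesis and by `sum_superset`, all terms except the initial subset of
    -- block r agree by induction, so the last terms agree.
    let S : (Σ j : Fin (n + 1), Sub n j) → F := fun p => s (Pi.single p.1
      (ι y p.1 * if Finset.range r ⊆ p.2.1 then Matrix.single p.2 p.2 1 else 0))
    let G : (Σ j : Fin (n + 1), Sub n j) → F := fun p =>
      N * q⁻¹ ^ n * y.1 id id * if Finset.range r ⊆ p.2.1 then (q - 1) ^ (n - p.2.1.card) else 0
    have hS : ∑ p, S p = N * q⁻¹ ^ (r : ℕ) * y.1 id id := by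
      rw [← h r hr ι hι y, Fintype.sum_sigma, ← Finset.univ_sum_single (ι y * modelF n q r), map_sum]
      refine Finset.sum_congr rfl fun j _ => ?_
      rw [Pi.mul_apply, modelF, subDiag_eq_sum, Finset.mul_sum]
      have e : ∀ f : Sub n j → Matrix (Sub n j) (Sub n j) (heckeAlg n q j),
          (Pi.single j (∑ I, f I) : Model n q) = ∑ I, Pi.single j (f I) := fun f =>
        map_sum (AddMonoidHom.single (fun j : Fin (n + 1) =>
          Matrix (Sub n j) (Sub n j) (heckeAlg n q j)) j) f _
      rw [e, map_sum]
    have hG : ∑ p, G p = N * q⁻¹ ^ (r : ℕ) * y.1 id id := by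
      rw [← Finset.mul_sum, Fintype.sum_sigma, sum_sub_apply
        (fun I => if Finset.range r ⊆ I then (q - 1) ^ (n - I.card) else 0), sum_superset q hr]
      have : q⁻¹ ^ n * q ^ (n - r) = q⁻¹ ^ (r : ℕ) := by
        have e : q⁻¹ ^ n = q⁻¹ ^ (n - (r : ℕ)) * q⁻¹ ^ (r : ℕ) := by
          rw [← pow_add]
          congr 1
          omega
        rw [e, mul_right_comm, ← mul_pow, inv_mul_cancel₀ hq, one_pow, one_mul]
      rw [← this]
      ring
    have hSG : ∀ p, p ≠ ⟨r, initSub hr⟩ → S p = G p := by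
      rintro ⟨j, I⟩ hne
      by_cases hI : Finset.range r ⊆ I.1
      · have hc := (Finset.mem_powersetCard.mp I.2).2
        have hle : (r : ℕ) ≤ j := by
          have := Finset.card_le_card hI
          rwa [Finset.card_range, hc] at this
        have hlt : (r : ℕ) < j := by
          refine lt_of_le_of_ne hle fun e => hne ?_
          obtain rfl : r = j := Fin.ext e
          congr 1
          refine Subtype.ext (Finset.eq_of_subset_of_card_le hI ?_).symm
          rw [hc, Finset.card_range]
        simp only [S, G, if_pos hI]
        rw [model_hecke_mul_single_of_subset hr hι hle I hI,
          ih (n - j) (by omega) j (by omega) I, hc]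
        ring
      · simp only [S, G, if_neg hI, mul_zero, Pi.single_zero, map_zero]
    have hfin : S ⟨r, initSub hr⟩ = G ⟨r, initSub hr⟩ := by
      rw [← Finset.add_sum_erase _ _ (Finset.mem_univ ⟨r, initSub hr⟩)] at hS hG
      rw [Finset.sum_congr rfl fun p hp => hSG p (Finset.ne_of_mem_erase hp)] at hS
      exact add_right_cancel (hS.trans hG.symm)
    have hsub : Finset.range r ⊆ (initSub hr).1 := subset_rfl
    have hc : (initSub hr).1.card = r := Finset.card_range _
    simp only [S, G, if_pos hsub] at hfin
    rw [model_hecke_mul_single_of_subset hr hι le_rfl _ hsub, hc] at hfin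
    refine hfin.trans ?_
    rw [show n - (r : ℕ) = d by omega]
    ring

end MiraModel

section MiraFaithful

variable {K : Type} [Field K] [Finite K] {n : ℕ}

/-- The functional `f ↦ ∑_F f(F, F, 0)`. -/
def traceZero (K : Type) [Field K] [Finite K] (n : ℕ) : mirabolicHecke K n →ₗ[ℂ] ℂ where
  toFun f := (Matrix.trace f.1).coeff 0
  map_add' f g := by
    change (Matrix.trace (f.1 + g.1)).coeff 0 = _
    rw [Matrix.trace_add, AddMonoidAlgebra.coeff_add, Finsupp.add_apply]
  map_smul' c f := by
    change (Matrix.trace (c • f.1)).coeff 0 = _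
    rw [Matrix.trace_smul, AddMonoidAlgebra.coeff_smul, Finsupp.smul_apply]
    rfl

theorem traceZero_mul_comm (f g : mirabolicHecke K n) :
    traceZero K n (f * g) = traceZero K n (g * f) := by
  change (Matrix.trace (f.1 * g.1)).coeff 0 = (Matrix.trace (g.1 * f.1)).coeff 0
  rw [Matrix.trace_mul_comm]

theorem spanMat_empty_diag {w : Equiv.Perm (Fin n)} (hw : w ≠ 1) (F : Flags K n) :
    spanMat K w ∅ F F = 0 := by
  classical
  induction F using QuotientGroup.induction_on with
  | H g =>
  rw [spanMat_empty_apply, if_neg]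
  rintro ⟨b, hb, e⟩
  obtain ⟨b', hb', e'⟩ := flag_eq_iff.mp e
  refine hw (perm_eq_of_borel (K := K) (w' := 1) hb (inv_mem hb') ?_)
  rw [mul_inv_eq_iff_eq_mul, permGL_one, one_mul]
  rw [mul_assoc] at e'
  exact mul_left_cancel e'

theorem traceZero_spanFun_mul {w : Equiv.Perm (Fin n)} (hw : w ≠ 1) {k : ℕ} (hk : k ≤ n) :
    traceZero K n (spanFun K w ∅ * mirF K n k) = 0 := by
  have := Fintype.ofFinite K
  change (Matrix.trace (spanMat K w ∅ * (mirF K n k).1)).coeff 0 = 0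
  rw [mirF_val hk, flagMat, Matrix.trace]
  simp [Matrix.diag_apply, Matrix.mul_diagonal, spanMat_empty_diag hw]

theorem traceZero_mirF {k : ℕ} (hk : k ≤ n) :
    traceZero K n (mirF K n k) = (Fintype.card (Flags K n) : ℂ) * (cardC K)⁻¹ ^ k := by
  classical
  have := Fintype.ofFinite K
  change (Matrix.trace (mirF K n k).1).coeff 0 = _
  rw [mirF_val hk, flagMat, Matrix.trace_diagonal, AddMonoidAlgebra.coeff_sum,
    Finsupp.finsetSum_apply, Finset.sum_congr rfl (g := fun _ => (cardC K)⁻¹ ^ k), Finset.sum_const,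
    Finset.card_univ, nsmul_eq_mul]
  intro F _
  rw [flagIdem, subIdem_coeff, if_pos, card_initFin hk]
  intro j _
  simp

/-- The functional `traceZero` sees only the identity permutation in the expansion of ι(y) f_r, so
`trace_corner` applies with N the number of flags. On a corner in the kernel it would give a nonzero
multiple of the nonzero canonical trace. -/
theorem injective_of_mira (φ : Model n (cardC K) →ₐ[ℂ] mirabolicHecke K n)
    (hT : ∀ i, i + 1 < n → φ (modelT n (cardC K) i) = mirT K n i)
    (hF : ∀ k ≤ n, φ (modelF n (cardC K) k) = mirF K n k) : Function.Injective φ := by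
  classical
  rw [injective_iff_map_eq_zero]
  intro x hx
  by_contra hne
  have hq : cardC K ≠ 0 := cardC_ne_zero
  obtain ⟨r, y, hy, hφ⟩ := exists_corner_mem hq φ hne hx
  have key := trace_corner (s := (traceZero K n).comp φ.toLinearMap)
    (N := (Fintype.card (Flags K n) : ℂ)) (fun a b => by
      change traceZero K n (φ (a * b)) = traceZero K n (φ (b * a))
      rw [map_mul φ, map_mul φ, traceZero_mul_comm]) hq ?_ (n - r) r (by omega)
      (initSub (Nat.le_of_lt_succ r.2)) y
  · have h0 : ((traceZero K n).comp φ.toLinearMap) (Pi.single r (Matrix.single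
        (initSub (Nat.le_of_lt_succ r.2)) (initSub (Nat.le_of_lt_succ r.2)) y)) = 0 := by
      change traceZero K n (φ _) = 0
      rw [hφ, map_zero]
    rw [h0] at key
    -- The factor (q - 1)^(n-r) is nonzero because a field has at least two elements.
    have hq1 : cardC K - 1 ≠ 0 := by
      rw [sub_ne_zero, cardC, Nat.cast_ne_one]
      exact Finite.one_lt_card.ne'
    have hN : (Fintype.card (Flags K n) : ℂ) ≠ 0 := Nat.cast_ne_zero.mpr Fintype.card_ne_zero
    exact mul_ne_zero (mul_ne_zero (mul_ne_zero hN (pow_ne_zero _ hq1))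
      (pow_ne_zero _ (inv_ne_zero hq))) hy key.symm
  · intro r hr ι hι y
    obtain ⟨c, -, hexp⟩ := hecke_expansion one_ne_zero hr (β := φ.comp ι)
      (a := fun σ => spanFun K σ⁻¹ ∅) (by rw [inv_one, spanFun_one])
      (fun σ i hi hf hlt => by
        have hin : i + 1 < n := by omega
        rw [AlgHom.comp_apply, hι i hi, hT i hin,
          mirT_mul_spanFun (w := σ⁻¹) hin hlt (by simp),
          Finset.map_empty, one_smul, adjSwap_of_lt hin, mul_inv_rev, Equiv.swap_inv])
    have hexp' : ∀ y : heckeAlg n (cardC K) r, traceZero K n (φ (ι y) * mirF K n r) =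
        y.1 id id * c 1 * ((Fintype.card (Flags K n) : ℂ) * (cardC K)⁻¹ ^ r) := by
      intro y
      rw [show φ (ι y) = _ from (hexp y).2, Finset.sum_mul, map_sum, Finset.sum_eq_single 1]
      · rw [smul_mul_assoc, map_smul, inv_one, spanFun_one, one_mul, traceZero_mirF hr, smul_eq_mul]
        rfl
      · intro σ _ hσ
        rw [smul_mul_assoc, map_smul, traceZero_spanFun_mul (inv_ne_one.mpr hσ) hr, smul_zero]
      · simp
    -- The constant of the identity permutation is fixed by evaluating at y = 1.
    have hc : c 1 = 1 := by
      have h1 := hexp' 1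
      rw [map_one, map_one, one_mul, traceZero_mirF hr] at h1
      have hne : (Fintype.card (Flags K n) : ℂ) * (cardC K)⁻¹ ^ r ≠ 0 :=
        mul_ne_zero (Nat.cast_ne_zero.mpr Fintype.card_ne_zero) (pow_ne_zero _ (inv_ne_zero hq))
      have h2 : (1 : heckeAlg n (cardC K) r).1 id id = 1 := Matrix.one_apply_eq _
      rw [h2, one_mul] at h1
      exact mul_right_cancel₀ hne (h1.symm.trans (one_mul _).symm)
    change traceZero K n (φ (ι y * modelF n (cardC K) r)) = _
    rw [map_mul φ, hF r hr, hexp', hc]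
    ring

end MiraFaithful

/-! ### Generation of the two families of algebras -/

section Generation

variable {B : Type*} [CommRing B] {E : Type*} [Ring E] [Algebra B E] {S : Subalgebra B E} {n : ℕ}
  {q q' : B}

/-- By the quadratic relation `s i` has the inverse q s - (q - 1), so no hypothesis beyond the
invertibility of q is needed, and the argument works over the Laurent polynomials as well. -/
theorem rookMat_mem_subalgebra (hq : q' * q = 1) {a : Equiv.Perm (Fin n) → ℕ →
    Equiv.Perm (Fin n) → E} {s : ℕ → E}
    (hS : ∀ i, i + 1 < n → (q - 1) • (1 : E) - q • s i ∈ S)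
    (hquad : ∀ i, i + 1 < n → s i * s i = q' • (1 + (q - 1) • s i))
    (hl : ∀ w k v i, ∀ h : i + 1 < n, LeftGood w k v ⟨i, by omega⟩ ⟨i + 1, h⟩ →
      s i * a w k v = a (adjSwap n i * w) k v)
    (hr : ∀ w k v i, ∀ h : i + 1 < n, RightGood w k v ⟨i, by omega⟩ ⟨i + 1, h⟩ →
      a w k v * s i = a w k (v * adjSwap n i))
    {k : ℕ} (hk : a 1 k 1 ∈ S) (w v : Equiv.Perm (Fin n)) : a w k v ∈ S := by
  have hs : ∀ i, i + 1 < n → s i ∈ S := fun i hi => by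
    have e : s i = q' • ((q - 1) • (1 : E) - ((q - 1) • (1 : E) - q • s i)) := by
      rw [sub_sub_cancel, smul_smul, hq, one_smul]
    rw [e]
    exact S.smul_mem (S.sub_mem (S.smul_mem S.one_mem _) (hS i hi)) _
  have hone : ∀ x y : E, x * x = q' • (1 + (q - 1) • x) → y = q • x - (q - 1) • 1 →
      y * x = 1 ∧ x * y = 1 := by
    rintro x _ hx rfl
    have e : q • (x * x) - (q - 1) • x = 1 := by
      rw [hx, smul_smul, mul_comm, hq, one_smul, add_sub_cancel_right]
    constructor
    · rw [sub_mul, smul_mul_assoc, smul_mul_assoc, one_mul, e]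
    · rw [mul_sub, mul_smul_comm, mul_smul_comm, mul_one, e]
  exact rookMat_mem S.toSubring (a := a) (s := s) (s' := fun i => q • s i - (q - 1) • 1) hs
    (fun i hi => S.sub_mem (S.smul_mem (hs i hi) _) (S.smul_mem S.one_mem _))
    (fun i hi => (hone _ _ (hquad i hi) rfl).1) (fun i hi => (hone _ _ (hquad i hi) rfl).2)
    hl hr hk w v

theorem orbit_mem_subalgebra {t f : ℕ → E} {sp : Equiv.Perm (Fin n) → Finset (Fin n) → E}
    {ob : OrbitLabel n → E} (ht : ∀ i, i + 1 < n → t i ∈ S) (hf : ∀ k ≤ n, f k ∈ S)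
    (hmul : ∀ w D i, ∀ h : i + 1 < n, w.symm ⟨i, by omega⟩ < w.symm ⟨i + 1, h⟩ →
      ((⟨i + 1, h⟩ : Fin n) ∈ D → (⟨i, by omega⟩ : Fin n) ∈ D) →
      t i * sp w D = sp (adjSwap n i * w) (D.map (adjSwap n i).toEmbedding))
    (hinit : ∀ w, ∀ k ≤ n, sp w (initFin n k) = q ^ k • (f k * sp w ∅)) (h1 : sp 1 ∅ = 1)
    (hsum : ∀ w D, Adm w D → sp w D = open Classical in
      ∑ β : {β : Finset (Fin n) // β ⊆ D ∧ Adm w β}, ob ⟨w, β.1, β.2.2⟩) (l : OrbitLabel n) :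
    ob l ∈ S :=
  orbit_mem S.toSubring ht hmul (fun w hw k hk => by
    rw [hinit w k hk]
    exact S.smul_mem (S.mul_mem (hf k hk) hw) _) (by rw [h1]; exact S.one_mem) hsum l

end Generation

/-! ### The isomorphisms over finite fields -/

section FiniteField

variable (K : Type) [Field K] [Finite K] (n : ℕ)

/-- The parameter is a variable equal to `cardC K`, so that the statement applies directly to the
specialization of 𝐪 at a prime power. -/
theorem exists_bijective_qRook {q : ℂ} (hq : q = cardC K) :
    ∃ φ : Model n q →ₐ[ℂ] qRook K n, Function.Bijective φ ∧
      (∀ i, i + 1 < n → φ (modelT n q i) = (q - 1) • 1 - q • rookS K n i) ∧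
        ∀ k ≤ n, φ (modelD n q k) = rookD K n k := by
  subst hq
  obtain ⟨φ, hT, hD⟩ := (rookData_rook K n).exists_algHom cardC_ne_zero
  refine ⟨φ, ⟨injective_of_rook φ hT hD, ?_⟩, hT, hD⟩
  rw [← AlgHom.range_eq_top]
  refine eq_top_of_avg_rookMat_mem fun w v k hk =>
    rookMat_mem_subalgebra (S := φ.range) (a := fun w k v => avg (rookMat K w k v)) (s := rookS K n)
      (q' := (cardC K)⁻¹) (q := cardC K) (inv_mul_cancel₀ cardC_ne_zero)
      (fun i hi => ⟨_, hT i hi⟩) (fun i hi => ?_) (fun w k v i hi hg => avg_rookMat_of_leftGood hi hg)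
      (fun w k v i hi hg => avg_rookMat_of_rightGood hi hg) ⟨modelD n _ k, ?_⟩ w v
  · rw [rookS_of_lt hi]
    exact avg_swap_mul_self rfl
  · exact (hD k hk).trans (by rw [rookMat_one_one, rookD])

theorem exists_bijective_mirabolicHecke {q : ℂ} (hq : q = cardC K) :
    ∃ φ : Model n q →ₐ[ℂ] mirabolicHecke K n, Function.Bijective φ ∧
      (∀ i, i + 1 < n → φ (modelT n q i) = mirT K n i) ∧
        ∀ k ≤ n, φ (modelF n q k) = mirF K n k := by
  subst hq
  obtain ⟨φ, hT, hF⟩ := (miraData_mir K n).exists_algHom cardC_ne_zero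
  refine ⟨φ, ⟨injective_of_mira φ hT hF, ?_⟩, hT, hF⟩
  rw [← AlgHom.range_eq_top]
  exact eq_top_of_orbitFun_mem fun l =>
    orbit_mem_subalgebra (S := φ.range) (q := cardC K) (t := mirT K n) (f := mirF K n) (sp := spanFun K)
      (fun i hi => ⟨_, hT i hi⟩) (fun k hk => ⟨_, hF k hk⟩)
      (fun w D i h hw hD => mirT_mul_spanFun h hw hD) (fun w k hk => mirF_mul_spanFun hk w)
      spanFun_one (fun w D hD => spanFun_eq_sum hD) l

theorem nonempty_algEquiv_finiteField : Nonempty (qRook K n ≃ₐ[ℂ] mirabolicHecke K n) := by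
  obtain ⟨φ, hφ, -⟩ := exists_bijective_qRook K n rfl
  obtain ⟨ψ, hψ, -⟩ := exists_bijective_mirabolicHecke K n rfl
  exact ⟨(AlgEquiv.ofBijective φ hφ).symm.trans (AlgEquiv.ofBijective ψ hψ)⟩

end FiniteField

/-! ### The algebras over the Laurent polynomials -/

section Laurent

theorem specialize_T (z : ℂˣ) : specialize z (LaurentPolynomial.T 1) = z := by
  rw [specialize, LaurentPolynomial.eval₂_T, zpow_one]

theorem specialize_qAt (i : PrimePowers) :
    specialize (qAt i) (LaurentPolynomial.T 1) = cardC (FieldAt i) := by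
  rw [specialize_T, cardC, GaloisField.card _ _ (Nat.succ_ne_zero _), Nat.cast_pow]
  rfl

/-- After multiplication by a power of T this is a polynomial having all primes as roots. -/
theorem eq_zero_of_specialize {a : ℂ[T;T⁻¹]} (h : ∀ i, specialize (qAt i) a = 0) : a = 0 := by
  obtain ⟨m, f, hf⟩ := a.exists_T_pow
  have hf0 : f = 0 := by
    refine Polynomial.eq_zero_of_infinite_isRoot f ?_
    have hinj : Function.Injective fun p : Nat.Primes => ((qAt (p, 0) : ℂˣ) : ℂ) := by
      intro p p' e
      have e' : (((p : ℕ) : ℂ) ^ (0 + 1)) = (((p' : ℕ) : ℂ) ^ (0 + 1)) := e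
      rw [zero_add, pow_one, pow_one] at e'
      exact Subtype.ext (Nat.cast_injective e')
    refine (Set.infinite_range_of_injective hinj).mono ?_
    rintro _ ⟨p, rfl⟩
    have e := LaurentPolynomial.eval₂_toLaurent (RingHom.id ℂ) (qAt (p, 0)) f
    rw [hf, map_mul] at e
    have h0 := h (p, 0)
    rw [specialize] at h0
    rw [h0, zero_mul, ← Polynomial.eval, eq_comm] at e
    exact e
  rw [hf0, map_zero] at hf
  exact ((LaurentPolynomial.isUnit_T m).mul_left_eq_zero).mp hf.symm

variable {D : PrimePowers → Type} [∀ i, Ring (D i)] [∀ i, Algebra ℂ (D i)] {n : ℕ}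

theorem primePowerProd_smul_apply (c : ℂ[T;T⁻¹]) (x : PrimePowerProd D) (i : PrimePowers) :
    (c • x) i = specialize (qAt i) c • x i := by
  rw [Algebra.smul_def, Algebra.smul_def]
  rfl

theorem primePowerProd_sub_apply (x y : PrimePowerProd D) (i : PrimePowers) :
    (x - y) i = x i - y i := rfl

theorem primePowerProd_add_apply (x y : PrimePowerProd D) (i : PrimePowers) :
    (x + y) i = x i + y i := rfl

theorem primePowerProd_mul_apply (x y : PrimePowerProd D) (i : PrimePowers) :
    (x * y) i = x i * y i := rfl

theorem primePowerProd_one_apply (i : PrimePowers) : (1 : PrimePowerProd D) i = 1 := rfl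

theorem modelMap_eq_zero {x : Model n (LaurentPolynomial.T 1 : ℂ[T;T⁻¹])}
    (h : ∀ i, modelMap n (specialize (qAt i)) (LaurentPolynomial.T 1) x = 0) : x = 0 := by
  ext r I J : 3
  refine Matrix.ext fun a b => ?_
  change (x r I J).1 a b = 0
  refine eq_zero_of_specialize fun i => ?_
  have e := congrFun (congrFun (congrFun (h i) r) I) J
  rw [modelMap_apply] at e
  exact congrFun (congrFun (congrArg Subtype.val e) a) b

/-- The family of specializations of an element of the generic model algebra. -/
def familyHom (φ : ∀ i, Model n (specialize (qAt i) (LaurentPolynomial.T 1)) →ₐ[ℂ] D i) :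
    Model n (LaurentPolynomial.T 1 : ℂ[T;T⁻¹]) →ₐ[ℂ[T;T⁻¹]] PrimePowerProd D :=
  AlgHom.ofLinearMap
    { toFun := fun x i => φ i (modelMap n (specialize (qAt i)) (LaurentPolynomial.T 1) x)
      map_add' := fun x y => funext fun i => by
        rw [map_add, map_add]
        rfl
      map_smul' := fun c x => funext fun i => by
        rw [modelMap_smul, map_smul]
        exact (primePowerProd_smul_apply c (fun i => φ i (modelMap n _ _ x) : PrimePowerProd D) i).symm }
    (funext fun i => by
      change φ i (modelMap n _ _ 1) = 1
      rw [map_one, map_one])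
    (fun x y => funext fun i => by
      change φ i (modelMap n _ _ (x * y)) = φ i (modelMap n _ _ x) * φ i (modelMap n _ _ y)
      rw [map_mul, map_mul])

theorem familyHom_apply
    (φ : ∀ i, Model n (specialize (qAt i) (LaurentPolynomial.T 1)) →ₐ[ℂ] D i)
    (x : Model n (LaurentPolynomial.T 1 : ℂ[T;T⁻¹])) (i : PrimePowers) :
    familyHom φ x i = φ i (modelMap n (specialize (qAt i)) (LaurentPolynomial.T 1) x) := rfl

theorem familyHom_injective
    {φ : ∀ i, Model n (specialize (qAt i) (LaurentPolynomial.T 1)) →ₐ[ℂ] D i}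
    (h : ∀ i, Function.Injective (φ i)) : Function.Injective (familyHom φ) := by
  rw [injective_iff_map_eq_zero]
  intro x hx
  refine modelMap_eq_zero fun i => (injective_iff_map_eq_zero (φ i)).mp (h i) _ ?_
  exact congrFun hx i

theorem nonempty_algEquiv_of_range
    {φ : ∀ i, Model n (specialize (qAt i) (LaurentPolynomial.T 1)) →ₐ[ℂ] D i}
    (h : ∀ i, Function.Injective (φ i)) {R : Subalgebra ℂ[T;T⁻¹] (PrimePowerProd D)}
    (hR : (familyHom φ).range = R) :
    Nonempty (Model n (LaurentPolynomial.T 1 : ℂ[T;T⁻¹]) ≃ₐ[ℂ[T;T⁻¹]] R) := by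
  subst hR
  exact ⟨AlgEquiv.ofInjective _ (familyHom_injective h)⟩

theorem T_neg_mul_T : (LaurentPolynomial.T (-1) * LaurentPolynomial.T 1 : ℂ[T;T⁻¹]) = 1 := by
  rw [← LaurentPolynomial.T_add, neg_add_cancel, LaurentPolynomial.T_zero]

theorem specialize_T_neg (i : PrimePowers) :
    specialize (qAt i) (LaurentPolynomial.T (-1)) = (cardC (FieldAt i))⁻¹ := by
  refine eq_inv_of_mul_eq_one_left ?_
  rw [← specialize_qAt, ← map_mul, T_neg_mul_T, map_one]

theorem rookElt_eq {K : Type} [Field K] [Finite K] (σ : Fin n ≃. Fin n) :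
    rookElt K σ = avg (σ.toMatrix : Matrix (Fin n) (Fin n) K) := rfl

/-- A family of rook matrices, averaged over all double cosets. -/
def avgFamily (w : Equiv.Perm (Fin n)) (k : ℕ) (v : Equiv.Perm (Fin n)) :
    PrimePowerProd fun i => qRook (FieldAt i) n := fun i => avg (rookMat (FieldAt i) w k v)

theorem avgFamily_mem {w v : Equiv.Perm (Fin n)} {k : ℕ} {σ : Fin n ≃. Fin n}
    (h : ∀ (K : Type) [Field K], (σ.toMatrix : Matrix (Fin n) (Fin n) K) = rookMat K w k v) :
    avgFamily w k v ∈ QRookInt n := by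
  exact Algebra.subset_adjoin ⟨σ, funext fun i => (rookElt_eq σ).trans (congrArg avg (h (FieldAt i)))⟩

/-- The matrix of a partial map has its ones at `(i, f i)` and `permGL` at `(w j, j)`, whence the
inverse. -/
theorem toMatrix_toPEquiv (K : Type) [Field K] (w : Equiv.Perm (Fin n)) :
    (w.symm.toPEquiv.toMatrix : Matrix (Fin n) (Fin n) K) = rookMat K w n 1 := by
  ext i j
  rw [rookMat_apply, PEquiv.toMatrix_apply]
  simp [Equiv.toPEquiv_apply, eq_comm]

theorem toMatrix_ofSet (K : Type) [Field K] (k : ℕ) :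
    ((PEquiv.ofSet {j : Fin n | (j : ℕ) < k}).toMatrix : Matrix (Fin n) (Fin n) K) =
      rookMat K 1 k 1 := by
  ext i j
  rw [rookMat_one_one, truncMat, Matrix.diagonal_apply, PEquiv.toMatrix_apply, ← ite_and]
  refine if_congr ?_ rfl rfl
  rw [PEquiv.mem_ofSet_iff, Set.mem_ofPred_eq]
  constructor
  · rintro ⟨rfl, h⟩
    exact ⟨rfl, h⟩
  · rintro ⟨rfl, h⟩
    exact ⟨rfl, h⟩

/-- The family of isomorphisms over finite fields is injective on the integral model. Its range lies
in the integral algebra since the model generators map to Laurent combinations of rook families, and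
it is everything since rook families are obtained from these by the generation argument applied to
families. -/
theorem nonempty_algEquiv_qRookInt (n : ℕ) :
    Nonempty (Model n (LaurentPolynomial.T 1 : ℂ[T;T⁻¹]) ≃ₐ[ℂ[T;T⁻¹]] QRookInt n) := by
  choose φ hφ hT hD using fun i : PrimePowers =>
    exists_bijective_qRook (FieldAt i) n (specialize_qAt i)
  have hD' : ∀ k ≤ n, familyHom φ (modelD n _ k) = avgFamily 1 k 1 := fun k hk => funext fun i => by
    rw [familyHom_apply, modelMap_modelD, hD i k hk, avgFamily, rookMat_one_one, rookD]
  let s : ℕ → PrimePowerProd fun i => qRook (FieldAt i) n := fun j i => rookS (FieldAt i) n j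
  have hsj : ∀ j i, s j i = rookS (FieldAt i) n j := fun _ _ => rfl
  have hT' : ∀ j, j + 1 < n → familyHom φ (modelT n _ j) =
      ((LaurentPolynomial.T 1 : ℂ[T;T⁻¹]) - 1) • 1 - (LaurentPolynomial.T 1 : ℂ[T;T⁻¹]) • s j := by
    refine fun j hj => funext fun i => ?_
    rw [familyHom_apply, modelMap_modelT, hT i j hj]
    rw [primePowerProd_sub_apply, primePowerProd_smul_apply, primePowerProd_smul_apply, map_sub,
      map_one, primePowerProd_one_apply, hsj]
  refine nonempty_algEquiv_of_range (fun i => (hφ i).1) (le_antisymm ?_ ?_)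
  · rw [← Algebra.map_top, Subalgebra.map_le]
    refine (eq_top_of_modelD_mem (LaurentPolynomial.isUnit_T 1) (fun j hj => ?_)
      fun k hk => ?_).ge
    · rw [Subalgebra.mem_comap]
      rw [hT' j hj]
      have hs : s j ∈ QRookInt n := by
        have e : s j = avgFamily (adjSwap n j) n 1 := funext fun i => by
          change rookS (FieldAt i) n j = avg _
          rw [rookS_of_lt hj, rookMat, truncMat_self, mul_one, permGL_one, Units.val_one, mul_one,
            adjSwap_of_lt hj]
        rw [e]
        exact avgFamily_mem fun K _ => toMatrix_toPEquiv K _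
      exact Subalgebra.sub_mem _ (Subalgebra.smul_mem _ (one_mem _) _) (Subalgebra.smul_mem _ hs _)
    · rw [Subalgebra.mem_comap]
      rw [hD' k hk]
      exact avgFamily_mem fun K _ => toMatrix_ofSet K k
  · refine Algebra.adjoin_le ?_
    rintro _ ⟨σ, rfl⟩
    obtain ⟨w, v, k, hk, e⟩ := exists_toMatrix_eq_rookMat σ
    have e' : (fun i => rookElt (FieldAt i) σ : PrimePowerProd fun i => qRook (FieldAt i) n) =
        avgFamily w k v := funext fun i => (rookElt_eq σ).trans (congrArg avg (e (FieldAt i)))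
    suffices h : avgFamily w k v ∈ (familyHom φ).range by
      rw [← e'] at h
      exact h
    refine rookMat_mem_subalgebra (a := avgFamily) (s := s) T_neg_mul_T
      (S := (familyHom φ).range) (fun j hj => ⟨_, hT' j hj⟩) (fun j hj => funext fun i => ?_)
      (fun w k v j hj hg => funext fun i => avg_rookMat_of_leftGood hj hg)
      (fun w k v j hj hg => funext fun i => avg_rookMat_of_rightGood hj hg) ⟨_, hD' k hk⟩ w v
    rw [primePowerProd_mul_apply, primePowerProd_smul_apply, primePowerProd_add_apply,
      primePowerProd_smul_apply, primePowerProd_one_apply, specialize_T_neg, map_sub, map_one,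
      specialize_qAt, hsj, rookS_of_lt hj]
    exact avg_swap_mul_self rfl

/-- As on the rook side: the model generators map to Laurent multiples of span families, which are
sums of orbit families, and conversely the orbit families are generated by their images. -/
theorem nonempty_algEquiv_mirabolicInt (n : ℕ) :
    Nonempty (Model n (LaurentPolynomial.T 1 : ℂ[T;T⁻¹]) ≃ₐ[ℂ[T;T⁻¹]] MirabolicInt n) := by
  classical
  choose φ hφ hT hF using fun i : PrimePowers =>
    exists_bijective_mirabolicHecke (FieldAt i) n (specialize_qAt i)
  let E := PrimePowerProd fun i => mirabolicHecke (FieldAt i) n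
  let t : ℕ → E := fun j i => mirT (FieldAt i) n j
  let f : ℕ → E := fun k i => mirF (FieldAt i) n k
  let sp : Equiv.Perm (Fin n) → Finset (Fin n) → E := fun w D i => spanFun (FieldAt i) w D
  let ob : OrbitLabel n → E := fun l i => orbitFun (FieldAt i) l
  have hT' : ∀ j, j + 1 < n → familyHom φ (modelT n _ j) = t j := fun j hj => funext fun i => by
    rw [familyHom_apply, modelMap_modelT, hT i j hj]
  have hF' : ∀ k ≤ n, familyHom φ (modelF n _ k) = f k := fun k hk => funext fun i => by
    rw [familyHom_apply, modelMap_modelF, hF i k hk]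
  have hsum : ∀ w D, Adm w D → sp w D =
      ∑ β : {β : Finset (Fin n) // β ⊆ D ∧ Adm w β}, ob ⟨w, β.1, β.2.2⟩ := fun w D hD =>
    funext fun i => by
      have e := Finset.sum_apply i Finset.univ
        (fun β : {β : Finset (Fin n) // β ⊆ D ∧ Adm w β} => ob ⟨w, β.1, β.2.2⟩)
      refine Eq.trans ?_ e.symm
      exact spanFun_eq_sum hD
  have hsp : ∀ w D, Adm w D → sp w D ∈ MirabolicInt n := fun w D hD => by
    rw [hsum w D hD]
    exact Subalgebra.sum_mem _ fun β _ => Algebra.subset_adjoin ⟨_, rfl⟩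
  have hfs : ∀ k, f k = (LaurentPolynomial.T (-1) : ℂ[T;T⁻¹]) ^ k • sp 1 (initFin n k) :=
    fun k => funext fun i => by
      rw [primePowerProd_smul_apply, map_pow, specialize_T_neg]
      rfl
  refine nonempty_algEquiv_of_range (fun i => (hφ i).1) (le_antisymm ?_ ?_)
  · rw [← Algebra.map_top, Subalgebra.map_le]
    refine (eq_top_of_modelF_mem (LaurentPolynomial.isUnit_T 1) (fun j hj => ?_)
      fun k hk => ?_).ge
    · rw [Subalgebra.mem_comap]
      rw [hT' j hj]
      exact hsp (adjSwap n j) ∅ (adm_empty _)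
    · rw [Subalgebra.mem_comap]
      rw [hF' k hk, hfs k]
      exact Subalgebra.smul_mem _ (hsp 1 _ (adm_initFin 1 k)) _
  · refine Algebra.adjoin_le ?_
    rintro _ ⟨l, rfl⟩
    refine orbit_mem_subalgebra (S := (familyHom φ).range) (q := (LaurentPolynomial.T 1 : ℂ[T;T⁻¹])) (t := t) (f := f) (sp := sp)
      (ob := ob) (fun j hj => ⟨_, hT' j hj⟩) (fun k hk => ⟨_, hF' k hk⟩)
      (fun w D j h hw hD => funext fun i => mirT_mul_spanFun h hw hD)
      (fun w k hk => funext fun i => ?_) (funext fun i => spanFun_one) hsum l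
    rw [primePowerProd_smul_apply, map_pow, specialize_qAt]
    exact mirF_mul_spanFun hk w

end Laurent

/-! ### Generic algebras and specializations -/

section BaseChangeModel

variable {A F : Type*} [CommRing A] [Field F] [Algebra A F] {n : ℕ}

theorem MiraData.restrictScalars {D : Type*} [Ring D] [Algebra A D] [Algebra F D]
    [IsScalarTower A F D] {q : A} {t f : ℕ → D} (h : MiraData q n t f) :
    MiraData (algebraMap A F q) n t f where
  hecke :=
    { quad := fun i hi => by
        rw [h.hecke.quad i hi, ← map_one (algebraMap A F), ← map_sub, algebraMap_smul,
          algebraMap_smul]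
      braid := h.hecke.braid
      comm := h.hecke.comm }
  bot := h.bot
  mul := h.mul
  comm := h.comm
  sandwich := h.sandwich
  flag i hi := by rw [h.flag i hi, algebraMap_smul]

/-- The mirabolic relations persist after base change, so the model over the field maps to the base
change of the integral model. The map is onto because both are generated by the data, and a quotient
of a semisimple ring is semisimple. Freeness of the integral model is not needed. -/
theorem isSemisimpleRing_baseChange {q : A} (hq : IsUnit q)
    (hn : ∀ m, 1 ≤ m → m ≤ n → qInt (algebraMap A F q) m ≠ 0) :
    IsSemisimpleRing (F ⊗[A] Model n q) := by
  have hq' : algebraMap A F q ≠ 0 := (hq.map (algebraMap A F)).ne_zero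
  obtain ⟨φ, hT, hF⟩ := (MiraData.restrictScalars (F := F) ((miraData_model n q).map
    (Algebra.TensorProduct.includeRight : Model n q →ₐ[A] F ⊗[A] Model n q))).exists_algHom hq'
  have := isSemisimpleRing_model hq' hn
  refine RingHom.isSemisimpleRing_of_surjective φ.toRingHom ?_
  have htop : (φ.range.restrictScalars A).comap
      (Algebra.TensorProduct.includeRight : Model n q →ₐ[A] F ⊗[A] Model n q) = ⊤ :=
    eq_top_of_modelF_mem hq (fun i hi => ⟨_, hT i hi⟩) fun k hk => ⟨_, hF k hk⟩
  intro x
  change x ∈ φ.range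
  induction x using TensorProduct.induction_on with
  | zero => exact zero_mem _
  | add x y hx hy => exact add_mem hx hy
  | tmul c x =>
    have hx : x ∈ (φ.range.restrictScalars A).comap
      (Algebra.TensorProduct.includeRight : Model n q →ₐ[A] F ⊗[A] Model n q) := htop ▸ trivial
    have e : c ⊗ₜ[A] x = c • ((1 : F) ⊗ₜ[A] x) := by
      rw [TensorProduct.smul_tmul', smul_eq_mul, mul_one]
    rw [e]
    have hx' : (1 : F) ⊗ₜ[A] x ∈ φ.range := hx
    exact Subalgebra.smul_mem φ.range hx' c

theorem isSemisimpleRing_of_algEquiv {q : A} (hq : IsUnit q)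
    (hn : ∀ m, 1 ≤ m → m ≤ n → qInt (algebraMap A F q) m ≠ 0) {R : Type*} [Ring R] [Algebra A R]
    (e : Model n q ≃ₐ[A] R) : IsSemisimpleRing (F ⊗[A] R) := by
  have := isSemisimpleRing_baseChange hq hn
  exact (Algebra.TensorProduct.congr (AlgEquiv.refl : F ≃ₐ[F] F) e).toRingEquiv.isSemisimpleRing

end BaseChangeModel

/-- At 𝐪 = 1 the q-integer specializes to m, which is not zero. -/
theorem qInt_generic_ne_zero {m : ℕ} (hm : 1 ≤ m) :
    qInt (algebraMap ℂ[T;T⁻¹] Cq (LaurentPolynomial.T 1)) m ≠ 0 := by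
  intro h
  have h1 : ∑ j ∈ Finset.range m, (LaurentPolynomial.T 1 : ℂ[T;T⁻¹]) ^ j = 0 := by
    refine IsFractionRing.injective ℂ[T;T⁻¹] Cq ?_
    rw [map_sum, map_zero, ← h, qInt]
    exact Finset.sum_congr rfl fun j _ => map_pow _ _ _
  have h2 := congrArg (specialize 1) h1
  rw [map_sum, map_zero] at h2
  simp only [map_pow, specialize_T, Units.val_one, one_pow, Finset.sum_const, Finset.card_range,
    nsmul_eq_mul, mul_one, Nat.cast_eq_zero] at h2
  omega

theorem algebraMap_CAt (z : ℂˣ) : algebraMap ℂ[T;T⁻¹] (CAt z) (LaurentPolynomial.T 1) = (z : ℂ) :=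
  specialize_T z

theorem qInt_CAt_ne_zero {n : ℕ} {z : ℂˣ} (hz : qFactorial n z ≠ 0) {m : ℕ} (hm : 1 ≤ m)
    (hn : m ≤ n) : qInt (algebraMap ℂ[T;T⁻¹] (CAt z) (LaurentPolynomial.T 1)) m ≠ 0 := by
  rw [algebraMap_CAt]
  exact Finset.prod_ne_zero_iff.mp hz m (Finset.mem_Icc.mpr ⟨hm, hn⟩)

/-- Base change to `CAt z` of an isomorphism, as an isomorphism over `ℂ`. -/
def congrCAt (z : ℂˣ) {R R' : Type*} [Ring R] [Ring R'] [Algebra ℂ[T;T⁻¹] R]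
    [Algebra ℂ[T;T⁻¹] R'] (e : R ≃ₐ[ℂ[T;T⁻¹]] R') :
    CAt z ⊗[ℂ[T;T⁻¹]] R ≃ₐ[ℂ] CAt z ⊗[ℂ[T;T⁻¹]] R' :=
  AlgEquiv.ofRingEquiv
    (f := (Algebra.TensorProduct.congr (AlgEquiv.refl : CAt z ≃ₐ[CAt z] CAt z) e).toRingEquiv)
    fun c => (Algebra.TensorProduct.congr (AlgEquiv.refl : CAt z ≃ₐ[CAt z] CAt z) e).commutes
      (c : CAt z)

end QRook

end

theorem mainTheorem7 (n : ℕ) :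
    (Nonempty (QRook.GenericQRook n ≃ₐ[QRook.Cq] QRook.GenericMirabolic n) ∧
      IsSemisimpleRing (QRook.GenericQRook n) ∧ IsSemisimpleRing (QRook.GenericMirabolic n)) ∧
    (∀ z : ℂˣ, QRook.qFactorial n z ≠ 0 →
      Nonempty (QRook.QRookAt n z ≃ₐ[ℂ] QRook.MirabolicAt n z) ∧
      IsSemisimpleRing (QRook.QRookAt n z) ∧ IsSemisimpleRing (QRook.MirabolicAt n z)) ∧
    (∀ (K : Type) [Field K] [Finite K],
      Nonempty (QRook.qRook K n ≃ₐ[ℂ] QRook.mirabolicHecke K n)) := by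
  -- Both integral algebras are isomorphic to the integral model, so the first two statements follow
  -- by tensoring.
  obtain ⟨e⟩ := QRook.nonempty_algEquiv_qRookInt n
  obtain ⟨e'⟩ := QRook.nonempty_algEquiv_mirabolicInt n
  have hT := LaurentPolynomial.isUnit_T (R := ℂ) 1
  refine ⟨⟨⟨Algebra.TensorProduct.congr AlgEquiv.refl (e.symm.trans e')⟩, ?_, ?_⟩,
    fun z hz => ⟨⟨QRook.congrCAt z (e.symm.trans e')⟩, ?_, ?_⟩,
    fun K _ _ => QRook.nonempty_algEquiv_finiteField K n⟩
  · exact QRook.isSemisimpleRing_of_algEquiv hT (fun m hm _ => QRook.qInt_generic_ne_zero hm) e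
  · exact QRook.isSemisimpleRing_of_algEquiv hT (fun m hm _ => QRook.qInt_generic_ne_zero hm) e'
  · exact QRook.isSemisimpleRing_of_algEquiv hT (fun m hm hn => QRook.qInt_CAt_ne_zero hz hm hn) e
  · exact QRook.isSemisimpleRing_of_algEquiv hT (fun m hm hn => QRook.qInt_CAt_ne_zero hz hm hn) e'
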